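/- Let $X=(M,j)$ be a complex manifold (finite-dimensional, Hausdorff, $\sigma$-compact), $L\to X$ a holomorphic line bundle, and $J\equiv\{-,-\}$ a holomorphic Jacobi structure on $L$, i.e. a skew-symmetric complex bi-derivation of $L$ of type $(2,0)$, with $\bar\partial J=0$, whose bracket satisfies the Jacobi identity. Notation and conventions: * For a line bundle $\ell$, $D\ell$ is the bundle of derivations of $\ell$ (with symbol map $\sigma$), $\mathfrak J^1_{\mathbb R}\ell=\mathrm{Hom}(D\ell,\ell)$ is its first jet bundle, with prolongation $\langle j^1s,\Delta\rangle=\Delta s$, and for a bi-derivation $J$ of $\ell$, $J^\sharp:\mathfrak J^1_{\mathbb R}\ell\to D\ell$ is given by $\langle\tau,J^\sharp\theta\rangle=J(\theta,\tau)$. If $J$ is Jacobi, the jet algebroid $(\mathfrak J^1_{\mathbb R}\ell)_J$ has anchor $\sigma\circ J^\sharp$ and bracket $[\theta,\tau]_J=\mathcal L_{J^\sharp\theta}\tau-\mathcal L_{J^\sharp\tau}\theta-j^1J(\theta,\tau)$. * $\mathfrak J^1L$ is the bundle of holomorphic jets of $L$ (the complex jets vanishing on all $\bar\partial_\xi$,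 $\xi\in T^{0,1}X$). The *real Lie algebroid* of the holomorphic jet algebroid $(\mathfrak J^1L)_J$ is the unique real Lie algebroid structure on $\mathfrak J^1L\to M$ with anchor $\rho(\theta)=2\,\mathrm{Re}\,\sigma(J^\sharp\theta)$ whose bracket is $[\theta,\tau]_J$ on local holomorphic sections. The *imaginary Lie algebroid* has anchor $\theta\mapsto\rho(i\theta)$ and bracket $[i\theta,\tau]+[\theta,i\tau]-i[\theta,\tau]$. * $\widetilde M=L^*\smallsetminus 0$, $\widehat p:\widehat M=\mathbb{RP}(L^*)\to M$ is the real projective bundle, and $\ell\to\widehat M$ is the real dual of the tautological real line bundle. Sections of $\ell$ correspond to real homogeneous functions of degree one on $\widetilde M$. For a section $\lambda$ of $L$, $\widetilde\lambda$ is the associated fibrewise linear function on $\widetilde M$, and $\widehat\lambda$ is the section of $\ell$ corresponding to $\mathrm{Re}\,\widetilde\lambda$. * $\Pi$ is the unique holomorphic bi-vector on $\widetilde M$ with $\{\widetilde\lambda,\widetilde\mu\}_\Pi=\widetilde{\{\lambda,\mu\}}$ for local holomorphic sections $\lambda,\mu$ of $L$; $\widehat J$ is the bi-derivation of $\ell$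 corresponding to $\mathrm{Im}\,\Pi$; $\widehat j:D_{\mathbb R}\ell\to D_{\mathbb R}\ell$ is the endomorphism corresponding to the complex structure of $\widetilde M$; and $\widehat J_{\widehat j}=\widehat J(\widehat j^\dagger-,-)$. * For a section $\theta$ of $\mathfrak J^1L$, $\nabla_\theta$ is the derivation of $L$ with real symbol that differs from $J^\sharp\theta$ by some $\bar\partial_\xi$, $\xi\in T^{0,1}X$. **Theorem.** All the objects above exist and are unique where this is claimed. Moreover: 1. $4\widehat J_{\widehat j}$ and $4\widehat J$ are real Jacobi structures on $\ell$. 2. Assigning to $\theta$ the vector field on $\widehat M$ induced by the linear vector field on $L^*$ that corresponds to $\nabla_\theta$ (resp. to $\nabla_{i\theta}$) is an action on the fibration $\widehat M\to M$ of the real (resp. imaginary) Lie algebroid of $(\mathfrak J^1L)_J$. 3. There is a vector bundle isomorphism $\Psi:\widehat p^{\,*}\mathfrak J^1L\to\mathfrak J^1_{\mathbb R}\ell$ over $\widehat M$ such that $\Psi(\widehat p^{\,*}j^1\lambda)=j^1\widehat\lambda$ for all local holomorphic sections $\lambda$ of $L$. It is an isomorphism of Lie algebroids from the action Lie algebroid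 of the real Lie algebroid onto the jet algebroid $(\mathfrak J^1_{\mathbb R}\ell)_{4\widehat J_{\widehat j}}$, and $-\Psi$ is an isomorphism of Lie algebroids from the action Lie algebroid of the imaginary Lie algebroid onto the jet algebroid $(\mathfrak J^1_{\mathbb R}\ell)_{4\widehat J}$. -/

import Mathlib

open Bundle
open scoped Manifold ContDiff LinearAlgebra.Projectivization

noncomputable section

namespace HolJacobi

/-! ### Derivations, jets, bi-derivations and Lie algebroids

Here `A` is the algebra of smooth functions of a manifold and `Γ` is the `A`-module of smooth
sections of a vector bundle over it. -/

section Algebra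

variable (k A Γ : Type*) [CommRing k] [CommRing A] [Algebra k A] [AddCommGroup Γ] [Module k Γ]
  [Module A Γ] [IsScalarTower k A Γ]

/-- The module of sections of the gauge algebroid: pairs `(Δ, ξ)` of a `k`-linear operator on sections and a
vector field (its symbol) such that `Δ (a s) = a Δ s + ξ(a) s`. -/
def gaugeModule : Submodule A ((Γ →ₗ[k] Γ) × Derivation k A A) where
  carrier := {p | ∀ (a : A) (s : Γ), p.1 (a • s) = a • p.1 s + p.2 a • s}
  add_mem' := by
    intro p q hp hq a s
    simp only [Set.mem_ofPred_eq] at hp hq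
    simp only [Prod.fst_add, Prod.snd_add, LinearMap.add_apply, Derivation.add_apply, hp a s,
      hq a s, smul_add, add_smul]
    abel
  zero_mem' := by intro a s; simp
  smul_mem' := by
    intro b p hp a s
    simp only [Set.mem_ofPred_eq] at hp
    simp only [Prod.smul_fst, Prod.smul_snd, LinearMap.smul_apply, Derivation.smul_apply, hp a s,
      smul_add, smul_smul, smul_eq_mul, mul_comm b a]

/-- Sections of the gauge algebroid (derivations). -/
def Gauge : Type _ := gaugeModule k A Γ

instance : AddCommGroup (Gauge k A Γ) := inferInstanceAs (AddCommGroup (gaugeModule k A Γ))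

instance : Module A (Gauge k A Γ) := inferInstanceAs (Module A (gaugeModule k A Γ))

/-- Sections of the first jet bundle of a line bundle `ℓ`, as the `ℓ`-valued dual of the gauge
algebroid: `𝔍¹ℓ = Hom (D ℓ, ℓ)`. -/
abbrev Jet := Gauge k A Γ →ₗ[A] Γ

variable {k A Γ}

/-- The operator on sections underlying a derivation. -/
def op (Δ : Gauge k A Γ) : Γ →ₗ[k] Γ := Δ.1.1

/-- The symbol of a derivation. -/
def symbol (Δ : Gauge k A Γ) : Derivation k A A := Δ.1.2

theorem op_smul (Δ : Gauge k A Γ) (a : A) (s : Γ) :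
    op Δ (a • s) = a • op Δ s + symbol Δ a • s := Δ.2 a s

/-- The commutator of derivations. -/
def comm (Δ D : Gauge k A Γ) : Gauge k A Γ :=
  ⟨(op Δ ∘ₗ op D - op D ∘ₗ op Δ, ⁅symbol Δ, symbol D⁆), by
    intro a s
    simp only [LinearMap.sub_apply, LinearMap.comp_apply, op_smul, map_add,
      Derivation.commutator_apply, sub_smul, smul_sub]
    abel⟩

theorem comm_add (Δ D D' : Gauge k A Γ) : comm Δ (D + D') = comm Δ D + comm Δ D' := by
  apply Subtype.ext
  apply Prod.ext
  · ext s
    change op Δ (op D s + op D' s) - (op D (op Δ s) + op D' (op Δ s)) =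
      (op Δ (op D s) - op D (op Δ s)) + (op Δ (op D' s) - op D' (op Δ s))
    rw [map_add]; abel
  · change ⁅symbol Δ, symbol D + symbol D'⁆ = ⁅symbol Δ, symbol D⁆ + ⁅symbol Δ, symbol D'⁆
    exact lie_add _ _ _

theorem comm_smul (Δ D : Gauge k A Γ) (a : A) :
    comm Δ (a • D) = a • comm Δ D + symbol Δ a • D := by
  apply Subtype.ext
  apply Prod.ext
  · ext s
    change op Δ (a • op D s) - a • op D (op Δ s) =
      a • (op Δ (op D s) - op D (op Δ s)) + symbol Δ a • op D s
    rw [op_smul, smul_sub]; abel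
  · ext b
    change ⁅symbol Δ, a • symbol D⁆ b = a • ⁅symbol Δ, symbol D⁆ b + symbol Δ a • symbol D b
    simp only [Derivation.commutator_apply, Derivation.smul_apply, smul_eq_mul,
      Derivation.leibniz]
    ring

/-- The jet prolongation `s ↦ j¹s`, with `⟨j¹s, Δ⟩ = Δ s`. -/
def j1 (s : Γ) : Jet k A Γ where
  toFun Δ := op Δ s
  map_add' _ _ := rfl
  map_smul' _ _ := rfl

/-- The Lie derivative of a jet along a derivation: the unique derivation of jets with the same
symbol as `Δ` and with `L_Δ (j¹s) = j¹(Δ s)`, namely `⟨L_Δ θ, D⟩ = Δ⟨θ, D⟩ - ⟨θ, [Δ, D]⟩`. -/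
def lieD (Δ : Gauge k A Γ) (θ : Jet k A Γ) : Jet k A Γ where
  toFun D := op Δ (θ D) - θ (comm Δ D)
  map_add' D D' := by rw [comm_add, map_add, map_add, map_add]; abel
  map_smul' a D := by
    rw [comm_smul, map_add, θ.map_smul, θ.map_smul, θ.map_smul, op_smul Δ a (θ D)]
    simp only [RingHom.id_apply, smul_sub]
    abel

theorem lieD_j1 (Δ : Gauge k A Γ) (s : Γ) : lieD Δ (j1 s : Jet k A Γ) = j1 (op Δ s) := by
  ext D
  change op Δ (op D s) - (op Δ (op D s) - op D (op Δ s)) = op D (op Δ s)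
  abel

/-- The transpose of an endomorphism of the gauge algebroid. -/
def dagger (φ : Gauge k A Γ →ₗ[A] Gauge k A Γ) : Jet k A Γ →ₗ[A] Jet k A Γ :=
  LinearMap.lcomp A Γ φ

/-- A bi-derivation `J` is given by its sharp map `S = J♯ : 𝔍¹ → D`, `⟨τ, J♯ θ⟩ = J (θ, τ)`, subject
to the condition that `J` is skew-symmetric. -/
def IsBiderivation (S : Jet k A Γ →ₗ[A] Gauge k A Γ) : Prop :=
  ∀ θ τ : Jet k A Γ, τ (S θ) = - θ (S τ)

/-- The bracket `{s, t} = J (j¹s, j¹t)` of a bi-derivation. -/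
def brack (S : Jet k A Γ →ₗ[A] Gauge k A Γ) (s t : Γ) : Γ := op (S (j1 s)) t

/-- Jacobi structures: bi-derivations whose bracket satisfies the Jacobi identity. -/
def IsJacobi (S : Jet k A Γ →ₗ[A] Gauge k A Γ) : Prop :=
  IsBiderivation S ∧ ∀ r s t : Γ,
    brack S r (brack S s t) + brack S s (brack S t r) + brack S t (brack S r s) = 0

/-- The bracket `[θ, τ]_J = L_{J♯θ} τ - L_{J♯τ} θ - j¹ J(θ, τ)` on jets. -/
def jetBracket (S : Jet k A Γ →ₗ[A] Gauge k A Γ) (θ τ : Jet k A Γ) : Jet k A Γ :=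
  lieD (S θ) τ - lieD (S τ) θ - j1 (τ (S θ))

end Algebra

/-- A (real) Lie algebroid structure on a vector bundle with module of sections `Γ` over a manifold
with algebra of real functions `A`. (Real bilinearity of the bracket follows from the Leibniz
rule.) -/
structure LieAlgebroid (A Γ : Type*) [CommRing A] [Algebra ℝ A] [AddCommGroup Γ] [Module A Γ] where
  anchor : Γ →ₗ[A] Derivation ℝ A A
  bracket : Γ → Γ → Γ
  bracket_add : ∀ a b c, bracket a (b + c) = bracket a b + bracket a c
  bracket_skew : ∀ a b, bracket a b = - bracket b a
  jacobi : ∀ a b c,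
    bracket a (bracket b c) + bracket b (bracket c a) + bracket c (bracket a b) = 0
  leibniz : ∀ a b (f : A), bracket a (f • b) = f • bracket a b + anchor a f • b
  anchor_bracket : ∀ a b, anchor (bracket a b) = ⁅anchor a, anchor b⁆

/-- `Φ` is an isomorphism of Lie algebroids over the identity of the base. -/
def LieAlgebroid.IsIso {A Γ Γ' : Type*} [CommRing A] [Algebra ℝ A] [AddCommGroup Γ] [Module A Γ]
    [AddCommGroup Γ'] [Module A Γ'] (R : LieAlgebroid A Γ) (R' : LieAlgebroid A Γ')
    (Φ : Γ ≃ₗ[A] Γ') : Prop :=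
  (∀ a, R'.anchor (Φ a) = R.anchor a) ∧ ∀ a b, Φ (R.bracket a b) = R'.bracket (Φ a) (Φ b)

/-- `V` is the jet algebroid `(𝔍¹ℓ)_J` of the Jacobi structure with sharp map `S`. -/
def IsJetAlgebroid {A Γ : Type*} [CommRing A] [Algebra ℝ A] [AddCommGroup Γ] [Module ℝ Γ]
    [Module A Γ] [IsScalarTower ℝ A Γ] (S : Jet ℝ A Γ →ₗ[A] Gauge ℝ A Γ)
    (V : LieAlgebroid A (Jet ℝ A Γ)) : Prop :=
  (∀ θ, V.anchor θ = symbol (S θ)) ∧ ∀ θ τ, V.bracket θ τ = jetBracket S θ τ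

/-- An infinitesimal action of a Lie algebroid `R` over a manifold (functions `A`) on a fibration
over it (functions `B`, pull-back of functions `A → B`): a map to the vector fields of the total
space, linear over `A`, such that the image of `a` projects to the anchor of `a`, and compatible
with brackets. -/
structure LieAlgebroidAction {A Γ : Type*} [CommRing A] [Algebra ℝ A] [AddCommGroup Γ]
    [Module A Γ] (R : LieAlgebroid A Γ) (B : Type*) [CommRing B] [Algebra ℝ B] [Algebra A B] where
  act : Γ → Derivation ℝ B B
  act_add : ∀ a b, act (a + b) = act a + act b
  act_smul : ∀ (f : A) a, act (f • a) = algebraMap A B f • act a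
  act_proj : ∀ a (f : A), act a (algebraMap A B f) = algebraMap A B (R.anchor a f)
  act_bracket : ∀ a b, act (R.bracket a b) = ⁅act a, act b⁆

/-- `T` is the action Lie algebroid of the action `α`, on the pull-back bundle with sections `P`;
`pull` is the pull-back of sections. -/
def IsActionAlgebroid {A Γ : Type*} [CommRing A] [Algebra ℝ A] [AddCommGroup Γ]
    [Module A Γ] {R : LieAlgebroid A Γ} {B : Type*} [CommRing B] [Algebra ℝ B] [Algebra A B]
    (α : LieAlgebroidAction R B) {P : Type*} [AddCommGroup P] [Module B P] (pull : Γ → P)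
    (T : LieAlgebroid B P) : Prop :=
  (∀ a, T.anchor (pull a) = α.act a) ∧
    ∀ a b, T.bracket (pull a) (pull b) = pull (R.bracket a b)

/-- `R'` is the Lie algebroid obtained from `R` by deforming with the endomorphism `φ`: the anchor
is `ρ ∘ φ` and `[a, b]_φ = [φ a, b] + [a, φ b] - φ [a, b]`. -/
def IsDeformation {A Γ : Type*} [CommRing A] [Algebra ℝ A] [AddCommGroup Γ] [Module A Γ]
    (R : LieAlgebroid A Γ) (φ : Γ → Γ) (R' : LieAlgebroid A Γ) : Prop :=
  (∀ a, R'.anchor a = R.anchor (φ a)) ∧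
    ∀ a b, R'.bracket a b = R.bracket (φ a) b + R.bracket a (φ b) - φ (R.bracket a b)

/-- `a` is the only object satisfying `p`. -/
def IsTheOnly {α : Type*} (p : α → Prop) (a : α) : Prop := p a ∧ ∀ b, p b → b = a

/-! ### Smooth functions -/

section Functions

variable {E H : Type*} [NormedAddCommGroup E] [NormedSpace ℝ E] [TopologicalSpace H]
  (I : ModelWithCorners ℝ E H) (N : Type*) [TopologicalSpace N] [ChartedSpace H N]

/-- `C^∞(N, ℂ)` as a subalgebra of all functions. -/
def smoothC : Subalgebra ℂ (N → ℂ) where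
  carrier := {f | ContMDiff I 𝓘(ℝ, ℂ) ∞ f}
  add_mem' hf hg := hf.add hg
  mul_mem' hf hg := by
    have h : ContDiff ℝ ∞ fun z : ℂ × ℂ => z.1 * z.2 := contDiff_fst.mul contDiff_snd
    exact h.contMDiff.comp (hf.prodMk_space hg)
  algebraMap_mem' _ := contMDiff_const

/-- `C^∞(N, ℝ)` as a subalgebra of all functions. -/
def smoothR : Subalgebra ℝ (N → ℝ) where
  carrier := {f | ContMDiff I 𝓘(ℝ, ℝ) ∞ f}
  add_mem' hf hg := hf.add hg
  mul_mem' hf hg := hf.mul hg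
  algebraMap_mem' _ := contMDiff_const

/-- The algebra `C^∞(N, ℂ)`. -/
def SmoothC : Type _ := smoothC I N

instance : CommRing (SmoothC I N) := inferInstanceAs (CommRing (smoothC I N))

instance : Algebra ℂ (SmoothC I N) := inferInstanceAs (Algebra ℂ (smoothC I N))

/-- The algebra `C^∞(N, ℝ)`. -/
def SmoothR : Type _ := smoothR I N

instance : CommRing (SmoothR I N) := inferInstanceAs (CommRing (smoothR I N))

instance : Algebra ℝ (SmoothR I N) := inferInstanceAs (Algebra ℝ (smoothR I N))

variable {I N}

/-- Complex conjugation of functions. -/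
def conjF (f : SmoothC I N) : SmoothC I N :=
  ⟨fun x => starRingEnd ℂ (f.1 x), Complex.conjCLE.contDiff.contMDiff.comp f.2⟩

/-- The real part of a function. -/
def reF (f : SmoothC I N) : SmoothR I N :=
  ⟨fun x => (f.1 x).re, Complex.reCLM.contDiff.contMDiff.comp f.2⟩

/-- The imaginary part of a function. -/
def imF (f : SmoothC I N) : SmoothR I N :=
  ⟨fun x => (f.1 x).im, Complex.imCLM.contDiff.contMDiff.comp f.2⟩

variable (I N) in
/-- Real functions as complex functions. -/
def ofRealF : SmoothR I N →+* SmoothC I N where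
  toFun f := ⟨fun x => (f.1 x : ℂ), Complex.ofRealCLM.contDiff.contMDiff.comp f.2⟩
  map_one' := Subtype.ext (funext fun _ => Complex.ofReal_one)
  map_mul' _ _ := Subtype.ext (funext fun _ => Complex.ofReal_mul _ _)
  map_zero' := Subtype.ext (funext fun _ => Complex.ofReal_zero)
  map_add' _ _ := Subtype.ext (funext fun _ => Complex.ofReal_add _ _)

end Functions

section Geometry

variable (E : Type*) [NormedAddCommGroup E] [NormedSpace ℂ E] {M : Type*} [TopologicalSpace M]
  [ChartedSpace E M] (L : M → Type*) [TopologicalSpace (TotalSpace ℂ L)]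
  [∀ x, AddCommGroup (L x)] [∀ x, Module ℂ (L x)] [∀ x, TopologicalSpace (L x)]
  [FiberBundle ℂ L] [VectorBundle ℂ ℂ L]

/-! ### The spaces `L^*`, `M̃ = L^* ∖ 0` and `M̂ = ℝℙ(L^*)` -/

/-- The fibre at `x` of the complex dual `L^*`. -/
abbrev DualFib (x : M) : Type _ := L x →L[ℂ] Bundle.Trivial M ℂ x

/-- The total space of the complex dual `L^*`. -/
abbrev DualTot : Type _ := TotalSpace (ℂ →L[ℂ] ℂ) (DualFib L)

theorem isOpen_slit : IsOpen {v : DualTot L | v.2 ≠ 0} := by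
  rw [isOpen_iff_mem_nhds]
  intro v hv
  let e := trivializationAt (ℂ →L[ℂ] ℂ) (DualFib L) v.proj
  have key : ∀ w ∈ e.source, ((e w).2 = 0 ↔ w.2 = 0) := by
    intro w hw
    have hb : w.proj ∈ e.baseSet := e.mem_source.1 hw
    have h1 : (e w).2 = e.continuousLinearEquivAt ℂ w.proj hb w.2 := rfl
    rw [h1]
    exact (e.continuousLinearEquivAt ℂ w.proj hb).map_eq_zero_iff
  have hs : v ∈ e.source := e.mem_source.2 (mem_baseSet_trivializationAt _ _ _)
  have hc : ContinuousOn (fun w => (e w).2) e.source :=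
    continuous_snd.comp_continuousOn e.continuousOn
  have ho : IsOpen (e.source ∩ (fun w => (e w).2) ⁻¹' {0}ᶜ) :=
    hc.isOpen_inter_preimage e.open_source isOpen_compl_singleton
  refine Filter.mem_of_superset (ho.mem_nhds ⟨hs, fun h => hv ((key v hs).1 h)⟩) ?_
  rintro w ⟨hw, hw'⟩ h
  exact hw' ((key w hw).2 h)

/-- The slit dual `M̃ = L^* ∖ 0`, as an open submanifold of `L^*`. -/
abbrev Slit : Type _ := (⟨{v : DualTot L | v.2 ≠ 0}, isOpen_slit L⟩ : TopologicalSpace.Opens _)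

/-- The real projective bundle `M̂ = ℝℙ(L^*)`. -/
abbrev Hat : Type _ := Σ x : M, ℙ ℝ (DualFib L x)

variable {L} in
/-- The base point in `M` of a point of `M̃`. -/
def base (v : Slit L) : M := v.1.proj

variable {L} in
/-- The covector underlying a point of `M̃`. -/
def vec (v : Slit L) : DualFib L (base v) := v.1.2

variable {L} in
theorem vec_ne_zero (v : Slit L) : vec v ≠ 0 := v.2

variable {L} in
/-- The projection `q : M̃ → M̂`. -/
def toHat (v : Slit L) : Hat L := ⟨base v, Projectivization.mk ℝ (vec v) (vec_ne_zero v)⟩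

variable {L} in
/-- A point of `M̃` as a vector of the tautological real line over its image in `M̂`. -/
def taut (v : Slit L) : (toHat v).2.submodule :=
  ⟨vec v, by
    change vec v ∈ (Projectivization.mk ℝ (vec v) (vec_ne_zero v)).submodule
    rw [Projectivization.submodule_mk]
    exact Submodule.mem_span_singleton_self _⟩

variable {L} in
/-- The fibre at `y ∈ M̂` of the line bundle `ℓ`: the real dual of the tautological real line. -/
def EllFib (y : Hat L) : Type _ := Module.Dual ℝ y.2.submodule

variable {L} in
instance (y : Hat L) : AddCommGroup (EllFib y) :=
  inferInstanceAs (AddCommGroup (Module.Dual ℝ y.2.submodule))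

variable {L} in
instance (y : Hat L) : Module ℝ (EllFib y) :=
  inferInstanceAs (Module ℝ (Module.Dual ℝ y.2.submodule))

variable {L} in
/-- Evaluation of an element of a fibre of `ℓ` on a tautological vector. -/
def evalEll {y : Hat L} (s : EllFib y) (φ : y.2.submodule) : ℝ :=
  (show Module.Dual ℝ y.2.submodule from s) φ

/-! ### Function algebras and modules of sections -/

/-- `C^∞(M, ℂ)`. -/
abbrev FunC (M : Type*) [TopologicalSpace M] [ChartedSpace E M] : Type _ :=
  SmoothC 𝓘(ℝ, E) M

/-- `C^∞(M, ℝ)`. -/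
abbrev FunR (M : Type*) [TopologicalSpace M] [ChartedSpace E M] : Type _ :=
  SmoothR 𝓘(ℝ, E) M

/-- `C^∞(M̃, ℂ)`. -/
abbrev SlitC : Type _ := SmoothC (𝓘(ℝ, E).prod 𝓘(ℝ, ℂ →L[ℂ] ℂ)) (Slit L)

/-- `C^∞(M̃, ℝ)`. -/
abbrev SlitR : Type _ := SmoothR (𝓘(ℝ, E).prod 𝓘(ℝ, ℂ →L[ℂ] ℂ)) (Slit L)

/-- `C^∞(M̃, ℂ)` as a subalgebra of all functions. -/
abbrev slitC : Subalgebra ℂ (Slit L → ℂ) := smoothC (𝓘(ℝ, E).prod 𝓘(ℝ, ℂ →L[ℂ] ℂ)) (Slit L)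

/-- `C^∞(M̃, ℝ)` as a subalgebra of all functions. -/
abbrev slitR : Subalgebra ℝ (Slit L → ℝ) := smoothR (𝓘(ℝ, E).prod 𝓘(ℝ, ℂ →L[ℂ] ℂ)) (Slit L)

/-- `C^∞(M̂, ℂ)`; the smooth structure of `M̂` is the quotient one: a function is smooth if its
pull-back along `M̃ → M̂` is. -/
def hatC : Subalgebra ℂ (Hat L → ℂ) where
  carrier := {f | (fun v => f (toHat v)) ∈ slitC E L}
  add_mem' hf hg := (slitC E L).add_mem hf hg
  mul_mem' hf hg := (slitC E L).mul_mem hf hg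
  algebraMap_mem' c := (slitC E L).algebraMap_mem c

/-- `C^∞(M̂, ℝ)`. -/
def hatR : Subalgebra ℝ (Hat L → ℝ) where
  carrier := {f | (fun v => f (toHat v)) ∈ slitR E L}
  add_mem' hf hg := (slitR E L).add_mem hf hg
  mul_mem' hf hg := (slitR E L).mul_mem hf hg
  algebraMap_mem' c := (slitR E L).algebraMap_mem c

/-- The algebra `C^∞(M̂, ℂ)`. -/
def HatC : Type _ := hatC E L

instance : CommRing (HatC E L) := inferInstanceAs (CommRing (hatC E L))

instance : Algebra ℂ (HatC E L) := inferInstanceAs (Algebra ℂ (hatC E L))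

/-- The algebra `C^∞(M̂, ℝ)`. -/
def HatR : Type _ := hatR E L

instance : CommRing (HatR E L) := inferInstanceAs (CommRing (hatR E L))

instance : Algebra ℝ (HatR E L) := inferInstanceAs (Algebra ℝ (hatR E L))

/-- `Γ(L)`: smooth (not necessarily holomorphic) sections of `L → M`. -/
def sec : Submodule (smoothC 𝓘(ℝ, E) M) (∀ x, L x) where
  carrier := {s | ContMDiff 𝓘(ℝ, E) (𝓘(ℝ, E).prod 𝓘(ℝ, ℂ)) ∞ fun x => TotalSpace.mk' ℂ x (s x)}
  add_mem' := by
    intro s t hs ht x₀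
    have hs' := (contMDiffAt_section x₀).1 (hs x₀)
    have ht' := (contMDiffAt_section x₀).1 (ht x₀)
    refine (contMDiffAt_section x₀).2 ((hs'.add ht').congr_of_eventuallyEq ?_)
    filter_upwards [(trivializationAt ℂ L x₀).open_baseSet.mem_nhds
      (mem_baseSet_trivializationAt ℂ L x₀)] with x hx
    exact ((trivializationAt ℂ L x₀).linear ℂ hx).map_add (s x) (t x)
  zero_mem' := by
    intro x₀
    refine (contMDiffAt_section x₀).2
      ((contMDiffAt_const (c := (0 : ℂ))).congr_of_eventuallyEq ?_)
    filter_upwards [(trivializationAt ℂ L x₀).open_baseSet.mem_nhds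
      (mem_baseSet_trivializationAt ℂ L x₀)] with x hx
    exact ((trivializationAt ℂ L x₀).linear ℂ hx).map_zero
  smul_mem' := by
    intro f s hs x₀
    have hs' := (contMDiffAt_section x₀).1 (hs x₀)
    have h : ContDiff ℝ ∞ fun z : ℂ × ℂ => z.1 * z.2 := contDiff_fst.mul contDiff_snd
    refine (contMDiffAt_section x₀).2
      ((h.contMDiff.contMDiffAt.comp x₀ ((f.2 x₀).prodMk_space hs')).congr_of_eventuallyEq ?_)
    filter_upwards [(trivializationAt ℂ L x₀).open_baseSet.mem_nhds
      (mem_baseSet_trivializationAt ℂ L x₀)] with x hx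
    exact ((trivializationAt ℂ L x₀).linear ℂ hx).map_smul (f.1 x) (s x)

/-- The module `Γ(L)`. -/
def Sec : Type _ := sec E L

instance : AddCommGroup (Sec E L) := inferInstanceAs (AddCommGroup (sec E L))

instance : Module (FunC E M) (Sec E L) := inferInstanceAs (Module (smoothC 𝓘(ℝ, E) M) (sec E L))

instance : Module ℂ (Sec E L) := Module.compHom _ (algebraMap ℂ (FunC E M))

instance : IsScalarTower ℂ (FunC E M) (Sec E L) := IsScalarTower.of_compHom ℂ (FunC E M) (Sec E L)

/-- `Γ(ℓ)`: smooth sections of the real dual `ℓ → M̂` of the tautological real line bundle. A section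
is smooth if its contraction with the tautological section over `M̃` is. -/
def secEll : Submodule (hatR E L) (∀ y : Hat L, EllFib y) where
  carrier := {s | (fun v => evalEll (s (toHat v)) (taut v)) ∈ slitR E L}
  add_mem' hs ht := (slitR E L).add_mem hs ht
  zero_mem' := (slitR E L).zero_mem
  smul_mem' f _ hs := (slitR E L).mul_mem f.2 hs

/-- The module `Γ(ℓ)`. -/
def SecEll : Type _ := secEll E L

instance : AddCommGroup (SecEll E L) := inferInstanceAs (AddCommGroup (secEll E L))

instance : Module (HatR E L) (SecEll E L) := inferInstanceAs (Module (hatR E L) (secEll E L))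

instance : Module ℝ (SecEll E L) := Module.compHom _ (algebraMap ℝ (HatR E L))

instance : IsScalarTower ℝ (HatR E L) (SecEll E L) :=
  IsScalarTower.of_compHom ℝ (HatR E L) (SecEll E L)

/-- Smooth sections of the pull-back of `L` along `M̂ → M`. -/
def pullSec : Submodule (hatC E L) (∀ y : Hat L, L y.1) where
  carrier := {s | (fun v => (vec v (s (toHat v)) : ℂ)) ∈ slitC E L}
  add_mem' := by
    intro s t hs ht
    have := (slitC E L).add_mem hs ht
    refine (congrArg (· ∈ slitC E L) (funext fun v => ?_)).mp this
    exact ((vec v).map_add _ _).symm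
  zero_mem' := by
    refine (congrArg (· ∈ slitC E L) (funext fun v => ?_)).mp (slitC E L).zero_mem
    exact (vec v).map_zero.symm
  smul_mem' := by
    intro f s hs
    have := (slitC E L).mul_mem f.2 hs
    refine (congrArg (· ∈ slitC E L) (funext fun v => ?_)).mp this
    exact ((vec v).map_smul _ _).symm

/-- The module of smooth sections of the pull-back of `L` along `M̂ → M`. -/
def PullSec : Type _ := pullSec E L

instance : AddCommGroup (PullSec E L) := inferInstanceAs (AddCommGroup (pullSec E L))

instance : Module (HatC E L) (PullSec E L) := inferInstanceAs (Module (hatC E L) (pullSec E L))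

/-! ### Pull-backs and lifts -/

variable {L} in
theorem contMDiff_base :
    ContMDiff (𝓘(ℝ, E).prod 𝓘(ℝ, ℂ →L[ℂ] ℂ)) 𝓘(ℝ, E) ∞ (base : Slit L → M) :=
  (contMDiff_proj (DualFib L)).comp contMDiff_subtype_val

/-- Pull-back of real functions along `M̂ → M`. -/
def pullR : FunR E M →+* HatR E L where
  toFun f := ⟨fun y => f.1 y.1, f.2.comp (contMDiff_base E)⟩
  map_one' := rfl
  map_mul' _ _ := rfl
  map_zero' := rfl
  map_add' _ _ := rfl

/-- Pull-back of complex functions along `M̂ → M`. -/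
def pullC : FunC E M →+* HatC E L where
  toFun f := ⟨fun y => f.1 y.1, f.2.comp (contMDiff_base E)⟩
  map_one' := rfl
  map_mul' _ _ := rfl
  map_zero' := rfl
  map_add' _ _ := rfl

/-- Real functions on `M̂` as complex functions. -/
def ofRealHat : HatR E L →+* HatC E L where
  toFun f := ⟨fun y => (f.1 y : ℂ), Complex.ofRealCLM.contDiff.contMDiff.comp f.2⟩
  map_one' := Subtype.ext (funext fun _ => Complex.ofReal_one)
  map_mul' _ _ := Subtype.ext (funext fun _ => Complex.ofReal_mul _ _)
  map_zero' := Subtype.ext (funext fun _ => Complex.ofReal_zero)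
  map_add' _ _ := Subtype.ext (funext fun _ => Complex.ofReal_add _ _)

instance : Algebra (FunR E M) (HatR E L) := (pullR E L).toAlgebra

instance : Module (HatR E L) (PullSec E L) := Module.compHom _ (ofRealHat E L)

instance : Module (FunC E M) (PullSec E L) := Module.compHom _ (pullC E L)

instance : SMulCommClass (FunC E M) (HatR E L) (PullSec E L) where
  smul_comm f g s := smul_comm (pullC E L f) (ofRealHat E L g) s

variable {E L}

/-- Pull-back of functions along `q : M̃ → M̂`. -/
def pullSlit (h : HatR E L) : SlitR E L := ⟨fun v => h.1 (toHat v), h.2⟩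

theorem pairing_mem (s : Sec E L) : (fun v => (vec v (s.1 (base v)) : ℂ)) ∈ slitC E L := by
  intro v₀
  let e := trivializationAt ℂ L (base v₀)
  let e' := trivializationAt (ℂ →L[ℂ] ℂ) (DualFib L) (base v₀)
  have h1 : ContMDiffAt (𝓘(ℝ, E).prod 𝓘(ℝ, ℂ →L[ℂ] ℂ)) 𝓘(ℝ, ℂ →L[ℂ] ℂ) ∞
      (fun v : Slit L => (e' v.1).2) v₀ := (contMDiffAt_totalSpace.1 (contMDiff_subtype_val v₀)).2
  have h2 : ContMDiffAt (𝓘(ℝ, E).prod 𝓘(ℝ, ℂ →L[ℂ] ℂ)) 𝓘(ℝ, ℂ) ∞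
      (fun v : Slit L => (e ⟨base v, s.1 (base v)⟩).2) v₀ :=
    ((contMDiffAt_section (base v₀)).1 (s.2 (base v₀))).comp v₀ (contMDiff_base E v₀)
  have h : ContDiff ℝ ∞ fun z : (ℂ →L[ℂ] ℂ) × ℂ => z.1 1 * z.2 :=
    ((((ContinuousLinearMap.apply ℂ ℂ (1 : ℂ)).restrictScalars ℝ).contDiff).comp
      contDiff_fst).mul contDiff_snd
  refine (h.contMDiff.contMDiffAt.comp v₀ (h1.prodMk_space h2)).congr_of_eventuallyEq ?_
  have hb : {v : Slit L | base v ∈ e.baseSet} ∈ nhds v₀ :=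
    ((contMDiff_base E).continuous.continuousAt).preimage_mem_nhds
      (e.open_baseSet.mem_nhds (mem_baseSet_trivializationAt ℂ L _))
  filter_upwards [hb] with v hv
  have h3 : ∀ z : ℂ, (e' v.1).2 z = vec v (e.symm (base v) z) := fun z => by
    simp only [e', hom_trivializationAt_apply, ContinuousLinearMap.inCoordinates]
    simp only [Trivial.continuousLinearMapAt_trivialization, Trivial.fiberBundle_trivializationAt',
      ContinuousLinearMap.comp_apply, ContinuousLinearMap.id_apply]
    exact congrArg (vec v) (e.symmL_apply hv z)
  change vec v (s.1 (base v)) = (e' v.1).2 1 * (e ⟨base v, s.1 (base v)⟩).2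
  rw [mul_comm, ← smul_eq_mul, ← map_smul, smul_eq_mul, mul_one, h3]
  congr 1
  exact (e.symm_apply_apply_mk hv (s.1 (base v))).symm

/-- The function `λ̃` on `M̃` associated with a section `λ` of `L`. -/
def tilde (s : Sec E L) : SlitC E L := ⟨fun v => vec v (s.1 (base v)), pairing_mem s⟩

/-- The homogeneous function on `M̃` associated with a section of `ℓ`. -/
def tildeEll (s : SecEll E L) : SlitR E L := ⟨fun v => evalEll (s.1 (toHat v)) (taut v), s.2⟩

/-- The section `λ̂` of `ℓ` whose associated homogeneous function is `Re λ̃`. -/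
def hatSec (s : Sec E L) : SecEll E L :=
  ⟨fun y => show Module.Dual ℝ y.2.submodule from
    { toFun := fun φ => (φ.1 (s.1 y.1) : ℂ).re
      map_add' := fun _ _ => rfl
      map_smul' := fun c φ => by
        change ((c : ℝ) • (φ.1 (s.1 y.1) : ℂ)).re = c • (φ.1 (s.1 y.1) : ℂ).re
        exact Complex.smul_re c _ }, (reF (tilde s)).2⟩

/-! ### Holomorphic objects on `X` and on `X̃` -/

/-- `f` is holomorphic on `U`. -/
def IsHolFun (U : Set M) (f : FunC E M) : Prop := MDifferentiableOn 𝓘(ℂ, E) 𝓘(ℂ, ℂ) f.1 U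

/-- `s` is holomorphic on `U`. -/
def IsHolSec (U : Set M) (s : Sec E L) : Prop :=
  MDifferentiableOn 𝓘(ℂ, E) (𝓘(ℂ, E).prod 𝓘(ℂ, ℂ)) (fun x => TotalSpace.mk' ℂ x (s.1 x)) U

/-- `f` is holomorphic on the subset `W` of `M̃`. -/
def IsHolSlit (W : Set (Slit L)) (f : SlitC E L) : Prop :=
  MDifferentiableOn (𝓘(ℂ, E).prod 𝓘(ℂ, ℂ →L[ℂ] ℂ)) 𝓘(ℂ, ℂ) f.1 W

variable (E L) in
/-- Sections of `D_ℂ L`: complex derivations of `L`. -/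
abbrev GaugeL : Type _ := Gauge ℂ (FunC E M) (Sec E L)

variable (E L) in
/-- Sections of `𝔍¹_ℝ L = Hom_ℂ (D_ℂ L, L)`. -/
abbrev JetL : Type _ := Jet ℂ (FunC E M) (Sec E L)

/-- `δ` is of the form `∂̄_ξ` with `ξ` a section of `T^{0,1}X`: it annihilates (locally defined)
holomorphic sections. -/
def IsDbar (δ : GaugeL E L) : Prop :=
  ∀ U : Set M, IsOpen U → ∀ s : Sec E L, IsHolSec U s → ∀ x ∈ U, (op δ s).1 x = 0

/-- The complex vector field `ξ` is a section of `T^{1,0}X`: it annihilates antiholomorphic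
functions. -/
def IsType10 (ξ : Derivation ℂ (FunC E M) (FunC E M)) : Prop :=
  ∀ U : Set M, IsOpen U → ∀ f : FunC E M, IsHolFun U f → ∀ x ∈ U, (ξ (conjF f)).1 x = 0

variable (E L) in
/-- Smooth sections of the bundle `𝔍¹L` of holomorphic jets, the kernel of the bundle map
`𝔍¹_ℝ L → (T^{0,1}X)^* ⊗ L`, `j¹s ↦ ∂̄ s`, that is `θ ↦ (ξ ↦ ⟨θ, ∂̄_ξ⟩)`. -/
def holJet : Submodule (FunC E M) (JetL E L) where
  carrier := {θ | ∀ δ : GaugeL E L, IsDbar δ → θ δ = 0}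
  add_mem' hθ hτ δ hδ := by rw [LinearMap.add_apply, hθ δ hδ, hτ δ hδ, add_zero]
  zero_mem' _ _ := rfl
  smul_mem' f _ hθ δ hδ := by rw [LinearMap.smul_apply, hθ δ hδ, smul_zero]

variable (E L) in
/-- The module `Γ(𝔍¹L)`. -/
def HolJet : Type _ := holJet E L

instance : AddCommGroup (HolJet E L) := inferInstanceAs (AddCommGroup (holJet E L))

instance : Module (FunC E M) (HolJet E L) := inferInstanceAs (Module (FunC E M) (holJet E L))

instance : Module (FunR E M) (HolJet E L) := Module.compHom _ (ofRealF 𝓘(ℝ, E) M)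

/-- The fibrewise complex structure of `𝔍¹L`. -/
def mulI (θ : HolJet E L) : HolJet E L := algebraMap ℂ (FunC E M) Complex.I • θ

/-- A section of `𝔍¹L` is holomorphic on `U`: it is annihilated there by the `T^{0,1}X`-connection
`∂̄_ξ θ = L_{∂̄_ξ} θ`. -/
def IsHolJet (U : Set M) (θ : JetL E L) : Prop :=
  ∀ δ : GaugeL E L, IsDbar δ → ∀ (Δ : GaugeL E L), ∀ x ∈ U, (lieD δ θ Δ).1 x = 0

/-- Holomorphic Jacobi structures on `L`: complex bi-derivations `J` of `L`, here given by
`S = J♯`, that satisfy the Jacobi identity, are of type `(2,0)` (that is, `J♯` takes values in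
`D^{1,0}L = σ⁻¹(T^{1,0}X)`), and are annihilated by `∂̄`: the `(2,0)`-component of `[∂̄_ξ, J]`, which
is the restriction of `[∂̄_ξ, J]` to `𝔍¹L`, vanishes for all `ξ`. -/
structure IsHolJacobi (S : JetL E L →ₗ[FunC E M] GaugeL E L) : Prop where
  jacobi : IsJacobi S
  type20 : ∀ θ, IsType10 (symbol (S θ))
  dbar : ∀ δ, IsDbar δ → ∀ θ ∈ holJet E L, ∀ τ ∈ holJet E L,
    τ (comm δ (S θ) - S (lieD δ θ)) = 0

/-- `R` is the real Lie algebroid of the holomorphic jet algebroid `(𝔍¹L)_J`: its anchor is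
`ρ(θ) = 2 Re σ(J♯θ)`, and its bracket agrees with
`[θ, τ]_J = L_{J♯θ} τ - L_{J♯τ} θ - j¹ J(θ, τ)` on (locally defined) holomorphic sections. -/
def IsRealLieAlgebroid (S : JetL E L →ₗ[FunC E M] GaugeL E L)
    (R : LieAlgebroid (FunR E M) (HolJet E L)) : Prop :=
  (∀ (θ : HolJet E L) (f : FunR E M) (x : M),
    (R.anchor θ f).1 x = 2 * ((symbol (S θ.1) (ofRealF 𝓘(ℝ, E) M f)).1 x).re) ∧
  ∀ U : Set M, IsOpen U → ∀ θ τ : HolJet E L, IsHolJet U θ.1 → IsHolJet U τ.1 →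
    ∀ (Δ : GaugeL E L), ∀ x ∈ U, ((R.bracket θ τ).1 Δ).1 x = (jetBracket S θ.1 τ.1 Δ).1 x

/-! ### Poissonization and the induced structures on `ℓ → M̂` -/

/-- `P` is the holomorphic bi-vector `Π` on `X̃` determined by `J`, acting on functions as
`P f g = Π (df, dg)`: it is skew-symmetric, of type `(2,0)`, holomorphic, and satisfies
`Π (dλ̃, dμ̃) = {λ, μ}~` for (locally defined) holomorphic sections `λ, μ` of `L`. -/
structure IsPoissonization (S : JetL E L →ₗ[FunC E M] GaugeL E L)
    (P : SlitC E L →ₗ[ℂ] Derivation ℂ (SlitC E L) (SlitC E L)) : Prop where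
  skew : ∀ f g, P f g = - P g f
  type20 : ∀ W : Set (Slit L), IsOpen W → ∀ f, IsHolSlit W f → ∀ g, ∀ v ∈ W,
    (P (conjF f) g).1 v = 0
  hol : ∀ W : Set (Slit L), IsOpen W → ∀ f g, IsHolSlit W f → IsHolSlit W g →
    IsHolSlit W (P f g)
  lift : ∀ U : Set M, IsOpen U → ∀ s t : Sec E L, IsHolSec U s → IsHolSec U t →
    ∀ v : Slit L, base v ∈ U → (P (tilde s) (tilde t)).1 v = (tilde (brack S s t)).1 v

variable (E L) in
/-- Sections of `D_ℝ ℓ`. -/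
abbrev GaugeEll : Type _ := Gauge ℝ (HatR E L) (SecEll E L)

variable (E L) in
/-- Sections of `𝔍¹_ℝ ℓ`. -/
abbrev JetEll : Type _ := Jet ℝ (HatR E L) (SecEll E L)

/-- `K` is the bi-derivation `Ĵ` of `ℓ` corresponding to the real bi-vector `π = Im Π` on `M̃`:
`({s, t}_Ĵ)~ = π (ds̃, dt̃)`. -/
def IsHatBiderivation (P : SlitC E L →ₗ[ℂ] Derivation ℂ (SlitC E L) (SlitC E L))
    (K : JetEll E L →ₗ[HatR E L] GaugeEll E L) : Prop :=
  IsBiderivation K ∧ ∀ (s t : SecEll E L) (v : Slit L),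
    (tildeEll (brack K s t)).1 v =
      ((P (ofRealF _ _ (tildeEll s)) (ofRealF _ _ (tildeEll t))).1 v).im

/-- `X` is the vector field on `M̃` corresponding to the derivation `Δ` of `ℓ`. -/
def Lifts (Δ : GaugeEll E L) (X : Derivation ℝ (SlitR E L) (SlitR E L)) : Prop :=
  ∀ s, X (tildeEll s) = tildeEll (op Δ s)

/-- `X' = j̃ X` for the complex structure `j̃` of `M̃`: `X' f = i X f` for (locally defined)
holomorphic functions `f`. -/
def IsRotation (X X' : Derivation ℝ (SlitR E L) (SlitR E L)) : Prop :=
  ∀ W : Set (Slit L), IsOpen W → ∀ f : SlitC E L, IsHolSlit W f → ∀ v ∈ W,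
    (X' (reF f)).1 v = - (X (imF f)).1 v ∧ (X' (imF f)).1 v = (X (reF f)).1 v

/-- `φ` is the endomorphism `ĵ` of `D_ℝ ℓ` corresponding to the complex structure `j̃` of `M̃`. -/
def IsHatComplexStructure (φ : GaugeEll E L →ₗ[HatR E L] GaugeEll E L) : Prop :=
  ∀ Δ, ∃ X X', Lifts Δ X ∧ Lifts (φ Δ) X' ∧ IsRotation X X'

/-! ### The action and the pull-back bundle -/

/-- `D = ι Δ` for the isomorphism `ι : D^{1,0}L → DL`, `ι Δ = Δ + ∂̄_{conj σ(Δ)}`: the derivation `D`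
differs from `Δ` by a derivation `∂̄_ξ` and has real symbol. -/
def IsIota (Δ D : GaugeL E L) : Prop :=
  IsDbar (D - Δ) ∧ ∀ f, symbol D (conjF f) = conjF (symbol D f)

/-- `X` is the restriction to `M̃` of the linear vector field on `L^*` corresponding to the
derivation `D` of `L` (equivalently to the dual derivation of `L^*`). -/
def IsLinearLift (D : GaugeL E L) (X : Derivation ℝ (SlitR E L) (SlitR E L)) : Prop :=
  ∀ s : Sec E L, X (reF (tilde s)) = reF (tilde (op D s)) ∧
    X (imF (tilde s)) = imF (tilde (op D s))

/-- `ξ` is the vector field on `M̂` induced by the derivation `∇_θ = ι (J♯ θ)` of `L`: the linear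
vector field on `L^*` corresponding to `∇_θ` descends to `ξ`. -/
def IsInducedField (S : JetL E L →ₗ[FunC E M] GaugeL E L) (θ : HolJet E L)
    (ξ : Derivation ℝ (HatR E L) (HatR E L)) : Prop :=
  ∃ D, IsIota (S θ.1) D ∧ ∃ X, IsLinearLift D X ∧ ∀ h, X (pullSlit h) = pullSlit (ξ h)

variable (E L) in
/-- Smooth sections of the pull-back of `𝔍¹L ⊆ Hom_ℂ (D_ℂ L, L)` along `M̂ → M`. -/
def pullJetModule : Submodule (HatR E L) (GaugeL E L →ₗ[FunC E M] PullSec E L) where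
  carrier := {Θ | ∀ δ : GaugeL E L, IsDbar δ → Θ δ = 0}
  add_mem' hθ hτ δ hδ := by rw [LinearMap.add_apply, hθ δ hδ, hτ δ hδ, add_zero]
  zero_mem' _ _ := rfl
  smul_mem' f _ hθ δ hδ := by rw [LinearMap.smul_apply, hθ δ hδ, smul_zero]

variable (E L) in
/-- The module of smooth sections of the pull-back of `𝔍¹L` along `M̂ → M`. -/
def PullJet : Type _ := pullJetModule E L

instance : AddCommGroup (PullJet E L) := inferInstanceAs (AddCommGroup (pullJetModule E L))

instance : Module (HatR E L) (PullJet E L) :=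
  inferInstanceAs (Module (HatR E L) (pullJetModule E L))

/-- The pull-back of a section of `𝔍¹L`. -/
def pullJet (θ : HolJet E L) : PullJet E L :=
  ⟨{ toFun := fun Δ => ⟨fun y => (θ.1 Δ).1 y.1, pairing_mem (θ.1 Δ)⟩
     map_add' := fun Δ D => by
       apply Subtype.ext
       funext y
       change (θ.1 (Δ + D)).1 y.1 = (θ.1 Δ).1 y.1 + (θ.1 D).1 y.1
       rw [map_add]; rfl
     map_smul' := fun f Δ => by
       apply Subtype.ext
       funext y
       change (θ.1 (f • Δ)).1 y.1 = f.1 y.1 • (θ.1 Δ).1 y.1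
       rw [map_smul]; rfl },
    fun δ hδ => by
      apply Subtype.ext
      funext y
      change (θ.1 δ).1 y.1 = 0
      rw [θ.2 δ hδ]; rfl⟩

/-- `Ψ` is the canonical isomorphism between the pull-back of `𝔍¹L` and `𝔍¹_ℝ ℓ`: it maps the
pull-back of `j¹λ` to `j¹λ̂` for (locally defined) holomorphic sections `λ` of `L`. -/
def IsCanonical (Ψ : PullJet E L ≃ₗ[HatR E L] JetEll E L) : Prop :=
  ∀ U : Set M, IsOpen U → ∀ s : Sec E L, IsHolSec U s → ∀ θ : HolJet E L,
    (∀ (Δ : GaugeL E L), ∀ x ∈ U, (θ.1 Δ).1 x = (op Δ s).1 x) →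
    ∀ (D : GaugeEll E L) (y : Hat L), y.1 ∈ U →
      (Ψ (pullJet θ) D).1 y = (op D (hatSec s)).1 y

end Geometry

end HolJacobi

set_option linter.unusedSectionVars false

/-! Everything is carried by functions on the slit dual M̃. Sections of L are the smooth functions
on M̃ of degree one under ℂ^*, sections of ℓ are the real functions of degree one under ℝ^*, and
functions on M and M̂ are the invariant ones. Vector fields on M̃ that are invariant under ℂ^*
induce derivations of L; real ones invariant under ℝ^* induce derivations of ℓ.

Let e be a local holomorphic frame of L and z_i coordinates on M. The sections e, z_i e give
functions λ̃_a that are holomorphic coordinates of M̃ and linear on the fibres. Because they have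
degree one, Euler's identity absorbs the zeroth order part of a derivation: Δ s, viewed on M̃, is
Σ_a ∂_a s̃ · (Δ λ_a)~ for holomorphic s (`tilde_op_eq`), and `tE_op_eq` is the real analogue for ℓ.
Conversely, values on holomorphic sections that obey this rule glue to a global vector field
(`vfield`), and if they have degree one the field descends (`exists_descG`, `exists_descL`).

Hence a derivation Δ of L yields a real field on M̃ that acts on holomorphic λ̃ as Δ does. It
descends to a derivation of ℓ (`hatDer`) and to the derivation ιΔ of L with real symbol (`iota`).
The derivations induced on ℓ span D_ℝ ℓ locally over C^∞(M̂), and all ∂̄_ξ induce zero. A real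
functional on a complex space being the real part of a unique complex one, dualizing gives the
isomorphism Ψ; its inverse is `phi`.

In these coordinates Π has the coefficients {λ_a, λ_b}~. As ∂ Re λ̃ = ½ ∂λ̃, one has 4 Re Π(d Re λ̃,
d Re μ̃) = Re {λ, μ}~ for holomorphic λ, μ, so λ ↦ λ̂ preserves brackets for the bi-derivation of 4
Re Π (`sharpEll`). The Jacobiator is a derivation in each argument, and derivations of ℓ are
determined on the λ̂ with λ holomorphic; so the Jacobi identity passes from J to 4 Re Π
(`isJacobi_sharpEll`).

The sharp map of 4 Re Π sends Ψ(p̂^*θ) to the derivation induced by J♯θ (`sharpEll_psi_pullJet`).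
Therefore Ψ ∘ p̂^* carries the bracket L_{∇θ} τ − L_{∇τ} θ − j¹⟨τ, ∇θ⟩ on 𝔍¹L to the jet bracket on
ℓ (`psi_holBracket`). This map is injective, so the real Lie algebroid inherits all its axioms from
the jet algebroid of ℓ, and the action algebroid is the jet algebroid transported along Ψ.

Finally iJ is again a holomorphic Jacobi structure, and its real Lie algebroid is the imaginary one
of J. Since 4 Re(iΠ) = −4 Im Π, the sharp map of 4Ĵ is minus the one built from iJ; since the
transpose of ĵ becomes multiplication by i under Ψ, the sharp map of 4Ĵ_ĵ is the one built from J.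
The sign is absorbed by −1 on jets, which is an isomorphism between the jet algebroids of a Jacobi
structure and of its negative: hence −Ψ in the imaginary case. -/

namespace HolJacobi

/-! ### Cartan calculus on jets and the Jacobi identity of the jet bracket -/

section Algebra

variable {k A Γ : Type*} [CommRing k] [CommRing A] [Algebra k A] [AddCommGroup Γ] [Module k Γ]
  [Module A Γ] [IsScalarTower k A Γ]

@[simp] theorem op_add (Δ D : Gauge k A Γ) (s : Γ) : op (Δ + D) s = op Δ s + op D s := rfl

@[simp] theorem op_zero (s : Γ) : op (0 : Gauge k A Γ) s = 0 := rfl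

@[simp] theorem op_neg (Δ : Gauge k A Γ) (s : Γ) : op (-Δ) s = -op Δ s := rfl

@[simp] theorem op_sub (Δ D : Gauge k A Γ) (s : Γ) : op (Δ - D) s = op Δ s - op D s := rfl

@[simp] theorem op_smul_left (a : A) (Δ : Gauge k A Γ) (s : Γ) : op (a • Δ) s = a • op Δ s := rfl

@[simp] theorem symbol_add (Δ D : Gauge k A Γ) : symbol (Δ + D) = symbol Δ + symbol D := rfl

@[simp] theorem symbol_neg (Δ : Gauge k A Γ) : symbol (-Δ) = -symbol Δ := rfl

@[simp] theorem symbol_sub (Δ D : Gauge k A Γ) : symbol (Δ - D) = symbol Δ - symbol D := rfl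

@[simp] theorem symbol_smul (a : A) (Δ : Gauge k A Γ) : symbol (a • Δ) = a • symbol Δ := rfl

@[simp] theorem op_comm (Δ D : Gauge k A Γ) (s : Γ) :
    op (comm Δ D) s = op Δ (op D s) - op D (op Δ s) := rfl

@[simp] theorem symbol_comm (Δ D : Gauge k A Γ) : symbol (comm Δ D) = ⁅symbol Δ, symbol D⁆ := rfl

@[simp] theorem j1_apply (s : Γ) (Δ : Gauge k A Γ) : (j1 s : Jet k A Γ) Δ = op Δ s := rfl

@[simp] theorem lieD_apply (Δ D : Gauge k A Γ) (θ : Jet k A Γ) :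
    lieD Δ θ D = op Δ (θ D) - θ (comm Δ D) := rfl

theorem gauge_ext {Δ D : Gauge k A Γ} (h : ∀ s, op Δ s = op D s) (h' : symbol Δ = symbol D) :
    Δ = D := Subtype.ext (Prod.ext (LinearMap.ext h) h')

variable (k A Γ) in
/-- Derivations are determined by their action on sections. -/
def GaugeFaithful : Prop := ∀ Δ D : Gauge k A Γ, (∀ s, op Δ s = op D s) → Δ = D

theorem comm_antisymm (Δ D : Gauge k A Γ) : comm Δ D = -comm D Δ := by
  refine gauge_ext (fun s => by simp) ?_
  rw [symbol_comm, symbol_neg, symbol_comm, lie_skew]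

theorem comm_jacobi (X Y Z : Gauge k A Γ) :
    comm (comm X Y) Z = comm X (comm Y Z) - comm Y (comm X Z) := by
  refine gauge_ext (fun s => ?_) ?_
  · simp only [op_comm, op_sub, map_sub]; abel
  · simp only [symbol_comm, symbol_sub]; exact lie_lie _ _ _

theorem j1_add (s t : Γ) : (j1 (s + t) : Jet k A Γ) = j1 s + j1 t := by
  ext D; simp

theorem j1_neg (s : Γ) : (j1 (-s) : Jet k A Γ) = -j1 s := by
  ext D; simp

theorem j1_smul_const (c : k) (s : Γ) : (j1 (c • s) : Jet k A Γ) = algebraMap k A c • j1 s := by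
  ext D; simp

theorem lieD_add_left (Δ D : Gauge k A Γ) (θ : Jet k A Γ) :
    lieD (Δ + D) θ = lieD Δ θ + lieD D θ := by
  ext Z
  have : comm (Δ + D) Z = comm Δ Z + comm D Z := by
    rw [comm_antisymm, comm_add, comm_antisymm Z Δ, comm_antisymm Z D]; abel
  simp only [lieD_apply, op_add, this, map_add, LinearMap.add_apply]; abel

theorem lieD_add_right (Δ : Gauge k A Γ) (θ τ : Jet k A Γ) :
    lieD Δ (θ + τ) = lieD Δ θ + lieD Δ τ := by
  ext Z
  simp only [lieD_apply, LinearMap.add_apply, map_add]; abel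

theorem lieD_neg_left (Δ : Gauge k A Γ) (θ : Jet k A Γ) : lieD (-Δ) θ = -lieD Δ θ := by
  have := lieD_add_left (-Δ) Δ θ
  rw [neg_add_cancel] at this
  have h0 : lieD (0 : Gauge k A Γ) θ = 0 := by
    have := lieD_add_left 0 0 θ
    rw [add_zero] at this
    exact left_eq_add.1 this
  rw [h0] at this
  exact eq_neg_of_add_eq_zero_left this.symm

theorem lieD_neg_right (Δ : Gauge k A Γ) (θ : Jet k A Γ) : lieD Δ (-θ) = -lieD Δ θ := by
  ext Z
  simp only [lieD_apply, LinearMap.neg_apply, map_neg]; abel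

theorem lieD_sub_right (Δ : Gauge k A Γ) (θ τ : Jet k A Γ) :
    lieD Δ (θ - τ) = lieD Δ θ - lieD Δ τ := by
  rw [sub_eq_add_neg, lieD_add_right, lieD_neg_right, ← sub_eq_add_neg]

theorem lieD_sub_left (Δ D : Gauge k A Γ) (θ : Jet k A Γ) :
    lieD (Δ - D) θ = lieD Δ θ - lieD D θ := by
  rw [sub_eq_add_neg, lieD_add_left, lieD_neg_left, ← sub_eq_add_neg]

theorem lieD_comm (Δ D : Gauge k A Γ) (θ : Jet k A Γ) :
    lieD (comm Δ D) θ = lieD Δ (lieD D θ) - lieD D (lieD Δ θ) := by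
  ext Z
  simp only [lieD_apply, LinearMap.sub_apply, op_comm, map_sub, comm_jacobi]; abel

theorem lieD_smul_right (Δ : Gauge k A Γ) (a : A) (θ : Jet k A Γ) :
    lieD Δ (a • θ) = a • lieD Δ θ + symbol Δ a • θ := by
  ext Z
  simp only [lieD_apply, LinearMap.smul_apply, LinearMap.add_apply, op_smul, smul_sub]; abel

section Jacobi

variable {S : Jet k A Γ →ₗ[A] Gauge k A Γ}

theorem IsBiderivation.op_eq (h : IsBiderivation S) (θ : Jet k A Γ) (t : Γ) :
    op (S θ) t = -θ (S (j1 t)) := h θ (j1 t)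

theorem IsBiderivation.brack_skew (h : IsBiderivation S) (s t : Γ) :
    brack S s t = -brack S t s := h (j1 s) (j1 t)

variable (hf : GaugeFaithful k A Γ) (h : IsJacobi S)
include hf h

/-- The Jacobi identity read as an identity of operators on the last argument; faithfulness supplies
the equality of symbols. -/
theorem IsJacobi.sharp_j1_brack (r s : Γ) :
    S (j1 (brack S r s)) = comm (S (j1 r)) (S (j1 s)) := by
  refine hf _ _ fun t => ?_
  have h1 := h.2 r s t
  have h2 := h.1.brack_skew t (brack S r s)
  have h3 := h.1.brack_skew t r
  simp only [op_comm]
  change brack S (brack S r s) t = brack S r (brack S s t) - brack S s (brack S r t)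
  rw [h2, h3] at h1
  have h4 : brack S s (-brack S r t) = -brack S s (brack S r t) := map_neg _ _
  rw [h4] at h1
  rw [eq_comm, ← sub_eq_zero, ← h1]; abel

/-- `J` is invariant under its Hamiltonian derivations. Skewness moves θ to the outside, so the case
of prolongations suffices for every θ; jets are nowhere assumed to be generated by prolongations. -/
theorem IsJacobi.sharp_lieD (r : Γ) (θ : Jet k A Γ) :
    S (lieD (S (j1 r)) θ) = comm (S (j1 r)) (S θ) := by
  refine hf _ _ fun t => ?_
  rw [op_comm, h.1.op_eq, h.1.op_eq θ, h.1.op_eq θ, lieD_apply, map_neg]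
  have : comm (S (j1 r)) (S (j1 t)) = S (j1 (op (S (j1 r)) t)) :=
    (IsJacobi.sharp_j1_brack hf h r t).symm
  rw [this]; abel

/-- Skewness for θ and the Lie derivative of τ, where invariance replaces the sharp of that Lie
derivative by a commutator. This is exactly the defect that appears when `S` is compared on the jet
bracket and on the commutator. -/
theorem IsJacobi.jetBracket_correction (θ τ : Jet k A Γ) (r : Γ) :
    θ (comm (S τ) (S (j1 r))) - τ (comm (S θ) (S (j1 r))) - op (S (j1 r)) (τ (S θ)) = 0 := by
  have h1 := h.1 θ (lieD (S (j1 r)) τ)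
  rw [lieD_apply, IsJacobi.sharp_lieD hf h] at h1
  rw [comm_antisymm (S τ), comm_antisymm (S θ), map_neg, map_neg]
  rw [← neg_eq_iff_eq_neg] at h1
  rw [← h1]; abel

theorem IsJacobi.sharp_jetBracket (θ τ : Jet k A Γ) :
    S (jetBracket S θ τ) = comm (S θ) (S τ) := by
  refine hf _ _ fun r => ?_
  have h1 := IsJacobi.jetBracket_correction hf h θ τ r
  rw [h.1.op_eq, op_comm, h.1.op_eq τ, h.1.op_eq θ r]
  simp only [jetBracket, LinearMap.sub_apply, lieD_apply, j1_apply, map_neg]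
  rw [eq_comm, ← sub_eq_zero]
  calc _ = θ (comm (S τ) (S (j1 r))) - τ (comm (S θ) (S (j1 r))) - op (S (j1 r)) (τ (S θ)) := by
        abel
    _ = 0 := h1

/-- Skewness for θ and the jet bracket of τ and υ, together with the fact that `S` is a morphism:
the vanishing of the Schouten square of `J` on three arbitrary jets. -/
theorem IsJacobi.cyclic (θ τ υ : Jet k A Γ) :
    op (S θ) (υ (S τ)) + op (S τ) (θ (S υ)) + op (S υ) (τ (S θ)) =
      θ (comm (S τ) (S υ)) + τ (comm (S υ) (S θ)) + υ (comm (S θ) (S τ)) := by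
  have h1 := h.1 θ (jetBracket S τ υ)
  rw [IsJacobi.sharp_jetBracket hf h] at h1
  simp only [jetBracket, LinearMap.sub_apply, lieD_apply, j1_apply] at h1
  rw [h.1 θ υ, map_neg, comm_antisymm (S τ) (S θ), map_neg] at h1
  rw [← sub_eq_zero] at h1 ⊢
  rw [← neg_eq_zero, ← h1]
  abel

/-- Since `S` is a morphism, the iterated Lie derivatives cancel in the cyclic sum by `lieD_comm`.
What is left is `j1` applied to the identity `IsJacobi.cyclic`. -/
theorem IsJacobi.jetBracket_jacobi (θ τ υ : Jet k A Γ) :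
    jetBracket S θ (jetBracket S τ υ) + jetBracket S τ (jetBracket S υ θ) +
      jetBracket S υ (jetBracket S θ τ) = 0 := by
  have key : ∀ θ τ υ : Jet k A Γ, jetBracket S θ (jetBracket S τ υ) =
      lieD (S θ) (lieD (S τ) υ) - lieD (S θ) (lieD (S υ) τ) - j1 (op (S θ) (υ (S τ)))
        - (lieD (S τ) (lieD (S υ) θ) - lieD (S υ) (lieD (S τ) θ)) +
        j1 (θ (comm (S τ) (S υ))) := by
    intro θ τ υ
    have e : jetBracket S τ υ (S θ) = -θ (comm (S τ) (S υ)) := by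
      rw [h.1, IsJacobi.sharp_jetBracket hf h]
    rw [jetBracket, IsJacobi.sharp_jetBracket hf h, e, lieD_comm, j1_neg, sub_neg_eq_add]
    rw [jetBracket, lieD_sub_right, lieD_sub_right, lieD_j1]
  have hc := congrArg (j1 (k := k) (A := A)) (IsJacobi.cyclic hf h θ τ υ)
  simp only [j1_add] at hc
  rw [key θ τ υ, key τ υ θ, key υ θ τ]
  rw [← sub_eq_zero] at hc
  rw [← neg_eq_zero, ← hc]; abel

end Jacobi

theorem jetBracket_skew {S : Jet k A Γ →ₗ[A] Gauge k A Γ} (h : IsBiderivation S)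
    (θ τ : Jet k A Γ) : jetBracket S θ τ = -jetBracket S τ θ := by
  rw [jetBracket, jetBracket, h, j1_neg]; abel

/-- Multiplication by −1 intertwines the jet brackets of `S` and `-S`; this is the origin of −Ψ for
the imaginary Lie algebroid. -/
theorem jetBracket_neg (S : Jet k A Γ →ₗ[A] Gauge k A Γ) (θ τ : Jet k A Γ) :
    jetBracket (-S) (-θ) (-τ) = -jetBracket S θ τ := by
  simp only [jetBracket, LinearMap.neg_apply, map_neg, neg_neg, lieD_neg_right, j1_neg]
  abel

theorem IsJacobi.neg {S : Jet k A Γ →ₗ[A] Gauge k A Γ} (h : IsJacobi S) : IsJacobi (-S) := by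
  refine ⟨fun θ τ => ?_, fun r s t => ?_⟩
  · rw [LinearMap.neg_apply, LinearMap.neg_apply, map_neg, map_neg, h.1 θ τ]
  · have e : ∀ a b : Γ, brack (-S) a b = -brack S a b := fun _ _ => rfl
    have e' : ∀ a b : Γ, brack S a (-b) = -brack S a b := fun _ _ => map_neg _ _
    simp only [e, e', neg_neg]
    exact h.2 r s t

end Algebra

/-! ### The jet algebroid as a Lie algebroid; transport of structure -/

section Real

variable {A Γ : Type*} [CommRing A] [Algebra ℝ A] [AddCommGroup Γ] [Module ℝ Γ]
  [Module A Γ] [IsScalarTower ℝ A Γ]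

/-- The jet algebroid of a Jacobi structure. -/
def jetAlgebroid (hf : GaugeFaithful ℝ A Γ) (S : Jet ℝ A Γ →ₗ[A] Gauge ℝ A Γ) (h : IsJacobi S) :
    LieAlgebroid A (Jet ℝ A Γ) where
  anchor := { toFun := fun θ => symbol (S θ)
              map_add' := fun θ τ => by rw [map_add, symbol_add]
              map_smul' := fun a θ => by rw [map_smul, symbol_smul]; rfl }
  bracket := jetBracket S
  bracket_add θ τ υ := by
    simp only [jetBracket, map_add, lieD_add_left, lieD_add_right, LinearMap.add_apply, j1_add]
    abel
  bracket_skew := jetBracket_skew h.1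
  jacobi := IsJacobi.jetBracket_jacobi hf h
  leibniz θ τ f := by
    -- Neither summand alone is linear in `f`: each produces, on a derivation D, the derivative of
    -- `f` along D times a section. Those sections are θ(Sτ) and τ(Sθ), so the two terms cancel by
    -- skewness.
    have e : lieD (f • S τ) θ + j1 (f • τ (S θ)) = f • lieD (S τ) θ + f • j1 (τ (S θ)) := by
      ext D
      simp only [LinearMap.add_apply, LinearMap.smul_apply, lieD_apply, j1_apply, op_smul_left,
        op_smul, comm_antisymm (f • S τ) D, comm_smul, comm_antisymm D (S τ), map_neg, map_add,
        map_smul, smul_sub, smul_neg, h.1 τ θ]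
      rw [h.1 θ τ]
      simp only [smul_neg, map_neg]
      abel
    simp only [jetBracket, map_smul, LinearMap.smul_apply, lieD_smul_right, smul_sub]
    rw [sub_sub, e]
    change _ = _ + symbol (S θ) f • τ
    abel
  anchor_bracket θ τ := by
    change symbol (S (jetBracket S θ τ)) = ⁅symbol (S θ), symbol (S τ)⁆
    rw [IsJacobi.sharp_jetBracket hf h, symbol_comm]

theorem jetAlgebroid_isJetAlgebroid (hf : GaugeFaithful ℝ A Γ)
    (S : Jet ℝ A Γ →ₗ[A] Gauge ℝ A Γ) (h : IsJacobi S) :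
    IsJetAlgebroid S (jetAlgebroid hf S h) := ⟨fun _ => rfl, fun _ _ => rfl⟩

/-- Transport of a Lie algebroid structure along an isomorphism of modules. -/
def LieAlgebroid.transport {Γ₁ Γ₂ : Type*} [AddCommGroup Γ₁] [Module A Γ₁] [AddCommGroup Γ₂]
    [Module A Γ₂] (V : LieAlgebroid A Γ₂) (Ψ : Γ₁ ≃ₗ[A] Γ₂) : LieAlgebroid A Γ₁ where
  anchor := V.anchor ∘ₗ Ψ.toLinearMap
  bracket a b := Ψ.symm (V.bracket (Ψ a) (Ψ b))
  bracket_add a b c := by rw [map_add, V.bracket_add, map_add]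
  bracket_skew a b := by rw [V.bracket_skew, map_neg]
  jacobi a b c := by
    simp only [LinearEquiv.apply_symm_apply]
    rw [← map_add, ← map_add, V.jacobi, map_zero]
  leibniz a b f := by
    rw [map_smul, V.leibniz, map_add, map_smul, map_smul, LinearEquiv.symm_apply_apply]; rfl
  anchor_bracket a b := by
    change V.anchor (Ψ (Ψ.symm _)) = _
    rw [LinearEquiv.apply_symm_apply, V.anchor_bracket]; rfl

theorem LieAlgebroid.transport_isIso {Γ₁ Γ₂ : Type*} [AddCommGroup Γ₁] [Module A Γ₁]
    [AddCommGroup Γ₂] [Module A Γ₂] (V : LieAlgebroid A Γ₂) (Ψ : Γ₁ ≃ₗ[A] Γ₂) :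
    (V.transport Ψ).IsIso V Ψ :=
  ⟨fun _ => rfl, fun _ _ => LinearEquiv.apply_symm_apply _ _⟩

end Real

end HolJacobi

namespace HolJacobi

/-! ### Homogeneous coordinates (u, u z_1, …, u z_n) on the dual line bundle -/

section Charts

variable (E : Type*) [NormedAddCommGroup E] [NormedSpace ℂ E] {M : Type*}
  [TopologicalSpace M] [ChartedSpace E M] (L : M → Type*) [TopologicalSpace (TotalSpace ℂ L)]
  [∀ x, AddCommGroup (L x)] [∀ x, Module ℂ (L x)] [∀ x, TopologicalSpace (L x)]
  [FiberBundle ℂ L] [VectorBundle ℂ ℂ L]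

/-- Indices of the local coordinates of `M̃`. -/
abbrev Idx : Type := Option (Fin (Module.finrank ℂ E))

variable {E} in
/-- The preferred local trivialization of `L`. -/
abbrev tr (x₀ : M) : Trivialization ℂ (π ℂ L) := trivializationAt ℂ L x₀

/-- The local frame of `L` given by a local trivialization. -/
def frm (x₀ x : M) : L x := (tr L x₀).symm x 1

theorem clm_frm {x₀ x : M} (hx : x ∈ (tr L x₀).baseSet) :
    (tr L x₀).continuousLinearMapAt ℂ x (frm L x₀ x) = 1 := by
  rw [frm, ← (tr L x₀).symmL_apply (R := ℂ) hx, (tr L x₀).continuousLinearMapAt_symmL hx]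

theorem eq_smul_frm {x₀ x : M} (hx : x ∈ (tr L x₀).baseSet) (l : L x) :
    l = (tr L x₀).continuousLinearMapAt ℂ x l • frm L x₀ x := by
  rw [frm, ← (tr L x₀).symmL_apply (R := ℂ) hx, ← map_smul, smul_eq_mul, mul_one,
    (tr L x₀).symmL_continuousLinearMapAt hx]

theorem vec_ext {x₀ x : M} (hx : x ∈ (tr L x₀).baseSet) {v w : DualFib L x}
    (h : v (frm L x₀ x) = w (frm L x₀ x)) : v = w := by
  ext l
  rw [eq_smul_frm L hx l, map_smul, map_smul, h]

/-- Transition functions of `L`: `frm x₀ = trans x₀ x₁ • frm x₁`. -/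
def transF (x₀ x₁ x : M) : ℂ := (tr L x₁).continuousLinearMapAt ℂ x (frm L x₀ x)

theorem frm_eq {x₀ x₁ x : M} (hx : x ∈ (tr L x₁).baseSet) :
    frm L x₀ x = transF L x₀ x₁ x • frm L x₁ x := eq_smul_frm L hx _

/-- The trivialization of the dual has values in the endomorphisms of ℂ, which are multiplications
by scalars; the scalar is the value on the frame. This links the manifold structure of the total
space with the explicit coordinates. -/
theorem dual_trivialization_apply {x₁ : M} {v : DualTot L} (hv : v.proj ∈ (tr L x₁).baseSet) :
    (trivializationAt (ℂ →L[ℂ] ℂ) (DualFib L) x₁ v).2 =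
      (v.2 (frm L x₁ v.proj) : ℂ) • ContinuousLinearMap.id ℂ ℂ := by
  ext
  simp only [hom_trivializationAt_apply, ContinuousLinearMap.inCoordinates]
  simp only [Trivial.continuousLinearMapAt_trivialization, Trivial.fiberBundle_trivializationAt',
      ContinuousLinearMap.comp_apply, ContinuousLinearMap.id_apply]
  have : ((trivializationAt ℂ L x₁).symmL ℂ v.proj) 1 = frm L x₁ v.proj :=
    (tr L x₁).symmL_apply hv 1
  rw [this]
  change v.2 (frm L x₁ v.proj) = v.2 (frm L x₁ v.proj) * 1
  rw [mul_one]

section Finite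

variable [FiniteDimensional ℂ E]

/-- Linear coordinates on the model space. -/
def coordE : E ≃L[ℂ] (Fin (Module.finrank ℂ E) → ℂ) := (Module.finBasis ℂ E).equivFunL

/-- Affine coordinates from homogeneous ones. -/
def affE (w : Idx E → ℂ) : E := (coordE E).symm fun i => w (some i) / w none

/-- The point of `M` with given homogeneous coordinates. -/
def pt (x₀ : M) (w : Idx E → ℂ) : M := (chartAt E x₀).symm (affE E w)

variable (M) in
/-- The homogeneous coordinates `(1, z)` of a point. -/
def homE (x₀ x : M) : Idx E → ℂ := fun a => a.elim 1 (coordE E (chartAt E x₀ x))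

/-- Homogeneous coordinates on the dual of `L`. -/
def coordF (x₀ : M) (v : DualTot L) : Idx E → ℂ :=
  (v.2 (frm L x₀ v.proj) : ℂ) • homE E M x₀ v.proj

/-- The covector with given homogeneous coordinates. -/
def cinv (x₀ : M) (w : Idx E → ℂ) : DualTot L :=
  ⟨pt E x₀ w, (w none • (tr L x₀).continuousLinearMapAt ℂ (pt E x₀ w) : L (pt E x₀ w) →L[ℂ] ℂ)⟩

/-- The domain of coordinates in `M`. -/
def dom (x₀ : M) : Set M := (chartAt E x₀).source ∩ (tr L x₀).baseSet

/-- The range of the homogeneous coordinates. -/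
def cone (x₀ : M) : Set (Idx E → ℂ) :=
  {w | w none ≠ 0 ∧ affE E w ∈ (chartAt E x₀).target ∧ pt E x₀ w ∈ (tr L x₀).baseSet}

variable {E L}

theorem isOpen_dom (x₀ : M) : IsOpen (dom E L x₀) :=
  (chartAt E x₀).open_source.inter (tr L x₀).open_baseSet

theorem mem_dom (x₀ : M) : x₀ ∈ dom E L x₀ :=
  ⟨mem_chart_source E x₀, mem_baseSet_trivializationAt ℂ L x₀⟩

theorem pt_mem_dom {x₀ : M} {w : Idx E → ℂ} (hw : w ∈ cone E L x₀) : pt E x₀ w ∈ dom E L x₀ :=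
  ⟨(chartAt E x₀).map_target hw.2.1, hw.2.2⟩

theorem affE_smul_homE {c : ℂ} (hc : c ≠ 0) (x₀ x : M) :
    affE E (c • homE E M x₀ x) = chartAt E x₀ x := by
  rw [affE, ContinuousLinearEquiv.symm_apply_eq]
  ext i
  simp [homE, hc]

theorem pt_smul_homE {c : ℂ} (hc : c ≠ 0) {x₀ x : M} (hx : x ∈ dom E L x₀) :
    pt E x₀ (c • homE E M x₀ x) = x := by
  rw [pt, affE_smul_homE hc, (chartAt E x₀).left_inv hx.1]

theorem smul_homE_mem_cone {c : ℂ} (hc : c ≠ 0) {x₀ x : M} (hx : x ∈ dom E L x₀) :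
    c • homE E M x₀ x ∈ cone E L x₀ := by
  refine ⟨by simpa [homE] using hc, ?_, ?_⟩
  · rw [affE_smul_homE hc]; exact (chartAt E x₀).map_source hx.1
  · rw [pt_smul_homE hc hx]; exact hx.2

theorem homE_pt {x₀ : M} {w : Idx E → ℂ} (hw : w ∈ cone E L x₀) :
    w none • homE E M x₀ (pt E x₀ w) = w := by
  funext a
  cases a with
  | none => simp [homE]
  | some i =>
    have : chartAt E x₀ (pt E x₀ w) = affE E w := (chartAt E x₀).right_inv hw.2.1
    simp only [Pi.smul_apply, homE, this, affE, Option.elim,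
      ContinuousLinearEquiv.apply_symm_apply, smul_eq_mul]
    field_simp [hw.1]

theorem cinv_frm {x₀ : M} {w : Idx E → ℂ} (hw : w ∈ cone E L x₀) :
    ((cinv E L x₀ w).2 (frm L x₀ (pt E x₀ w)) : ℂ) = w none := by
  change w none * (tr L x₀).continuousLinearMapAt ℂ (pt E x₀ w) (frm L x₀ (pt E x₀ w)) = w none
  rw [clm_frm L hw.2.2, mul_one]

theorem coordF_cinv {x₀ : M} {w : Idx E → ℂ} (hw : w ∈ cone E L x₀) :
    coordF E L x₀ (cinv E L x₀ w) = w := by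
  rw [coordF]
  change ((cinv E L x₀ w).2 (frm L x₀ (pt E x₀ w)) : ℂ) • homE E M x₀ (pt E x₀ w) = w
  rw [cinv_frm hw, homE_pt hw]

theorem cinv_smul_homE {c : ℂ} (hc : c ≠ 0) {x₀ x : M} (hx : x ∈ dom E L x₀) :
    cinv E L x₀ (c • homE E M x₀ x) =
      ⟨x, (c • (tr L x₀).continuousLinearMapAt ℂ x : L x →L[ℂ] ℂ)⟩ := by
  have h : (c • homE E M x₀ x) none = c := by simp [homE]
  unfold cinv
  rw [h, pt_smul_homE hc hx]

theorem vec_frm_ne_zero {x₀ : M} {v : DualTot L} (hv : v.proj ∈ dom E L x₀) (h : v.2 ≠ 0) :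
    (v.2 (frm L x₀ v.proj) : ℂ) ≠ 0 := by
  intro h0
  refine h (vec_ext L hv.2 ?_)
  rw [h0]; rfl

theorem cinv_coordF {x₀ : M} {v : DualTot L} (hv : v.proj ∈ dom E L x₀) (h : v.2 ≠ 0) :
    cinv E L x₀ (coordF E L x₀ v) = v := by
  rw [coordF, cinv_smul_homE (vec_frm_ne_zero hv h) hv]
  obtain ⟨x, v⟩ := v
  congr 1
  refine vec_ext L hv.2 ?_
  change (v (frm L x₀ x) : ℂ) * (tr L x₀).continuousLinearMapAt ℂ x (frm L x₀ x) = v (frm L x₀ x)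
  rw [clm_frm L hv.2, mul_one]

theorem cinv_ne_zero {x₀ : M} {w : Idx E → ℂ} (hw : w ∈ cone E L x₀) :
    (cinv E L x₀ w).2 ≠ 0 := by
  intro h
  have := cinv_frm hw
  rw [h] at this
  exact hw.1 this.symm

theorem coordF_mem_cone {x₀ : M} {v : DualTot L} (hv : v.proj ∈ dom E L x₀) (h : v.2 ≠ 0) :
    coordF E L x₀ v ∈ cone E L x₀ :=
  smul_homE_mem_cone (vec_frm_ne_zero hv h) hv

theorem continuousOn_affE : ContinuousOn (affE E) {w | w none ≠ 0} := by
  refine (coordE E).symm.continuous.comp_continuousOn (continuousOn_pi.2 fun i => ?_)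
  exact (continuous_apply _).continuousOn.div (continuous_apply _).continuousOn fun w hw => hw

theorem isOpen_cone (x₀ : M) : IsOpen (cone E L x₀) := by
  have h0 : IsOpen {w : Idx E → ℂ | w none ≠ 0} :=
    isOpen_compl_singleton.preimage (continuous_apply none)
  have h1 : IsOpen ((chartAt E x₀).target ∩ (chartAt E x₀).symm ⁻¹' (tr L x₀).baseSet) :=
    (chartAt E x₀).isOpen_inter_preimage_symm (tr L x₀).open_baseSet
  exact continuousOn_affE.isOpen_inter_preimage h0 h1

theorem smul_mem_cone {x₀ : M} {w : Idx E → ℂ} (hw : w ∈ cone E L x₀) {c : ℂ} (hc : c ≠ 0) :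
    c • w ∈ cone E L x₀ := by
  rw [← homE_pt hw, smul_smul]
  exact smul_homE_mem_cone (mul_ne_zero hc hw.1) (pt_mem_dom hw)

/-! ### Regularity of the coordinates, over ℝ and over ℂ at once -/

section Regularity

variable {𝕜 : Type*} [NontriviallyNormedField 𝕜] [NormedAlgebra 𝕜 ℂ] [NormedSpace 𝕜 E]
  [IsScalarTower 𝕜 ℂ E] {n : ℕ∞ω} [IsManifold 𝓘(𝕜, E) n M]

/-- The map to the model space underlying homogeneous coordinates. -/
theorem contMDiffOn_affE : ContDiffOn 𝕜 n (affE E) {w | w none ≠ 0} := by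
  have h : ContDiff 𝕜 n ((coordE E).symm : (Fin (Module.finrank ℂ E) → ℂ) → E) :=
    ((coordE E).symm.toContinuousLinearMap.restrictScalars 𝕜).contDiff
  refine h.comp_contDiffOn (contDiffOn_pi.2 fun i => ?_)
  have h1 : ContDiffOn 𝕜 n (fun w : Idx E → ℂ => w none) {w | w none ≠ 0} :=
    (contDiff_apply 𝕜 ℂ none).contDiffOn
  have h2 : ContDiffOn 𝕜 n (fun w : Idx E → ℂ => w (some i)) {w | w none ≠ 0} :=
    (contDiff_apply 𝕜 ℂ (some i)).contDiffOn
  simp only [div_eq_mul_inv]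
  exact h2.mul (h1.inv fun w hw => hw)

theorem contMDiffOn_pt (x₀ : M) :
    ContMDiffOn 𝓘(𝕜, Idx E → ℂ) 𝓘(𝕜, E) n (pt E x₀) (cone E L x₀) :=
  (contMDiffOn_chart_symm (I := 𝓘(𝕜, E)) (n := n)).comp
    (contMDiffOn_affE.contMDiffOn.mono fun _ hw => hw.1) fun _ hw => hw.2.1

theorem contMDiffOn_homE (x₀ : M) :
    ContMDiffOn 𝓘(𝕜, E) 𝓘(𝕜, Idx E → ℂ) n (homE E M x₀) (chartAt E x₀).source := by
  have h : ContDiff 𝕜 n (fun e : E => fun a : Idx E => a.elim 1 (coordE E e)) := by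
    refine contDiff_pi.2 fun a => ?_
    cases a with
    | none => exact contDiff_const
    | some i =>
      exact (contDiff_apply 𝕜 ℂ i).comp
        ((coordE E).toContinuousLinearMap.restrictScalars 𝕜).contDiff
  exact h.contMDiff.comp_contMDiffOn (contMDiffOn_chart (I := 𝓘(𝕜, E)) (n := n))

variable (htr : ∀ x₀ x₁ : M, ContMDiffOn 𝓘(𝕜, E) 𝓘(𝕜, ℂ) n (transF L x₀ x₁)
  ((tr L x₀).baseSet ∩ (tr L x₁).baseSet))
include htr

/-- The manifold structure of the total space is tested in the trivialization at the image point,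
not in the one at `x₀`. The two differ by a transition function of `L`, which is why `htr` is the
only input about the bundle; it holds over ℂ by assumption and over ℝ by restriction of scalars. -/
theorem contMDiffOn_cinv (x₀ : M) :
    ContMDiffOn 𝓘(𝕜, Idx E → ℂ) (𝓘(𝕜, E).prod 𝓘(𝕜, ℂ →L[ℂ] ℂ)) n (cinv E L x₀)
      (cone E L x₀) := by
  intro w hw
  refine ContMDiffAt.contMDiffWithinAt (contMDiffAt_totalSpace.2 ?_)
  have hc : cone E L x₀ ∈ nhds w := (isOpen_cone x₀).mem_nhds hw
  have h1 : ContMDiffAt 𝓘(𝕜, Idx E → ℂ) 𝓘(𝕜, E) n (pt E x₀) w :=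
    (contMDiffOn_pt x₀).contMDiffAt hc
  refine ⟨h1, ?_⟩
  set x₁ := pt E x₀ w with hx₁
  have hb : {w' | pt E x₀ w' ∈ (tr L x₁).baseSet} ∈ nhds w :=
    h1.continuousAt.preimage_mem_nhds
      ((tr L x₁).open_baseSet.mem_nhds (mem_baseSet_trivializationAt ℂ L x₁))
  have h2 : ContMDiffAt 𝓘(𝕜, Idx E → ℂ) 𝓘(𝕜, ℂ) n (fun w' => transF L x₁ x₀ (pt E x₀ w')) w := by
    refine ContMDiffAt.comp w (g := transF L x₁ x₀) ?_ h1
    exact (htr x₁ x₀).contMDiffAt (((tr L x₁).open_baseSet.inter (tr L x₀).open_baseSet).mem_nhds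
      ⟨mem_baseSet_trivializationAt ℂ L x₁, hw.2.2⟩)
  have h3 : ContDiff 𝕜 n fun z : (Idx E → ℂ) × ℂ =>
      ((z.1 none * z.2 : ℂ) • ContinuousLinearMap.id ℂ ℂ : ℂ →L[ℂ] ℂ) :=
    (((contDiff_apply 𝕜 ℂ none).comp contDiff_fst).mul contDiff_snd).smul contDiff_const
  refine ((h3.contMDiff.contMDiffAt).comp w
    (contMDiffAt_id.prodMk_space h2)).congr_of_eventuallyEq ?_
  filter_upwards [hb, hc] with w' hw' hw''
  have := dual_trivialization_apply L (x₁ := x₁) (v := cinv E L x₀ w') hw'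
  refine this.trans ?_
  congr 1

theorem contMDiffAt_coordF (x₀ : M) {v : DualTot L} (hv : v.proj ∈ dom E L x₀) :
    ContMDiffAt (𝓘(𝕜, E).prod 𝓘(𝕜, ℂ →L[ℂ] ℂ)) 𝓘(𝕜, Idx E → ℂ) n (coordF E L x₀) v := by
  have hp : ContMDiffAt (𝓘(𝕜, E).prod 𝓘(𝕜, ℂ →L[ℂ] ℂ)) 𝓘(𝕜, E) n
      (fun v : DualTot L => v.proj) v := (contMDiffAt_totalSpace.1 contMDiffAt_id).1
  set x₁ := v.proj with hx₁
  have h0 : ContMDiffAt (𝓘(𝕜, E).prod 𝓘(𝕜, ℂ →L[ℂ] ℂ)) 𝓘(𝕜, ℂ →L[ℂ] ℂ) n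
      (fun v : DualTot L => (trivializationAt (ℂ →L[ℂ] ℂ) (DualFib L) x₁ v).2) v :=
    (contMDiffAt_totalSpace.1 contMDiffAt_id).2
  have h1 : ContMDiffAt (𝓘(𝕜, E).prod 𝓘(𝕜, ℂ →L[ℂ] ℂ)) 𝓘(𝕜, ℂ) n
      (fun v : DualTot L => transF L x₀ x₁ v.proj) v := by
    refine ContMDiffAt.comp v (g := transF L x₀ x₁) ?_ hp
    exact (htr x₀ x₁).contMDiffAt (((tr L x₀).open_baseSet.inter (tr L x₁).open_baseSet).mem_nhds
      ⟨hv.2, mem_baseSet_trivializationAt ℂ L x₁⟩)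
  have h2 : ContMDiffAt (𝓘(𝕜, E).prod 𝓘(𝕜, ℂ →L[ℂ] ℂ)) 𝓘(𝕜, Idx E → ℂ) n
      (fun v : DualTot L => homE E M x₀ v.proj) v :=
    ((contMDiffOn_homE x₀).contMDiffAt ((chartAt E x₀).open_source.mem_nhds hv.1)).comp v hp
  have h3 : ContDiff 𝕜 n fun z : ((ℂ →L[ℂ] ℂ) × ℂ) × (Idx E → ℂ) =>
      ((z.1.2 * z.1.1 1 : ℂ) • z.2 : Idx E → ℂ) :=
    ((contDiff_snd.comp contDiff_fst).mul
      ((((ContinuousLinearMap.apply ℂ ℂ (1 : ℂ)).restrictScalars 𝕜).contDiff).comp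
        (contDiff_fst.comp contDiff_fst))).smul contDiff_snd
  refine ((h3.contMDiff.contMDiffAt).comp v
    ((h0.prodMk_space h1).prodMk_space h2)).congr_of_eventuallyEq ?_
  have hb : {v' : DualTot L | v'.proj ∈ (tr L x₁).baseSet} ∈ nhds v :=
    hp.continuousAt.preimage_mem_nhds
      ((tr L x₁).open_baseSet.mem_nhds (mem_baseSet_trivializationAt ℂ L x₁))
  filter_upwards [hb] with v' hv'
  simp only [Function.comp]
  rw [dual_trivialization_apply L hv', coordF]
  congr 1
  rw [frm_eq L (x₀ := x₀) (x₁ := x₁) (x := v'.proj) hv', map_smul]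
  change _ * _ = _ * (v'.2 (frm L x₁ v'.proj) * 1 : ℂ)
  rw [mul_one]

theorem contMDiffAt_cinv_homE (x₀ : M) {c : ℂ} (hc : c ≠ 0) {x : M} (hx : x ∈ dom E L x₀) :
    ContMDiffAt 𝓘(𝕜, E) (𝓘(𝕜, E).prod 𝓘(𝕜, ℂ →L[ℂ] ℂ)) n
      (fun x => cinv E L x₀ (c • homE E M x₀ x)) x := by
  have h1 : ContMDiffAt 𝓘(𝕜, E) 𝓘(𝕜, Idx E → ℂ) n (fun x => c • homE E M x₀ x) x := by
    have : ContDiff 𝕜 n fun w : Idx E → ℂ => c • w :=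
      contDiff_pi.2 fun a => contDiff_const.mul (contDiff_apply 𝕜 ℂ a)
    exact this.contMDiff.contMDiffAt.comp x
      ((contMDiffOn_homE x₀).contMDiffAt ((chartAt E x₀).open_source.mem_nhds hx.1))
  exact ((contMDiffOn_cinv htr x₀).contMDiffAt
    ((isOpen_cone x₀).mem_nhds (smul_homE_mem_cone hc hx))).comp x h1

end Regularity

end Finite

end Charts

end HolJacobi

namespace HolJacobi

/-! ### Smooth and holomorphic functions on M̃ in coordinates -/

section SmoothStructure

variable {E : Type*} [NormedAddCommGroup E] [NormedSpace ℂ E] [FiniteDimensional ℂ E]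
  {M : Type*} [TopologicalSpace M] [T2Space M] [ChartedSpace E M] [IsManifold 𝓘(ℂ, E) ω M]
  {L : M → Type*} [TopologicalSpace (TotalSpace ℂ L)] [∀ x, AddCommGroup (L x)]
  [∀ x, Module ℂ (L x)] [∀ x, TopologicalSpace (L x)] [FiberBundle ℂ L] [VectorBundle ℂ ℂ L]
  [ContMDiffVectorBundle ω ℂ L 𝓘(ℂ, E)]

/-- Restriction of scalars in the charts; both models have full range, so the two differentiability
conditions refer to the same set. -/
theorem contMDiffAt_real_of_complex {F : Type*} [NormedAddCommGroup F] [NormedSpace ℂ F]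
    {f : M → F} {x : M} (h : ContMDiffAt 𝓘(ℂ, E) 𝓘(ℂ, F) ω f x) :
    ContMDiffAt 𝓘(ℝ, E) 𝓘(ℝ, F) ∞ f x := by
  rw [contMDiffAt_iff] at h ⊢
  refine ⟨h.1, ?_⟩
  have h2 := (h.2.restrict_scalars ℝ).of_le (m := ∞) le_top
  have e1 : Set.range (𝓘(ℂ, E)) = Set.univ := ModelWithCorners.range_eq_univ _
  have e2 : Set.range (𝓘(ℝ, E)) = Set.univ := ModelWithCorners.range_eq_univ _
  rw [e1] at h2
  rw [e2]
  exact h2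

variable (E M) in
theorem isManifold_real : IsManifold 𝓘(ℝ, E) ∞ M := by
  refine isManifold_of_contDiffOn _ _ _ fun e e' he he' => ?_
  have h : ContMDiffOn 𝓘(ℂ, E) 𝓘(ℂ, E) ω (e.symm.trans e') (e.symm.trans e').source := by
    have h1 := contMDiffOn_symm_of_mem_maximalAtlas (I := 𝓘(ℂ, E)) (n := ω)
      (IsManifold.subset_maximalAtlas he)
    have h2 := contMDiffOn_of_mem_maximalAtlas (I := 𝓘(ℂ, E)) (n := ω)
      (IsManifold.subset_maximalAtlas he')
    exact ContMDiffOn.comp (g := e') (f := e.symm) h2 (h1.mono fun x hx => hx.1) fun x hx => hx.2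
  rw [contMDiffOn_iff_contDiffOn] at h
  have h' := (h.restrict_scalars ℝ).of_le (m := ∞) le_top
  exact h'.mono fun x hx => hx.1

theorem contMDiffOn_transF (x₀ x₁ : M) : ContMDiffOn 𝓘(ℂ, E) 𝓘(ℂ, ℂ) ω (transF L x₀ x₁)
    ((tr L x₀).baseSet ∩ (tr L x₁).baseSet) := by
  have h1 := contMDiffOn_coordChangeL (IB := 𝓘(ℂ, E)) (n := ω) (tr L x₀) (tr L x₁)
  have h2 : ContDiff ℂ ω (ContinuousLinearMap.apply ℂ ℂ (1 : ℂ)) :=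
    (ContinuousLinearMap.apply ℂ ℂ (1 : ℂ)).contDiff
  refine (h2.contMDiff.comp_contMDiffOn h1).congr fun x hx => ?_
  change transF L x₀ x₁ x = (tr L x₀).coordChangeL ℂ (tr L x₁) x 1
  rw [(tr L x₀).coordChangeL_apply (tr L x₁) hx, transF,
    (tr L x₁).continuousLinearMapAt_apply_of_mem (R := ℂ) hx.2]
  rfl

theorem contMDiffOn_transF_real (x₀ x₁ : M) : ContMDiffOn 𝓘(ℝ, E) 𝓘(ℝ, ℂ) ∞ (transF L x₀ x₁)
    ((tr L x₀).baseSet ∩ (tr L x₁).baseSet) := fun _ hx =>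
  (contMDiffAt_real_of_complex ((contMDiffOn_transF (E := E) x₀ x₁).contMDiffAt
    (((tr L x₀).open_baseSet.inter (tr L x₁).open_baseSet).mem_nhds hx))).contMDiffWithinAt

/-- Extension by zero of a function on `M̃` to `L^*`. -/
def extS (f : Slit L → ℂ) (v : DualTot L) : ℂ :=
  open Classical in if h : v.2 ≠ 0 then f ⟨v, h⟩ else 0

theorem extS_val (f : Slit L → ℂ) (v : Slit L) : extS f v.1 = f v := dif_pos v.2

/-- Local expression of a function on `M̃`. -/
def loc (x₀ : M) (f : Slit L → ℂ) (w : Idx E → ℂ) : ℂ := extS f (cinv E L x₀ w)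

/-- Homogeneous coordinates on `M̃`. -/
def crd (E : Type*) [NormedAddCommGroup E] [NormedSpace ℂ E] [FiniteDimensional ℂ E]
    {M : Type*} [TopologicalSpace M] [ChartedSpace E M]
    {L : M → Type*} [TopologicalSpace (TotalSpace ℂ L)] [∀ x, AddCommGroup (L x)]
    [∀ x, Module ℂ (L x)] [∀ x, TopologicalSpace (L x)] [FiberBundle ℂ L] [VectorBundle ℂ ℂ L]
    (x₀ : M) (v : Slit L) : Idx E → ℂ := coordF E L x₀ v.1

theorem crd_mem_cone {x₀ : M} {v : Slit L} (hv : base v ∈ dom E L x₀) : crd E x₀ v ∈ cone E L x₀ :=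
  coordF_mem_cone hv v.2

theorem loc_crd {x₀ : M} {v : Slit L} (hv : base v ∈ dom E L x₀) (f : Slit L → ℂ) :
    loc x₀ f (crd E x₀ v) = f v := by
  rw [loc, crd, cinv_coordF hv v.2, extS_val]

/-- The point of `M̃` with given homogeneous coordinates. -/
def slitPt {x₀ : M} {w : Idx E → ℂ} (hw : w ∈ cone E L x₀) : Slit L :=
  ⟨cinv E L x₀ w, cinv_ne_zero hw⟩

theorem crd_slitPt {x₀ : M} {w : Idx E → ℂ} (hw : w ∈ cone E L x₀) :
    crd E x₀ (slitPt hw) = w := coordF_cinv hw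

theorem loc_eq {x₀ : M} {w : Idx E → ℂ} (hw : w ∈ cone E L x₀) (f : Slit L → ℂ) :
    loc x₀ f w = f (slitPt hw) := dif_pos (cinv_ne_zero hw)

theorem slitPt_crd {x₀ : M} {v : Slit L} (hv : base v ∈ dom E L x₀) :
    slitPt (crd_mem_cone hv) = v := Subtype.ext (cinv_coordF hv v.2)

theorem continuous_base : Continuous (base : Slit L → M) := 
  (FiberBundle.continuous_proj (ℂ →L[ℂ] ℂ) (DualFib L)).comp continuous_subtype_val

theorem isOpen_base_preimage {U : Set M} (hU : IsOpen U) : IsOpen (base ⁻¹' U : Set (Slit L)) :=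
  hU.preimage continuous_base

theorem contMDiffAt_slit_iff {f : Slit L → ℂ} {v : Slit L} :
    ContMDiffAt (𝓘(ℝ, E).prod 𝓘(ℝ, ℂ →L[ℂ] ℂ)) 𝓘(ℝ, ℂ) ∞ f v ↔
      ContMDiffAt (𝓘(ℝ, E).prod 𝓘(ℝ, ℂ →L[ℂ] ℂ)) 𝓘(ℝ, ℂ) ∞ (extS f) v.1 := by
  rw [← contMDiffAt_subtype_iff]
  have : (fun x : Slit L => extS f x.1) = f := funext (extS_val f)
  rw [this]

theorem mdifferentiableAt_slit_iff {f : Slit L → ℂ} {v : Slit L} :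
    MDifferentiableAt (𝓘(ℂ, E).prod 𝓘(ℂ, ℂ →L[ℂ] ℂ)) 𝓘(ℂ, ℂ) f v ↔
      MDifferentiableAt (𝓘(ℂ, E).prod 𝓘(ℂ, ℂ →L[ℂ] ℂ)) 𝓘(ℂ, ℂ) (extS f) v.1 := by
  have h := (differentiableWithinAt_localInvariantProp
    (I := 𝓘(ℂ, E).prod 𝓘(ℂ, ℂ →L[ℂ] ℂ)) (I' := 𝓘(ℂ, ℂ))).liftPropAt_iff_comp_subtype_val
      (extS f) v
  have e : extS f ∘ Subtype.val = f := funext (extS_val f)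
  rw [e] at h
  exact h.symm

theorem contMDiffAt_crd {x₀ : M} {v : Slit L} (hv : base v ∈ dom E L x₀) :
    ContMDiffAt (𝓘(ℝ, E).prod 𝓘(ℝ, ℂ →L[ℂ] ℂ)) 𝓘(ℝ, Idx E → ℂ) ∞ (crd E x₀) v := by
  have := isManifold_real E M
  exact (contMDiffAt_coordF (n := ∞) (contMDiffOn_transF_real (E := E)) x₀ hv).comp v
    (contMDiff_subtype_val v)

theorem contDiffAt_loc {f : Slit L → ℂ} {x₀ : M} {w : Idx E → ℂ} (hw : w ∈ cone E L x₀)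
    (hf : ContMDiffAt (𝓘(ℝ, E).prod 𝓘(ℝ, ℂ →L[ℂ] ℂ)) 𝓘(ℝ, ℂ) ∞ f (slitPt hw)) :
    ContDiffAt ℝ ∞ (loc x₀ f) w := by
  have := isManifold_real E M
  have h1 := (contMDiffOn_cinv (n := ∞) (contMDiffOn_transF_real (E := E) (L := L))
    x₀).contMDiffAt ((isOpen_cone x₀).mem_nhds hw)
  have h2 := contMDiffAt_slit_iff.1 hf
  exact (ContMDiffAt.comp w (g := extS f) h2 h1).contDiffAt

theorem contDiffOn_loc (f : SlitC E L) (x₀ : M) : ContDiffOn ℝ ∞ (loc x₀ f.1) (cone E L x₀) :=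
  fun _ hw => (contDiffAt_loc hw (f.2 _)).contDiffWithinAt

theorem contMDiffAt_of_crd {f : Slit L → ℂ} {x₀ : M} {v : Slit L} (hv : base v ∈ dom E L x₀)
    {G : (Idx E → ℂ) → ℂ} (hG : ContDiffAt ℝ ∞ G (crd E x₀ v))
    (h : f =ᶠ[nhds v] fun v => G (crd E x₀ v)) :
    ContMDiffAt (𝓘(ℝ, E).prod 𝓘(ℝ, ℂ →L[ℂ] ℂ)) 𝓘(ℝ, ℂ) ∞ f v :=
  (ContMDiffAt.comp v (g := G) hG.contMDiffAt (contMDiffAt_crd hv)).congr_of_eventuallyEq h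

theorem mdifferentiableAt_cinv {x₀ : M} {w : Idx E → ℂ} (hw : w ∈ cone E L x₀) :
    MDifferentiableAt 𝓘(ℂ, Idx E → ℂ) (𝓘(ℂ, E).prod 𝓘(ℂ, ℂ →L[ℂ] ℂ)) (cinv E L x₀) w :=
  ((contMDiffOn_cinv (𝕜 := ℂ) (n := ω) (contMDiffOn_transF (E := E) (L := L))
    x₀).contMDiffAt ((isOpen_cone x₀).mem_nhds hw)).mdifferentiableAt (by simp)

/-- The coordinates and their inverse are both holomorphic, so holomorphy at one point may be tested
on the coordinate expression. -/
theorem mdifferentiableAt_slit_iff_loc {f : Slit L → ℂ} {x₀ : M} {v : Slit L}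
    (hv : base v ∈ dom E L x₀) :
    MDifferentiableAt (𝓘(ℂ, E).prod 𝓘(ℂ, ℂ →L[ℂ] ℂ)) 𝓘(ℂ, ℂ) f v ↔
      DifferentiableAt ℂ (loc x₀ f) (crd E x₀ v) := by
  rw [mdifferentiableAt_slit_iff]
  constructor
  · intro h
    have h1 := mdifferentiableAt_cinv (crd_mem_cone hv)
    have e : cinv E L x₀ (crd E x₀ v) = v.1 := cinv_coordF hv v.2
    rw [← e] at h
    exact (MDifferentiableAt.comp _ h h1).differentiableAt
  · intro h
    have h1 : MDifferentiableAt (𝓘(ℂ, E).prod 𝓘(ℂ, ℂ →L[ℂ] ℂ)) 𝓘(ℂ, Idx E → ℂ)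
        (coordF E L x₀) v.1 :=
      (contMDiffAt_coordF (𝕜 := ℂ) (n := ω) (contMDiffOn_transF (E := E)) x₀
        hv).mdifferentiableAt (by simp)
    refine (MDifferentiableAt.comp v.1 (g := loc x₀ f) h.mdifferentiableAt
      h1).congr_of_eventuallyEq ?_
    have hb : {v' : DualTot L | v'.proj ∈ dom E L x₀} ∈ nhds v.1 :=
      (FiberBundle.continuous_proj (ℂ →L[ℂ] ℂ) (DualFib L)).continuousAt.preimage_mem_nhds
        ((isOpen_dom x₀).mem_nhds hv)
    filter_upwards [hb, (isOpen_slit L).mem_nhds v.2] with v' h1 h2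
    exact ((loc_crd (v := ⟨v', h2⟩) h1 f).trans (extS_val f ⟨v', h2⟩).symm).symm

end SmoothStructure

end HolJacobi

namespace HolJacobi

/-! ### Complex and real smooth functions -/

section FunctionAlgebras

variable {E H : Type*} [NormedAddCommGroup E] [NormedSpace ℝ E] [TopologicalSpace H]
  {I : ModelWithCorners ℝ E H} {N : Type*} [TopologicalSpace N] [ChartedSpace H N]

theorem smoothC_ext {f g : SmoothC I N} (h : ∀ x, f.1 x = g.1 x) : f = g := Subtype.ext (funext h)

theorem smoothR_ext {f g : SmoothR I N} (h : ∀ x, f.1 x = g.1 x) : f = g := Subtype.ext (funext h)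

@[simp] theorem smoothC_add (f g : SmoothC I N) (x : N) : (f + g).1 x = f.1 x + g.1 x := rfl

@[simp] theorem smoothC_sub (f g : SmoothC I N) (x : N) : (f - g).1 x = f.1 x - g.1 x := rfl

@[simp] theorem smoothC_neg (f : SmoothC I N) (x : N) : (-f).1 x = -f.1 x := rfl

@[simp] theorem smoothC_mul (f g : SmoothC I N) (x : N) : (f * g).1 x = f.1 x * g.1 x := rfl

@[simp] theorem smoothC_zero (x : N) : (0 : SmoothC I N).1 x = 0 := rfl

@[simp] theorem smoothC_one (x : N) : (1 : SmoothC I N).1 x = 1 := rfl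

@[simp] theorem smoothC_smul (c : ℂ) (f : SmoothC I N) (x : N) : (c • f).1 x = c * f.1 x := rfl

@[simp] theorem smoothC_algebraMap (c : ℂ) (x : N) : (algebraMap ℂ (SmoothC I N) c).1 x = c := rfl

@[simp] theorem conjF_val (f : SmoothC I N) (x : N) :
    (conjF f).1 x = starRingEnd ℂ (f.1 x) := rfl

@[simp] theorem reF_val (f : SmoothC I N) (x : N) : (reF f).1 x = (f.1 x).re := rfl

@[simp] theorem imF_val (f : SmoothC I N) (x : N) : (imF f).1 x = (f.1 x).im := rfl

@[simp] theorem ofRealF_val (f : SmoothR I N) (x : N) : (ofRealF I N f).1 x = (f.1 x : ℂ) := rfl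

@[simp] theorem smoothC_sum {ι : Type*} (s : Finset ι) (f : ι → SmoothC I N) (x : N) :
    (∑ i ∈ s, f i).1 x = ∑ i ∈ s, (f i).1 x := by
  classical
  induction s using Finset.induction_on with
  | empty => rfl
  | insert a s ha ih => rw [Finset.sum_insert ha, Finset.sum_insert ha, smoothC_add, ih]

@[simp] theorem conjF_conjF (f : SmoothC I N) : conjF (conjF f) = f :=
  smoothC_ext fun _ => Complex.conj_conj _

theorem conjF_add (f g : SmoothC I N) : conjF (f + g) = conjF f + conjF g :=
  smoothC_ext fun _ => map_add _ _ _

theorem conjF_mul (f g : SmoothC I N) : conjF (f * g) = conjF f * conjF g :=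
  smoothC_ext fun _ => map_mul _ _ _

@[simp] theorem conjF_ofRealF (f : SmoothR I N) : conjF (ofRealF I N f) = ofRealF I N f :=
  smoothC_ext fun _ => Complex.conj_ofReal _

theorem ofRealF_reF (f : SmoothC I N) :
    ofRealF I N (reF f) = (1 / 2 : ℂ) • (f + conjF f) := smoothC_ext fun x => by
  simp only [ofRealF_val, reF_val, smoothC_smul, smoothC_add, conjF_val, Complex.add_conj]
  push_cast; ring

theorem eq_re_add_im (f : SmoothC I N) :
    f = ofRealF I N (reF f) + Complex.I • ofRealF I N (imF f) := smoothC_ext fun x => by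
  simp only [smoothC_add, ofRealF_val, reF_val, smoothC_smul, imF_val]
  rw [mul_comm]; exact (Complex.re_add_im _).symm

theorem ofRealF_injective : Function.Injective (ofRealF I N) := fun _ _ h =>
  smoothR_ext fun x => Complex.ofReal_injective (congrArg (fun k : SmoothC I N => k.1 x) h)

theorem ofRealF_smul (c : ℝ) (f : SmoothR I N) :
    ofRealF I N (c • f) = (c : ℂ) • ofRealF I N f :=
  smoothC_ext fun _ => Complex.ofReal_mul _ _

theorem derivation_const_smul {k A : Type*} [CommRing k] [CommRing A] [Algebra k A]
    (X : Derivation k A A) (c : k) (f : A) : X (c • f) = c • X f := X.map_smul c f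

end FunctionAlgebras

/-! ### Complex scaling; functions on M and sections of L as homogeneous functions on M̃ -/

section Scaling

variable {E : Type*} [NormedAddCommGroup E] [NormedSpace ℂ E] [FiniteDimensional ℂ E]
  {M : Type*} [TopologicalSpace M] [T2Space M] [ChartedSpace E M] [IsManifold 𝓘(ℂ, E) ω M]
  {L : M → Type*} [TopologicalSpace (TotalSpace ℂ L)] [∀ x, AddCommGroup (L x)]
  [∀ x, Module ℂ (L x)] [∀ x, TopologicalSpace (L x)] [FiberBundle ℂ L] [VectorBundle ℂ ℂ L]
  [ContMDiffVectorBundle ω ℂ L 𝓘(ℂ, E)]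

/-- Multiplication by nonzero complex numbers on `M̃`. -/
def sc (ζ : ℂˣ) (v : Slit L) : Slit L :=
  ⟨⟨v.1.proj, ((ζ : ℂ) • v.1.2 : L v.1.proj →L[ℂ] ℂ)⟩, smul_ne_zero (M := L v.1.proj →L[ℂ] ℂ)
    ζ.ne_zero v.2⟩

@[simp] theorem base_sc (ζ : ℂˣ) (v : Slit L) : base (sc ζ v) = base v := rfl

theorem crd_sc (x₀ : M) (ζ : ℂˣ) (v : Slit L) : crd E x₀ (sc ζ v) = (ζ : ℂ) • crd E x₀ v := by
  simp only [crd, coordF, smul_smul]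
  rfl

theorem exists_sc_eq {v w : Slit L} (h : base v = base w) : ∃ ζ : ℂˣ, w = sc ζ v := by
  obtain ⟨⟨x, a⟩, ha⟩ := v
  obtain ⟨⟨x', b⟩, hb⟩ := w
  obtain rfl : x = x' := h
  have hx := mem_baseSet_trivializationAt ℂ L x
  have ha' : (a (frm L x x) : ℂ) ≠ 0 := fun h0 => ha (vec_ext L hx (by rw [h0]; rfl))
  have hb' : (b (frm L x x) : ℂ) ≠ 0 := fun h0 => hb (vec_ext L hx (by rw [h0]; rfl))
  refine ⟨Units.mk0 _ (div_ne_zero hb' ha'), Subtype.ext ?_⟩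
  change (⟨x, b⟩ : DualTot L) = ⟨x, _⟩
  congr 1
  refine vec_ext L hx ?_
  change (b (frm L x x) : ℂ) = (b (frm L x x) : ℂ) / a (frm L x x) * a (frm L x x)
  field_simp

theorem vec_eq_of_eq_sc {ζ : ℂˣ} {v w : Slit L} (h : w = sc ζ v) (s : ∀ x, L x) :
    (vec w (s (base w)) : ℂ) = ζ * (vec v (s (base v)) : ℂ) := by
  subst h; rfl

/-- A point of `M̃` over a given point of `M`. -/
def slitOver (x : M) : Slit L :=
  ⟨⟨x, (tr L x).continuousLinearMapAt ℂ x⟩, fun h => by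
    have := clm_frm L (mem_baseSet_trivializationAt ℂ L x)
    change (tr L x).continuousLinearMapAt ℂ x = 0 at h
    rw [h] at this
    exact zero_ne_one this⟩

/-- Pull-back of functions along a complex scaling. -/
def scF (ζ : ℂˣ) (f : SlitC E L) : SlitC E L :=
  ⟨fun v => f.1 (sc ζ v), fun v => by
    have hv : base v ∈ dom E L (base v) := mem_dom _
    have hG : ContDiffAt ℝ ∞ (fun w => loc (base v) f.1 ((ζ : ℂ) • w)) (crd E (base v) v) := by
      have h1 : ContDiffAt ℝ ∞ (loc (base v) f.1) ((ζ : ℂ) • crd E (base v) v) :=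
        (contDiffOn_loc f (base v)).contDiffAt
          ((isOpen_cone _).mem_nhds (smul_mem_cone (crd_mem_cone hv) ζ.ne_zero))
      have h2 : ContDiff ℝ ∞ fun w : Idx E → ℂ => (ζ : ℂ) • w :=
        contDiff_pi.2 fun a => contDiff_const.mul (contDiff_apply ℝ ℂ a)
      exact ContDiffAt.comp _ (g := loc (base v) f.1) h1 h2.contDiffAt
    refine contMDiffAt_of_crd hv hG ?_
    filter_upwards [(isOpen_base_preimage (isOpen_dom (base v))).mem_nhds hv] with v' hv'
    rw [← crd_sc, loc_crd (v := sc ζ v') hv']⟩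

@[simp] theorem scF_val (ζ : ℂˣ) (f : SlitC E L) (v : Slit L) : (scF ζ f).1 v = f.1 (sc ζ v) := rfl

theorem scF_mul (ζ : ℂˣ) (f g : SlitC E L) : scF ζ (f * g) = scF ζ f * scF ζ g := rfl

theorem scF_smul (ζ : ℂˣ) (c : ℂ) (f : SlitC E L) : scF ζ (c • f) = c • scF ζ f := rfl

theorem scF_conjF (ζ : ℂˣ) (f : SlitC E L) : scF ζ (conjF f) = conjF (scF ζ f) := rfl

theorem tilde_val (s : Sec E L) (v : Slit L) : (tilde s).1 v = vec v (s.1 (base v)) := rfl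

theorem scF_tilde (ζ : ℂˣ) (s : Sec E L) : scF ζ (tilde s) = (ζ : ℂ) • tilde s := rfl

/-- Pull-back of functions along `M̃ → M`. -/
def pb : FunC E M →+* SlitC E L where
  toFun f := ⟨fun v => f.1 (base v), f.2.comp (contMDiff_base E)⟩
  map_one' := rfl
  map_mul' _ _ := rfl
  map_zero' := rfl
  map_add' _ _ := rfl

@[simp] theorem pb_val (f : FunC E M) (v : Slit L) : (pb (L := L) f).1 v = f.1 (base v) := rfl

theorem scF_pb (ζ : ℂˣ) (f : FunC E M) : scF ζ (pb (L := L) f) = pb f := rfl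

theorem pb_conjF (f : FunC E M) : pb (L := L) (conjF f) = conjF (pb f) := rfl

theorem pb_injective : Function.Injective (pb (E := E) (L := L)) := fun _ _ h =>
  smoothC_ext fun x => congrArg (fun k : SlitC E L => k.1 (slitOver x)) h

theorem tilde_add (s t : Sec E L) : tilde (s + t) = tilde s + tilde t :=
  smoothC_ext fun v => (vec v).map_add _ _

theorem tilde_zero : tilde (0 : Sec E L) = 0 := smoothC_ext fun v => (vec v).map_zero

theorem tilde_neg (s : Sec E L) : tilde (-s) = -tilde s :=
  smoothC_ext fun v => (vec v).map_neg _

theorem tilde_sub (s t : Sec E L) : tilde (s - t) = tilde s - tilde t :=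
  smoothC_ext fun v => (vec v).map_sub _ _

theorem tilde_smul (f : FunC E M) (s : Sec E L) : tilde (f • s) = pb f * tilde s :=
  smoothC_ext fun v => (vec v).map_smul _ _

theorem tilde_const_smul (c : ℂ) (s : Sec E L) : tilde (c • s) = c • tilde s :=
  smoothC_ext fun v => (vec v).map_smul _ _

theorem eq_of_vec_eq {v : Slit L} {l l' : L (base v)} (h : (vec v l : ℂ) = vec v l') : l = l' := by
  have hx := mem_baseSet_trivializationAt ℂ L (base v)
  have h0 : (vec v (frm L (base v) (base v)) : ℂ) ≠ 0 := fun h0 =>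
    v.2 (vec_ext L hx (by change (vec v _ : ℂ) = _; rw [h0]; rfl))
  rw [eq_smul_frm L hx l, eq_smul_frm L hx l', map_smul, map_smul] at h
  rw [eq_smul_frm L hx l, eq_smul_frm L hx l']
  congr 1
  exact mul_right_cancel₀ h0 h

theorem sec_ext_tilde {s t : Sec E L} (h : tilde s = tilde t) : s = t :=
  Subtype.ext (funext fun x => eq_of_vec_eq (v := slitOver x)
    (congrArg (fun k : SlitC E L => k.1 (slitOver x)) h))

theorem sec_eq_at {s t : Sec E L} {v : Slit L} (h : (tilde s).1 v = (tilde t).1 v) :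
    s.1 (base v) = t.1 (base v) := eq_of_vec_eq h

theorem tilde_eq_at {s t : Sec E L} {v : Slit L} (h : s.1 (base v) = t.1 (base v)) :
    (tilde s).1 v = (tilde t).1 v := by rw [tilde_val, tilde_val, h]

/-- The map x ↦ `cinv` of `c • homE` is the constant multiple `c` of the dual frame, a local section
of M̃ → M. Restricting to it brings functions on M̃ down to M, smoothly and holomorphically. -/
theorem extS_section {x₀ x : M} (hx : x ∈ dom E L x₀) (f : Slit L → ℂ) {c : ℂ} (hc : c ≠ 0)
    (h : (c • (tr L x₀).continuousLinearMapAt ℂ x : L x →L[ℂ] ℂ) ≠ 0) :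
    extS f (cinv E L x₀ (c • homE E M x₀ x)) =
      f ⟨⟨x, (c • (tr L x₀).continuousLinearMapAt ℂ x : L x →L[ℂ] ℂ)⟩, h⟩ := by
  rw [cinv_smul_homE hc hx]
  exact dif_pos h

theorem smul_clm_ne_zero {x₀ x : M} (hx : x ∈ dom E L x₀) {c : ℂ} (hc : c ≠ 0) :
    (c • (tr L x₀).continuousLinearMapAt ℂ x : L x →L[ℂ] ℂ) ≠ 0 := by
  intro h
  have h1 := clm_frm L hx.2
  have h2 : (c • (tr L x₀).continuousLinearMapAt ℂ x : L x →L[ℂ] ℂ) (frm L x₀ x) = 0 := by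
    rw [h]; rfl
  change c * (tr L x₀).continuousLinearMapAt ℂ x (frm L x₀ x) = 0 at h2
  rw [h1, mul_one] at h2
  exact hc h2

theorem contMDiffAt_extS_section (f : SlitC E L) {x₀ x : M} (hx : x ∈ dom E L x₀) {c : ℂ}
    (hc : c ≠ 0) :
    ContMDiffAt 𝓘(ℝ, E) 𝓘(ℝ, ℂ) ∞ (fun x => extS f.1 (cinv E L x₀ (c • homE E M x₀ x))) x := by
  have := isManifold_real E M
  have h1 := contMDiffAt_cinv_homE (n := ∞) (contMDiffOn_transF_real (E := E) (L := L)) x₀ hc hx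
  refine ContMDiffAt.comp x (g := extS f.1) ?_ h1
  have h2 : ContMDiffAt _ _ _ f.1 (slitPt (smul_homE_mem_cone hc hx)) := f.2 _
  exact contMDiffAt_slit_iff.1 h2

theorem mdifferentiableAt_extS_section {f : Slit L → ℂ} {x₀ x : M} (hx : x ∈ dom E L x₀) {c : ℂ}
    (hc : c ≠ 0) (hf : MDifferentiableAt (𝓘(ℂ, E).prod 𝓘(ℂ, ℂ →L[ℂ] ℂ)) 𝓘(ℂ, ℂ) f
      ⟨⟨x, (c • (tr L x₀).continuousLinearMapAt ℂ x : L x →L[ℂ] ℂ)⟩, smul_clm_ne_zero hx hc⟩) :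
    MDifferentiableAt 𝓘(ℂ, E) 𝓘(ℂ, ℂ) (fun x => extS f (cinv E L x₀ (c • homE E M x₀ x))) x := by
  have h1 := (contMDiffAt_cinv_homE (𝕜 := ℂ) (n := ω) (contMDiffOn_transF (E := E) (L := L)) x₀
    hc hx).mdifferentiableAt (by simp)
  refine MDifferentiableAt.comp x (g := extS f) ?_ h1
  have h2 := mdifferentiableAt_slit_iff.1 hf
  rw [cinv_smul_homE hc hx]
  exact h2

/-- Functions on `M̃` that are constant on the fibres descend to `M`. -/
theorem exists_pb_eq (f : SlitC E L) (hf : ∀ ζ, scF ζ f = f) : ∃ g : FunC E M, pb g = f := by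
  have h0 : ∀ v, f.1 (slitOver (base v)) = f.1 v := fun v => by
    obtain ⟨ζ, hζ⟩ := exists_sc_eq (v := v) (w := slitOver (base v)) rfl
    rw [hζ, ← scF_val, hf]
  refine ⟨⟨fun x => f.1 (slitOver x), fun x₀ => ?_⟩, smoothC_ext h0⟩
  refine (contMDiffAt_extS_section f (mem_dom x₀) one_ne_zero).congr_of_eventuallyEq ?_
  filter_upwards [(isOpen_dom (E := E) (L := L) x₀).mem_nhds (mem_dom x₀)] with x hx
  rw [extS_section hx _ one_ne_zero (smul_clm_ne_zero hx one_ne_zero)]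
  exact h0 ⟨⟨x, _⟩, smul_clm_ne_zero hx one_ne_zero⟩

theorem trivialization_eq_extS {s : ∀ x, L x} {f : Slit L → ℂ}
    (h : ∀ v, f v = vec v (s (base v))) {x₀ x : M} (hx : x ∈ dom E L x₀) :
    (trivializationAt ℂ L x₀ ⟨x, s x⟩).2 = extS f (cinv E L x₀ ((1 : ℂ) • homE E M x₀ x)) := by
  rw [extS_section hx _ one_ne_zero (smul_clm_ne_zero hx one_ne_zero), h]
  change _ = (1 : ℂ) * (tr L x₀).continuousLinearMapAt ℂ x (s x)
  rw [one_mul, (tr L x₀).continuousLinearMapAt_apply_of_mem (R := ℂ) hx.2]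

/-- Functions on `M̃` that are linear on the fibres are given by sections of `L`. -/
theorem exists_tilde_eq (f : SlitC E L) (hf : ∀ ζ, scF ζ f = (ζ : ℂ) • f) :
    ∃ s : Sec E L, tilde s = f := by
  -- `slitOver x` takes the value 1 on `frm L x x`, so this is the section whose fibrewise linear
  -- function has the right value at `slitOver x`; homogeneity does the rest of the fibre.
  let s : ∀ x, L x := fun x => f.1 (slitOver x) • frm L x x
  have hs : ∀ v, f.1 v = vec v (s (base v)) := fun v => by
    obtain ⟨ζ, hζ⟩ := exists_sc_eq (v := slitOver (base v)) (w := v) rfl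
    have hx := mem_baseSet_trivializationAt ℂ L (base v)
    have h1 : (vec (slitOver (base v)) (s (base v)) : ℂ) = f.1 (slitOver (base v)) := by
      change (tr L (base v)).continuousLinearMapAt ℂ (base v) (_ • _) = _
      rw [map_smul, clm_frm L hx, smul_eq_mul, mul_one]
    have h2 : (vec v (s (base v)) : ℂ) = ζ * (vec (slitOver (base v)) (s (base v)) : ℂ) :=
      vec_eq_of_eq_sc hζ s
    rw [h2, h1]
    conv_lhs => rw [hζ, ← scF_val, hf]
    rfl
  refine ⟨⟨s, fun x₀ => ?_⟩, smoothC_ext fun v => (hs v).symm⟩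
  refine (contMDiffAt_section x₀).2 ?_
  refine (contMDiffAt_extS_section f (mem_dom x₀) one_ne_zero).congr_of_eventuallyEq ?_
  filter_upwards [(isOpen_dom (E := E) (L := L) x₀).mem_nhds (mem_dom x₀)] with x hx
  exact trivialization_eq_extS hs hx

/-- In one direction the function is restricted to a holomorphic local section of the dual through
`v`, where it is a constant multiple of the coefficient of `s`. In the other it is the product of
that coefficient with the linear fibre coordinate. -/
theorem mdifferentiableAt_tilde_iff {s : Sec E L} {v : Slit L} :
    MDifferentiableAt (𝓘(ℂ, E).prod 𝓘(ℂ, ℂ →L[ℂ] ℂ)) 𝓘(ℂ, ℂ) (tilde s).1 v ↔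
      MDifferentiableAt 𝓘(ℂ, E) (𝓘(ℂ, E).prod 𝓘(ℂ, ℂ)) (fun x => TotalSpace.mk' ℂ x (s.1 x))
        (base v) := by
  set x₀ := base v with hx₀
  have hd : dom E L x₀ ∈ nhds x₀ := (isOpen_dom x₀).mem_nhds (mem_dom x₀)
  rw [mdifferentiableAt_section]
  constructor
  · intro h
    have hc : (vec v (frm L x₀ x₀) : ℂ) ≠ 0 := vec_frm_ne_zero (mem_dom (E := E) x₀) v.2
    have e : v = ⟨⟨x₀, ((vec v (frm L x₀ x₀) : ℂ) • (tr L x₀).continuousLinearMapAt ℂ x₀ :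
        L x₀ →L[ℂ] ℂ)⟩, smul_clm_ne_zero (mem_dom (E := E) x₀) hc⟩ := by
      apply Subtype.ext
      obtain ⟨⟨x, a⟩, ha⟩ := v
      change (⟨x, a⟩ : DualTot L) = ⟨x, _⟩
      congr 1
      refine vec_ext L (mem_baseSet_trivializationAt ℂ L x) ?_
      change _ = (a (frm L x x) : ℂ) * (tr L x).continuousLinearMapAt ℂ x (frm L x x)
      rw [clm_frm L (mem_baseSet_trivializationAt ℂ L x), mul_one]
    rw [e] at h
    have h1 := mdifferentiableAt_extS_section (mem_dom x₀) hc h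
    set c : ℂ := vec v (frm L x₀ x₀)
    have h2 : MDifferentiableAt 𝓘(ℂ, E) 𝓘(ℂ, ℂ) (fun x => c⁻¹ *
        extS (tilde s).1 (cinv E L x₀ (c • homE E M x₀ x))) x₀ :=
      MDifferentiableAt.comp x₀ (g := fun z : ℂ => c⁻¹ * z)
        (differentiableAt_id.const_mul _).mdifferentiableAt h1
    refine h2.congr_of_eventuallyEq ?_
    filter_upwards [hd] with x hx
    rw [extS_section hx _ hc (smul_clm_ne_zero hx hc)]
    change _ = c⁻¹ * (c * (tr L x₀).continuousLinearMapAt ℂ x (s.1 x))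
    rw [inv_mul_cancel_left₀ hc, (tr L x₀).continuousLinearMapAt_apply_of_mem (R := ℂ) hx.2]
  · intro h
    rw [mdifferentiableAt_slit_iff]
    have hp : MDifferentiableAt (𝓘(ℂ, E).prod 𝓘(ℂ, ℂ →L[ℂ] ℂ)) 𝓘(ℂ, E)
        (fun v : DualTot L => v.proj) v.1 :=
      ((mdifferentiableAt_totalSpace 𝓘(ℂ, E) _).1 mdifferentiableAt_id).1
    have h1 := MDifferentiableAt.comp v.1 (f := fun v : DualTot L => v.proj) h hp
    have h2 : MDifferentiableAt (𝓘(ℂ, E).prod 𝓘(ℂ, ℂ →L[ℂ] ℂ)) 𝓘(ℂ, ℂ)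
        (fun v => coordF E L x₀ v none) v.1 := by
      have h3 : MDifferentiableAt (𝓘(ℂ, E).prod 𝓘(ℂ, ℂ →L[ℂ] ℂ)) 𝓘(ℂ, Idx E → ℂ)
          (coordF E L x₀) v.1 :=
        (contMDiffAt_coordF (𝕜 := ℂ) (n := ω) (contMDiffOn_transF (E := E)) x₀
          (mem_dom x₀)).mdifferentiableAt (by simp)
      exact MDifferentiableAt.comp v.1 (g := fun w : Idx E → ℂ => w none)
        (differentiableAt_apply none _).mdifferentiableAt h3
    have h4 := MDifferentiableAt.comp v.1 (g := fun z : ℂ × ℂ => z.1 * z.2)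
      (f := fun v : DualTot L => (coordF E L x₀ v none,
        (trivializationAt ℂ L x₀ ⟨v.proj, s.1 v.proj⟩).2))
      (differentiableAt_fst.mul differentiableAt_snd).mdifferentiableAt (h2.prodMk_space h1)
    refine h4.congr_of_eventuallyEq ?_
    filter_upwards [(FiberBundle.continuous_proj (ℂ →L[ℂ] ℂ)
      (DualFib L)).continuousAt.preimage_mem_nhds hd, (isOpen_slit L).mem_nhds v.2] with w hw hw'
    have e1 : extS (tilde s).1 w = (w.2 (s.1 w.proj) : ℂ) := dif_pos hw'
    rw [e1]
    change (w.2 (s.1 w.proj) : ℂ) = ((w.2 (frm L x₀ w.proj) : ℂ) * 1) * _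
    rw [mul_one, mul_comm, ← (tr L x₀).continuousLinearMapAt_apply_of_mem (R := ℂ) hw.2,
      ← smul_eq_mul, ← map_smul, ← eq_smul_frm L hw.2]

theorem isHolSec_iff {U : Set M} (hU : IsOpen U) {s : Sec E L} :
    IsHolSec U s ↔ IsHolSlit (base ⁻¹' U) (tilde s) := by
  constructor
  · intro h v hv
    exact (mdifferentiableAt_tilde_iff.2 (h.mdifferentiableAt
      (hU.mem_nhds hv))).mdifferentiableWithinAt
  · intro h x hx
    have := h.mdifferentiableAt (x := slitOver x) ((isOpen_base_preimage hU).mem_nhds hx)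
    exact (mdifferentiableAt_tilde_iff.1 this).mdifferentiableWithinAt

/-- Bump functions on `M`. -/
theorem exists_bump {U : Set M} (hU : IsOpen U) {x : M} (hx : x ∈ U) :
    ∃ (b : FunR E M) (V : Set M), IsOpen V ∧ x ∈ V ∧ V ⊆ U ∧ (∀ y ∈ V, b.1 y = 1) ∧
      tsupport b.1 ⊆ U := by
  have := isManifold_real E M
  obtain ⟨φ, -, hφ⟩ := (SmoothBumpFunction.nhds_basis_tsupport (I := 𝓘(ℝ, E)) x).mem_iff.1
    (hU.mem_nhds hx)
  obtain ⟨V, hV, hVo, hxV⟩ := mem_nhds_iff.1 (φ.eventuallyEq_one)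
  exact ⟨⟨φ, φ.contMDiff⟩, V ∩ U, hVo.inter hU, ⟨hxV, hx⟩, Set.inter_subset_right,
    fun y hy => hV hy.1, hφ⟩

/-- Cut-off of a function of the homogeneous coordinates. -/
def liftF (x₀ : M) (χ : FunR E M) (hχ : tsupport χ.1 ⊆ dom E L x₀) (G : (Idx E → ℂ) → ℂ)
    (hG : ContDiffOn ℝ ∞ G (cone E L x₀)) : SlitC E L :=
  ⟨fun v => (χ.1 (base v) : ℂ) * G (crd E x₀ v), fun v => by
    by_cases hv : base v ∈ tsupport χ.1
    · have h1 : ContMDiffAt (𝓘(ℝ, E).prod 𝓘(ℝ, ℂ →L[ℂ] ℂ)) 𝓘(ℝ, ℂ) ∞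
          (fun v : Slit L => G (crd E x₀ v)) v :=
        contMDiffAt_of_crd (hχ hv) (hG.contDiffAt ((isOpen_cone x₀).mem_nhds
          (crd_mem_cone (hχ hv)))) Filter.EventuallyEq.rfl
      have h2 := (pb (L := L) (ofRealF _ _ χ)).2 v
      have h : ContDiff ℝ ∞ fun z : ℂ × ℂ => z.1 * z.2 := contDiff_fst.mul contDiff_snd
      exact h.contMDiff.contMDiffAt.comp v (h2.prodMk_space h1)
    · refine (contMDiffAt_const (c := (0 : ℂ))).congr_of_eventuallyEq ?_
      filter_upwards [(isOpen_base_preimage (isClosed_tsupport χ.1).isOpen_compl).mem_nhds hv]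
        with w hw
      rw [image_eq_zero_of_notMem_tsupport hw]
      simp⟩

end Scaling

end HolJacobi

namespace HolJacobi

/-! ### Hadamard's lemma by integration along segments -/

section Hadamard

open intervalIntegral MeasureTheory

variable {V : Type} [NormedAddCommGroup V] [NormedSpace ℝ V] [FiniteDimensional ℝ V]

/-- Differentiation under the integral: on the compact product of a closed ball and [0,1] the
derivative is bounded, and the bound is the dominating function. -/
theorem hasFDerivAt_parametric_integral {W : Type} [NormedAddCommGroup W] [NormedSpace ℝ W]
    [CompleteSpace W] {φ : V × ℝ → W} (hφ : ContDiff ℝ 1 φ) (x : V) :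
    HasFDerivAt (fun x => ∫ t in (0 : ℝ)..1, φ (x, t))
      (∫ t in (0 : ℝ)..1, (fderiv ℝ φ (x, t)).comp (ContinuousLinearMap.inl ℝ V ℝ)) x := by
  have hd : Continuous fun z : V × ℝ =>
      (fderiv ℝ φ z).comp (ContinuousLinearMap.inl ℝ V ℝ) :=
    (hφ.continuous_fderiv one_ne_zero).clm_comp continuous_const
  obtain ⟨C, hC⟩ := ((isCompact_closedBall x 1).prod (isCompact_Icc (a := (0 : ℝ)) (b := 1))).bddAbove_image
    (f := fun z => ‖(fderiv ℝ φ z).comp (ContinuousLinearMap.inl ℝ V ℝ)‖) hd.norm.continuousOn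
  refine intervalIntegral.hasFDerivAt_integral_of_dominated_of_fderiv_le
    (F' := fun x t => (fderiv ℝ φ (x, t)).comp (ContinuousLinearMap.inl ℝ V ℝ))
    (bound := fun _ => C) (Metric.closedBall_mem_nhds x one_pos) ?_ ?_ ?_ ?_ ?_ ?_
  · refine Filter.Eventually.of_forall fun y => ?_
    exact (hφ.continuous.comp (continuous_const.prodMk continuous_id)).aestronglyMeasurable
  · exact (hφ.continuous.comp (continuous_const.prodMk continuous_id)).intervalIntegrable _ _
  · exact (hd.comp (continuous_const.prodMk continuous_id)).aestronglyMeasurable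
  · refine Filter.Eventually.of_forall fun t ht y hy => hC ⟨(y, t), ⟨hy, ?_⟩, rfl⟩
    rw [Set.uIoc_of_le zero_le_one] at ht
    exact ⟨ht.1.le, ht.2⟩
  · exact intervalIntegrable_const
  · refine Filter.Eventually.of_forall fun t _ y _ => ?_
    have h1 : HasFDerivAt (fun y : V => (y, t)) (ContinuousLinearMap.inl ℝ V ℝ) y :=
      hasFDerivAt_prodMk_left y t
    exact ((hφ.differentiable one_ne_zero (y, t)).hasFDerivAt).comp y h1

/-- Induction on the order of differentiability over all targets `W` at once, because the derivative
takes values in the linear maps from `V` to `W`. Both are kept in `Type` so that this space of maps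
is again an admissible target. -/
theorem contDiff_parametric_integral (n : ℕ) : ∀ {W : Type} [NormedAddCommGroup W]
    [NormedSpace ℝ W] [CompleteSpace W] {φ : V × ℝ → W}, ContDiff ℝ n φ →
    ContDiff ℝ n fun x => ∫ t in (0 : ℝ)..1, φ (x, t) := by
  induction n with
  | zero =>
    intro W _ _ _ φ hφ
    refine contDiff_zero.2 ?_
    have hc : Continuous φ := hφ.continuous
    exact continuous_parametric_intervalIntegral_of_continuous' (f := fun x t => φ (x, t)) hc 0 1
  | succ n ih =>
    intro W _ _ _ φ hφ
    have h1 : ContDiff ℝ 1 φ := hφ.of_le (by exact_mod_cast Nat.le_add_left 1 n)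
    have hd := hasFDerivAt_parametric_integral h1
    rw [Nat.cast_add, Nat.cast_one, contDiff_succ_iff_fderiv] at *
    refine ⟨fun x => (hd x).differentiableAt, by simp, ?_⟩
    have e : (fderiv ℝ fun x => ∫ t in (0 : ℝ)..1, φ (x, t)) = fun x =>
        ∫ t in (0 : ℝ)..1, (fderiv ℝ φ (x, t)).comp (ContinuousLinearMap.inl ℝ V ℝ) :=
      funext fun x => (hd x).fderiv
    rw [e]
    exact ih (φ := fun z => (fderiv ℝ φ z).comp (ContinuousLinearMap.inl ℝ V ℝ))
      (hφ.2.2.clm_comp contDiff_const)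

/-- Hadamard's lemma. -/
theorem exists_hadamard {F : V → ℂ} (hF : ContDiff ℝ ∞ F) (p : V) :
    ∃ G : V → V →L[ℝ] ℂ, ContDiff ℝ ∞ G ∧ (∀ y, F y = F p + G y (y - p)) ∧
      G p = fderiv ℝ F p := by
  have hd : ContDiff ℝ ∞ (fderiv ℝ F) := (contDiff_infty_iff_fderiv.1 hF).2
  -- The derivative of `F` along the segment from `p` to a second point; its average over the
  -- segment is the required `G`, by the fundamental theorem of calculus.
  let φ : V × ℝ → V →L[ℝ] ℂ := fun z => fderiv ℝ F (p + z.2 • (z.1 - p))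
  have hφ : ContDiff ℝ ∞ φ :=
    hd.comp (contDiff_const.add (contDiff_snd.smul (contDiff_fst.sub contDiff_const)))
  refine ⟨fun x => ∫ t in (0 : ℝ)..1, φ (x, t), contDiff_infty.2 fun n =>
    contDiff_parametric_integral n (hφ.of_le (by exact_mod_cast le_top)), fun y => ?_, ?_⟩
  · have hcont : Continuous fun t : ℝ => φ (y, t) :=
      hφ.continuous.comp (continuous_const.prodMk continuous_id)
    have h1 : ∀ t ∈ Set.uIcc (0 : ℝ) 1, HasDerivAt (fun t : ℝ => F (p + t • (y - p)))
        (φ (y, t) (y - p)) t := fun t _ => by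
      have hl : HasDerivAt (fun t : ℝ => p + t • (y - p)) (y - p) t := by
        simpa using ((hasDerivAt_id t).smul_const (y - p)).const_add p
      exact ((hF.differentiable (by simp)) (p + t • (y - p))).hasFDerivAt.comp_hasDerivAt t hl
    have h2 := integral_eq_sub_of_hasDerivAt h1
      ((hcont.clm_apply continuous_const).intervalIntegrable _ _)
    have h3 := ContinuousLinearMap.intervalIntegral_apply (hcont.intervalIntegrable 0 1) (y - p)
      (μ := volume)
    simp only [one_smul, add_sub_cancel, zero_smul, add_zero] at h2
    rw [h3, h2]; ring
  · simp [φ]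

end Hadamard

end HolJacobi

namespace HolJacobi

/-! ### Wirtinger components of real linear maps -/

section Wirtinger

variable {ι : Type*} [Fintype ι] [DecidableEq ι]

/-- Complex linear part of a real linear function. -/
def wd (T : (ι → ℂ) →L[ℝ] ℂ) (a : ι) : ℂ :=
  (1 / 2 : ℂ) * (T (Pi.single a 1) - Complex.I * T (Pi.single a Complex.I))

/-- Antilinear part of a real linear function. -/
def wb (T : (ι → ℂ) →L[ℝ] ℂ) (a : ι) : ℂ :=
  (1 / 2 : ℂ) * (T (Pi.single a 1) + Complex.I * T (Pi.single a Complex.I))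

theorem map_single_wirtinger (T : (ι → ℂ) →L[ℝ] ℂ) (a : ι) (z : ℂ) :
    T (Pi.single a z) = z * wd T a + starRingEnd ℂ z * wb T a := by
  have h : (Pi.single a z : ι → ℂ) = z.re • (Pi.single a 1 : ι → ℂ) +
      z.im • (Pi.single a Complex.I : ι → ℂ) := by
    rw [← Pi.single_smul, ← Pi.single_smul, ← Pi.single_add]
    congr 1
    apply Complex.ext <;> simp
  rw [h, map_add, map_smul, map_smul, wd, wb]
  conv_rhs => rw [← Complex.re_add_im z]
  simp only [map_add, map_mul, Complex.conj_ofReal, Complex.conj_I, Complex.real_smul]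
  linear_combination ((z.im : ℂ) * T (Pi.single a Complex.I)) * Complex.I_mul_I

theorem map_wirtinger (T : (ι → ℂ) →L[ℝ] ℂ) (w : ι → ℂ) :
    T w = ∑ a, (w a * wd T a + starRingEnd ℂ (w a) * wb T a) := by
  conv_lhs => rw [← Finset.univ_sum_single w, map_sum]
  exact Finset.sum_congr rfl fun a _ => map_single_wirtinger T a (w a)

/-- The Cauchy–Riemann equations: the real derivative is the restriction of a complex linear map
exactly when its antilinear coefficients are zero. -/
theorem differentiableAt_complex_iff {F : (ι → ℂ) → ℂ} {p : ι → ℂ}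
    (hF : DifferentiableAt ℝ F p) :
    DifferentiableAt ℂ F p ↔ ∀ a, wb (fderiv ℝ F p) a = 0 := by
  constructor
  · intro h a
    have e := h.fderiv_restrictScalars (𝕜 := ℝ)
    rw [wb, e]
    have : (Pi.single a Complex.I : ι → ℂ) = Complex.I • Pi.single a (1 : ℂ) := by
      rw [← Pi.single_smul, smul_eq_mul, mul_one]
    rw [this]
    simp only [ContinuousLinearMap.coe_restrictScalars', map_smul, smul_eq_mul]
    linear_combination (1 / 2 * (fderiv ℂ F p) (Pi.single a 1)) * Complex.I_mul_I
  · intro h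
    let T : (ι → ℂ) →L[ℂ] ℂ :=
      ∑ a, wd (fderiv ℝ F p) a • ContinuousLinearMap.proj (R := ℂ) (φ := fun _ : ι => ℂ) a
    have e : T.restrictScalars ℝ = fderiv ℝ F p := by
      ext w
      rw [map_wirtinger (fderiv ℝ F p) w]
      simp only [T, ContinuousLinearMap.coe_restrictScalars', sum_apply, h,
        mul_zero, add_zero, smul_apply, ContinuousLinearMap.proj_apply,
        smul_eq_mul]
      exact Finset.sum_congr rfl fun a _ => mul_comm _ _
    exact (hasFDerivAt_of_restrictScalars ℝ hF.hasFDerivAt e).differentiableAt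

end Wirtinger

/-! ### Coordinate vector fields on M̃ and local frames -/

section Frames

variable {E : Type*} [NormedAddCommGroup E] [NormedSpace ℂ E] [FiniteDimensional ℂ E]
  {M : Type*} [TopologicalSpace M] [T2Space M] [ChartedSpace E M] [IsManifold 𝓘(ℂ, E) ω M]
  {L : M → Type*} [TopologicalSpace (TotalSpace ℂ L)] [∀ x, AddCommGroup (L x)]
  [∀ x, Module ℂ (L x)] [∀ x, TopologicalSpace (L x)] [FiberBundle ℂ L] [VectorBundle ℂ ℂ L]
  [ContMDiffVectorBundle ω ℂ L 𝓘(ℂ, E)]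

theorem eventually_slitPt {x₀ : M} {v : Slit L} (hv : base v ∈ dom E L x₀) {W : Set (Slit L)}
    (hW : W ∈ nhds v) : ∀ᶠ w in nhds (crd E x₀ v), ∃ hw : w ∈ cone E L x₀, slitPt hw ∈ W := by
  have hc := crd_mem_cone hv
  have h1 : ContinuousAt (cinv E L x₀) (crd E x₀ v) :=
    (mdifferentiableAt_cinv hc).continuousAt
  have e : cinv E L x₀ (crd E x₀ v) = v.1 := cinv_coordF hv v.2
  have h2 : Subtype.val '' W ∈ nhds v.1 :=
    (TopologicalSpace.Opens.isOpenEmbedding' _).image_mem_nhds.2 hW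
  rw [← e] at h2
  filter_upwards [h1.preimage_mem_nhds h2, (isOpen_cone x₀).mem_nhds hc] with w ⟨w', hw', ew⟩ hw
  refine ⟨hw, ?_⟩
  have : slitPt hw = w' := Subtype.ext ew.symm
  rwa [this]

theorem loc_eventuallyEq {x₀ : M} {v : Slit L} (hv : base v ∈ dom E L x₀) {f g : Slit L → ℂ}
    (h : f =ᶠ[nhds v] g) : loc x₀ f =ᶠ[nhds (crd E x₀ v)] loc x₀ g := by
  filter_upwards [eventually_slitPt hv h] with w ⟨hw, hw'⟩
  rw [loc_eq hw, loc_eq hw]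
  exact hw'

theorem differentiableAt_loc (f : SlitC E L) {x₀ : M} {v : Slit L} (hv : base v ∈ dom E L x₀) :
    DifferentiableAt ℝ (loc x₀ f.1) (crd E x₀ v) :=
  ((contDiffOn_loc f x₀).contDiffAt ((isOpen_cone x₀).mem_nhds
    (crd_mem_cone hv))).differentiableAt (by simp)

theorem liftF_val {x₀ : M} {χ : FunR E M} (hχ : tsupport χ.1 ⊆ dom E L x₀) {G : (Idx E → ℂ) → ℂ}
    (hG : ContDiffOn ℝ ∞ G (cone E L x₀)) (v : Slit L) :
    (liftF x₀ χ hχ G hG).1 v = (χ.1 (base v) : ℂ) * G (crd E x₀ v) := rfl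

theorem contDiffOn_fderiv_loc (f : SlitC E L) (x₀ : M) :
    ContDiffOn ℝ ∞ (fderiv ℝ (loc x₀ f.1)) (cone E L x₀) :=
  (contDiffOn_loc f x₀).fderiv_of_isOpen (isOpen_cone x₀) (by simp)

/-- Outside the coordinate domain the cut-off vanishes, so identities between cut-off expressions
need to be checked only inside. -/
theorem mul_congr_dom {x₀ : M} {χ : FunR E M} (hχ : tsupport χ.1 ⊆ dom E L x₀) {v : Slit L}
    {z z' : ℂ} (h : base v ∈ dom E L x₀ → z = z') :
    (χ.1 (base v) : ℂ) * z = (χ.1 (base v) : ℂ) * z' := by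
  by_cases hv : base v ∈ dom E L x₀
  · rw [h hv]
  · rw [image_eq_zero_of_notMem_tsupport fun h => hv (hχ h)]; simp

/-- Cut-off directional derivatives in homogeneous coordinates. -/
def dirD (x₀ : M) (χ : FunR E M) (hχ : tsupport χ.1 ⊆ dom E L x₀) (e : Idx E → ℂ) :
    Derivation ℂ (SlitC E L) (SlitC E L) :=
  Derivation.mk'
    { toFun := fun f => liftF x₀ χ hχ (fun w => fderiv ℝ (loc x₀ f.1) w e)
        ((contDiffOn_fderiv_loc f x₀).clm_apply contDiffOn_const)
      map_add' := fun f g => smoothC_ext fun v => by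
        rw [smoothC_add, liftF_val, liftF_val, liftF_val, ← mul_add]
        refine mul_congr_dom hχ fun hv => ?_
        have e1 : loc x₀ (f + g).1 =ᶠ[nhds (crd E x₀ v)] loc x₀ f.1 + loc x₀ g.1 := by
          filter_upwards [(isOpen_cone x₀).mem_nhds (crd_mem_cone hv)] with w hw
          simp only [Pi.add_apply, loc_eq hw, smoothC_add]
        rw [e1.fderiv_eq, fderiv_add (differentiableAt_loc f hv) (differentiableAt_loc g hv)]
        rfl
      map_smul' := fun c f => smoothC_ext fun v => by
        rw [RingHom.id_apply, smoothC_smul, liftF_val, liftF_val, mul_left_comm]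
        refine mul_congr_dom hχ fun hv => ?_
        have e1 : loc x₀ (c • f).1 =ᶠ[nhds (crd E x₀ v)] fun w => c * loc x₀ f.1 w := by
          filter_upwards [(isOpen_cone x₀).mem_nhds (crd_mem_cone hv)] with w hw
          simp only [loc_eq hw, smoothC_smul]
        rw [e1.fderiv_eq, fderiv_const_mul (differentiableAt_loc f hv)]
        rfl }
    fun f g => smoothC_ext fun v => by
      simp only [smoothC_add, smul_eq_mul, smoothC_mul]
      change (χ.1 (base v) : ℂ) * _ = f.1 v * ((χ.1 (base v) : ℂ) * _) +
        g.1 v * ((χ.1 (base v) : ℂ) * _)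
      rw [mul_left_comm, mul_left_comm (g.1 v), ← mul_add]
      refine mul_congr_dom hχ fun hv => ?_
      have e1 : loc x₀ (f * g).1 =ᶠ[nhds (crd E x₀ v)] fun w => loc x₀ f.1 w * loc x₀ g.1 w := by
        filter_upwards [(isOpen_cone x₀).mem_nhds (crd_mem_cone hv)] with w hw
        simp only [loc_eq hw, smoothC_mul]
      change fderiv ℝ (loc x₀ (f * g).1) (crd E x₀ v) e = f.1 v * fderiv ℝ (loc x₀ g.1)
        (crd E x₀ v) e + g.1 v * fderiv ℝ (loc x₀ f.1) (crd E x₀ v) e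
      rw [e1.fderiv_eq, fderiv_fun_mul (differentiableAt_loc f hv) (differentiableAt_loc g hv),
        loc_crd hv, loc_crd hv]
      rfl

theorem dirD_val {x₀ : M} {χ : FunR E M} (hχ : tsupport χ.1 ⊆ dom E L x₀) (e : Idx E → ℂ)
    (f : SlitC E L) (v : Slit L) : (dirD x₀ χ hχ e f).1 v =
      (χ.1 (base v) : ℂ) * fderiv ℝ (loc x₀ f.1) (crd E x₀ v) e := rfl

/-- Cut-off holomorphic coordinate vector fields. -/
def ddF (x₀ : M) (χ : FunR E M) (hχ : tsupport χ.1 ⊆ dom E L x₀) (a : Idx E) :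
    Derivation ℂ (SlitC E L) (SlitC E L) :=
  (1 / 2 : ℂ) • (dirD x₀ χ hχ (Pi.single a 1) - Complex.I • dirD x₀ χ hχ (Pi.single a Complex.I))

/-- Cut-off antiholomorphic coordinate vector fields. -/
def dbF (x₀ : M) (χ : FunR E M) (hχ : tsupport χ.1 ⊆ dom E L x₀) (a : Idx E) :
    Derivation ℂ (SlitC E L) (SlitC E L) :=
  (1 / 2 : ℂ) • (dirD x₀ χ hχ (Pi.single a 1) + Complex.I • dirD x₀ χ hχ (Pi.single a Complex.I))

theorem ddF_val {x₀ : M} {χ : FunR E M} (hχ : tsupport χ.1 ⊆ dom E L x₀) (a : Idx E)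
    (f : SlitC E L) (v : Slit L) : (ddF x₀ χ hχ a f).1 v =
      (χ.1 (base v) : ℂ) * wd (fderiv ℝ (loc x₀ f.1) (crd E x₀ v)) a := by
  change (1 / 2 : ℂ) * ((dirD x₀ χ hχ _ f).1 v - Complex.I * (dirD x₀ χ hχ _ f).1 v) = _
  rw [dirD_val, dirD_val, wd]; ring

theorem dbF_val {x₀ : M} {χ : FunR E M} (hχ : tsupport χ.1 ⊆ dom E L x₀) (a : Idx E)
    (f : SlitC E L) (v : Slit L) : (dbF x₀ χ hχ a f).1 v =
      (χ.1 (base v) : ℂ) * wb (fderiv ℝ (loc x₀ f.1) (crd E x₀ v)) a := by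
  change (1 / 2 : ℂ) * ((dirD x₀ χ hχ _ f).1 v + Complex.I * (dirD x₀ χ hχ _ f).1 v) = _
  rw [dirD_val, dirD_val, wb]; ring

/-- Point derivations of `C^∞(M̃, ℂ)` at `v`. -/
structure IsPointDer (v : Slit L) (d : SlitC E L → ℂ) : Prop where
  add : ∀ f g, d (f + g) = d f + d g
  mul : ∀ f g, d (f * g) = f.1 v * d g + g.1 v * d f

theorem IsPointDer.one {v : Slit L} {d : SlitC E L → ℂ} (hd : IsPointDer v d) : d 1 = 0 := by
  have := hd.mul 1 1
  rw [mul_one, smoothC_one] at this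
  linear_combination -this

theorem IsPointDer.zero {v : Slit L} {d : SlitC E L → ℂ} (hd : IsPointDer v d) : d 0 = 0 := by
  have := hd.add 0 0
  rw [add_zero] at this
  linear_combination -this

theorem IsPointDer.sub {v : Slit L} {d : SlitC E L → ℂ} (hd : IsPointDer v d) (f g : SlitC E L) :
    d (f - g) = d f - d g := by
  have := hd.add (f - g) g
  rw [sub_add_cancel] at this
  rw [this, add_sub_cancel_right]

theorem IsPointDer.sum {v : Slit L} {d : SlitC E L → ℂ} (hd : IsPointDer v d) {ι : Type*}
    (s : Finset ι) (f : ι → SlitC E L) : d (∑ i ∈ s, f i) = ∑ i ∈ s, d (f i) := by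
  classical
  induction s using Finset.induction_on with
  | empty => exact hd.zero
  | insert a s ha ih => rw [Finset.sum_insert ha, Finset.sum_insert ha, hd.add, ih]

variable (E L) in
/-- Local coordinates `tilde (lam a)` on `M̃`, over an open subset of `M`, with the (cut-off)
holomorphic and antiholomorphic coordinate vector fields. -/
structure LocFrame (x₀ : M) where
  U : Set M
  isOpen : IsOpen U
  mem : x₀ ∈ U
  lam : Idx E → Sec E L
  dd : Idx E → Derivation ℂ (SlitC E L) (SlitC E L)
  db : Idx E → Derivation ℂ (SlitC E L) (SlitC E L)
  -- Of `d` only the Leibniz rule, additivity and vanishing on constants are asked. The point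
  -- derivations used below are assembled from restrictions and real parts, and these properties are
  -- the ones checked for them; complex linearity follows.
  pd : ∀ v, base v ∈ U → ∀ d, (∀ c : ℂ, d (algebraMap ℂ (SlitC E L) c) = 0) → IsPointDer v d → ∀ f,
    d f = ∑ a, (d (tilde (lam a)) * (dd a f).1 v + d (conjF (tilde (lam a))) * (db a f).1 v)
  dd_lam : ∀ v, base v ∈ U → ∀ a b, (dd a (tilde (lam b))).1 v = if a = b then 1 else 0
  dd_conj : ∀ v, base v ∈ U → ∀ a b, (dd a (conjF (tilde (lam b)))).1 v = 0
  db_eq : ∀ a f, db a f = conjF (dd a (conjF f))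
  local_dd : ∀ v f g, f.1 =ᶠ[nhds v] g.1 → ∀ a, (dd a f).1 v = (dd a g).1 v
  hol_iff : ∀ v, base v ∈ U → ∀ f : SlitC E L,
    MDifferentiableAt (𝓘(ℂ, E).prod 𝓘(ℂ, ℂ →L[ℂ] ℂ)) 𝓘(ℂ, ℂ) f.1 v ↔ ∀ a, (db a f).1 v = 0
  dd_sc : ∀ (ζ : ℂˣ) a f, dd a (scF ζ f) = (ζ : ℂ) • scF ζ (dd a f)
  -- Over `U`, the reciprocal of the coordinate `tilde (lam none)`. It has degree −1, so multiplying
  -- by it makes degree-one functions invariant.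
  q : SlitC E L
  q_mul : ∀ v, base v ∈ U → q.1 v * (tilde (lam none)).1 v = 1
  q_sc : ∀ ζ : ℂˣ, (ζ : ℂ) • scF ζ q = q

theorem wd_conj {T : (Idx E → ℂ) →L[ℝ] ℂ} (a : Idx E) :
    wb T a = starRingEnd ℂ (wd (Complex.conjCLE.toContinuousLinearMap.comp T) a) := by
  have h : ∀ w, (Complex.conjCLE.toContinuousLinearMap.comp T) w = starRingEnd ℂ (T w) :=
    fun _ => rfl
  rw [wb, wd, h, h]
  simp only [map_mul, map_sub, map_div₀, map_one, map_ofNat, Complex.conj_conj, Complex.conj_I]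
  ring

theorem loc_conjF (f : SlitC E L) (x₀ : M) :
    loc x₀ (conjF f).1 = fun w : Idx E → ℂ => Complex.conjCLE (loc x₀ f.1 w) := by
  funext w
  simp only [loc, extS]
  split_ifs
  · rfl
  · simp

theorem dbF_eq {x₀ : M} {χ : FunR E M} (hχ : tsupport χ.1 ⊆ dom E L x₀) (a : Idx E)
    (f : SlitC E L) : dbF x₀ χ hχ a f = conjF (ddF x₀ χ hχ a (conjF f)) := smoothC_ext fun v => by
  rw [conjF_val, dbF_val, ddF_val, map_mul, Complex.conj_ofReal]
  refine mul_congr_dom hχ fun hv => ?_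
  rw [wd_conj, loc_conjF]
  congr 2
  exact ((Complex.conjCLE.toContinuousLinearMap.hasFDerivAt.comp _
    (differentiableAt_loc f hv).hasFDerivAt).fderiv).symm

/-- Multiplication by ζ is complex linear, so the chain rule multiplies the holomorphic derivative
by ζ without mixing in the antiholomorphic one: the coordinate fields have degree −1. -/
theorem ddF_sc {x₀ : M} {χ : FunR E M} (hχ : tsupport χ.1 ⊆ dom E L x₀) (a : Idx E)
    (ζ : ℂˣ) (f : SlitC E L) :
    ddF x₀ χ hχ a (scF ζ f) = (ζ : ℂ) • scF ζ (ddF x₀ χ hχ a f) := smoothC_ext fun v => by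
  rw [smoothC_smul, scF_val, ddF_val, ddF_val, base_sc, mul_left_comm]
  refine mul_congr_dom hχ fun hv => ?_
  have hc := crd_mem_cone hv
  have e1 : loc x₀ (scF ζ f).1 =ᶠ[nhds (crd E x₀ v)] fun w => loc x₀ f.1 ((ζ : ℂ) • w) := by
    filter_upwards [(isOpen_cone x₀).mem_nhds hc] with w hw
    rw [loc_eq hw, scF_val, ← loc_crd (x₀ := x₀) (v := sc ζ (slitPt hw)) (pt_mem_dom hw) f.1, crd_sc,
      crd_slitPt]
  let m : (Idx E → ℂ) →L[ℝ] (Idx E → ℂ) :=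
    (((ζ : ℂ) • ContinuousLinearMap.id ℂ (Idx E → ℂ)).restrictScalars ℝ)
  have h2 : DifferentiableAt ℝ (loc x₀ f.1) (m (crd E x₀ v)) := by
    have := differentiableAt_loc f (x₀ := x₀) (v := sc ζ v) hv
    rwa [crd_sc] at this
  have e2 : fderiv ℝ (loc x₀ (scF ζ f).1) (crd E x₀ v) =
      (fderiv ℝ (loc x₀ f.1) (crd E x₀ (sc ζ v))).comp m := by
    rw [e1.fderiv_eq, crd_sc]
    exact (h2.hasFDerivAt.comp _ m.hasFDerivAt).fderiv
  have e3 : ∀ z : ℂ, m (Pi.single a z) = Pi.single a (ζ * z) := fun z => by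
    change (ζ : ℂ) • (Pi.single a z : Idx E → ℂ) = _
    rw [← Pi.single_smul, smul_eq_mul]
  rw [e2]
  conv_lhs => rw [wd]
  rw [ContinuousLinearMap.comp_apply, ContinuousLinearMap.comp_apply, e3, e3,
    map_single_wirtinger, map_single_wirtinger]
  simp only [map_mul, map_one, Complex.conj_I]
  linear_combination (-(1 / 2) * (ζ : ℂ) * wd (fderiv ℝ (loc x₀ f.1) (crd E x₀ (sc ζ v))) a +
    (1 / 2) * starRingEnd ℂ (ζ : ℂ) * wb (fderiv ℝ (loc x₀ f.1) (crd E x₀ (sc ζ v))) a) *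
    Complex.I_mul_I

end Frames

end HolJacobi

/-! ### Point derivations in coordinates and existence of local frames -/

namespace HolJacobi

variable {E : Type*} [NormedAddCommGroup E] [NormedSpace ℂ E] [FiniteDimensional ℂ E]
  {M : Type*} [TopologicalSpace M] [T2Space M] [ChartedSpace E M] [IsManifold 𝓘(ℂ, E) ω M]
  {L : M → Type*} [TopologicalSpace (TotalSpace ℂ L)] [∀ x, AddCommGroup (L x)]
  [∀ x, Module ℂ (L x)] [∀ x, TopologicalSpace (L x)] [FiberBundle ℂ L] [VectorBundle ℂ ℂ L]
  [ContMDiffVectorBundle ω ℂ L 𝓘(ℂ, E)]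

/-- A bump function on the base, equal to 1 at the base point, kills `f`; the Leibniz rule for this
zero product gives the claim. Cut-offs come from M, so this locality is over open sets of M. -/
theorem IsPointDer.pb_eq_zero {v : Slit L} {d : SlitC E L → ℂ} (hd : IsPointDer v d) {U : Set M}
    (hU : IsOpen U) (hv : base v ∈ U) {f : SlitC E L} (hf : ∀ w, base w ∈ U → f.1 w = 0) :
    d f = 0 := by
  obtain ⟨b, V, -, hxV, -, hb, hbU⟩ := exists_bump (E := E) hU hv
  have h0 : pb (L := L) (ofRealF _ _ b) * f = 0 := smoothC_ext fun w => by
    rw [smoothC_mul, pb_val, smoothC_zero]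
    by_cases hw : base w ∈ U
    · rw [hf w hw, mul_zero]
    · have : b.1 (base w) = 0 := image_eq_zero_of_notMem_tsupport fun h => hw (hbU h)
      change ((b.1 (base w) : ℝ) : ℂ) * _ = 0
      rw [this]; simp
  have h1 := hd.mul (pb (ofRealF _ _ b)) f
  have h2 : (pb (L := L) (ofRealF _ _ b)).1 v = 1 := by
    change ((b.1 (base v) : ℝ) : ℂ) = 1
    rw [hb _ hxV]; simp
  rw [h0, hd.zero, hf v hv, h2] at h1
  linear_combination -h1

theorem IsPointDer.congr {v : Slit L} {d : SlitC E L → ℂ} (hd : IsPointDer v d) {U : Set M}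
    (hU : IsOpen U) (hv : base v ∈ U) {f g : SlitC E L} (hf : ∀ w, base w ∈ U → f.1 w = g.1 w) :
    d f = d g := by
  have := hd.pb_eq_zero hU hv (f := f - g) fun w hw => by rw [smoothC_sub, hf w hw, sub_self]
  rw [hd.sub] at this
  linear_combination this

theorem contDiffOn_wd {s : Set (Idx E → ℂ)} {G : (Idx E → ℂ) → (Idx E → ℂ) →L[ℝ] ℂ}
    (hG : ContDiffOn ℝ ∞ G s) (a : Idx E) : ContDiffOn ℝ ∞ (fun w => wd (G w) a) s :=
  contDiffOn_const.mul ((hG.clm_apply contDiffOn_const).sub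
    (contDiffOn_const.mul (hG.clm_apply contDiffOn_const)))

theorem contDiffOn_wb {s : Set (Idx E → ℂ)} {G : (Idx E → ℂ) → (Idx E → ℂ) →L[ℝ] ℂ}
    (hG : ContDiffOn ℝ ∞ G s) (a : Idx E) : ContDiffOn ℝ ∞ (fun w => wb (G w) a) s :=
  contDiffOn_const.mul ((hG.clm_apply contDiffOn_const).add
    (contDiffOn_const.mul (hG.clm_apply contDiffOn_const)))

theorem contDiff_coord (a : Idx E) : ContDiff ℝ ∞ fun w : Idx E → ℂ => w a :=
  contDiff_apply ℝ ℂ a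

theorem wd_add (S T : (Idx E → ℂ) →L[ℝ] ℂ) (a : Idx E) : wd (S + T) a = wd S a + wd T a := by
  simp only [wd, add_apply]; ring

theorem wb_add (S T : (Idx E → ℂ) →L[ℝ] ℂ) (a : Idx E) : wb (S + T) a = wb S a + wb T a := by
  simp only [wb, add_apply]; ring

theorem wd_smul (c : ℂ) (T : (Idx E → ℂ) →L[ℝ] ℂ) (a : Idx E) : wd (c • T) a = c * wd T a := by
  simp only [wd, smul_apply, smul_eq_mul]; ring

theorem wb_smul (c : ℂ) (T : (Idx E → ℂ) →L[ℝ] ℂ) (a : Idx E) : wb (c • T) a = c * wb T a := by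
  simp only [wb, smul_apply, smul_eq_mul]; ring

/-- Cut-off homogeneous coordinate functions. -/
def coordLift (x₀ : M) (χ : FunR E M) (hχ : tsupport χ.1 ⊆ dom E L x₀) (a : Idx E) : SlitC E L :=
  liftF x₀ χ hχ (fun w => w a) (contDiff_coord a).contDiffOn

/-- By Hadamard's lemma `f` is f(v) plus a combination of the functions w_a − p_a and their
conjugates, whose coefficients at v are the Wirtinger derivatives; the Leibniz rule then evaluates
`d`. The coordinate expression lives on the cone only, so it is first multiplied by a cut-off Ψ
there. -/
theorem isPointDer_coord {x₀ : M} {χ : FunR E M} (hχ : tsupport χ.1 ⊆ dom E L x₀) {U : Set M}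
    (hU : IsOpen U) (h1 : ∀ x ∈ U, χ.1 x = 1) (hUd : U ⊆ dom E L x₀)
    {v : Slit L} (hv : base v ∈ U) {d : SlitC E L → ℂ}
    (hc : ∀ c : ℂ, d (algebraMap ℂ (SlitC E L) c) = 0) (hd : IsPointDer v d) (f : SlitC E L) :
    d f = ∑ a, (d (coordLift x₀ χ hχ a) * (ddF x₀ χ hχ a f).1 v +
      d (conjF (coordLift x₀ χ hχ a)) * (dbF x₀ χ hχ a f).1 v) := by
  set p := crd E x₀ v with hp
  have hpc : p ∈ cone E L x₀ := crd_mem_cone (hUd hv)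
  obtain ⟨ψ, hψs, -, hψ, -, hψ1⟩ := exists_contDiff_tsupport_subset (n := ⊤)
    ((isOpen_cone x₀).mem_nhds hpc)
  let Ψ : (Idx E → ℂ) → ℂ := fun w => (ψ w : ℂ)
  have hΨ : ContDiff ℝ ∞ Ψ := Complex.ofRealCLM.contDiff.comp hψ
  have hχd : d (pb (ofRealF _ _ χ)) = 0 := by
    have := hd.congr hU hv (f := pb (ofRealF _ _ χ)) (g := 1) fun w hw => by
      change ((χ.1 (base w) : ℝ) : ℂ) = 1
      rw [h1 _ hw]; simp
    rw [this, hd.one]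
  have hχv : (pb (L := L) (ofRealF _ _ χ)).1 v = 1 := by
    change ((χ.1 (base v) : ℝ) : ℂ) = 1
    rw [h1 _ hv]; simp
  have hcv : ∀ a, (coordLift x₀ χ hχ a).1 v = p a := fun a => by
    change ((χ.1 (base v) : ℝ) : ℂ) * p a = p a
    rw [h1 _ hv]; simp
  have key : ∀ f : SlitC E L, d f + f.1 v * d (liftF x₀ χ hχ Ψ hΨ.contDiffOn) =
      ∑ a, (d (coordLift x₀ χ hχ a) * (f.1 v * wd (fderiv ℝ Ψ p) a + wd (fderiv ℝ (loc x₀ f.1) p) a)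
       + d (conjF (coordLift x₀ χ hχ a)) *
        (f.1 v * wb (fderiv ℝ Ψ p) a + wb (fderiv ℝ (loc x₀ f.1) p) a)) := by
    intro f
    have hF : ContDiff ℝ ∞ fun w => Ψ w * loc x₀ f.1 w := by
      rw [contDiff_iff_contDiffAt]
      intro w
      by_cases hw : w ∈ tsupport ψ
      · exact hΨ.contDiffAt.mul ((contDiffOn_loc f x₀).contDiffAt
          ((isOpen_cone x₀).mem_nhds (hψs hw)))
      · refine (contDiffAt_const (c := (0 : ℂ))).congr_of_eventuallyEq ?_
        filter_upwards [(isClosed_tsupport ψ).isOpen_compl.mem_nhds hw] with y hy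
        have : ψ y = 0 := image_eq_zero_of_notMem_tsupport hy
        simp [Ψ, this]
    obtain ⟨G, hG, hGe, hGp⟩ := exists_hadamard hF p
    have hpl : Ψ p * loc x₀ f.1 p = f.1 v := by
      rw [hp, loc_crd (hUd hv), ← hp]; simp [Ψ, hψ1]
    have hfd : fderiv ℝ (fun w => Ψ w * loc x₀ f.1 w) p =
        f.1 v • fderiv ℝ Ψ p + fderiv ℝ (loc x₀ f.1) p := by
      rw [fderiv_fun_mul (hΨ.differentiable (by simp) p) (differentiableAt_loc f (hUd hv)),
        hp, loc_crd (hUd hv), ← hp, add_comm]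
      simp [Ψ, hψ1]
    let g := fun a => liftF x₀ χ hχ (fun w => wd (G w) a) (contDiffOn_wd hG.contDiffOn a)
    let gb := fun a => liftF x₀ χ hχ (fun w => wb (G w) a) (contDiffOn_wb hG.contDiffOn a)
    -- The Hadamard expansion as an identity of global functions: every term carries the factor χ²,
    -- so it also holds off the coordinate domain.
    have id : pb (ofRealF _ _ χ) * (f * liftF x₀ χ hχ Ψ hΨ.contDiffOn) =
        f.1 v • (pb (ofRealF _ _ χ) * pb (ofRealF _ _ χ)) +
        ∑ a, ((coordLift x₀ χ hχ a - p a • pb (ofRealF _ _ χ)) * g a +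
          (conjF (coordLift x₀ χ hχ a) - starRingEnd ℂ (p a) • pb (ofRealF _ _ χ)) * gb a) := by
      refine smoothC_ext fun w => ?_
      simp only [smoothC_mul, smoothC_add, smoothC_sum, smoothC_sub, smoothC_smul, conjF_val, g, gb,
        liftF_val, coordLift, map_mul, Complex.conj_ofReal]
      change ((χ.1 (base w) : ℝ) : ℂ) * _ = f.1 v * (((χ.1 (base w) : ℝ) : ℂ) *
        ((χ.1 (base w) : ℝ) : ℂ)) + ∑ a, ((_ - p a * ((χ.1 (base w) : ℝ) : ℂ)) * _ + (_ -
        starRingEnd ℂ (p a) * ((χ.1 (base w) : ℝ) : ℂ)) * _)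
      by_cases hw : base w ∈ dom E L x₀
      · have e := hGe (crd E x₀ w)
        rw [hpl, loc_crd hw, map_wirtinger] at e
        rw [show ((χ.1 (base w) : ℝ) : ℂ) * (f.1 w * (((χ.1 (base w) : ℝ) : ℂ) * Ψ (crd E x₀ w))) =
          ((χ.1 (base w) : ℝ) : ℂ) ^ 2 * (Ψ (crd E x₀ w) * f.1 w) by ring, e, mul_add,
          Finset.mul_sum]
        congr 1
        · ring
        · refine Finset.sum_congr rfl fun a _ => ?_
          simp only [Pi.sub_apply, map_sub]
          ring
      · have : χ.1 (base w) = 0 := image_eq_zero_of_notMem_tsupport fun h => hw (hχ h)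
        rw [this]; simp
    have hds : ∀ (c : ℂ) (k : SlitC E L), d (c • k) = c * d k := fun c k => by
      rw [Algebra.smul_def, hd.mul, hc]
      simp
    have e := congrArg d id
    rw [hd.mul, hd.mul, hχd, hχv, hd.add, hds, hd.mul, hχd, hd.sum] at e
    simp only [hd.add, hd.mul, hd.sub, hds, hχd, smoothC_sub, smoothC_smul, hcv, conjF_val, hχv] at e
    have hl : (liftF x₀ χ hχ Ψ hΨ.contDiffOn).1 v = 1 := by
      rw [liftF_val, h1 _ hv, ← hp]; simp [Ψ, hψ1]
    have hga : ∀ a, (g a).1 v = f.1 v * wd (fderiv ℝ Ψ p) a + wd (fderiv ℝ (loc x₀ f.1) p) a :=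
      fun a => by
        change (liftF x₀ χ hχ _ _).1 v = _
        rw [liftF_val, h1 _ hv, ← hp, hGp, hfd, wd_add, wd_smul]; simp
    have hgb : ∀ a, (gb a).1 v = f.1 v * wb (fderiv ℝ Ψ p) a + wb (fderiv ℝ (loc x₀ f.1) p) a :=
      fun a => by
        change (liftF x₀ χ hχ _ _).1 v = _
        rw [liftF_val, h1 _ hv, ← hp, hGp, hfd, wb_add, wb_smul]; simp
    rw [hl] at e
    simp only [hga, hgb] at e
    calc _ = _ := by ring
      _ = _ := e
      _ = _ := by
        simp only [mul_zero, zero_add, add_zero]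
        refine Finset.sum_congr rfl fun a _ => ?_
        ring
  -- Only Ψ(p) = 1 is known, not that Ψ is constant near p. The case f = 1 computes `d` on the
  -- lifted Ψ, and subtracting it removes all derivatives of Ψ; thus no locality in the fibre
  -- direction is needed.
  have k1 := key 1
  have l1 : fderiv ℝ (loc x₀ (1 : SlitC E L).1) p = 0 := by
    have : loc x₀ (1 : SlitC E L).1 =ᶠ[nhds p] fun _ => (1 : ℂ) := by
      filter_upwards [(isOpen_cone x₀).mem_nhds hpc] with w hw
      rw [loc_eq hw, smoothC_one]
    rw [this.fderiv_eq]; simp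
  have w0 : ∀ a, wd (0 : (Idx E → ℂ) →L[ℝ] ℂ) a = 0 := fun a => by simp [wd]
  have w0' : ∀ a, wb (0 : (Idx E → ℂ) →L[ℝ] ℂ) a = 0 := fun a => by simp [wb]
  simp only [hd.one, l1, w0, w0', smoothC_one, one_mul, zero_add, add_zero] at k1
  have kf := key f
  rw [k1, Finset.mul_sum] at kf
  rw [eq_sub_of_add_eq kf, ← Finset.sum_sub_distrib]
  refine Finset.sum_congr rfl fun a _ => ?_
  rw [ddF_val, dbF_val, h1 _ hv, ← hp]
  push_cast
  ring

variable (E L) in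
-- The cut-off homogeneous coordinates have degree one under ℂ^*, hence come from sections of L; for
-- this reason homogeneous coordinates are used instead of affine ones.
theorem nonempty_locFrame (x₀ : M) : Nonempty (LocFrame E L x₀) := by
  obtain ⟨χ, U, hU, hxU, hUd, h1, hχ⟩ := exists_bump (E := E) (isOpen_dom (E := E) (L := L) x₀)
    (mem_dom x₀)
  have hex : ∀ a, ∃ s : Sec E L, tilde s = coordLift x₀ χ hχ a := fun a =>
    exists_tilde_eq _ fun ζ => smoothC_ext fun v => by
      rw [scF_val, smoothC_smul]
      change ((χ.1 (base v) : ℝ) : ℂ) * crd E x₀ (sc ζ v) a = ζ * (_ * crd E x₀ v a)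
      rw [crd_sc, mul_left_comm]; rfl
  choose lam hlam using hex
  have hloc : ∀ v, base v ∈ U → ∀ b, loc x₀ (tilde (lam b)).1 =ᶠ[nhds (crd E x₀ v)]
      fun w => w b := fun v hv b => by
    filter_upwards [eventually_slitPt (hUd hv) ((isOpen_base_preimage hU).mem_nhds hv)]
      with w ⟨hw, hw'⟩
    rw [loc_eq hw, hlam]
    change ((χ.1 (base (slitPt hw)) : ℝ) : ℂ) * crd E x₀ (slitPt hw) b = w b
    rw [h1 _ hw', crd_slitPt]; simp
  have hwn : ∀ w ∈ cone E L x₀, w none ≠ 0 := fun w hw => hw.1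
  refine ⟨⟨U, hU, hxU, lam, ddF x₀ χ hχ, dbF x₀ χ hχ, ?_, ?_, ?_, dbF_eq hχ, ?_, ?_,
    fun ζ a => ddF_sc hχ a ζ,
    liftF x₀ χ hχ (fun w => (w none)⁻¹) ((contDiff_coord none).contDiffOn.inv hwn), ?_, ?_⟩⟩
  · intro v hv d hc hd f
    simp only [hlam]
    exact isPointDer_coord hχ hU h1 hUd hv hc hd f
  · intro v hv a b
    rw [ddF_val, h1 _ hv, (hloc v hv b).fderiv_eq]
    rw [show (fun w : Idx E → ℂ => w b) = ContinuousLinearMap.proj (R := ℝ) (φ := fun _ => ℂ) b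
      from rfl, ContinuousLinearMap.fderiv]
    simp only [wd, ContinuousLinearMap.proj_apply, Pi.single_apply, Complex.ofReal_one, eq_comm]
    split_ifs <;> norm_num
  · intro v hv a b
    have e : loc x₀ (conjF (tilde (lam b))).1 =ᶠ[nhds (crd E x₀ v)]
        fun w => Complex.conjCLE (w b) := by
      rw [loc_conjF]
      filter_upwards [hloc v hv b] with w hw
      rw [hw]
    rw [ddF_val, h1 _ hv, e.fderiv_eq]
    rw [show (fun w : Idx E → ℂ => Complex.conjCLE (w b)) =
      Complex.conjCLE.toContinuousLinearMap.comp
        (ContinuousLinearMap.proj (R := ℝ) (φ := fun _ => ℂ) b) from rfl,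
      ContinuousLinearMap.fderiv]
    simp only [wd, ContinuousLinearMap.comp_apply, ContinuousLinearMap.proj_apply, Pi.single_apply]
    split_ifs <;> simp
  · intro v f g hfg a
    rw [ddF_val, ddF_val]
    refine mul_congr_dom hχ fun hv => ?_
    rw [(loc_eventuallyEq hv hfg).fderiv_eq]
  · intro v hv f
    rw [mdifferentiableAt_slit_iff_loc (hUd hv),
      differentiableAt_complex_iff (differentiableAt_loc f (hUd hv))]
    simp only [dbF_val, h1 _ hv, Complex.ofReal_one, one_mul]
  · intro v hv
    rw [liftF_val, hlam]
    change _ * (((χ.1 (base v) : ℝ) : ℂ) * crd E x₀ v none) = 1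
    rw [h1 _ hv]
    have := hwn _ (crd_mem_cone (hUd hv))
    field_simp
    simp
  · intro ζ
    refine smoothC_ext fun v => ?_
    rw [smoothC_smul, scF_val, liftF_val, liftF_val, base_sc, crd_sc, Pi.smul_apply, smul_eq_mul,
      mul_inv, mul_left_comm, mul_inv_cancel_left₀ ζ.ne_zero]

end HolJacobi

namespace HolJacobi

variable {E : Type*} [NormedAddCommGroup E] [NormedSpace ℂ E] [FiniteDimensional ℂ E]
  {M : Type*} [TopologicalSpace M] [T2Space M] [ChartedSpace E M] [IsManifold 𝓘(ℂ, E) ω M]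
  {L : M → Type*} [TopologicalSpace (TotalSpace ℂ L)] [∀ x, AddCommGroup (L x)]
  [∀ x, Module ℂ (L x)] [∀ x, TopologicalSpace (L x)] [FiberBundle ℂ L] [VectorBundle ℂ ℂ L]
  [ContMDiffVectorBundle ω ℂ L 𝓘(ℂ, E)]

/-! ### Real scaling and homogeneous functions -/

/-- Real units as complex units. -/
def ru : ℝˣ →* ℂˣ := Units.map Complex.ofRealHom.toMonoidHom

@[simp] theorem ru_val (r : ℝˣ) : ((ru r : ℂˣ) : ℂ) = ((r : ℝ) : ℂ) := rfl

theorem toHat_sc (r : ℝˣ) (v : Slit L) : toHat (sc (ru r) v) = toHat v := by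
  obtain ⟨⟨x, a⟩, ha⟩ := v
  refine Sigma.ext rfl (heq_of_eq ?_)
  refine (Projectivization.mk_eq_mk_iff' ℝ _ _ _ _).2 ⟨r, ?_⟩
  apply ContinuousLinearMap.ext
  intro l
  exact Complex.real_smul

theorem exists_toHat (y : Hat L) : ∃ v : Slit L, toHat v = y := by
  obtain ⟨x, a⟩ := y
  refine ⟨⟨⟨x, a.rep⟩, a.rep_nonzero⟩, ?_⟩
  exact Sigma.ext rfl (heq_of_eq a.mk_rep)

/-- A point of `M̃` over a given point of `M̂`. -/
def repr (y : Hat L) : Slit L := (exists_toHat y).choose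

@[simp] theorem toHat_repr (y : Hat L) : toHat (repr y) = y := (exists_toHat y).choose_spec

theorem exists_ru_eq {v w : Slit L} (h : toHat v = toHat w) : ∃ r : ℝˣ, w = sc (ru r) v := by
  obtain ⟨⟨x, a⟩, ha⟩ := v
  obtain ⟨⟨x', b⟩, hb⟩ := w
  obtain rfl : x = x' := congrArg Sigma.fst h
  have h2 : Projectivization.mk ℝ (b : DualFib L x) hb = Projectivization.mk ℝ a ha :=
    (eq_of_heq (Sigma.mk.inj h).2).symm
  obtain ⟨r, hr⟩ := (Projectivization.mk_eq_mk_iff ℝ _ _ _ _).1 h2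
  refine ⟨r, Subtype.ext ?_⟩
  change (⟨x, b⟩ : DualTot L) = ⟨x, (((r : ℝ) : ℂ) • a : L x →L[ℂ] ℂ)⟩
  rw [← hr]
  congr 1

theorem exists_repr_eq (v : Slit L) : ∃ r : ℝˣ, v = sc (ru r) (repr (toHat v)) :=
  exists_ru_eq (toHat_repr _)

/-- Real functions on `M̂` as functions on `M̃`. -/
def hs (h : HatR E L) : SlitC E L := ofRealF _ _ (pullSlit h)

/-- The homogeneous function of a section of `ℓ`, as a complex function. -/
def tE (s : SecEll E L) : SlitC E L := ofRealF _ _ (tildeEll s)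

/-- The homogeneous function of a section of the pull-back of `L`. -/
def tP (s : PullSec E L) : SlitC E L := ⟨fun v => vec v (s.1 (toHat v)), s.2⟩

theorem hs_val (h : HatR E L) (v : Slit L) : (hs h).1 v = (h.1 (toHat v) : ℂ) := rfl

theorem hs_add (f g : HatR E L) : hs (f + g) = hs f + hs g :=
  smoothC_ext fun _ => Complex.ofReal_add _ _

theorem hs_mul (f g : HatR E L) : hs (f * g) = hs f * hs g :=
  smoothC_ext fun _ => Complex.ofReal_mul _ _

theorem hs_one : hs (1 : HatR E L) = 1 := smoothC_ext fun _ => Complex.ofReal_one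

theorem hs_zero : hs (0 : HatR E L) = 0 := smoothC_ext fun _ => Complex.ofReal_zero

theorem hs_smul (c : ℝ) (f : HatR E L) : hs (c • f) = (c : ℂ) • hs f :=
  smoothC_ext fun _ => Complex.ofReal_mul _ _

theorem hs_algebraMap (f : FunR E M) :
    hs (algebraMap (FunR E M) (HatR E L) f) = pb (ofRealF _ _ f) := rfl

@[simp] theorem conjF_hs (f : HatR E L) : conjF (hs f) = hs f := conjF_ofRealF _

theorem scF_hs (r : ℝˣ) (f : HatR E L) : scF (ru r) (hs f) = hs f := smoothC_ext fun v => by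
  rw [scF_val, hs_val, hs_val, toHat_sc]

theorem hs_injective : Function.Injective (hs (E := E) (L := L)) := fun f g h =>
  Subtype.ext (funext fun y => by
    have := congrArg (fun k : SlitC E L => k.1 (repr y)) h
    simp only [hs_val, toHat_repr] at this
    exact_mod_cast this)

@[simp] theorem conjF_tE (s : SecEll E L) : conjF (tE s) = tE s := conjF_ofRealF _

theorem tE_add (s t : SecEll E L) : tE (s + t) = tE s + tE t :=
  smoothC_ext fun _ => Complex.ofReal_add _ _

theorem tE_neg (s : SecEll E L) : tE (-s) = -tE s :=
  smoothC_ext fun _ => Complex.ofReal_neg _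

theorem tE_sub (s t : SecEll E L) : tE (s - t) = tE s - tE t :=
  smoothC_ext fun _ => Complex.ofReal_sub _ _

theorem tE_zero : tE (0 : SecEll E L) = 0 := smoothC_ext fun _ => Complex.ofReal_zero

theorem tE_smul (h : HatR E L) (s : SecEll E L) : tE (h • s) = hs h * tE s :=
  smoothC_ext fun _ => Complex.ofReal_mul _ _

theorem tE_const_smul (c : ℝ) (s : SecEll E L) : tE (c • s) = (c : ℂ) • tE s :=
  smoothC_ext fun _ => Complex.ofReal_mul _ _

theorem tE_hatSec (s : Sec E L) : tE (hatSec s) = (1 / 2 : ℂ) • (tilde s + conjF (tilde s)) :=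
  ofRealF_reF (tilde s)

theorem exists_smul_eq_of_mem_submodule {V : Type*} [AddCommGroup V] [Module ℝ V] {x φ : V}
    (hx : x ≠ 0) (h : φ ∈ (Projectivization.mk ℝ x hx).submodule) : ∃ c : ℝ, c • x = φ := by
  rwa [Projectivization.submodule_mk, Submodule.mem_span_singleton] at h

theorem exists_dual_mk_ne_zero {V : Type*} [AddCommGroup V] [Module ℝ V] {x : V}
    (hx : x ≠ 0) (h : x ∈ (Projectivization.mk ℝ x hx).submodule) :
    ∃ e : Module.Dual ℝ (Projectivization.mk ℝ x hx).submodule, e ⟨x, h⟩ ≠ 0 := by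
  by_contra! h'
  exact hx (congrArg Subtype.val ((Module.forall_dual_apply_eq_zero_iff ℝ _).1 h'))

theorem taut_eq (v : Slit L) (φ : (toHat v).2.submodule) : ∃ c : ℝ, φ = c • taut v := by
  obtain ⟨φ, hφ⟩ := φ
  obtain ⟨c, hc⟩ := exists_smul_eq_of_mem_submodule (vec_ne_zero v) hφ
  exact ⟨c, Subtype.ext hc.symm⟩

theorem evalEll_smul {y : Hat L} (s : EllFib y) (c : ℝ) (φ : y.2.submodule) :
    evalEll s (c • φ) = c * evalEll s φ :=
  (show Module.Dual ℝ y.2.submodule from s).map_smul c φ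

theorem tE_val (s : SecEll E L) (v : Slit L) :
    (tE s).1 v = (evalEll (s.1 (toHat v)) (taut v) : ℝ) := rfl

theorem ell_eq_at {s t : SecEll E L} {v : Slit L} (h : (tE s).1 v = (tE t).1 v) :
    s.1 (toHat v) = t.1 (toHat v) := by
  rw [tE_val, tE_val, Complex.ofReal_inj] at h
  have : ∀ φ, evalEll (s.1 (toHat v)) φ = evalEll (t.1 (toHat v)) φ := fun φ => by
    obtain ⟨c, rfl⟩ := taut_eq v φ
    rw [evalEll_smul, evalEll_smul, h]
  exact LinearMap.ext (σ := RingHom.id ℝ) (M := (toHat v).2.submodule) this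

theorem tE_injective : Function.Injective (tE (E := E) (L := L)) := fun s t h =>
  Subtype.ext (funext fun y => by
    obtain ⟨v, rfl⟩ := exists_toHat y
    exact ell_eq_at (congrArg (fun k : SlitC E L => k.1 v) h))

/-- A point and its real multiple have equal but not definitionally equal images in M̂, so elements
of the two fibres of ℓ are compared by `HEq`. Inside, the image point is generalized in order to
eliminate the equation. -/
theorem evalEll_taut_sc_of_heq (r : ℝˣ) (v : Slit L) (ε : EllFib (toHat v))
    (ε' : EllFib (toHat (sc (ru r) v))) (h : HEq ε' ε) :
    evalEll ε' (taut (sc (ru r) v)) = r * evalEll ε (taut v) := by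
  have key : ∀ y (φ : y.2.submodule) (ε' : EllFib y) (_ : toHat v = y) (_ : HEq ε' ε)
      (_ : HEq φ.1 (((r : ℝ) • vec v : DualFib L (base v)))), evalEll ε' φ =
      r * evalEll ε (taut v) := by
    rintro y φ ε' rfl h h2
    have : φ = (r : ℝ) • taut v := Subtype.ext (eq_of_heq h2)
    rw [this, evalEll_smul, eq_of_heq h]
  refine key _ _ _ (toHat_sc r v).symm h ?_
  obtain ⟨⟨x, a⟩, ha⟩ := v
  refine heq_of_eq ?_
  apply ContinuousLinearMap.ext
  intro l
  exact Complex.real_smul.symm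

theorem evalEll_taut_sc (s : ∀ y : Hat L, EllFib y) (r : ℝˣ) (v : Slit L) :
    evalEll (s (toHat (sc (ru r) v))) (taut (sc (ru r) v)) =
      r * evalEll (s (toHat v)) (taut v) :=
  evalEll_taut_sc_of_heq r v _ _ (by rw [toHat_sc])

theorem scF_tE (r : ℝˣ) (s : SecEll E L) : scF (ru r) (tE s) = ((r : ℝ) : ℂ) • tE s :=
  smoothC_ext fun v => by
    rw [scF_val, smoothC_smul, tE_val, tE_val, evalEll_taut_sc, Complex.ofReal_mul]

theorem tP_add (s t : PullSec E L) : tP (s + t) = tP s + tP t :=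
  smoothC_ext fun v => (vec v).map_add _ _

theorem tP_zero : tP (0 : PullSec E L) = 0 := smoothC_ext fun v => (vec v).map_zero

theorem tP_smul (h : HatR E L) (s : PullSec E L) : tP (h • s) = hs h * tP s :=
  smoothC_ext fun v => (vec v).map_smul _ _

theorem tP_pb_smul (f : FunC E M) (s : PullSec E L) : tP (f • s) = pb f * tP s :=
  smoothC_ext fun v => (vec v).map_smul _ _

theorem tP_val (s : PullSec E L) (v : Slit L) : (tP s).1 v = vec v (s.1 (toHat v)) := rfl

theorem pull_eq_at {s t : PullSec E L} {v : Slit L} (h : (tP s).1 v = (tP t).1 v) :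
    s.1 (toHat v) = t.1 (toHat v) := eq_of_vec_eq (v := v) h

theorem tP_injective : Function.Injective (tP (E := E) (L := L)) := fun s t h =>
  Subtype.ext (funext fun y => by
    obtain ⟨v, rfl⟩ := exists_toHat y
    exact pull_eq_at (congrArg (fun k : SlitC E L => k.1 v) h))

theorem scF_tP (r : ℝˣ) (s : PullSec E L) : scF (ru r) (tP s) = ((r : ℝ) : ℂ) • tP s :=
  smoothC_ext fun v => by
    rw [scF_val, smoothC_smul, tP_val, tP_val]
    have key : ∀ y (_ : toHat v = y) (a : DualFib L y.1) (_ : HEq a (vec v)),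
        (((r : ℝ) : ℂ) * (a (s.1 y) : ℂ)) = ((r : ℝ) : ℂ) * vec v (s.1 (toHat v)) := by
      rintro y rfl a h2
      rw [eq_of_heq h2]; rfl
    exact key _ (toHat_sc r v).symm (vec v) HEq.rfl

theorem exists_dual_taut_ne_zero (v : Slit L) :
    ∃ e : Module.Dual ℝ (toHat v).2.submodule, e (taut v) ≠ 0 :=
  exists_dual_mk_ne_zero (vec_ne_zero v) (taut v).2

theorem exists_hs_eq (f : SlitC E L) (hr : conjF f = f) (hf : ∀ r, scF (ru r) f = f) :
    ∃ h : HatR E L, hs h = f := by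
  have e : ∀ v, (f.1 (repr (toHat v))).re = (f.1 v).re := fun v => by
    obtain ⟨r, hr⟩ := exists_repr_eq v
    conv_rhs => rw [hr, ← scF_val, hf]
  refine ⟨⟨fun y => (f.1 (repr y)).re, ?_⟩, smoothC_ext fun v => ?_⟩
  · exact (congrArg (· ∈ slitR E L) (funext fun v => (e v).symm)).mp (reF f).2
  · change (((f.1 (repr (toHat v))).re : ℝ) : ℂ) = f.1 v
    rw [e, Complex.conj_eq_iff_re.1 (congrArg (fun k : SlitC E L => k.1 v) hr)]

/-- A functional on a real line is fixed by its value on one nonzero vector, and homogeneity makes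
the choice of that vector irrelevant. Smoothness of the section is by definition that of `f`. -/
theorem exists_tE_eq (f : SlitC E L) (hr : conjF f = f)
    (hf : ∀ r, scF (ru r) f = ((r : ℝ) : ℂ) • f) : ∃ s : SecEll E L, tE s = f := by
  have hd : ∀ y : Hat L, ∃ ε : EllFib y, ∀ v (ε' : EllFib (toHat v)), toHat v = y → HEq ε' ε →
      evalEll ε' (taut v) = (f.1 v).re := by
    intro y
    obtain ⟨v, rfl⟩ := exists_toHat y
    obtain ⟨e, he⟩ := exists_dual_taut_ne_zero v
    refine ⟨(((f.1 v).re * (e (taut v))⁻¹) • e : Module.Dual ℝ _), fun w ε' hw hε => ?_⟩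
    obtain ⟨r, rfl⟩ := exists_ru_eq hw.symm
    rw [evalEll_taut_sc_of_heq r v _ _ hε, ← scF_val, hf, smoothC_smul, Complex.re_ofReal_mul]
    congr 1
    change (f.1 v).re * (e (taut v))⁻¹ * e (taut v) = _
    rw [mul_assoc, inv_mul_cancel₀ he, mul_one]
  choose s hs' using hd
  have hs1 : ∀ v, evalEll (s (toHat v)) (taut v) = (f.1 v).re := fun v =>
    hs' _ v _ rfl HEq.rfl
  refine ⟨⟨s, ?_⟩, smoothC_ext fun v => ?_⟩
  · exact (congrArg (· ∈ slitR E L) (funext fun v => (hs1 v).symm)).mp (reF f).2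
  · change ((evalEll (s (toHat v)) (taut v) : ℝ) : ℂ) = f.1 v
    rw [hs1, Complex.conj_eq_iff_re.1 (congrArg (fun k : SlitC E L => k.1 v) hr)]

theorem exists_vec_eq_one (v : Slit L) : ∃ l : L (base v), (vec v l : ℂ) = 1 := by
  obtain ⟨l, hl⟩ : ∃ l : L (base v), (vec v l : ℂ) ≠ 0 := by
    by_contra! h
    exact vec_ne_zero v (ContinuousLinearMap.ext h)
  refine ⟨(vec v l : ℂ)⁻¹ • l, ?_⟩
  rw [map_smul]
  exact inv_mul_cancel₀ hl

theorem exists_tP_eq (f : SlitC E L) (hf : ∀ r, scF (ru r) f = ((r : ℝ) : ℂ) • f) :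
    ∃ s : PullSec E L, tP s = f := by
  have hl : ∀ y : Hat L, ∃ l : L y.1, ∀ v (l' : L (base v)), toHat v = y → HEq l' l →
      (vec v l' : ℂ) = f.1 v := by
    intro y
    obtain ⟨v, rfl⟩ := exists_toHat y
    obtain ⟨l, hl⟩ := exists_vec_eq_one v
    refine ⟨(f.1 v • l : L (base v)), fun w l' hw hl' => ?_⟩
    obtain ⟨r, rfl⟩ := exists_ru_eq hw.symm
    obtain rfl : l' = f.1 v • l := eq_of_heq hl'
    change ((r : ℝ) : ℂ) * (vec v (f.1 v • l) : ℂ) = _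
    rw [map_smul, hl, ← scF_val, hf, smoothC_smul]
    simp
  choose s hs' using hl
  have hs1 : ∀ v, (vec v (s (toHat v)) : ℂ) = f.1 v := fun v => hs' _ v _ rfl HEq.rfl
  refine ⟨⟨s, ?_⟩, smoothC_ext fun v => hs1 v⟩
  exact (congrArg (· ∈ slitC E L) (funext fun v => (hs1 v).symm)).mp f.2

/-! ### Rescaling by functions -/

/-- The extension by zero of `f` evaluated at a rescaled covector. -/
def scaleAt (f : SlitC E L) (z : ℂ) (w : Slit L) : ℂ :=
  extS f.1 ⟨w.1.proj, (z • w.1.2 : L w.1.proj →L[ℂ] ℂ)⟩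

theorem scaleAt_unit (f : SlitC E L) (ζ : ℂˣ) (w : Slit L) : scaleAt f ζ w = f.1 (sc ζ w) :=
  dif_pos (sc ζ w).2

/-- In homogeneous coordinates rescaling is multiplication by a scalar, and the cone is stable under
nonzero scalars. -/
theorem contMDiffAt_scaleAt (f : SlitC E L) {κ : Slit L → ℂ} {v : Slit L}
    (hκ : ContMDiffAt (𝓘(ℝ, E).prod 𝓘(ℝ, ℂ →L[ℂ] ℂ)) 𝓘(ℝ, ℂ) ∞ κ v) (h : κ v ≠ 0) :
    ContMDiffAt (𝓘(ℝ, E).prod 𝓘(ℝ, ℂ →L[ℂ] ℂ)) 𝓘(ℝ, ℂ) ∞ (fun w => scaleAt f (κ w) w) v := by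
  have hv : base v ∈ dom E L (base v) := mem_dom _
  set x₀ := base v
  have hp := crd_mem_cone hv
  have hκ' := contDiffAt_loc hp (f := κ) (by rwa [slitPt_crd hv])
  refine contMDiffAt_of_crd (x₀ := x₀) hv (G := fun w => loc x₀ f.1 (loc x₀ κ w • w)) ?_ ?_
  · have h1 : ContDiffAt ℝ ∞ (loc x₀ f.1) (loc x₀ κ (crd E x₀ v) • crd E x₀ v) := by
      rw [loc_crd hv]
      exact (contDiffOn_loc f x₀).contDiffAt ((isOpen_cone x₀).mem_nhds (smul_mem_cone hp h))
    exact ContDiffAt.comp (crd E x₀ v) (f := fun w => loc x₀ κ w • w) h1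
      (hκ'.smul contDiffAt_id)
  · filter_upwards [(isOpen_base_preimage (isOpen_dom (E := E) (L := L) x₀)).mem_nhds hv,
      hκ.continuousAt.preimage_mem_nhds (isOpen_ne.mem_nhds h)] with w hw hκw
    rw [loc_crd hw]
    have e := scaleAt_unit f (Units.mk0 _ hκw) w
    rw [Units.val_mk0] at e
    rw [e, ← loc_crd (x₀ := x₀) (v := sc (Units.mk0 _ hκw) w) hw f.1, crd_sc]
    rfl

theorem scaleAt_sc (f : SlitC E L) (z : ℂ) (ζ : ℂˣ) (w : Slit L) :
    scaleAt f z (sc ζ w) = scaleAt f (z * ζ) w := by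
  rw [scaleAt, scaleAt]
  congr 1
  change (⟨w.1.proj, (z • ((ζ : ℂ) • w.1.2 : L w.1.proj →L[ℂ] ℂ))⟩ : DualTot L) =
    ⟨w.1.proj, ((z * ζ) • w.1.2 : L w.1.proj →L[ℂ] ℂ)⟩
  rw [smul_smul]

theorem sc_one (v : Slit L) : sc 1 v = v := by
  refine Subtype.ext ?_
  obtain ⟨⟨x, a⟩, ha⟩ := v
  change (⟨x, ((1 : ℂ)) • (a : L x →L[ℂ] ℂ)⟩ : DualTot L) = ⟨x, a⟩
  rw [one_smul]

theorem hasDerivAt_scaleAt (f : SlitC E L) (v : Slit L) :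
    ∃ c, HasDerivAt (fun r : ℝ => scaleAt f r v) c 1 := by
  have hv : base v ∈ dom E L (base v) := mem_dom _
  set x₀ := base v
  have hp := crd_mem_cone hv
  have h1 : DifferentiableAt ℝ (fun r : ℝ => loc x₀ f.1 ((r : ℂ) • crd E x₀ v)) 1 := by
    have h2 := differentiableAt_loc f hv
    have e : crd E x₀ v = (((1 : ℝ) : ℂ)) • crd E x₀ v := by simp
    rw [e] at h2
    refine DifferentiableAt.comp (1 : ℝ) (g := loc x₀ f.1) h2 ?_
    exact (Complex.ofRealCLM.differentiableAt).smul_const _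
  refine ⟨_, h1.hasDerivAt.congr_of_eventuallyEq ?_⟩
  filter_upwards [isOpen_ne.mem_nhds (one_ne_zero (α := ℝ))] with r hr
  have e := scaleAt_unit f (ru (Units.mk0 r hr)) v
  rw [ru_val, Units.val_mk0] at e
  rw [e, ← loc_crd (x₀ := x₀) (v := sc (ru (Units.mk0 r hr)) v) hv f.1, crd_sc]
  rfl

/-- Euler's identity: the derivative of f(rv) = r f(v) at r = 1. That derivative is a point
derivation vanishing on constants, so it expands in coordinates, and the coordinates themselves have
degree one. -/
theorem LocFrame.euler {x₀ : M} (F : LocFrame E L x₀) {v : Slit L} (hv : base v ∈ F.U)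
    {f : SlitC E L} (hf : ∀ r, scF (ru r) f = ((r : ℝ) : ℂ) • f) :
    f.1 v = ∑ a, ((tilde (F.lam a)).1 v * (F.dd a f).1 v +
      (conjF (tilde (F.lam a))).1 v * (F.db a f).1 v) := by
  have e : ∀ (f : SlitC E L), ∀ r : ℝ, (hr : r ≠ 0) → scaleAt f r v =
      (scF (ru (Units.mk0 r hr)) f).1 v := fun f r hr => scaleAt_unit f (ru (Units.mk0 r hr)) v
  have e1 : ∀ f : SlitC E L, scaleAt f (1 : ℝ) v = f.1 v := fun f => by
    rw [e f 1 one_ne_zero]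
    have : Units.mk0 (1 : ℝ) one_ne_zero = 1 := Units.ext rfl
    rw [this, map_one, scF_val, sc_one]
  have hne : ∀ᶠ r : ℝ in nhds 1, r ≠ 0 := isOpen_ne.mem_nhds one_ne_zero
  have hhom : ∀ f : SlitC E L, (∀ r, scF (ru r) f = ((r : ℝ) : ℂ) • f) →
      deriv (fun r : ℝ => scaleAt f r v) 1 = f.1 v := fun f hf => by
    have h2 : (fun r : ℝ => scaleAt f r v) =ᶠ[nhds 1] fun r : ℝ => (r : ℂ) * f.1 v := by
      filter_upwards [hne] with r hr
      rw [e f r hr, hf]; rfl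
    rw [h2.deriv_eq]
    have := (Complex.ofRealCLM.hasDerivAt (x := (1 : ℝ))).mul_const (f.1 v)
    simpa using this.deriv
  have hd : IsPointDer v fun f : SlitC E L => deriv (fun r : ℝ => scaleAt f r v) 1 := by
    constructor
    · intro f g
      obtain ⟨c, hc⟩ := hasDerivAt_scaleAt f v
      obtain ⟨c', hc'⟩ := hasDerivAt_scaleAt g v
      have : (fun r : ℝ => scaleAt (f + g) r v) =ᶠ[nhds 1]
          fun r : ℝ => scaleAt f r v + scaleAt g r v := by
        filter_upwards [hne] with r hr
        rw [e _ r hr, e _ r hr, e _ r hr]; rfl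
      change deriv (fun r : ℝ => scaleAt (f + g) r v) 1 = deriv (fun r : ℝ => scaleAt f r v) 1 +
        deriv (fun r : ℝ => scaleAt g r v) 1
      rw [this.deriv_eq, hc.deriv, hc'.deriv]
      exact (hc.add hc').deriv
    · intro f g
      obtain ⟨c, hc⟩ := hasDerivAt_scaleAt f v
      obtain ⟨c', hc'⟩ := hasDerivAt_scaleAt g v
      have : (fun r : ℝ => scaleAt (f * g) r v) =ᶠ[nhds 1]
          fun r : ℝ => scaleAt f r v * scaleAt g r v := by
        filter_upwards [hne] with r hr
        rw [e _ r hr, e _ r hr, e _ r hr]; rfl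
      change deriv (fun r : ℝ => scaleAt (f * g) r v) 1 =
        f.1 v * deriv (fun r : ℝ => scaleAt g r v) 1 + g.1 v * deriv (fun r : ℝ => scaleAt f r v) 1
      rw [this.deriv_eq, hc.deriv, hc'.deriv]
      refine (HasDerivAt.fun_mul hc hc').deriv.trans ?_
      rw [e1, e1]
      ring
  have hconst : ∀ c : ℂ, (fun f : SlitC E L => deriv (fun r : ℝ => scaleAt f r v) 1)
      (algebraMap ℂ (SlitC E L) c) = 0 := fun c => by
    have : (fun r : ℝ => scaleAt (algebraMap ℂ (SlitC E L) c) r v) =ᶠ[nhds 1] fun _ => c := by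
      filter_upwards [hne] with r hr
      rw [e _ r hr]; rfl
    change deriv _ 1 = 0
    rw [this.deriv_eq, deriv_const]
  refine (hhom f hf).symm.trans ((F.pd v hv _ hconst hd f).trans ?_)
  refine Finset.sum_congr rfl fun a _ => ?_
  have h1 := hhom (tilde (F.lam a)) fun r => scF_tilde _ _
  have h2 := hhom (conjF (tilde (F.lam a))) fun r => by
    rw [scF_conjF, scF_tilde]
    exact smoothC_ext fun w => (map_mul (starRingEnd ℂ) _ _).trans
      (congrArg (· * _) (Complex.conj_ofReal _))
  exact congrArg₂ (· + ·) (congrArg (· * _) h1) (congrArg (· * _) h2)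

end HolJacobi

namespace HolJacobi

variable {E : Type*} [NormedAddCommGroup E] [NormedSpace ℂ E] [FiniteDimensional ℂ E]
  {M : Type*} [TopologicalSpace M] [T2Space M] [ChartedSpace E M] [IsManifold 𝓘(ℂ, E) ω M]
  {L : M → Type*} [TopologicalSpace (TotalSpace ℂ L)] [∀ x, AddCommGroup (L x)]
  [∀ x, Module ℂ (L x)] [∀ x, TopologicalSpace (L x)] [FiberBundle ℂ L] [VectorBundle ℂ ℂ L]
  [ContMDiffVectorBundle ω ℂ L 𝓘(ℂ, E)]

/-! ### Locality -/

theorem der_local (X : Derivation ℂ (FunC E M) (FunC E M)) {U : Set M} (hU : IsOpen U) {x : M}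
    (hx : x ∈ U) {f g : FunC E M} (h : ∀ y ∈ U, f.1 y = g.1 y) : (X f).1 x = (X g).1 x := by
  obtain ⟨b, V, -, hxV, -, hb, hbU⟩ := exists_bump (E := E) hU hx
  have h0 : ofRealF _ _ b * (f - g) = 0 := smoothC_ext fun y => by
    rw [smoothC_mul, ofRealF_val, smoothC_sub, smoothC_zero]
    by_cases hy : y ∈ U
    · rw [h y hy, sub_self, mul_zero]
    · rw [image_eq_zero_of_notMem_tsupport fun h => hy (hbU h)]; simp
  have h1 := congrArg (fun k : FunC E M => k.1 x) (X.leibniz (ofRealF _ _ b) (f - g))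
  simp only [h0, map_zero, smul_eq_mul, smoothC_add, smoothC_mul, ofRealF_val, hb x hxV, map_sub,
    smoothC_sub, h x hx, sub_self, zero_mul, add_zero, smoothC_zero] at h1
  push_cast at h1
  linear_combination -h1

theorem op_local (Δ : GaugeL E L) {U : Set M} (hU : IsOpen U) {x : M} (hx : x ∈ U)
    {s t : Sec E L} (h : ∀ y ∈ U, s.1 y = t.1 y) : (op Δ s).1 x = (op Δ t).1 x := by
  obtain ⟨b, V, -, hxV, -, hb, hbU⟩ := exists_bump (E := E) hU hx
  have h0 : ofRealF _ _ b • (s - t) = 0 := Subtype.ext (funext fun y => by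
    change ((b.1 y : ℝ) : ℂ) • (s.1 y - t.1 y) = 0
    by_cases hy : y ∈ U
    · rw [h y hy, sub_self, smul_zero]
    · rw [image_eq_zero_of_notMem_tsupport fun h => hy (hbU h)]; simp)
  have h1 := congrArg (fun k : Sec E L => k.1 x) (op_smul Δ (ofRealF _ _ b) (s - t))
  rw [h0, map_zero, map_sub] at h1
  change 0 = ((b.1 x : ℝ) : ℂ) • ((op Δ s).1 x - (op Δ t).1 x) +
    (symbol Δ (ofRealF _ _ b)).1 x • (s.1 x - t.1 x) at h1
  rw [hb x hxV, h x hx, sub_self, smul_zero, add_zero, Complex.ofReal_one, one_smul] at h1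
  exact (sub_eq_zero.1 h1.symm)

theorem tilde_op_local (Δ : GaugeL E L) {U : Set M} (hU : IsOpen U) {v : Slit L} (hv : base v ∈ U)
    {s t : Sec E L} (h : ∀ w, base w ∈ U → (tilde s).1 w = (tilde t).1 w) :
    (tilde (op Δ s)).1 v = (tilde (op Δ t)).1 v :=
  tilde_eq_at (op_local Δ hU hv fun y hy => sec_eq_at (v := slitOver y) (h _ hy))

/-- Locality on M̂ itself. Bump functions from M would not suffice below, because the frames of ℓ in
use vanish somewhere on each fibre of M̂ → M. -/
theorem opE_local_of_bump (D : GaugeEll E L) {v : Slit L} {b : HatR E L} (hb : (hs b).1 v = 1)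
    {s t : SecEll E L} (h : ∀ w, (hs b).1 w ≠ 0 → (tE s).1 w = (tE t).1 w) :
    (tE (op D s)).1 v = (tE (op D t)).1 v := by
  have h0 : b • (s - t) = 0 := tE_injective (smoothC_ext fun w => by
    rw [tE_smul, tE_sub, smoothC_mul, smoothC_sub, tE_zero, smoothC_zero]
    by_cases hw : (hs b).1 w = 0
    · rw [hw, zero_mul]
    · rw [h w hw, sub_self, mul_zero])
  have h1 := congrArg (fun k => (tE k).1 v) (op_smul D b (s - t))
  simp only [h0, map_zero, map_sub, tE_add, tE_smul, tE_sub, tE_zero, smoothC_add, smoothC_mul,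
    smoothC_sub, smoothC_zero, hb, h v (by rw [hb]; exact one_ne_zero), sub_self, mul_zero,
    add_zero] at h1
  linear_combination -h1

theorem symE_local_of_bump (X : Derivation ℝ (HatR E L) (HatR E L)) {v : Slit L} {b : HatR E L}
    (hb : (hs b).1 v = 1) {f g : HatR E L}
    (h : ∀ w, (hs b).1 w ≠ 0 → (hs f).1 w = (hs g).1 w) :
    (hs (X f)).1 v = (hs (X g)).1 v := by
  have hsub : ∀ f g : HatR E L, hs (f - g) = hs f - hs g := fun f g =>
    smoothC_ext fun _ => Complex.ofReal_sub _ _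
  have h0 : b * (f - g) = 0 := hs_injective (smoothC_ext fun w => by
    rw [hs_mul, hsub, smoothC_mul, smoothC_sub, hs_zero, smoothC_zero]
    by_cases hw : (hs b).1 w = 0
    · rw [hw, zero_mul]
    · rw [h w hw, sub_self, mul_zero])
  have h1 := congrArg (fun k => (hs k).1 v) (X.leibniz b (f - g))
  simp only [h0, map_zero, map_sub, smul_eq_mul, hs_add, hs_mul, hsub, hs_zero, smoothC_add,
    smoothC_mul, smoothC_sub, smoothC_zero, hb, h v (by rw [hb]; exact one_ne_zero), sub_self,
    zero_mul, add_zero] at h1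
  linear_combination -h1

theorem exists_hat_bump {U : Set M} (hU : IsOpen U) {v : Slit L} (hv : base v ∈ U) :
    ∃ b : HatR E L, (hs b).1 v = 1 ∧ ∀ w, (hs b).1 w ≠ 0 → base w ∈ U := by
  obtain ⟨b, V, -, hxV, -, hb, hbU⟩ := exists_bump (E := E) hU hv
  refine ⟨algebraMap (FunR E M) (HatR E L) b, ?_, fun w hw => ?_⟩
  · rw [hs_algebraMap, pb_val, ofRealF_val, hb _ hxV, Complex.ofReal_one]
  · by_contra h
    refine hw ?_
    rw [hs_algebraMap, pb_val, ofRealF_val, image_eq_zero_of_notMem_tsupport fun h' => h (hbU h'),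
      Complex.ofReal_zero]

theorem opE_local (D : GaugeEll E L) {U : Set M} (hU : IsOpen U) {v : Slit L} (hv : base v ∈ U)
    {s t : SecEll E L} (h : ∀ w, base w ∈ U → (tE s).1 w = (tE t).1 w) :
    (tE (op D s)).1 v = (tE (op D t)).1 v := by
  obtain ⟨b, hb, hbU⟩ := exists_hat_bump (E := E) hU hv
  exact opE_local_of_bump D hb fun w hw => h w (hbU w hw)

theorem derSlit_isPointDer (X : Derivation ℂ (SlitC E L) (SlitC E L)) (v : Slit L) :
    IsPointDer v fun f => (X f).1 v :=
  ⟨fun f g => by rw [X.map_add, smoothC_add], fun f g => by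
    rw [X.leibniz, smoothC_add, smul_eq_mul, smul_eq_mul, smoothC_mul, smoothC_mul]⟩

theorem derSlit_local (X : Derivation ℂ (SlitC E L) (SlitC E L)) {U : Set M} (hU : IsOpen U)
    {v : Slit L} (hv : base v ∈ U) {f g : SlitC E L} (h : ∀ w, base w ∈ U → f.1 w = g.1 w) :
    (X f).1 v = (X g).1 v := (derSlit_isPointDer X v).congr hU hv h

theorem LocFrame.pd_der {x₀ : M} (F : LocFrame E L x₀) {v : Slit L} (hv : base v ∈ F.U)
    (X : Derivation ℂ (SlitC E L) (SlitC E L)) (f : SlitC E L) :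
    (X f).1 v = ∑ a, ((X (tilde (F.lam a))).1 v * (F.dd a f).1 v +
      (X (conjF (tilde (F.lam a)))).1 v * (F.db a f).1 v) :=
  F.pd v hv _ (fun c => by
    rw [X.map_algebraMap, smoothC_zero]) (derSlit_isPointDer X v) f

theorem LocFrame.hol_tilde {x₀ : M} (F : LocFrame E L x₀) {U : Set M} (hU : IsOpen U)
    {v : Slit L} (hv : base v ∈ F.U) (hvU : base v ∈ U) {f : SlitC E L}
    (hf : IsHolSlit (base ⁻¹' U) f) (a : Idx E) : (F.db a f).1 v = 0 :=
  (F.hol_iff v hv f).1 ((hf v hvU).mdifferentiableAt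
    ((isOpen_base_preimage hU).mem_nhds hvU)) a

theorem LocFrame.isHolSlit {x₀ : M} (F : LocFrame E L x₀) {V : Set M} (hVF : V ⊆ F.U)
    {f : SlitC E L} (h : ∀ v, base v ∈ V → ∀ a, (F.db a f).1 v = 0) : IsHolSlit (base ⁻¹' V) f :=
  fun v hv => ((F.hol_iff v (hVF hv) f).2 (h v hv)).mdifferentiableWithinAt

theorem LocFrame.db_tilde_lam {x₀ : M} (F : LocFrame E L x₀) {v : Slit L} (hv : base v ∈ F.U)
    (a b : Idx E) : (F.db a (tilde (F.lam b))).1 v = 0 := by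
  rw [F.db_eq, conjF_val, F.dd_conj v hv, map_zero]

theorem LocFrame.isHolSec_lam {x₀ : M} (F : LocFrame E L x₀) (a : Idx E) :
    IsHolSec F.U (F.lam a) :=
  (isHolSec_iff F.isOpen).2 (F.isHolSlit le_rfl fun _ hv b => F.db_tilde_lam hv b a)

theorem LocFrame.euler_hol {x₀ : M} (F : LocFrame E L x₀) {v : Slit L} (hv : base v ∈ F.U)
    {s : Sec E L} (h : ∀ a, (F.db a (tilde s)).1 v = 0) :
    (tilde s).1 v = ∑ a, (tilde (F.lam a)).1 v * (F.dd a (tilde s)).1 v := by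
  rw [F.euler hv fun r => scF_tilde _ _]
  exact Finset.sum_congr rfl fun a _ => by rw [h, mul_zero, add_zero]

/-! ### Retractions of `M̃` onto `M` and `M̂` -/

variable (E) in
-- Here `r` restricts functions to the local section of M̃ → M on which the function of `s₀` equals
-- 1. Every section t of L is `r (tilde t) • s₀` over `V`, and so a derivation of L can be evaluated
-- through its symbol on restricted functions.
theorem exists_base_retraction (v : Slit L) {U : Set M} (hU : IsOpen U) (hvU : base v ∈ U) :
    ∃ (V : Set M) (s₀ : Sec E L) (r : SlitC E L → FunC E M), IsOpen V ∧ base v ∈ V ∧ V ⊆ U ∧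
      IsHolSec V s₀ ∧ (tilde s₀).1 v = 1 ∧ ∀ w, base w ∈ V → ∃ ζ : ℂˣ,
        (ζ : ℂ) * (tilde s₀).1 w = 1 ∧ ∀ f, (r f).1 (base w) = f.1 (sc ζ w) := by
  obtain ⟨F⟩ := nonempty_locFrame E L (base v)
  obtain ⟨χ, V, hV, hxV, hVF, hχ, hχF⟩ := exists_bump (E := E) (F.isOpen.inter hU) ⟨F.mem, hvU⟩
  have hu : (tilde (F.lam none)).1 v ≠ 0 := right_ne_zero_of_mul_eq_one (F.q_mul v F.mem)
  set u := (tilde (F.lam none)).1 v with hu'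
  -- Over `F.U` this is the reciprocal of the function of `s₀`; rescaling a covector by it moves it
  -- onto the section.
  let κ : SlitC E L := u • F.q
  have hκ : ∀ w, base w ∈ F.U → κ.1 w ≠ 0 := fun w hw =>
    mul_ne_zero hu (left_ne_zero_of_mul_eq_one (F.q_mul w hw))
  have hg : ∀ f : SlitC E L, ContMDiff (𝓘(ℝ, E).prod 𝓘(ℝ, ℂ →L[ℂ] ℂ)) 𝓘(ℝ, ℂ) ∞
      fun w => (χ.1 (base w) : ℂ) * scaleAt f (κ.1 w) w := by
    intro f w
    by_cases hw : base w ∈ tsupport χ.1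
    · have h : ContDiff ℝ ∞ fun z : ℂ × ℂ => z.1 * z.2 := contDiff_fst.mul contDiff_snd
      exact h.contMDiff.contMDiffAt.comp w (((pb (L := L) (ofRealF _ _ χ)).2 w).prodMk_space
        (contMDiffAt_scaleAt f (κ.2 w) (hκ w (hχF hw).1)))
    · refine (contMDiffAt_const (c := (0 : ℂ))).congr_of_eventuallyEq ?_
      filter_upwards [(isOpen_base_preimage (isClosed_tsupport χ.1).isOpen_compl).mem_nhds hw]
        with w hw
      rw [image_eq_zero_of_notMem_tsupport hw]
      simp
  have hr : ∀ f : SlitC E L, ∃ g : FunC E M, pb (L := L) g = (⟨_, hg f⟩ : SlitC E L) := fun f =>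
    exists_pb_eq _ fun ζ => smoothC_ext fun w => by
      change (χ.1 (base w) : ℂ) * scaleAt f ((scF ζ κ).1 w) (sc ζ w) = _ * scaleAt f (κ.1 w) w
      rw [scaleAt_sc, mul_comm ((scF ζ κ).1 w)]
      congr 2
      change (ζ : ℂ) * (u * (scF ζ F.q).1 w) = u * F.q.1 w
      rw [mul_left_comm]
      congr 1
      exact congrArg (fun k : SlitC E L => k.1 w) (F.q_sc ζ)
  choose r hr using hr
  refine ⟨V, u⁻¹ • F.lam none, r, hV, hxV, fun x hx => (hVF hx).2, ?_, ?_, fun w hw => ?_⟩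
  · rw [isHolSec_iff hV]
    refine F.isHolSlit (fun x hx => (hVF hx).1) fun w hw a => ?_
    rw [tilde_const_smul, derivation_const_smul, smoothC_smul,
      F.db_tilde_lam (hVF hw).1, mul_zero]
  · rw [tilde_const_smul, smoothC_smul, ← hu', inv_mul_cancel₀ hu]
  · refine ⟨Units.mk0 (κ.1 w) (hκ w (hVF hw).1), ?_, fun f => ?_⟩
    · rw [tilde_const_smul]
      change u * F.q.1 w * (u⁻¹ * (tilde (F.lam none)).1 w) = 1
      rw [mul_mul_mul_comm, mul_inv_cancel₀ hu, one_mul, F.q_mul w (hVF hw).1]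
    · have h1 := congrArg (fun k : SlitC E L => k.1 w) (hr f)
      change (r f).1 (base w) = (χ.1 (base w) : ℂ) * scaleAt f (κ.1 w) w at h1
      rw [h1, hχ _ hw, Complex.ofReal_one, one_mul]
      exact scaleAt_unit f (Units.mk0 (κ.1 w) (hκ w (hVF hw).1)) w

/-- Composition with a smooth function of the real part. -/
def compRe (φ : ℝ → ℝ) (hφ : ContDiff ℝ ∞ φ) (T : SlitC E L) : SlitC E L :=
  ⟨fun w => (φ (T.1 w).re : ℂ), (Complex.ofRealCLM.contDiff.comp
    (hφ.comp Complex.reCLM.contDiff)).contMDiff.comp T.2⟩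

variable (E) in
-- The counterpart for ℓ → M̂, with frame k = ŝ₀. Where s₀ is nonzero, Re s̃₀ vanishes on one real
-- line of the fibre of L^*, so k is a frame only on part of each fibre of M̂ → M and the cut-off
-- must localize there too.
theorem exists_hat_retraction (v : Slit L) :
    ∃ (k : SecEll E L) (b : HatR E L) (r : SlitC E L → HatR E L), (tE k).1 v = 1 ∧
      (hs b).1 v = 1 ∧ ∀ w, (hs b).1 w ≠ 0 → ∃ ρ : ℝˣ, ((ρ : ℝ) : ℂ) * (tE k).1 w = 1 ∧
        ∀ f : SlitC E L, (hs (r f)).1 w = ((f.1 (sc (ru ρ) w)).re : ℂ) := by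
  obtain ⟨F⟩ := nonempty_locFrame E L (base v)
  obtain ⟨χ, V, hV, hxV, hVF, hχ, hχF⟩ := exists_bump (E := E) F.isOpen F.mem
  have hqv := F.q_mul v F.mem
  have hu : (tilde (F.lam none)).1 v ≠ 0 := right_ne_zero_of_mul_eq_one hqv
  set u := (tilde (F.lam none)).1 v with hu'
  let k : SecEll E L := hatSec (u⁻¹ • F.lam none)
  have hkv : (tE k).1 v = 1 := by
    have h1 : (tilde (u⁻¹ • F.lam none)).1 v = 1 := by
      rw [tilde_const_smul, smoothC_smul, ← hu', inv_mul_cancel₀ hu]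
    rw [tE_hatSec, smoothC_smul, smoothC_add, conjF_val, h1, map_one]
    norm_num
  -- Over `F.U`, T = χ k̃² / |s̃₀|². It is invariant under real scaling, equals 1 at v and vanishes
  -- where k̃ does; both cut-offs are functions of T.
  let T : SlitC E L := (u • F.q) * conjF (u • F.q) * (pb (ofRealF _ _ χ) * (tE k * tE k))
  have hTsc : ∀ ρ : ℝˣ, scF (ru ρ) T = T := fun ρ => by
    have e1 := F.q_sc (ru ρ)
    have hρ : ((ρ : ℝ) : ℂ) ≠ 0 := (ru ρ).ne_zero
    refine smoothC_ext fun w => ?_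
    have e2 : F.q.1 w = ((ρ : ℝ) : ℂ) * (scF (ru ρ) F.q).1 w :=
      (congrArg (fun k : SlitC E L => k.1 w) e1).symm
    simp only [T, scF_mul, scF_conjF, scF_smul, scF_tE, scF_pb, smoothC_mul, conjF_val,
      smoothC_smul, e2, map_mul, Complex.conj_ofReal]
    ring
  have hTv : T.1 v = 1 := by
    have e : u * F.q.1 v = 1 := by rw [mul_comm]; exact hqv
    simp only [T, smoothC_mul, conjF_val, smoothC_smul, e, hkv, pb_val, ofRealF_val, hχ _ hxV,
      map_one, Complex.ofReal_one, mul_one]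
  have hT0 : ∀ w, (tE k).1 w = 0 → T.1 w = 0 := fun w hw => by
    simp only [T, smoothC_mul, hw, mul_zero]
  -- With c = 2 one gets `b`, which is nonzero only where T > 1/2. With c = 4 one gets the factor
  -- inside `r`, which is 1 for T ≥ 1/2 and 0 for T ≤ 1/4: it keeps `r f` smooth across the zeros of
  -- k̃ and is invisible where `b` is nonzero.
  have hc : ∀ c : ℝ, ContDiff ℝ ∞ fun t : ℝ => Real.smoothTransition (c * t - 1) := fun c =>
    Real.smoothTransition.contDiff.comp ((contDiff_const.mul contDiff_id).sub contDiff_const)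
  obtain ⟨b, hb⟩ := exists_hs_eq (compRe _ (hc 2) T) (conjF_ofRealF (reF (compRe _ (hc 2) T)))
    fun ρ => by
      refine smoothC_ext fun w => ?_
      change ((Real.smoothTransition (2 * ((scF (ru ρ) T).1 w).re - 1) : ℝ) : ℂ) = _
      rw [hTsc]; rfl
  have hbT : ∀ w, (hs b).1 w ≠ 0 → 1 / 2 < (T.1 w).re := fun w hw => by
    rw [hb] at hw
    by_contra h
    refine hw ?_
    change ((Real.smoothTransition (2 * (T.1 w).re - 1) : ℝ) : ℂ) = 0
    rw [Real.smoothTransition.zero_of_nonpos (by linarith), Complex.ofReal_zero]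
  have hbk : ∀ w, (hs b).1 w ≠ 0 → (tE k).1 w ≠ 0 := fun w hw h => by
    have := hbT w hw
    rw [hT0 w h, Complex.zero_re] at this
    norm_num at this
  have hg : ∀ f : SlitC E L, ContMDiff (𝓘(ℝ, E).prod 𝓘(ℝ, ℂ →L[ℂ] ℂ)) 𝓘(ℝ, ℂ) ∞
      fun w => (compRe _ (hc 4) T).1 w * scaleAt f ((tE k).1 w)⁻¹ w := by
    intro f w
    by_cases hw : (tE k).1 w = 0
    · refine (contMDiffAt_const (c := (0 : ℂ))).congr_of_eventuallyEq ?_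
      have hcont : ContinuousAt (fun w => (T.1 w).re) w :=
        Complex.continuous_re.continuousAt.comp (T.2 w).continuousAt
      have h0 : (T.1 w).re < 1 / 4 := by rw [hT0 w hw]; norm_num
      filter_upwards [hcont.preimage_mem_nhds (isOpen_Iio.mem_nhds h0)] with w' hw'
      change ((Real.smoothTransition (4 * (T.1 w').re - 1) : ℝ) : ℂ) * _ = 0
      have : (T.1 w').re < 1 / 4 := hw'
      rw [Real.smoothTransition.zero_of_nonpos (by linarith), Complex.ofReal_zero, zero_mul]
    · have h : ContDiff ℝ ∞ fun z : ℂ × ℂ => z.1 * z.2 := contDiff_fst.mul contDiff_snd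
      have hi : ContMDiffAt (𝓘(ℝ, E).prod 𝓘(ℝ, ℂ →L[ℂ] ℂ)) 𝓘(ℝ, ℂ) ∞
          (fun w => ((tE k).1 w)⁻¹) w :=
        ContMDiffAt.comp w (g := fun z : ℂ => z⁻¹)
          ((contDiffAt_inv ℝ hw).contMDiffAt) ((tE k).2 w)
      exact h.contMDiff.contMDiffAt.comp w (((compRe _ (hc 4) T).2 w).prodMk_space
        (contMDiffAt_scaleAt f hi (inv_ne_zero hw)))
  have hr : ∀ f : SlitC E L, ∃ h : HatR E L, hs h = ofRealF _ _ (reF (⟨_, hg f⟩ : SlitC E L)) :=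
    fun f => exists_hs_eq _ (conjF_ofRealF _) fun ρ => smoothC_ext fun w => by
      change ((((compRe _ (hc 4) T).1 (sc (ru ρ) w) *
        scaleAt f ((scF (ru ρ) (tE k)).1 w)⁻¹ (sc (ru ρ) w)).re : ℝ) : ℂ) =
        ((((compRe _ (hc 4) T).1 w * scaleAt f ((tE k).1 w)⁻¹ w).re : ℝ) : ℂ)
      have e1 : (compRe _ (hc 4) T).1 (sc (ru ρ) w) = (compRe _ (hc 4) T).1 w := by
        change ((Real.smoothTransition (4 * ((scF (ru ρ) T).1 w).re - 1) : ℝ) : ℂ) = _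
        rw [hTsc]; rfl
      rw [e1, scaleAt_sc, scF_tE, smoothC_smul, ru_val, mul_inv, mul_right_comm,
        inv_mul_cancel₀ (show ((ρ : ℝ) : ℂ) ≠ 0 from (ru ρ).ne_zero), one_mul]
  choose r hr using hr
  refine ⟨k, b, r, hkv, ?_, fun w hw => ?_⟩
  · rw [hb]
    change ((Real.smoothTransition (2 * (T.1 v).re - 1) : ℝ) : ℂ) = 1
    rw [hTv, Complex.one_re, Real.smoothTransition.one_of_one_le (by norm_num), Complex.ofReal_one]
  · have hk := hbk w hw
    have hkr : (((tE k).1 w).re : ℂ) = (tE k).1 w := Complex.ofReal_re _ ▸ rfl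
    have hkr0 : ((tE k).1 w).re ≠ 0 := fun h => hk (by rw [← hkr, h, Complex.ofReal_zero])
    refine ⟨(Units.mk0 _ hkr0)⁻¹, ?_, fun f => ?_⟩
    · rw [Units.val_inv_eq_inv_val, Units.val_mk0, Complex.ofReal_inv, hkr, inv_mul_cancel₀ hk]
    · rw [hr]
      change ((((Real.smoothTransition (4 * (T.1 w).re - 1) : ℝ) : ℂ) *
        scaleAt f ((tE k).1 w)⁻¹ w).re : ℂ) = _
      have := hbT w hw
      rw [Real.smoothTransition.one_of_one_le (by linarith), Complex.ofReal_one, one_mul,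
        ← scaleAt_unit, ru_val, Units.val_inv_eq_inv_val, Units.val_mk0, Complex.ofReal_inv, hkr]

end HolJacobi

namespace HolJacobi

variable {E : Type*} [NormedAddCommGroup E] [NormedSpace ℂ E] [FiniteDimensional ℂ E]
  {M : Type*} [TopologicalSpace M] [T2Space M] [ChartedSpace E M] [IsManifold 𝓘(ℂ, E) ω M]
  {L : M → Type*} [TopologicalSpace (TotalSpace ℂ L)] [∀ x, AddCommGroup (L x)]
  [∀ x, Module ℂ (L x)] [∀ x, TopologicalSpace (L x)] [FiberBundle ℂ L] [VectorBundle ℂ ℂ L]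
  [ContMDiffVectorBundle ω ℂ L 𝓘(ℂ, E)]

/-! ### Derivations in local coordinates -/

/-- Writing t = `r (tilde t) • s₀` near the base point, the Leibniz rule splits Δt into a point
derivation of t̃ at v and a multiple of t̃(v). The first expands in coordinates and Euler's identity
expands the second; the two sums combine into the values on the coordinate sections. Only the
vanishing of ∂̄s̃ at the one point v is used. -/
theorem tilde_op_eq (Δ : GaugeL E L) {x₀ : M} (F : LocFrame E L x₀) {v : Slit L}
    (hv : base v ∈ F.U) {s : Sec E L} (hs : ∀ a, (F.db a (tilde s)).1 v = 0) :
    (tilde (op Δ s)).1 v =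
      ∑ a, (F.dd a (tilde s)).1 v * (tilde (op Δ (F.lam a))).1 v := by
  obtain ⟨V, s₀, r, hV, hvV, -, -, hs₀, hr⟩ := exists_base_retraction E v F.isOpen hv
  let d : SlitC E L → ℂ := fun f => (symbol Δ (r f)).1 (base v)
  have hrv : ∀ f, (r f).1 (base v) = f.1 v := fun f => by
    obtain ⟨ζ, h1, h2⟩ := hr v hvV
    rw [hs₀, mul_one] at h1
    obtain rfl : ζ = 1 := Units.ext h1
    rw [h2, sc_one]
  have hrx : ∀ x ∈ V, ∃ w, base w = x ∧ ∀ f, (r f).1 x = f.1 w := fun x hx => by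
    obtain ⟨ζ, h1, h2⟩ := hr (slitOver x) hx
    exact ⟨sc ζ (slitOver x), rfl, h2⟩
  have hd : IsPointDer v d := by
    constructor
    · intro f g
      have : (symbol Δ (r (f + g))).1 (base v) = (symbol Δ (r f + r g)).1 (base v) :=
        der_local _ hV hvV fun x hx => by
          obtain ⟨w, -, hw⟩ := hrx x hx
          rw [smoothC_add, hw, hw, hw, smoothC_add]
      change (symbol Δ (r (f + g))).1 (base v) = _
      rw [this, Derivation.map_add, smoothC_add]
    · intro f g
      have : (symbol Δ (r (f * g))).1 (base v) = (symbol Δ (r f * r g)).1 (base v) :=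
        der_local _ hV hvV fun x hx => by
          obtain ⟨w, -, hw⟩ := hrx x hx
          rw [smoothC_mul, hw, hw, hw, smoothC_mul]
      change (symbol Δ (r (f * g))).1 (base v) = _
      rw [this, Derivation.leibniz, smoothC_add, smul_eq_mul, smul_eq_mul, smoothC_mul,
        smoothC_mul, hrv, hrv]
  have hc : ∀ c : ℂ, d (algebraMap ℂ (SlitC E L) c) = 0 := fun c => by
    have : (symbol Δ (r (algebraMap ℂ (SlitC E L) c))).1 (base v) =
        (symbol Δ (algebraMap ℂ (FunC E M) c)).1 (base v) :=
      der_local _ hV hvV fun x hx => by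
        obtain ⟨w, -, hw⟩ := hrx x hx
        rw [hw]; rfl
    change (symbol Δ _).1 _ = 0
    rw [this, Derivation.map_algebraMap, smoothC_zero]
  have key : ∀ t : Sec E L, (tilde (op Δ t)).1 v =
      d (tilde t) + (tilde t).1 v * (tilde (op Δ s₀)).1 v := by
    intro t
    have h1 : (tilde (op Δ t)).1 v = (tilde (op Δ (r (tilde t) • s₀))).1 v :=
      tilde_op_local Δ hV hvV fun w hw => by
        obtain ⟨ζ, h1, h2⟩ := hr w hw
        rw [tilde_smul, smoothC_mul, pb_val, h2, ← scF_val, scF_tilde, smoothC_smul,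
          mul_right_comm, h1, one_mul]
    rw [h1, op_smul, tilde_add, tilde_smul, tilde_smul, smoothC_add, smoothC_mul, smoothC_mul,
      pb_val, pb_val, hrv, hs₀, mul_one, add_comm]
  have e1 : d (tilde s) = ∑ a, d (tilde (F.lam a)) * (F.dd a (tilde s)).1 v := by
    rw [F.pd v hv d hc hd]
    exact Finset.sum_congr rfl fun a _ => by rw [hs, mul_zero, add_zero]
  rw [key, e1, F.euler_hol hv hs, Finset.sum_mul, ← Finset.sum_add_distrib]
  refine Finset.sum_congr rfl fun a _ => ?_
  rw [key (F.lam a)]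
  ring

/-- The complexified action of a derivation of `ℓ` on sections of `L`. -/
def opC (D : GaugeEll E L) (s : Sec E L) : SlitC E L :=
  tE (op D (hatSec s)) - Complex.I • tE (op D (hatSec (Complex.I • s)))

/-- The same argument on M̂. As the section of ℓ given by iλ has the function −Im λ̃, `opC D λ` is
the value on λ̃ of the real field on M̃ belonging to D; the sum is that field written out in
holomorphic and antiholomorphic coordinates. -/
theorem tE_op_eq (D : GaugeEll E L) {x₀ : M} (F : LocFrame E L x₀) {v : Slit L}
    (hv : base v ∈ F.U) (t : SecEll E L) :
    (tE (op D t)).1 v = ∑ a, ((F.dd a (tE t)).1 v * (opC D (F.lam a)).1 v +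
      (F.db a (tE t)).1 v * starRingEnd ℂ ((opC D (F.lam a)).1 v)) := by
  obtain ⟨k, b, r, hk, hb, hr⟩ := exists_hat_retraction E v
  let δ : HatR E L → ℂ := fun h => (hs (symbol D h)).1 v
  have hbv : (hs b).1 v ≠ 0 := by rw [hb]; exact one_ne_zero
  have hδ : ∀ f g : HatR E L, (∀ w, (hs b).1 w ≠ 0 → (hs f).1 w = (hs g).1 w) → δ f = δ g :=
    fun f g h => symE_local_of_bump (symbol D) hb h
  have hδa : ∀ f g, δ (f + g) = δ f + δ g := fun f g => by
    change (hs (symbol D (f + g))).1 v = _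
    rw [Derivation.map_add, hs_add, smoothC_add]
  have hδm : ∀ f g, δ (f * g) = (hs f).1 v * δ g + (hs g).1 v * δ f := fun f g => by
    change (hs (symbol D (f * g))).1 v = _
    rw [Derivation.leibniz, hs_add, smul_eq_mul, smul_eq_mul, hs_mul, hs_mul, smoothC_add,
      smoothC_mul, smoothC_mul]
  have hδs : ∀ (c : ℝ) f, δ (c • f) = c * δ f := fun c f => by
    change (hs (symbol D (c • f))).1 v = _
    rw [(symbol D).map_smul, hs_smul, smoothC_smul]
  have hrv : ∀ f, (hs (r f)).1 v = ((f.1 v).re : ℂ) := fun f => by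
    obtain ⟨ρ, h1, h2⟩ := hr v hbv
    rw [hk, mul_one] at h1
    have h1' : ((ρ : ℝ) : ℂ) = ((1 : ℝ) : ℂ) := by rw [h1, Complex.ofReal_one]
    obtain rfl : ρ = 1 := Units.ext (Complex.ofReal_injective h1')
    rw [h2, map_one, sc_one]
  -- `r` sees only real parts and Re(−if) = Im f, so this is the complex linear extension of δ ∘ r.
  let d : SlitC E L → ℂ := fun f => δ (r f) + Complex.I * δ (r (-Complex.I • f))
  have him : ∀ z : ℂ, (-Complex.I * z).re = z.im := fun z => by simp
  have hd : IsPointDer v d := by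
    constructor
    · intro f g
      have e1 : δ (r (f + g)) = δ (r f + r g) := hδ _ _ fun w hw => by
        obtain ⟨ρ, -, h2⟩ := hr w hw
        rw [hs_add, smoothC_add, h2, h2, h2, smoothC_add, Complex.add_re, Complex.ofReal_add]
      have e2 : δ (r (-Complex.I • (f + g))) = δ (r (-Complex.I • f) + r (-Complex.I • g)) :=
        hδ _ _ fun w hw => by
          obtain ⟨ρ, -, h2⟩ := hr w hw
          rw [hs_add, smoothC_add, h2, h2, h2, smul_add, smoothC_add, Complex.add_re,
            Complex.ofReal_add]
      change δ (r (f + g)) + Complex.I * δ (r (-Complex.I • (f + g))) =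
        (δ (r f) + Complex.I * δ (r (-Complex.I • f))) +
        (δ (r g) + Complex.I * δ (r (-Complex.I • g)))
      rw [e1, e2, hδa, hδa]; ring
    · intro f g
      have e1 : δ (r (f * g)) = δ (r f * r g + (-1 : ℝ) • (r (-Complex.I • f) *
          r (-Complex.I • g))) := hδ _ _ fun w hw => by
        obtain ⟨ρ, -, h2⟩ := hr w hw
        simp only [hs_add, hs_smul, hs_mul, smoothC_add, smoothC_mul, smoothC_smul, h2, him,
          Complex.mul_re]
        push_cast; ring
      have e2 : δ (r (-Complex.I • (f * g))) = δ (r f * r (-Complex.I • g) +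
          r g * r (-Complex.I • f)) := hδ _ _ fun w hw => by
        obtain ⟨ρ, -, h2⟩ := hr w hw
        simp only [hs_add, hs_mul, smoothC_add, smoothC_mul, smoothC_smul, h2, him,
          Complex.mul_im]
        push_cast; ring
      change δ (r (f * g)) + Complex.I * δ (r (-Complex.I • (f * g))) =
        f.1 v * (δ (r g) + Complex.I * δ (r (-Complex.I • g))) +
        g.1 v * (δ (r f) + Complex.I * δ (r (-Complex.I • f)))
      rw [e1, e2, hδa, hδa, hδs, hδm, hδm, hδm, hδm, hrv, hrv, hrv, hrv, smoothC_smul,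
        smoothC_smul, him, him]
      conv_rhs => rw [← Complex.re_add_im (f.1 v), ← Complex.re_add_im (g.1 v)]
      push_cast
      linear_combination (-((f.1 v).im : ℂ) * δ (r (-Complex.I • g)) -
        ((g.1 v).im : ℂ) * δ (r (-Complex.I • f))) * Complex.I_mul_I
  have hδ1 : δ 1 = 0 := by
    have := hδm 1 1
    rw [mul_one, hs_one, smoothC_one] at this
    linear_combination -this
  have hc : ∀ c : ℂ, d (algebraMap ℂ (SlitC E L) c) = 0 := fun c => by
    have e1 : δ (r (algebraMap ℂ (SlitC E L) c)) = δ (c.re • (1 : HatR E L)) :=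
      hδ _ _ fun w hw => by
        obtain ⟨ρ, -, h2⟩ := hr w hw
        rw [h2, hs_smul, hs_one, smoothC_smul, smoothC_one, mul_one]; rfl
    have e2 : δ (r (-Complex.I • algebraMap ℂ (SlitC E L) c)) = δ (c.im • (1 : HatR E L)) :=
      hδ _ _ fun w hw => by
        obtain ⟨ρ, -, h2⟩ := hr w hw
        rw [h2, hs_smul, hs_one, smoothC_smul, smoothC_smul, smoothC_one, mul_one, him]; rfl
    change δ _ + Complex.I * δ _ = 0
    rw [e1, e2, hδs, hδs, hδ1]; simp
  have key : ∀ t : SecEll E L, (tE (op D t)).1 v =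
      δ (r (tE t)) + (tE t).1 v * (tE (op D k)).1 v := by
    intro t
    have h1 : (tE (op D t)).1 v = (tE (op D (r (tE t) • k))).1 v :=
      opE_local_of_bump D hb fun w hw => by
        obtain ⟨ρ, h1, h2⟩ := hr w hw
        have h3 : ((((tE t).1 (sc (ru ρ) w)).re : ℝ) : ℂ) = (tE t).1 (sc (ru ρ) w) :=
          Complex.ofReal_re _ ▸ rfl
        rw [tE_smul, smoothC_mul, h2, h3, ← scF_val, scF_tE, smoothC_smul, mul_right_comm, h1,
          one_mul]
    have h3 : ((((tE t).1 v).re : ℝ) : ℂ) = (tE t).1 v := Complex.ofReal_re _ ▸ rfl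
    rw [h1, op_smul, tE_add, tE_smul, tE_smul, smoothC_add, smoothC_mul, smoothC_mul, hk, hrv,
      mul_one, add_comm, h3]
  have hreal : ∀ f : SlitC E L, conjF f = f → d f = δ (r f) := fun f hf => by
    have e2 : δ (r (-Complex.I • f)) = δ ((0 : ℝ) • (1 : HatR E L)) :=
      hδ _ _ fun w hw => by
        obtain ⟨ρ, -, h2⟩ := hr w hw
        rw [h2, hs_smul, hs_one, smoothC_smul, smoothC_smul, smoothC_one, mul_one, him]
        congr 1
        exact Complex.conj_eq_iff_im.1 (congrArg (fun k : SlitC E L => k.1 _) hf)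
    change δ _ + Complex.I * δ _ = _
    rw [e2, hδs, hδ1, mul_zero, mul_zero, add_zero]
  have hδreal : ∀ h, starRingEnd ℂ (δ h) = δ h := fun h =>
    congrArg (fun k : SlitC E L => k.1 v) (conjF_hs (symbol D h))
  have hκ : starRingEnd ℂ ((tE (op D k)).1 v) = (tE (op D k)).1 v :=
    congrArg (fun f : SlitC E L => f.1 v) (conjF_tE (op D k))
  have hconj : ∀ f, d (conjF f) = starRingEnd ℂ (d f) := fun f => by
    have e1 : δ (r (conjF f)) = δ (r f) := hδ _ _ fun w hw => by
      obtain ⟨ρ, -, h2⟩ := hr w hw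
      rw [h2, h2, conjF_val, Complex.conj_re]
    have e2 : δ (r (-Complex.I • conjF f)) = δ ((-1 : ℝ) • r (-Complex.I • f)) :=
      hδ _ _ fun w hw => by
        obtain ⟨ρ, -, h2⟩ := hr w hw
        rw [hs_smul, smoothC_smul, h2, h2, smoothC_smul, smoothC_smul, him, him, conjF_val,
          Complex.conj_im]
        push_cast; ring
    change δ _ + Complex.I * δ _ = starRingEnd ℂ (δ _ + Complex.I * δ _)
    rw [e1, e2, hδs, map_add, map_mul, hδreal, hδreal, Complex.conj_I]
    push_cast; ring
  have hlam : ∀ s : Sec E L, (opC D s).1 v =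
      d (tilde s) + (tilde s).1 v * (tE (op D k)).1 v := by
    intro s
    have hh : ∀ s : Sec E L, ∀ w, (tE (hatSec s)).1 w = (((tilde s).1 w).re : ℂ) := fun s w => rfl
    have e1 : δ (r (tE (hatSec s))) = δ (r (tilde s)) := hδ _ _ fun w hw => by
      obtain ⟨ρ, -, h2⟩ := hr w hw
      rw [h2, h2, hh, Complex.ofReal_re]
    have e2 : δ (r (tE (hatSec (Complex.I • s)))) = δ ((-1 : ℝ) • r (-Complex.I • tilde s)) :=
      hδ _ _ fun w hw => by
        obtain ⟨ρ, -, h2⟩ := hr w hw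
        rw [hs_smul, smoothC_smul, h2, h2, hh, Complex.ofReal_re, tilde_const_smul, smoothC_smul,
          smoothC_smul, him]
        simp
    change (tE (op D (hatSec s))).1 v - Complex.I * (tE (op D (hatSec (Complex.I • s)))).1 v = _
    rw [key (hatSec s), key (hatSec (Complex.I • s)), e1, e2, hδs, hh, hh, tilde_const_smul, smoothC_smul, Complex.I_mul_re]
    change _ = (δ _ + Complex.I * δ _) + _
    conv_rhs => rw [← Complex.re_add_im ((tilde s).1 v)]
    push_cast
    ring
  have e1 : d (tE t) = _ := F.pd v hv d hc hd (tE t)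
  rw [hreal _ (conjF_tE t)] at e1
  have e2 : (tE t).1 v = _ := F.euler hv fun r => scF_tE r t
  rw [key, e1, e2, Finset.sum_mul, ← Finset.sum_add_distrib]
  refine Finset.sum_congr rfl fun a _ => ?_
  have e3 : starRingEnd ℂ ((opC D (F.lam a)).1 v) = starRingEnd ℂ (d (tilde (F.lam a))) +
      starRingEnd ℂ ((tilde (F.lam a)).1 v) * (tE (op D k)).1 v := by
    rw [hlam, RingHom.map_add, RingHom.map_mul, hκ]
  rw [e3, hlam, hconj, conjF_val]
  ring

/-- Point derivations of `C^∞(M, ℂ)` that annihilate holomorphic and antiholomorphic functions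
vanish. -/
theorem derivation_eq_zero_of_hol (X : Derivation ℂ (FunC E M) (FunC E M)) (v : Slit L)
    (h : ∀ U, IsOpen U → base v ∈ U → ∀ f, IsHolFun U f → (X f).1 (base v) = 0)
    (h' : ∀ U, IsOpen U → base v ∈ U → ∀ f, IsHolFun U f → (X (conjF f)).1 (base v) = 0)
    (f : FunC E M) : (X f).1 (base v) = 0 := by
  obtain ⟨F⟩ := nonempty_locFrame E L (base v)
  have hv := F.mem
  obtain ⟨V, s₀, r, hV, hvV, hVF, hol, hs₀, hr⟩ := exists_base_retraction E v F.isOpen hv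
  let d : SlitC E L → ℂ := fun f => (X (r f)).1 (base v)
  have hrv : ∀ f, (r f).1 (base v) = f.1 v := fun f => by
    obtain ⟨ζ, h1, h2⟩ := hr v hvV
    rw [hs₀, mul_one] at h1
    obtain rfl : ζ = 1 := Units.ext h1
    rw [h2, sc_one]
  have hrx : ∀ x ∈ V, ∃ w, base w = x ∧ ∀ f, (r f).1 x = f.1 w := fun x hx => by
    obtain ⟨ζ, h1, h2⟩ := hr (slitOver x) hx
    exact ⟨sc ζ (slitOver x), rfl, h2⟩
  have hd : IsPointDer v d := by
    constructor
    · intro f g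
      have : (X (r (f + g))).1 (base v) = (X (r f + r g)).1 (base v) :=
        der_local _ hV hvV fun x hx => by
          obtain ⟨w, -, hw⟩ := hrx x hx
          rw [smoothC_add, hw, hw, hw, smoothC_add]
      change (X (r (f + g))).1 (base v) = _
      rw [this, Derivation.map_add, smoothC_add]
    · intro f g
      have : (X (r (f * g))).1 (base v) = (X (r f * r g)).1 (base v) :=
        der_local _ hV hvV fun x hx => by
          obtain ⟨w, -, hw⟩ := hrx x hx
          rw [smoothC_mul, hw, hw, hw, smoothC_mul]
      change (X (r (f * g))).1 (base v) = _
      rw [this, Derivation.leibniz, smoothC_add, smul_eq_mul, smul_eq_mul, smoothC_mul,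
        smoothC_mul, hrv, hrv]
  have hc : ∀ c : ℂ, d (algebraMap ℂ (SlitC E L) c) = 0 := fun c => by
    have : (X (r (algebraMap ℂ (SlitC E L) c))).1 (base v) =
        (X (algebraMap ℂ (FunC E M) c)).1 (base v) :=
      der_local _ hV hvV fun x hx => by
        obtain ⟨w, -, hw⟩ := hrx x hx
        rw [hw]; rfl
    change (X _).1 _ = 0
    rw [this, Derivation.map_algebraMap, smoothC_zero]
  -- The restriction of λ̃_a is the quotient of the holomorphic sections λ_a and s₀: on M̃ its
  -- product with s̃₀ is λ̃_a, and ∂̄ of this relation gives holomorphy.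
  have hrl : ∀ a, IsHolFun V (r (tilde (F.lam a))) := fun a x hx => by
    have hw : ∀ w, base w ∈ V → (pb (r (tilde (F.lam a))) * tilde s₀).1 w =
        (tilde (F.lam a)).1 w := fun w hw => by
      obtain ⟨ζ, h1, h2⟩ := hr w hw
      rw [smoothC_mul, pb_val, h2, ← scF_val, scF_tilde, smoothC_smul, mul_right_comm, h1, one_mul]
    have hpb : IsHolSlit (base ⁻¹' V) (pb (L := L) (r (tilde (F.lam a)))) :=
      F.isHolSlit hVF fun w hwV b => by
        have e1 := derSlit_local (F.db b) hV hwV hw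
        rw [F.db_tilde_lam (hVF hwV), Derivation.leibniz, smoothC_add, smul_eq_mul, smul_eq_mul,
          smoothC_mul, smoothC_mul,
          F.hol_tilde hV (hVF hwV) hwV ((isHolSec_iff hV).1 hol), mul_zero, zero_add] at e1
        obtain ⟨ζ, h1, -⟩ := hr w hwV
        exact (mul_eq_zero.1 e1).resolve_left (right_ne_zero_of_mul_eq_one h1)
    have hx' : x ∈ dom E L x := mem_dom x
    have h2 := mdifferentiableAt_extS_section (x₀ := x) (x := x) hx' (c := 1) one_ne_zero
      (f := (pb (L := L) (r (tilde (F.lam a)))).1) ((hpb _ hx).mdifferentiableAt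
        ((isOpen_base_preimage hV).mem_nhds hx))
    refine (h2.congr_of_eventuallyEq ?_).mdifferentiableWithinAt
    filter_upwards [(isOpen_dom (E := E) (L := L) x).mem_nhds hx'] with y hy
    rw [extS_section hy _ one_ne_zero (smul_clm_ne_zero hy one_ne_zero)]
    rfl
  have hrc : ∀ a, d (conjF (tilde (F.lam a))) = 0 := fun a => by
    have : (X (r (conjF (tilde (F.lam a))))).1 (base v) =
        (X (conjF (r (tilde (F.lam a))))).1 (base v) := der_local _ hV hvV fun x hx => by
      obtain ⟨w, -, hw⟩ := hrx x hx
      rw [conjF_val, hw, hw, conjF_val]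
    exact this.trans (h' V hV hvV _ (hrl a))
  have hfr : (X f).1 (base v) = d (pb f) := der_local X hV hvV fun x hx => by
    obtain ⟨w, rfl, hw⟩ := hrx x hx
    rw [hw, pb_val]
  rw [hfr, F.pd v hv d hc hd]
  refine Finset.sum_eq_zero fun a _ => ?_
  rw [hrc, zero_mul, add_zero]
  exact mul_eq_zero_of_left (h V hV hvV _ (hrl a)) _

end HolJacobi

namespace HolJacobi

variable {E : Type*} [NormedAddCommGroup E] [NormedSpace ℂ E] [FiniteDimensional ℂ E]
  {M : Type*} [TopologicalSpace M] [T2Space M] [ChartedSpace E M] [IsManifold 𝓘(ℂ, E) ω M]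
  {L : M → Type*} [TopologicalSpace (TotalSpace ℂ L)] [∀ x, AddCommGroup (L x)]
  [∀ x, Module ℂ (L x)] [∀ x, TopologicalSpace (L x)] [FiberBundle ℂ L] [VectorBundle ℂ ℂ L]
  [ContMDiffVectorBundle ω ℂ L 𝓘(ℂ, E)]

/-! ### Vector fields on `M̃` given by their values on holomorphic sections -/

/-- `G` depends on holomorphic sections like a derivation of type `(1,0)`. -/
def IsConsistent (G : Sec E L → SlitC E L) : Prop :=
  ∀ (x₀ : M) (F : LocFrame E L x₀) (v : Slit L), base v ∈ F.U → ∀ s : Sec E L,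
    (∀ a, (F.db a (tilde s)).1 v = 0) →
    (G s).1 v = ∑ a, (F.dd a (tilde s)).1 v * (G (F.lam a)).1 v

theorem IsConsistent.zero : IsConsistent (fun _ : Sec E L => 0) := fun _ _ _ _ _ _ => by
  simp

theorem LocFrame.dd_conj_eq {x₀ : M} (F : LocFrame E L x₀) (a : Idx E) (f : SlitC E L) :
    F.dd a (conjF f) = conjF (F.db a f) := by
  rw [F.db_eq, conjF_conjF]

theorem LocFrame.db_conj_eq {x₀ : M} (F : LocFrame E L x₀) (a : Idx E) (f : SlitC E L) :
    F.db a (conjF f) = conjF (F.dd a f) := by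
  rw [F.db_eq, conjF_conjF]

theorem LocFrame.db_lam' {x₀ x₁ : M} (F : LocFrame E L x₀) (F' : LocFrame E L x₁) {v : Slit L}
    (hv : base v ∈ F.U) (hv' : base v ∈ F'.U) (a b : Idx E) :
    (F'.db b (tilde (F.lam a))).1 v = 0 :=
  (F'.hol_iff v hv' _).1 ((F.hol_iff v hv _).2 fun b => F.db_tilde_lam hv b a) b

/-- Local expression of the vector field with given values on holomorphic sections. -/
def LocFrame.field {x₀ : M} (F : LocFrame E L x₀) (G G' : Sec E L → SlitC E L) (f : SlitC E L) :
    SlitC E L :=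
  ∑ a, (G (F.lam a) * F.dd a f + conjF (G' (F.lam a)) * F.db a f)

/-- The coordinates of one frame are holomorphic for the other, so the antiholomorphic terms drop
out of the chain rule. Consistency of `G` is precisely the dual rule, whence the frame independence
below. -/
theorem LocFrame.dd_change {x₀ x₁ : M} (F : LocFrame E L x₀) (F' : LocFrame E L x₁) {v : Slit L}
    (hv : base v ∈ F.U) (hv' : base v ∈ F'.U) (b : Idx E) (f : SlitC E L) :
    (F'.dd b f).1 v = ∑ a, (F'.dd b (tilde (F.lam a))).1 v * (F.dd a f).1 v := by
  rw [F.pd_der hv]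
  refine Finset.sum_congr rfl fun a _ => ?_
  rw [F'.dd_conj_eq, conjF_val, F.db_lam' F' hv hv', map_zero, zero_mul, add_zero]

theorem LocFrame.sum_dd_change {x₀ x₁ : M} (F : LocFrame E L x₀) (F' : LocFrame E L x₁)
    {v : Slit L} (hv : base v ∈ F.U) (hv' : base v ∈ F'.U) {G : Sec E L → SlitC E L}
    (hG : IsConsistent G) (f : SlitC E L) :
    ∑ a, (G (F.lam a)).1 v * (F.dd a f).1 v = ∑ b, (G (F'.lam b)).1 v * (F'.dd b f).1 v := by
  have h1 : ∀ b, (G (F'.lam b)).1 v * (F'.dd b f).1 v = ∑ a, (F'.dd b (tilde (F.lam a))).1 v *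
      (G (F'.lam b)).1 v * (F.dd a f).1 v := fun b => by
    rw [F.dd_change F' hv hv', Finset.mul_sum]
    exact Finset.sum_congr rfl fun a _ => by ring
  simp only [h1]
  rw [Finset.sum_comm]
  refine Finset.sum_congr rfl fun a _ => ?_
  rw [hG x₁ F' v hv' (F.lam a) fun b => F.db_lam' F' hv hv' a b, Finset.sum_mul]

theorem LocFrame.field_val {x₀ : M} (F : LocFrame E L x₀) (G G' : Sec E L → SlitC E L)
    (f : SlitC E L) (v : Slit L) : (F.field G G' f).1 v =
      ∑ a, (G (F.lam a)).1 v * (F.dd a f).1 v +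
      starRingEnd ℂ (∑ a, (G' (F.lam a)).1 v * (F.dd a (conjF f)).1 v) := by
  rw [LocFrame.field, smoothC_sum, map_sum, ← Finset.sum_add_distrib]
  refine Finset.sum_congr rfl fun a _ => ?_
  rw [smoothC_add, smoothC_mul, smoothC_mul, conjF_val, F.dd_conj_eq, conjF_val, map_mul,
    Complex.conj_conj]

theorem LocFrame.field_eq {x₀ x₁ : M} (F : LocFrame E L x₀) (F' : LocFrame E L x₁)
    {v : Slit L} (hv : base v ∈ F.U) (hv' : base v ∈ F'.U) {G G' : Sec E L → SlitC E L}
    (hG : IsConsistent G) (hG' : IsConsistent G') (f : SlitC E L) :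
    (F.field G G' f).1 v = (F'.field G G' f).1 v := by
  rw [F.field_val, F'.field_val, F.sum_dd_change F' hv hv' hG, F.sum_dd_change F' hv hv' hG']

theorem LocFrame.field_add {x₀ : M} (F : LocFrame E L x₀) (G G' : Sec E L → SlitC E L)
    (f g : SlitC E L) : F.field G G' (f + g) = F.field G G' f + F.field G G' g := by
  rw [LocFrame.field, LocFrame.field, LocFrame.field, ← Finset.sum_add_distrib]
  refine Finset.sum_congr rfl fun a _ => ?_
  rw [Derivation.map_add, Derivation.map_add]; ring

theorem LocFrame.field_smul {x₀ : M} (F : LocFrame E L x₀) (G G' : Sec E L → SlitC E L)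
    (c : ℂ) (f : SlitC E L) : F.field G G' (c • f) = c • F.field G G' f := by
  rw [LocFrame.field, LocFrame.field, Finset.smul_sum]
  refine Finset.sum_congr rfl fun a _ => ?_
  rw [derivation_const_smul, derivation_const_smul, smul_add, mul_smul_comm, mul_smul_comm]

theorem LocFrame.field_mul {x₀ : M} (F : LocFrame E L x₀) (G G' : Sec E L → SlitC E L)
    (f g : SlitC E L) : F.field G G' (f * g) = f * F.field G G' g + g * F.field G G' f := by
  rw [LocFrame.field, LocFrame.field, LocFrame.field, Finset.mul_sum, Finset.mul_sum,
    ← Finset.sum_add_distrib]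
  refine Finset.sum_congr rfl fun a _ => ?_
  rw [Derivation.leibniz, Derivation.leibniz, smul_eq_mul, smul_eq_mul, smul_eq_mul, smul_eq_mul]
  ring

/-- A local frame around a point. -/
def frameAt (E : Type*) [NormedAddCommGroup E] [NormedSpace ℂ E] [FiniteDimensional ℂ E]
    {M : Type*} [TopologicalSpace M] [T2Space M] [ChartedSpace E M] [IsManifold 𝓘(ℂ, E) ω M]
    (L : M → Type*) [TopologicalSpace (TotalSpace ℂ L)] [∀ x, AddCommGroup (L x)]
    [∀ x, Module ℂ (L x)] [∀ x, TopologicalSpace (L x)] [FiberBundle ℂ L] [VectorBundle ℂ ℂ L]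
    [ContMDiffVectorBundle ω ℂ L 𝓘(ℂ, E)] (x : M) : LocFrame E L x :=
  (nonempty_locFrame E L x).some

/-- The vector field on `M̃` with given values on holomorphic sections and their conjugates. -/
def vfield (G G' : Sec E L → SlitC E L) (hG : IsConsistent G) (hG' : IsConsistent G') :
    Derivation ℂ (SlitC E L) (SlitC E L) :=
  Derivation.mk'
    { toFun := fun f => ⟨fun v => ((frameAt E L (base v)).field G G' f).1 v, fun v => by
        refine (((frameAt E L (base v)).field G G' f).2 v).congr_of_eventuallyEq ?_
        filter_upwards [(isOpen_base_preimage (frameAt E L (base v)).isOpen).mem_nhds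
          (frameAt E L (base v)).mem] with w hw
        exact (frameAt E L (base w)).field_eq _ (frameAt E L (base w)).mem hw hG hG' f⟩
      map_add' := fun f g => smoothC_ext fun v => by
        have := congrArg (fun k : SlitC E L => k.1 v) ((frameAt E L (base v)).field_add G G' f g)
        exact this
      map_smul' := fun c f => smoothC_ext fun v => by
        have := congrArg (fun k : SlitC E L => k.1 v) ((frameAt E L (base v)).field_smul G G' c f)
        exact this }
    fun f g => smoothC_ext fun v => by
      have := congrArg (fun k : SlitC E L => k.1 v) ((frameAt E L (base v)).field_mul G G' f g)
      exact this

section VField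

variable {G G' : Sec E L → SlitC E L} {hG : IsConsistent G} {hG' : IsConsistent G'}

theorem vfield_val {x₀ : M} (F : LocFrame E L x₀) {v : Slit L} (hv : base v ∈ F.U)
    (f : SlitC E L) : (vfield G G' hG hG' f).1 v = (F.field G G' f).1 v :=
  (frameAt E L (base v)).field_eq F (frameAt E L (base v)).mem hv hG hG' f

theorem vfield_tilde {x₀ : M} (F : LocFrame E L x₀) {v : Slit L} (hv : base v ∈ F.U)
    {s : Sec E L} (hs : ∀ a, (F.db a (tilde s)).1 v = 0) :
    (vfield G G' hG hG' (tilde s)).1 v = (G s).1 v := by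
  rw [vfield_val F hv, LocFrame.field, smoothC_sum, hG _ F v hv s hs]
  refine Finset.sum_congr rfl fun a _ => ?_
  rw [smoothC_add, smoothC_mul, smoothC_mul, hs, mul_zero, add_zero, mul_comm]

theorem vfield_lam {x₀ : M} (F : LocFrame E L x₀) {v : Slit L} (hv : base v ∈ F.U) (a : Idx E) :
    (vfield G G' hG hG' (tilde (F.lam a))).1 v = (G (F.lam a)).1 v :=
  vfield_tilde F hv fun b => F.db_tilde_lam hv b a

theorem conjF_vfield (h : IsConsistent G) (f : SlitC E L) :
    conjF (vfield G G h h f) = vfield G G h h (conjF f) := smoothC_ext fun v => by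
  rw [conjF_val, vfield_val (frameAt E L (base v)) (frameAt E L (base v)).mem,
    vfield_val (frameAt E L (base v)) (frameAt E L (base v)).mem, LocFrame.field_val,
    LocFrame.field_val, conjF_conjF, map_add, Complex.conj_conj, add_comm]

theorem LocFrame.sum_scF {x₀ : M} (F : LocFrame E L x₀) {ζ : ℂˣ}
    (h : ∀ s, scF ζ (G s) = (ζ : ℂ) • G s) (f : SlitC E L) (v : Slit L) :
    ∑ a, (G (F.lam a)).1 (sc ζ v) * (F.dd a f).1 (sc ζ v) =
      ∑ a, (G (F.lam a)).1 v * (F.dd a (scF ζ f)).1 v := by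
  refine Finset.sum_congr rfl fun a _ => ?_
  rw [F.dd_sc, smoothC_smul, scF_val, ← scF_val ζ (G _), h, smoothC_smul]
  ring

/-- Coefficients of degree one against coordinate fields of degree −1. -/
theorem scF_vfield {ζ : ℂˣ} (h : ∀ s, scF ζ (G s) = (ζ : ℂ) • G s)
    (h' : ∀ s, scF ζ (G' s) = (ζ : ℂ) • G' s) (f : SlitC E L) :
    scF ζ (vfield G G' hG hG' f) = vfield G G' hG hG' (scF ζ f) := smoothC_ext fun v => by
  have hm := (frameAt E L (base v)).mem
  rw [scF_val, vfield_val (v := sc ζ v) (frameAt E L (base v)) hm,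
    vfield_val (frameAt E L (base v)) hm, LocFrame.field_val,
    LocFrame.field_val, LocFrame.sum_scF _ h, LocFrame.sum_scF _ h', scF_conjF]

end VField

theorem derSlit_ext {X Y : Derivation ℂ (SlitC E L) (SlitC E L)}
    (h : ∀ x₀ (F : LocFrame E L x₀) v, base v ∈ F.U → ∀ a,
      (X (tilde (F.lam a))).1 v = (Y (tilde (F.lam a))).1 v ∧
      (X (conjF (tilde (F.lam a)))).1 v = (Y (conjF (tilde (F.lam a)))).1 v) : X = Y := by
  refine Derivation.ext fun f => smoothC_ext fun v => ?_
  have hm := (frameAt E L (base v)).mem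
  rw [(frameAt E L (base v)).pd_der hm X, (frameAt E L (base v)).pd_der hm Y]
  refine Finset.sum_congr rfl fun a _ => ?_
  rw [(h _ _ v hm a).1, (h _ _ v hm a).2]

/-! ### Descent of vector fields -/

theorem exists_tE_ne_zero (v : Slit L) : ∃ k : SecEll E L, (tE k).1 v ≠ 0 := by
  obtain ⟨k, b, r, hk, -⟩ := exists_hat_retraction E v
  exact ⟨k, by rw [hk]; exact one_ne_zero⟩

/-- At each point some section of ℓ is nonzero, and against it the Leibniz rule recovers the symbol.
-/
theorem gaugeFaithful_ell : GaugeFaithful ℝ (HatR E L) (SecEll E L) := fun Δ D h =>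
  gauge_ext h <| Derivation.ext fun f => hs_injective (smoothC_ext fun v => by
    obtain ⟨k, hk⟩ := exists_tE_ne_zero (E := E) v
    have h1 := op_smul Δ f k
    rw [h, h, op_smul D f k] at h1
    have h2 := congrArg (fun s => (tE s).1 v) (add_left_cancel h1)
    simp only [tE_smul, smoothC_mul] at h2
    exact (mul_right_cancel₀ hk h2).symm)

/-- A real invariant field preserves real functions, those of degree one as well as the invariant
ones, which are the sections of ℓ and the functions on M̂. -/
theorem exists_descG (X : Derivation ℂ (SlitC E L) (SlitC E L))
    (hr : ∀ f, conjF (X f) = X (conjF f)) (hs' : ∀ ρ f, scF (ru ρ) (X f) = X (scF (ru ρ) f)) :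
    ∃ D : GaugeEll E L, (∀ t, tE (op D t) = X (tE t)) ∧ ∀ h, hs (symbol D h) = X (hs h) := by
  have h1 : ∀ t : SecEll E L, ∃ s, tE s = X (tE t) := fun t => exists_tE_eq _
    (by rw [hr, conjF_tE]) fun ρ => by rw [hs', scF_tE, derivation_const_smul]
  have h2 : ∀ t : HatR E L, ∃ s, hs s = X (hs t) := fun t => exists_hs_eq _
    (by rw [hr, conjF_hs]) fun ρ => by rw [hs', scF_hs]
  choose O hO using h1
  choose S hS using h2
  let O' : SecEll E L →ₗ[ℝ] SecEll E L :=
    { toFun := O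
      map_add' := fun s t => tE_injective (by
        rw [hO, tE_add, tE_add, hO, hO, Derivation.map_add])
      map_smul' := fun c s => tE_injective (by
        rw [hO, RingHom.id_apply, tE_const_smul, tE_const_smul, hO, derivation_const_smul]) }
  let S' : Derivation ℝ (HatR E L) (HatR E L) := Derivation.mk'
    { toFun := S
      map_add' := fun s t => hs_injective (by
        rw [hS, hs_add, hs_add, hS, hS, Derivation.map_add])
      map_smul' := fun c s => hs_injective (by
        rw [hS, RingHom.id_apply, hs_smul, hs_smul, hS, derivation_const_smul]) }
    fun f g => hs_injective (by
      change hs (S (f * g)) = hs (f * S g + g * S f)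
      rw [hS, hs_mul, hs_add, hs_mul, hs_mul, hS, hS, X.leibniz, smul_eq_mul, smul_eq_mul])
  refine ⟨⟨(O', S'), fun a s => tE_injective ?_⟩, hO, hS⟩
  change tE (O (a • s)) = tE (a • O s + S a • s)
  rw [hO, tE_smul, tE_add, tE_smul, tE_smul, hO, hS, X.leibniz, smul_eq_mul, smul_eq_mul,
    mul_comm (tE s)]

theorem exists_descL (X : Derivation ℂ (SlitC E L) (SlitC E L))
    (hs' : ∀ ζ f, scF ζ (X f) = X (scF ζ f)) :
    ∃ Δ : GaugeL E L, (∀ s, tilde (op Δ s) = X (tilde s)) ∧ ∀ h, pb (symbol Δ h) = X (pb h) := by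
  have h1 : ∀ t : Sec E L, ∃ s : Sec E L, tilde s = X (tilde t) := fun t => exists_tilde_eq _
    fun ζ => by rw [hs', scF_tilde, derivation_const_smul]
  have h2 : ∀ t : FunC E M, ∃ s : FunC E M, pb s = X (pb t) := fun t => exists_pb_eq _
    fun ζ => by rw [hs', scF_pb]
  choose O hO using h1
  choose S hS using h2
  let O' : Sec E L →ₗ[ℂ] Sec E L :=
    { toFun := O
      map_add' := fun s t => sec_ext_tilde (by
        rw [hO, tilde_add, tilde_add, hO, hO, Derivation.map_add])
      map_smul' := fun c s => sec_ext_tilde (by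
        rw [hO, RingHom.id_apply, tilde_const_smul, tilde_const_smul, hO,
          derivation_const_smul]) }
  have pbs : ∀ (c : ℂ) (f : FunC E M), pb (L := L) (c • f) = c • pb f := fun c f => rfl
  let S' : Derivation ℂ (FunC E M) (FunC E M) := Derivation.mk'
    { toFun := S
      map_add' := fun s t => pb_injective (L := L) (by
        rw [hS, (pb (L := L)).map_add, (pb (L := L)).map_add, hS, hS, Derivation.map_add])
      map_smul' := fun c s => pb_injective (L := L) (by
        rw [hS, RingHom.id_apply, pbs, pbs, hS, derivation_const_smul]) }
    fun f g => pb_injective (L := L) (by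
      change pb (L := L) (S (f * g)) = pb (f * S g + g * S f)
      rw [hS, (pb (L := L)).map_mul, (pb (L := L)).map_add, (pb (L := L)).map_mul,
        (pb (L := L)).map_mul, hS, hS, X.leibniz, smul_eq_mul, smul_eq_mul])
  refine ⟨⟨(O', S'), fun a s => sec_ext_tilde ?_⟩, hO, hS⟩
  change tilde (O (a • s)) = tilde (a • O s + S a • s)
  rw [hO, tilde_smul, tilde_add, tilde_smul, tilde_smul, hO, hS, X.leibniz, smul_eq_mul,
    smul_eq_mul, mul_comm (tilde s)]

theorem opC_eq {D : GaugeEll E L} {X : Derivation ℂ (SlitC E L) (SlitC E L)}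
    (h : ∀ t, tE (op D t) = X (tE t)) (s : Sec E L) : opC D s = X (tilde s) := by
  have e : conjF (tilde (Complex.I • s)) = -Complex.I • conjF (tilde s) := by
    rw [tilde_const_smul]
    exact smoothC_ext fun v => by
      rw [conjF_val, smoothC_smul, smoothC_smul, map_mul, Complex.conj_I, conjF_val]
  rw [opC, h, h, tE_hatSec, tE_hatSec, derivation_const_smul, derivation_const_smul, e,
    tilde_const_smul, Derivation.map_add, Derivation.map_add, derivation_const_smul,
    derivation_const_smul]
  refine smoothC_ext fun v => ?_
  simp only [smoothC_sub, smoothC_smul, smoothC_add]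
  linear_combination (-(1 / 2) * (X (tilde s)).1 v + (1 / 2) * (X (conjF (tilde s))).1 v) *
    Complex.I_mul_I

theorem gaugeEll_ext {D D' : GaugeEll E L}
    (h : ∀ x₀ (F : LocFrame E L x₀) v, base v ∈ F.U → ∀ a,
      (opC D (F.lam a)).1 v = (opC D' (F.lam a)).1 v) : D = D' :=
  gaugeFaithful_ell _ _ fun t => tE_injective (smoothC_ext fun v => by
    have hm := (frameAt E L (base v)).mem
    rw [tE_op_eq D _ hm, tE_op_eq D' _ hm]
    exact Finset.sum_congr rfl fun a _ => by rw [h _ _ v hm a])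

theorem isConsistent_op (Δ : GaugeL E L) : IsConsistent fun s => tilde (op Δ s) :=
  fun _ F _ hv _ hs => tilde_op_eq Δ F hv hs

/-- The coordinate formula is applied to the sections of ℓ given by s and by is; in the combination
defining `opC` the conjugate halves cancel and the holomorphic halves add. -/
theorem isConsistent_opC (D : GaugeEll E L) : IsConsistent (opC D) := by
  intro x₀ F v hv s hs
  have h1 : ∀ s : Sec E L, (∀ a, (F.db a (tilde s)).1 v = 0) → (tE (op D (hatSec s))).1 v =
      (1 / 2 : ℂ) * ∑ a, ((F.dd a (tilde s)).1 v * (opC D (F.lam a)).1 v +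
        starRingEnd ℂ ((F.dd a (tilde s)).1 v * (opC D (F.lam a)).1 v)) := fun s hs => by
    rw [tE_op_eq D F hv, Finset.mul_sum]
    refine Finset.sum_congr rfl fun a _ => ?_
    rw [tE_hatSec, derivation_const_smul, derivation_const_smul, Derivation.map_add,
      Derivation.map_add, F.dd_conj_eq, F.db_conj_eq, smoothC_smul, smoothC_smul, smoothC_add,
      smoothC_add, conjF_val, conjF_val, hs, map_zero, map_mul]
    ring
  have h2 : (opC D s).1 v = (tE (op D (hatSec s))).1 v -
    Complex.I * (tE (op D (hatSec (Complex.I • s)))).1 v := rfl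
  have hds : ∀ a, F.dd a (tilde (Complex.I • s)) = Complex.I • F.dd a (tilde s) := fun a => by
    rw [tilde_const_smul, derivation_const_smul]
  rw [h2, h1 s hs, h1 (Complex.I • s) fun a => by
    rw [tilde_const_smul, derivation_const_smul, smoothC_smul, hs, mul_zero]]
  rw [← mul_assoc, mul_comm Complex.I, mul_assoc, ← mul_sub, Finset.mul_sum _ _ Complex.I,
    ← Finset.sum_sub_distrib, Finset.mul_sum]
  refine Finset.sum_congr rfl fun a _ => ?_
  rw [hds, smoothC_smul, mul_assoc, map_mul (starRingEnd ℂ) Complex.I, Complex.conj_I]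
  linear_combination (-(1 / 2) * ((F.dd a (tilde s)).1 v * (opC D (F.lam a)).1 v) + 1 / 2 *
    starRingEnd ℂ ((F.dd a (tilde s)).1 v * (opC D (F.lam a)).1 v)) * Complex.I_mul_I

end HolJacobi

namespace HolJacobi

variable {E : Type*} [NormedAddCommGroup E] [NormedSpace ℂ E] [FiniteDimensional ℂ E]
  {M : Type*} [TopologicalSpace M] [T2Space M] [ChartedSpace E M] [IsManifold 𝓘(ℂ, E) ω M]
  {L : M → Type*} [TopologicalSpace (TotalSpace ℂ L)] [∀ x, AddCommGroup (L x)]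
  [∀ x, Module ℂ (L x)] [∀ x, TopologicalSpace (L x)] [FiberBundle ℂ L] [VectorBundle ℂ ℂ L]
  [ContMDiffVectorBundle ω ℂ L 𝓘(ℂ, E)]

/-! ### The vector fields and derivations associated with a derivation of `L` -/

theorem der_add (X : Derivation ℂ (SlitC E L) (SlitC E L)) (f g : SlitC E L) :
    X (f + g) = X f + X g := X.map_add f g

theorem der_zero (X : Derivation ℂ (SlitC E L) (SlitC E L)) : X 0 = 0 := X.map_zero

theorem der_mul (X : Derivation ℂ (SlitC E L) (SlitC E L)) (f g : SlitC E L) :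
    X (f * g) = f * X g + g * X f := X.leibniz f g

theorem der_mul_val (X : Derivation ℂ (SlitC E L) (SlitC E L)) (f g : SlitC E L) (v : Slit L) :
    (X (f * g)).1 v = f.1 v * (X g).1 v + g.1 v * (X f).1 v := by
  rw [der_mul, smoothC_add, smoothC_mul, smoothC_mul]

theorem opC_val (D : GaugeEll E L) (s : Sec E L) (v : Slit L) : (opC D s).1 v =
    (tE (op D (hatSec s))).1 v - Complex.I * (tE (op D (hatSec (Complex.I • s)))).1 v := rfl

theorem tE_re (s : SecEll E L) (v : Slit L) : (tE s).1 v = (((tE s).1 v).re : ℂ) :=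
  (Complex.ofReal_re _ ▸ rfl : (((tE s).1 v).re : ℂ) = (tE s).1 v).symm

theorem opC_add (D D' : GaugeEll E L) (s : Sec E L) : opC (D + D') s = opC D s + opC D' s := by
  rw [opC, opC, opC, op_add, op_add, tE_add, tE_add, smul_add]
  abel

theorem opC_smul (h : HatR E L) (D : GaugeEll E L) (s : Sec E L) :
    opC (h • D) s = hs h * opC D s := by
  rw [opC, opC, op_smul_left, op_smul_left, tE_smul, tE_smul, mul_sub, mul_smul_comm]

theorem opC_zero (s : Sec E L) : opC (0 : GaugeEll E L) s = 0 := by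
  rw [opC, op_zero, op_zero, tE_zero, smul_zero, sub_zero]

theorem opC_sum {ι : Type*} (A : Finset ι) (D : ι → GaugeEll E L) (s : Sec E L) :
    opC (∑ i ∈ A, D i) s = ∑ i ∈ A, opC (D i) s := by
  classical
  induction A using Finset.induction_on with
  | empty => exact opC_zero s
  | insert a A ha ih => rw [Finset.sum_insert ha, Finset.sum_insert ha, opC_add, ih]

theorem scF_opC (ρ : ℝˣ) (D : GaugeEll E L) (s : Sec E L) :
    scF (ru ρ) (opC D s) = ((ru ρ : ℂˣ) : ℂ) • opC D s := by
  refine smoothC_ext fun v => ?_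
  have h1 := congrArg (fun k : SlitC E L => k.1 v) (scF_tE ρ (op D (hatSec s)))
  have h2 := congrArg (fun k : SlitC E L => k.1 v) (scF_tE ρ (op D (hatSec (Complex.I • s))))
  simp only [scF_val, smoothC_smul] at h1 h2
  rw [scF_val, opC_val, h1, h2, smoothC_smul, opC_val, ru_val]
  ring

theorem tE_op_eq_re (D : GaugeEll E L) {x₀ : M} (F : LocFrame E L x₀) {v : Slit L}
    (hv : base v ∈ F.U) (t : SecEll E L) : (tE (op D t)).1 v =
      ((2 * ∑ a, (F.dd a (tE t)).1 v * (opC D (F.lam a)).1 v).re : ℂ) := by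
  have h : ∀ a, (F.db a (tE t)).1 v = starRingEnd ℂ ((F.dd a (tE t)).1 v) := fun a => by
    rw [F.db_eq, conjF_tE, conjF_val]
  rw [tE_op_eq D F hv, Finset.sum_add_distrib]
  simp only [h, ← map_mul]
  rw [← map_sum, Complex.add_conj]
  simp

theorem tE_op_congr (D D' : GaugeEll E L) {x₀ : M} (F : LocFrame E L x₀) {v : Slit L}
    (hv : base v ∈ F.U) (h : ∀ a, (opC D (F.lam a)).1 v = (opC D' (F.lam a)).1 v)
    (t : SecEll E L) : (tE (op D t)).1 v = (tE (op D' t)).1 v := by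
  rw [tE_op_eq D F hv, tE_op_eq D' F hv]
  exact Finset.sum_congr rfl fun a _ => by rw [h]

/-- The vector field on `M̃` of type `(1, 0)` associated with a derivation. -/
def wField (Δ : GaugeL E L) : Derivation ℂ (SlitC E L) (SlitC E L) :=
  vfield _ _ (isConsistent_op Δ) IsConsistent.zero

/-- The real vector field on `M̃` associated with a derivation. -/
def xField (Δ : GaugeL E L) : Derivation ℂ (SlitC E L) (SlitC E L) :=
  vfield _ _ (isConsistent_op Δ) (isConsistent_op Δ)

theorem wField_val (Δ : GaugeL E L) {x₀ : M} (F : LocFrame E L x₀) {v : Slit L}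
    (hv : base v ∈ F.U) (f : SlitC E L) :
    (wField Δ f).1 v = ∑ a, (tilde (op Δ (F.lam a))).1 v * (F.dd a f).1 v := by
  rw [wField, vfield_val F hv, F.field_val]
  simp

theorem wField_tilde (Δ : GaugeL E L) {x₀ : M} (F : LocFrame E L x₀) {v : Slit L}
    (hv : base v ∈ F.U) {s : Sec E L} (hs : ∀ a, (F.db a (tilde s)).1 v = 0) :
    (wField Δ (tilde s)).1 v = (tilde (op Δ s)).1 v := vfield_tilde F hv hs

theorem xField_tilde (Δ : GaugeL E L) {x₀ : M} (F : LocFrame E L x₀) {v : Slit L}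
    (hv : base v ∈ F.U) {s : Sec E L} (hs : ∀ a, (F.db a (tilde s)).1 v = 0) :
    (xField Δ (tilde s)).1 v = (tilde (op Δ s)).1 v := vfield_tilde F hv hs

theorem conjF_xField (Δ : GaugeL E L) (f : SlitC E L) :
    conjF (xField Δ f) = xField Δ (conjF f) := conjF_vfield _ f

theorem scF_xField (Δ : GaugeL E L) (ζ : ℂˣ) (f : SlitC E L) :
    scF ζ (xField Δ f) = xField Δ (scF ζ f) :=
  scF_vfield (fun _ => scF_tilde _ _) (fun _ => scF_tilde _ _) f

theorem exists_hatDer (Δ : GaugeL E L) : ∃ D : GaugeEll E L,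
    (∀ t, tE (op D t) = xField Δ (tE t)) ∧ ∀ h, hs (symbol D h) = xField Δ (hs h) :=
  exists_descG _ (conjF_xField Δ) fun _ f => scF_xField Δ _ f

/-- The derivation of `ℓ` induced by a derivation of `L`. -/
def hatDer (Δ : GaugeL E L) : GaugeEll E L := (exists_hatDer Δ).choose

theorem tE_op_hatDer (Δ : GaugeL E L) (t : SecEll E L) :
    tE (op (hatDer Δ) t) = xField Δ (tE t) := (exists_hatDer Δ).choose_spec.1 t

theorem hs_symbol_hatDer (Δ : GaugeL E L) (h : HatR E L) :
    hs (symbol (hatDer Δ) h) = xField Δ (hs h) := (exists_hatDer Δ).choose_spec.2 h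

theorem opC_hatDer (Δ : GaugeL E L) (s : Sec E L) : opC (hatDer Δ) s = xField Δ (tilde s) :=
  opC_eq (tE_op_hatDer Δ) s

theorem opC_hatDer_val (Δ : GaugeL E L) {x₀ : M} (F : LocFrame E L x₀) {v : Slit L}
    (hv : base v ∈ F.U) {s : Sec E L} (hs : ∀ a, (F.db a (tilde s)).1 v = 0) :
    (opC (hatDer Δ) s).1 v = (tilde (op Δ s)).1 v := by
  rw [opC_hatDer, xField_tilde Δ F hv hs]

theorem opC_hatDer_lam (Δ : GaugeL E L) {x₀ : M} (F : LocFrame E L x₀) {v : Slit L}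
    (hv : base v ∈ F.U) (a : Idx E) :
    (opC (hatDer Δ) (F.lam a)).1 v = (tilde (op Δ (F.lam a))).1 v :=
  opC_hatDer_val Δ F hv fun b => F.db_tilde_lam hv b a

theorem hatDer_add (Δ Δ' : GaugeL E L) : hatDer (Δ + Δ') = hatDer Δ + hatDer Δ' :=
  gaugeEll_ext fun x₀ F v hv a => by
    rw [opC_add, smoothC_add, opC_hatDer_lam _ F hv, opC_hatDer_lam _ F hv,
      opC_hatDer_lam _ F hv, op_add, tilde_add, smoothC_add]

theorem hatDer_smul (f : FunR E M) (Δ : GaugeL E L) :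
    hatDer (ofRealF _ _ f • Δ) = algebraMap (FunR E M) (HatR E L) f • hatDer Δ :=
  gaugeEll_ext fun x₀ F v hv a => by
    rw [opC_smul, smoothC_mul, opC_hatDer_lam _ F hv, opC_hatDer_lam _ F hv, op_smul_left,
      tilde_smul, smoothC_mul, hs_algebraMap]

/-- The induced derivation depends only on values on local holomorphic sections, so it factors
through derivations of L modulo the ∂̄_ξ, that is, through D^{1,0}L. -/
theorem hatDer_eq_zero {δ : GaugeL E L} (hδ : IsDbar δ) : hatDer δ = 0 :=
  gaugeEll_ext fun x₀ F v hv a => by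
    rw [opC_zero, opC_hatDer_lam _ F hv]
    have := hδ F.U F.isOpen _ (F.isHolSec_lam a) (base v) hv
    rw [tilde_eq_at (t := 0) this, tilde_zero]

/-- The constant function `i`. -/
def cI (E M : Type*) [NormedAddCommGroup E] [NormedSpace ℂ E] [TopologicalSpace M]
    [ChartedSpace E M] : FunC E M := algebraMap ℂ (FunC E M) Complex.I

theorem cI_smul (s : Sec E L) : cI E M • s = Complex.I • s := rfl

theorem cI_mul_cI : cI E M * cI E M = -1 := smoothC_ext fun _ => Complex.I_mul_I

theorem pb_cI_mul (f : SlitC E L) : pb (cI E M) * f = Complex.I • f := rfl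

theorem cI_cI_smul {Γ : Type*} [AddCommGroup Γ] [Module (FunC E M) Γ] (s : Γ) :
    cI E M • cI E M • s = -s := by
  rw [smul_smul, cI_mul_cI, neg_one_smul]

theorem funC_eq (f : FunC E M) : f = ofRealF _ _ (reF f) + ofRealF _ _ (imF f) * cI E M := by
  conv_lhs => rw [eq_re_add_im f]
  rw [Algebra.smul_def, mul_comm]; rfl

theorem hatDer_neg (Δ : GaugeL E L) : hatDer (-Δ) = -hatDer Δ := by
  have h : hatDer (0 : GaugeL E L) = 0 := hatDer_eq_zero fun _ _ _ _ _ _ => rfl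
  have := hatDer_add Δ (-Δ)
  rw [add_neg_cancel, h] at this
  exact eq_neg_of_add_eq_zero_right this.symm

theorem hatDer_smulC (f : FunC E M) (Δ : GaugeL E L) : hatDer (f • Δ) =
    algebraMap (FunR E M) (HatR E L) (reF f) • hatDer Δ +
    algebraMap (FunR E M) (HatR E L) (imF f) • hatDer (cI E M • Δ) := by
  conv_lhs => rw [funC_eq f, add_smul, mul_smul]
  rw [hatDer_add, hatDer_smul, hatDer_smul]

theorem exists_iota (Δ : GaugeL E L) : ∃ D : GaugeL E L,
    (∀ s, tilde (op D s) = xField Δ (tilde s)) ∧ ∀ f, pb (symbol D f) = xField Δ (pb f) :=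
  exists_descL _ fun _ f => scF_xField Δ _ f

/-- The isomorphism `ι : D^{1,0}L → DL`. -/
def iota (Δ : GaugeL E L) : GaugeL E L := (exists_iota Δ).choose

theorem tilde_op_iota (Δ : GaugeL E L) (s : Sec E L) :
    tilde (op (iota Δ) s) = xField Δ (tilde s) := (exists_iota Δ).choose_spec.1 s

theorem pb_symbol_iota (Δ : GaugeL E L) (f : FunC E M) :
    pb (symbol (iota Δ) f) = xField Δ (pb f) := (exists_iota Δ).choose_spec.2 f

/-- On holomorphic sections the real field acts as Δ, so ιΔ − Δ annihilates them; the field commutes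
with conjugation, so the symbol of ιΔ is real. -/
theorem isIota_iota (Δ : GaugeL E L) : IsIota Δ (iota Δ) := by
  constructor
  · intro U hU s hs x hx
    have hm := (frameAt E L x).mem
    have h : (tilde (op (iota Δ - Δ) s)).1 (slitOver x) = (tilde (0 : Sec E L)).1 (slitOver x) := by
      rw [op_sub, tilde_sub, smoothC_sub, tilde_op_iota, xField_tilde Δ (frameAt E L x)
        (v := slitOver x) hm fun a => (frameAt E L x).hol_tilde hU
          (v := slitOver x) hm hx ((isHolSec_iff hU).1 hs) a,
        sub_self, tilde_zero, smoothC_zero]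
    exact sec_eq_at h
  · intro f
    refine pb_injective (L := L) ?_
    rw [pb_symbol_iota, pb_conjF, pb_conjF, pb_symbol_iota, conjF_xField]

theorem hatDer_iota (Δ : GaugeL E L) : hatDer (iota Δ) = hatDer Δ := by
  have h := hatDer_eq_zero (isIota_iota Δ).1
  rw [sub_eq_add_neg, hatDer_add, hatDer_neg] at h
  exact add_neg_eq_zero.1 h

/-- Valid for all smooth s, since the real field commutes with taking real parts. With Δ in place of
ιΔ it would hold for holomorphic s only; this is why brackets of smooth jets are formed with ι. -/
theorem hatSec_op_iota (Δ : GaugeL E L) (s : Sec E L) :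
    op (hatDer Δ) (hatSec s) = hatSec (op (iota Δ) s) := tE_injective (by
  rw [tE_op_hatDer, tE_hatSec, tE_hatSec, derivation_const_smul, der_add, ← conjF_xField,
    tilde_op_iota])

theorem hatDer_comm_iota (Δ Δ' : GaugeL E L) :
    hatDer (comm (iota Δ) (iota Δ')) = comm (hatDer Δ) (hatDer Δ') :=
  gaugeEll_ext fun x₀ F v hv a => by
    have h1 : ∀ t, tE (op (comm (hatDer Δ) (hatDer Δ')) t) = ⁅xField Δ, xField Δ'⁆ (tE t) :=
      fun t => by
        rw [op_comm, tE_sub, tE_op_hatDer, tE_op_hatDer, tE_op_hatDer, tE_op_hatDer,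
          Derivation.commutator_apply]
    rw [opC_hatDer_lam _ F hv, opC_eq h1, op_comm, tilde_sub, tilde_op_iota, tilde_op_iota,
      tilde_op_iota, tilde_op_iota, Derivation.commutator_apply]

/-! ### Local frames of derivations -/

/-- The degree-one factor compensates for the degree −1 of the coordinate field, so that the product
is invariant and descends to a derivation of L. -/
theorem scF_dd_mul {x₀ : M} (F : LocFrame E L x₀) (a : Idx E) (ζ : ℂˣ) (f : SlitC E L) :
    scF ζ (tilde (F.lam none) * F.dd a f) = tilde (F.lam none) * F.dd a (scF ζ f) := by
  rw [scF_mul, scF_tilde, F.dd_sc, mul_smul_comm, smul_mul_assoc]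

theorem exists_frameDer {x₀ : M} (F : LocFrame E L x₀) (a : Idx E) : ∃ Δ : GaugeL E L,
    ∀ s, tilde (op Δ s) = tilde (F.lam none) * F.dd a (tilde s) := by
  obtain ⟨Δ, h, -⟩ := exists_descL (tilde (F.lam none) • F.dd a) (scF_dd_mul F a)
  exact ⟨Δ, h⟩

/-- The derivations of `L` of type `(1, 0)` corresponding to the coordinates. -/
def LocFrame.der {x₀ : M} (F : LocFrame E L x₀) (a : Idx E) : GaugeL E L :=
  (exists_frameDer F a).choose

theorem LocFrame.tilde_op_der {x₀ : M} (F : LocFrame E L x₀) (a : Idx E) (s : Sec E L) :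
    tilde (op (F.der a) s) = tilde (F.lam none) * F.dd a (tilde s) :=
  (exists_frameDer F a).choose_spec s

theorem exists_frameDbar {x₀ : M} (F : LocFrame E L x₀) (a : Idx E) : ∃ Δ : GaugeL E L,
    ∀ s, tilde (op Δ s) = conjF (tilde (F.lam none)) * F.db a (tilde s) := by
  obtain ⟨Δ, h, -⟩ := exists_descL (conjF (tilde (F.lam none)) • F.db a) (fun ζ f => by
    change scF ζ (conjF (tilde (F.lam none)) * F.db a f) =
      conjF (tilde (F.lam none)) * F.db a (scF ζ f)
    rw [F.db_eq, F.db_eq, ← conjF_mul, ← conjF_mul, scF_conjF, scF_dd_mul, scF_conjF])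
  exact ⟨Δ, h⟩

/-- A section annihilated by all `∂̄` is holomorphic. -/
theorem isHolSec_of_dbar {U : Set M} (hU : IsOpen U) {s : Sec E L}
    (h : ∀ δ : GaugeL E L, IsDbar δ → ∀ x ∈ U, (op δ s).1 x = 0) : IsHolSec U s := by
  rw [isHolSec_iff hU]
  intro v hv
  have hm := (frameAt E L (base v)).mem
  set F := frameAt E L (base v)
  refine ((F.hol_iff v hm _).2 fun a => ?_).mdifferentiableWithinAt
  obtain ⟨b, V, -, hxV, hVF, hb, hbF⟩ := exists_bump (E := E) F.isOpen hm
  obtain ⟨Δ, hΔ⟩ := exists_frameDbar F a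
  -- Only over `F.U` is the coordinate field known to annihilate holomorphic functions, hence the
  -- cut-off.
  have hd : IsDbar (ofRealF _ _ b • Δ) := by
    intro W hW t ht x hx
    by_cases hxF : x ∈ F.U
    · have : (tilde (op Δ t)).1 (slitOver x) = (tilde (0 : Sec E L)).1 (slitOver x) := by
        rw [hΔ, smoothC_mul, F.hol_tilde hW (v := slitOver x) hxF hx ((isHolSec_iff hW).1 ht),
          mul_zero, tilde_zero, smoothC_zero]
      have h2 : (op Δ t).1 x = 0 := sec_eq_at this
      change ((b.1 x : ℝ) : ℂ) • (op Δ t).1 x = 0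
      rw [h2, smul_zero]
    · change ((b.1 x : ℝ) : ℂ) • (op Δ t).1 x = 0
      rw [image_eq_zero_of_notMem_tsupport fun h => hxF (hbF h), Complex.ofReal_zero, zero_smul]
  have h1 := h _ hd (base v) hv
  have h2 : (tilde (op (ofRealF _ _ b • Δ) s)).1 v = 0 := by
    rw [tilde_eq_at (t := 0) h1, tilde_zero, smoothC_zero]
  rw [op_smul_left, tilde_smul, smoothC_mul, pb_val, ofRealF_val, hb _ hxV, Complex.ofReal_one,
    one_mul, hΔ, smoothC_mul, conjF_val] at h2
  refine (mul_eq_zero.1 h2).resolve_left fun h => ?_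
  exact right_ne_zero_of_mul_eq_one (F.q_mul v hm) ((map_eq_zero _).1 h)

end HolJacobi

/-! ### The bi-vector Π on M̃: existence and uniqueness -/

namespace HolJacobi

variable {E : Type*} [NormedAddCommGroup E] [NormedSpace ℂ E] [FiniteDimensional ℂ E]
  {M : Type*} [TopologicalSpace M] [T2Space M] [ChartedSpace E M] [IsManifold 𝓘(ℂ, E) ω M]
  {L : M → Type*} [TopologicalSpace (TotalSpace ℂ L)] [∀ x, AddCommGroup (L x)]
  [∀ x, Module ℂ (L x)] [∀ x, TopologicalSpace (L x)] [FiberBundle ℂ L] [VectorBundle ℂ ℂ L]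
  [ContMDiffVectorBundle ω ℂ L 𝓘(ℂ, E)]

/-- A cut-off of the jet of a local holomorphic section is a holomorphic jet. -/
theorem cutoff_j1_mem_holJet {U : Set M} (hU : IsOpen U) {b : FunR E M} (hb : tsupport b.1 ⊆ U)
    {s : Sec E L} (hs : IsHolSec U s) : (ofRealF _ _ b • j1 s : JetL E L) ∈ holJet E L := by
  intro δ hδ
  refine Subtype.ext (funext fun x => ?_)
  change ((b.1 x : ℝ) : ℂ) • (op δ s).1 x = 0
  by_cases hx : x ∈ U
  · rw [hδ U hU s hs x hx, smul_zero]
  · rw [image_eq_zero_of_notMem_tsupport fun h => hx (hb h), Complex.ofReal_zero, zero_smul]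

theorem ofRealF_smul_sec_val (b : FunR E M) (s : Sec E L) (x : M) :
    (ofRealF _ _ b • s).1 x = ((b.1 x : ℝ) : ℂ) • s.1 x := rfl

/-- Holomorphic sections are closed under the bracket of a holomorphic Jacobi structure. -/
theorem IsHolJacobi.isHolSec_brack {J : JetL E L →ₗ[FunC E M] GaugeL E L} (hJ : IsHolJacobi J)
    {U : Set M} (hU : IsOpen U) {s t : Sec E L} (hs : IsHolSec U s) (ht : IsHolSec U t) :
    IsHolSec U (brack J s t) := by
  refine isHolSec_of_dbar hU fun δ hδ x hx => ?_
  obtain ⟨b, V, hV, hxV, -, hb, hbU⟩ := exists_bump (E := E) hU hx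
  have hcut : ∀ r : Sec E L, ∀ y ∈ V, (ofRealF _ _ b • r).1 y = r.1 y := fun r y hy => by
    rw [ofRealF_smul_sec_val, hb y hy, Complex.ofReal_one, one_smul]
  set θ : JetL E L := ofRealF _ _ b • j1 s with hθ
  -- The condition ∂̄J = 0 speaks of globally defined holomorphic jets, so the prolongations of s
  -- and t enter cut off; near x the cut-off is invisible.
  have h := hJ.dbar δ hδ θ (cutoff_j1_mem_holJet hU hbU hs) _ (cutoff_j1_mem_holJet hU hbU ht)
  have hz : ∀ (Δ : GaugeL E L) (r : Sec E L), IsHolSec U r → (op Δ (op δ r)).1 x = 0 :=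
    fun Δ r hr => by
      rw [op_local Δ hU hx (t := 0) (fun y hy => hδ U hU r hr y hy), map_zero]; rfl
  have e1 : J θ = ofRealF _ _ b • J (j1 s) := J.map_smul _ _
  have h0 : (op (comm δ (J θ) - J (lieD δ θ)) t).1 x = 0 := by
    have := congrArg (fun r : Sec E L => r.1 x) h
    rw [← hcut _ x hxV]
    exact this
  have h1 : (op (comm δ (J θ)) t).1 x = (op δ (brack J s t)).1 x := by
    rw [op_comm]
    change (op δ (op (J θ) t)).1 x - (op (J θ) (op δ t)).1 x = _
    rw [hz _ t ht, sub_zero, e1]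
    exact op_local δ hV hxV fun y hy => hcut _ y hy
  -- Near x the jet L_δ θ is the prolongation of δs, which vanishes there.
  have h2 : (op (J (lieD δ θ)) t).1 x = 0 := by
    have : op (J (lieD δ θ)) t = -(lieD δ θ (J (j1 t))) := hJ.jacobi.1 (lieD δ θ) (j1 t)
    rw [this, lieD_apply]
    change -((op δ (ofRealF _ _ b • op (J (j1 t)) s)).1 x -
      (ofRealF _ _ b • op (comm δ (J (j1 t))) s).1 x) = 0
    rw [hcut _ x hxV, op_local δ hV hxV fun y hy => hcut (op (J (j1 t)) s) y hy, op_comm]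
    change -((op δ (op (J (j1 t)) s)).1 x - ((op δ (op (J (j1 t)) s)).1 x -
      (op (J (j1 t)) (op δ s)).1 x)) = 0
    rw [hz _ s hs]
    simp
  rw [op_sub] at h0
  change (op (comm δ (J θ)) t).1 x - (op (J (lieD δ θ)) t).1 x = 0 at h0
  rw [h1, h2, sub_zero] at h0
  exact h0

theorem tilde_op_sharp_lam {S : JetL E L →ₗ[FunC E M] GaugeL E L} (h : IsBiderivation S)
    {x₀ : M} (F : LocFrame E L x₀) {v : Slit L} (hv : base v ∈ F.U) {s : Sec E L}
    (hs : ∀ a, (F.db a (tilde s)).1 v = 0) (t : Sec E L) :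
    (tilde (op (S (j1 s)) t)).1 v =
      ∑ a, (F.dd a (tilde s)).1 v * (tilde (brack S (F.lam a) t)).1 v := by
  have e : ∀ r : Sec E L, op (S (j1 r)) t = -op (S (j1 t)) r := fun r => h.brack_skew r t
  rw [e, tilde_neg, smoothC_neg, tilde_op_eq _ F hv hs, ← Finset.sum_neg_distrib]
  refine Finset.sum_congr rfl fun a _ => ?_
  rw [brack, e, tilde_neg, smoothC_neg, mul_neg]

section Poisson

variable {S : JetL E L →ₗ[FunC E M] GaugeL E L}

/-- For fixed f, the value Π(df, ds̃) should be minus the Hamiltonian (1,0)-field of s applied to f.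
By skewness that field depends on s through the same coordinate formula as a derivation applied to
s. -/
theorem isConsistent_bivector (h : IsBiderivation S) (f : SlitC E L) :
    IsConsistent fun s => -wField (S (j1 s)) f := fun x₀ F v hv s hs => by
  rw [smoothC_neg, wField_val _ F hv, ← Finset.sum_neg_distrib]
  simp only [smoothC_neg, wField_val _ F hv, mul_neg, Finset.mul_sum,
    Finset.sum_neg_distrib, tilde_op_sharp_lam h F hv hs, Finset.sum_mul]
  rw [Finset.sum_comm]
  simp only [brack, mul_assoc]

theorem bivector_val (h : IsBiderivation S) (f : SlitC E L) {x₀ : M} (F : LocFrame E L x₀)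
    {v : Slit L} (hv : base v ∈ F.U) (g : SlitC E L) :
    (vfield _ _ (isConsistent_bivector h f) IsConsistent.zero g).1 v =
      ∑ a, ∑ b, (tilde (brack S (F.lam a) (F.lam b))).1 v * (F.dd a f).1 v * (F.dd b g).1 v := by
  rw [vfield_val F hv, F.field_val]
  simp only [smoothC_zero, zero_mul, Finset.sum_const_zero, map_zero, add_zero, smoothC_neg,
    wField_val _ F hv]
  rw [Finset.sum_comm]
  refine Finset.sum_congr rfl fun b _ => ?_
  rw [neg_mul, Finset.sum_mul, ← Finset.sum_neg_distrib]
  refine Finset.sum_congr rfl fun a _ => ?_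
  have e : op (S (j1 (F.lam b))) (F.lam a) = -brack S (F.lam a) (F.lam b) :=
    h.brack_skew (F.lam b) (F.lam a)
  rw [e, tilde_neg, smoothC_neg]
  ring

/-- The bi-vector `Π` on `M̃` determined by a bi-derivation. -/
def bivector (h : IsBiderivation S) :
    SlitC E L →ₗ[ℂ] Derivation ℂ (SlitC E L) (SlitC E L) where
  toFun f := vfield _ _ (isConsistent_bivector h f) IsConsistent.zero
  map_add' f f' := Derivation.ext fun g => smoothC_ext fun v => by
    have hv := (frameAt E L (base v)).mem
    rw [Derivation.add_apply, smoothC_add, bivector_val h _ _ hv, bivector_val h _ _ hv,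
      bivector_val h _ _ hv]
    simp only [der_add, smoothC_add, mul_add, add_mul, Finset.sum_add_distrib]
  map_smul' c f := Derivation.ext fun g => smoothC_ext fun v => by
    have hv := (frameAt E L (base v)).mem
    rw [Derivation.smul_apply, smoothC_smul, bivector_val h _ _ hv, bivector_val h _ _ hv]
    simp only [derivation_const_smul, smoothC_smul, Finset.mul_sum, RingHom.id_apply]
    exact Finset.sum_congr rfl fun a _ => Finset.sum_congr rfl fun b _ => by ring

variable (h : IsBiderivation S)

theorem bivector_apply (f : SlitC E L) {x₀ : M} (F : LocFrame E L x₀)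
    {v : Slit L} (hv : base v ∈ F.U) (g : SlitC E L) :
    (bivector h f g).1 v =
      ∑ a, ∑ b, (tilde (brack S (F.lam a) (F.lam b))).1 v * (F.dd a f).1 v * (F.dd b g).1 v :=
  bivector_val h f F hv g

theorem bivector_skew (f g : SlitC E L) : bivector h f g = -bivector h g f :=
  smoothC_ext fun v => by
    have hv := (frameAt E L (base v)).mem
    rw [smoothC_neg, bivector_apply h _ _ hv, bivector_apply h _ _ hv, Finset.sum_comm,
      ← Finset.sum_neg_distrib]
    refine Finset.sum_congr rfl fun a _ => ?_
    rw [← Finset.sum_neg_distrib]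
    refine Finset.sum_congr rfl fun b _ => ?_
    rw [h.brack_skew, tilde_neg, smoothC_neg]
    ring

theorem bivector_tilde (f : SlitC E L) {s : Sec E L} {x₀ : M} (F : LocFrame E L x₀)
    {v : Slit L} (hv : base v ∈ F.U) (hs : ∀ a, (F.db a (tilde s)).1 v = 0) :
    (bivector h f (tilde s)).1 v = -(wField (S (j1 s)) f).1 v :=
  vfield_tilde (hG := isConsistent_bivector h f) (hG' := IsConsistent.zero) F hv hs

theorem bivector_type20 {W : Set (Slit L)} (hW : IsOpen W) {f : SlitC E L} (hf : IsHolSlit W f)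
    (g : SlitC E L) {v : Slit L} (hv : v ∈ W) : (bivector h (conjF f) g).1 v = 0 := by
  have hm := (frameAt E L (base v)).mem
  rw [bivector_apply h _ _ hm]
  have h1 := ((frameAt E L (base v)).hol_iff v hm f).1 ((hf v hv).mdifferentiableAt
    (hW.mem_nhds hv))
  refine Finset.sum_eq_zero fun a _ => Finset.sum_eq_zero fun b _ => ?_
  rw [LocFrame.dd_conj_eq, conjF_val, h1 a, map_zero, mul_zero, zero_mul]

end Poisson

/-- Coordinate vector fields commute. -/
theorem LocFrame.db_dd {x₀ : M} (F : LocFrame E L x₀) {v : Slit L} (hv : base v ∈ F.U)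
    (a c : Idx E) (f : SlitC E L) : (F.db c (F.dd a f)).1 v = (F.dd a (F.db c f)).1 v := by
  -- The commutator is a derivation, and it annihilates all coordinates and their conjugates because
  -- over `F.U` both fields have constant values on these.
  have key := F.pd_der hv ⁅F.db c, F.dd a⁆ f
  have hc : ∀ (X : Derivation ℂ (SlitC E L) (SlitC E L)) (g : SlitC E L) (z : ℂ),
      (∀ w, base w ∈ F.U → g.1 w = z) → (X g).1 v = 0 := fun X g z hg => by
    rw [derSlit_local X F.isOpen hv (g := algebraMap ℂ _ z) hg, X.map_algebraMap]; rfl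
  have e1 : ∀ b, (⁅F.db c, F.dd a⁆ (tilde (F.lam b))).1 v = 0 := fun b => by
    rw [Derivation.commutator_apply, smoothC_sub,
      hc _ _ _ fun w hw => F.dd_lam w hw a b, hc _ _ _ fun w hw => F.db_tilde_lam hw c b, sub_zero]
  have e2 : ∀ b, (⁅F.db c, F.dd a⁆ (conjF (tilde (F.lam b)))).1 v = 0 := fun b => by
    rw [Derivation.commutator_apply, smoothC_sub,
      hc _ _ _ fun w hw => F.dd_conj w hw a b,
      hc (F.dd a) _ (if c = b then 1 else 0) fun w hw => ?_, sub_zero]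
    rw [F.db_conj_eq, conjF_val, F.dd_lam w hw]
    split_ifs <;> simp
  simp only [e1, e2, zero_mul, add_zero, Finset.sum_const_zero] at key
  rw [Derivation.commutator_apply, smoothC_sub] at key
  exact sub_eq_zero.1 key

theorem LocFrame.dd_hol {x₀ : M} (F : LocFrame E L x₀) {v : Slit L} (hv : base v ∈ F.U)
    {W : Set (Slit L)} (hW : IsOpen W) (hvW : v ∈ W) {f : SlitC E L} (hf : IsHolSlit W f)
    (a c : Idx E) : (F.db c (F.dd a f)).1 v = 0 := by
  rw [F.db_dd hv, F.local_dd v _ 0 _ a]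
  · rw [der_zero]; rfl
  · filter_upwards [hW.mem_nhds hvW, (isOpen_base_preimage F.isOpen).mem_nhds hv] with w hw hwF
    exact (F.hol_iff w hwF f).1 ((hf w hw).mdifferentiableAt (hW.mem_nhds hw)) c

variable {J : JetL E L →ₗ[FunC E M] GaugeL E L}

/-- For holomorphy, the coefficients {λ_a, λ_b}~ are holomorphic because of ∂̄J = 0, and the fields
∂_a preserve holomorphic functions because they commute with the ∂̄_c. -/
theorem isPoissonization_bivector (hJ : IsHolJacobi J) :
    IsPoissonization J (bivector hJ.jacobi.1) where
  skew := bivector_skew _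
  type20 W hW f hf g v hv := bivector_type20 _ hW hf g hv
  hol W hW f g hf hg v hv := by
    have hm := (frameAt E L (base v)).mem
    set F := frameAt E L (base v)
    refine ((F.hol_iff v hm _).2 fun c => ?_).mdifferentiableWithinAt
    have e : (F.db c (bivector hJ.jacobi.1 f g)).1 v =
        (F.db c (∑ a, ∑ b, tilde (brack J (F.lam a) (F.lam b)) * F.dd a f * F.dd b g)).1 v :=
      derSlit_local _ F.isOpen hm fun w hw => by
        rw [bivector_apply _ _ F hw]
        simp only [smoothC_sum, smoothC_mul]
    have hs : ∀ (u : Idx E → SlitC E L), F.db c (∑ a, u a) = ∑ a, F.db c (u a) := fun u =>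
      map_sum (F.db c : SlitC E L →ₗ[ℂ] SlitC E L) _ _
    rw [e, hs, smoothC_sum]
    refine Finset.sum_eq_zero fun a _ => ?_
    rw [hs, smoothC_sum]
    refine Finset.sum_eq_zero fun b _ => ?_
    rw [der_mul_val, der_mul_val, F.dd_hol hm hW hv hf, F.dd_hol hm hW hv hg,
      F.hol_tilde F.isOpen hm hm ((isHolSec_iff F.isOpen).1
        (hJ.isHolSec_brack F.isOpen (F.isHolSec_lam a) (F.isHolSec_lam b)))]
    ring
  lift U hU s t hs ht v hv := by
    have hm := (frameAt E L (base v)).mem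
    set F := frameAt E L (base v)
    have h1 := fun a => F.hol_tilde hU hm hv ((isHolSec_iff hU).1 hs) a
    have h2 := fun a => F.hol_tilde hU hm hv ((isHolSec_iff hU).1 ht) a
    rw [bivector_skew, smoothC_neg, bivector_tilde _ _ F hm h1, neg_neg, wField_tilde _ F hm h2]
    rfl

/-- Type (2,0) fixes the values on conjugate coordinates and the lifting property those on the
coordinates; expanding in each argument separately gives all others. -/
theorem IsPoissonization.eq_bivector (hJ : IsHolJacobi J)
    {P : SlitC E L →ₗ[ℂ] Derivation ℂ (SlitC E L) (SlitC E L)} (hP : IsPoissonization J P) :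
    P = bivector hJ.jacobi.1 := by
  have hB := isPoissonization_bivector hJ
  have red : ∀ {P' : SlitC E L →ₗ[ℂ] Derivation ℂ (SlitC E L) (SlitC E L)},
      IsPoissonization J P' → ∀ {x₀ : M} (F : LocFrame E L x₀) {v : Slit L}, base v ∈ F.U →
      ∀ (a : Idx E) (f : SlitC E L), (P' f (conjF (tilde (F.lam a)))).1 v = 0 :=
    fun hP' x₀ F v hv a f => by
      rw [hP'.skew, smoothC_neg, hP'.type20 _ (isOpen_base_preimage F.isOpen) _
        ((isHolSec_iff F.isOpen).1 (F.isHolSec_lam a)) f v hv, neg_zero]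
  have step : ∀ (f : SlitC E L) {x₀ : M} (F : LocFrame E L x₀) {v : Slit L}, base v ∈ F.U →
      ∀ a, (P f (tilde (F.lam a))).1 v = (bivector hJ.jacobi.1 f (tilde (F.lam a))).1 v :=
    fun f x₀ F v hv a => by
      rw [hP.skew, hB.skew, smoothC_neg, smoothC_neg, F.pd_der hv, F.pd_der hv]
      simp only [red hP F hv, red hB F hv,
        hP.lift _ F.isOpen _ _ (F.isHolSec_lam a) (F.isHolSec_lam _) v hv,
        hB.lift _ F.isOpen _ _ (F.isHolSec_lam a) (F.isHolSec_lam _) v hv]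
  refine LinearMap.ext fun f => derSlit_ext fun x₀ F v hv a => ⟨step f F hv a, ?_⟩
  rw [red hP F hv, red hB F hv]

end HolJacobi

/-! ### The isomorphism Ψ between the pull-back of 𝔍¹L and 𝔍¹_ℝ ℓ -/

namespace HolJacobi

variable {E : Type*} [NormedAddCommGroup E] [NormedSpace ℂ E] [FiniteDimensional ℂ E]
  {M : Type*} [TopologicalSpace M] [T2Space M] [ChartedSpace E M] [IsManifold 𝓘(ℂ, E) ω M]
  {L : M → Type*} [TopologicalSpace (TotalSpace ℂ L)] [∀ x, AddCommGroup (L x)]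
  [∀ x, Module ℂ (L x)] [∀ x, TopologicalSpace (L x)] [FiberBundle ℂ L] [VectorBundle ℂ ℂ L]
  [ContMDiffVectorBundle ω ℂ L 𝓘(ℂ, E)]

theorem IsDbar.smul {δ : GaugeL E L} (hδ : IsDbar δ) (f : FunC E M) : IsDbar (f • δ) :=
  fun U hU s hs x hx => by
    change f.1 x • (op δ s).1 x = 0
    rw [hδ U hU s hs x hx, smul_zero]

theorem LocFrame.scF_q_mul {x₀ : M} (F : LocFrame E L x₀) {ζ : ℂˣ} {f : SlitC E L}
    (hf : scF ζ f = (ζ : ℂ) • f) : scF ζ (F.q * f) = F.q * f := by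
  rw [scF_mul, hf, mul_smul_comm, ← smul_mul_assoc, F.q_sc]

/-- Sections of the pull-back of `𝔍¹L` in terms of a local frame. -/
theorem tP_pullJet_eq (Θ : PullJet E L) {x₀ : M} (F : LocFrame E L x₀) {v : Slit L}
    (hv : base v ∈ F.U) (Δ : GaugeL E L) : (tP (Θ.1 Δ)).1 v =
      ∑ a, (tilde (op Δ (F.lam a))).1 v * (F.q.1 v * (tP (Θ.1 (F.der a))).1 v) := by
  obtain ⟨b, V, hV, hxV, -, hb, hbF⟩ := exists_bump (E := E) F.isOpen hv
  have hg : ∀ a, ∃ g : FunC E M, pb g = pb (ofRealF _ _ b) * (F.q * tilde (op Δ (F.lam a))) :=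
    fun a => exists_pb_eq _ fun ζ => by rw [scF_mul, scF_pb, F.scF_q_mul (scF_tilde ζ _)]
  choose g hg using hg
  -- After the cut-off, Δ and Σ_a q (Δλ_a)~ · `F.der a` agree on holomorphic sections. They differ
  -- by a ∂̄_ξ, which Θ annihilates.
  have hδ : IsDbar (ofRealF _ _ b • Δ - ∑ a, g a • F.der a) := by
    intro W hW s hs x hx
    have e : ∀ w : Slit L, (tilde (op (ofRealF _ _ b • Δ - ∑ a, g a • F.der a) s)).1 w =
        (b.1 (base w) : ℂ) * ((tilde (op Δ s)).1 w - ∑ a, F.q.1 w *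
          (tilde (op Δ (F.lam a))).1 w * ((tilde (F.lam none)).1 w * (F.dd a (tilde s)).1 w)) := by
      intro w
      have h1 : op (∑ a, g a • F.der a) s = ∑ a, g a • op (F.der a) s := by
        change j1 s (∑ a, g a • F.der a) = _
        rw [map_sum]; rfl
      have h2 : tilde (∑ a, g a • op (F.der a) s) = ∑ a, tilde (g a • op (F.der a) s) :=
        map_sum (⟨⟨tilde, tilde_zero⟩, tilde_add⟩ : Sec E L →+ SlitC E L) _ _
      rw [op_sub, tilde_sub, h1, h2, smoothC_sub, smoothC_sum, op_smul_left, tilde_smul,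
        smoothC_mul, mul_sub, Finset.mul_sum]
      congr 1
      refine Finset.sum_congr rfl fun a _ => ?_
      rw [tilde_smul, hg, F.tilde_op_der]
      simp only [smoothC_mul, pb_val, ofRealF_val]
      ring
    refine sec_eq_at (v := slitOver x) (t := 0) ?_
    rw [e, tilde_zero, smoothC_zero]
    by_cases hxF : x ∈ F.U
    · have hxF' : base (slitOver (L := L) x) ∈ F.U := hxF
      rw [tilde_op_eq Δ F hxF' (s := s) fun a => F.hol_tilde hW hxF' hx ((isHolSec_iff hW).1 hs) a,
        ← Finset.sum_sub_distrib]
      rw [Finset.sum_eq_zero fun a _ => ?_, mul_zero]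
      linear_combination (-(F.dd a (tilde s)).1 (slitOver x) *
        (tilde (op Δ (F.lam a))).1 (slitOver x)) * F.q_mul _ hxF'
    · have : b.1 (base (slitOver (L := L) x)) = 0 :=
        image_eq_zero_of_notMem_tsupport fun h => hxF (hbF h)
      rw [this, Complex.ofReal_zero, zero_mul]
  have h0 := Θ.2 _ hδ
  rw [map_sub, map_sum, sub_eq_zero] at h0
  have h1 := congrArg (fun s => (tP s).1 v) h0
  have h2 : ∀ u : Idx E → PullSec E L, tP (∑ a, u a) = ∑ a, tP (u a) := fun u =>
    map_sum (⟨⟨tP, tP_zero⟩, tP_add⟩ : PullSec E L →+ SlitC E L) _ _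
  simp only [h2, smoothC_sum, map_smul, tP_pb_smul, hg, smoothC_mul, pb_val, ofRealF_val,
    hb _ hxV, Complex.ofReal_one, one_mul] at h1
  rw [h1]
  exact Finset.sum_congr rfl fun a _ => by ring

section Phi

/-- A complex linear functional is determined by its real part. Prescribing η on the derivation
induced by Δ as the real part forces the imaginary part to be minus the value of η on the derivation
induced by iΔ. -/
theorem exists_phi (η : JetEll E L) (Δ : GaugeL E L) : ∃ s : PullSec E L, tP s =
    tE (η (hatDer Δ)) - Complex.I • tE (η (hatDer (cI E M • Δ))) :=
  exists_tP_eq _ fun r => smoothC_ext fun v => by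
    have h1 := congrArg (fun k : SlitC E L => k.1 v) (scF_tE r (η (hatDer Δ)))
    have h2 := congrArg (fun k : SlitC E L => k.1 v) (scF_tE r (η (hatDer (cI E M • Δ))))
    simp only [scF_val, smoothC_smul] at h1 h2
    rw [scF_val, smoothC_sub, smoothC_smul, h1, h2, smoothC_smul, smoothC_sub, smoothC_smul]
    ring

/-- The value of the inverse of the canonical isomorphism. -/
def phiFun (η : JetEll E L) (Δ : GaugeL E L) : PullSec E L := (exists_phi η Δ).choose

theorem tP_phiFun (η : JetEll E L) (Δ : GaugeL E L) : tP (phiFun η Δ) =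
    tE (η (hatDer Δ)) - Complex.I • tE (η (hatDer (cI E M • Δ))) := (exists_phi η Δ).choose_spec

theorem tP_phiFun_val (η : JetEll E L) (Δ : GaugeL E L) (v : Slit L) :
    (tP (phiFun η Δ)).1 v = (tE (η (hatDer Δ))).1 v -
      Complex.I * (tE (η (hatDer (cI E M • Δ)))).1 v := by
  rw [tP_phiFun]; rfl

theorem phiFun_add (η : JetEll E L) (Δ Δ' : GaugeL E L) :
    phiFun η (Δ + Δ') = phiFun η Δ + phiFun η Δ' := tP_injective (by
  rw [tP_add]
  simp only [tP_phiFun, smul_add, hatDer_add, map_add, tE_add]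
  abel)

theorem tE_hatDer_smul (η : JetEll E L) (f : FunC E M) (Δ : GaugeL E L) (v : Slit L) :
    (tE (η (hatDer (f • Δ)))).1 v = ((f.1 (base v)).re : ℂ) * (tE (η (hatDer Δ))).1 v +
      ((f.1 (base v)).im : ℂ) * (tE (η (hatDer (cI E M • Δ)))).1 v := by
  rw [hatDer_smulC, map_add, map_smul, map_smul, tE_add, tE_smul, tE_smul, hs_algebraMap,
    hs_algebraMap]
  rfl

theorem phiFun_smul (η : JetEll E L) (f : FunC E M) (Δ : GaugeL E L) :
    phiFun η (f • Δ) = f • phiFun η Δ := tP_injective (smoothC_ext fun v => by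
  rw [tP_pb_smul, smoothC_mul, tP_phiFun_val, tP_phiFun_val, smul_comm (cI E M) f Δ,
    tE_hatDer_smul η f Δ, tE_hatDer_smul η f (cI E M • Δ), cI_cI_smul, hatDer_neg, map_neg, tE_neg, smoothC_neg, pb_val]
  conv_rhs => rw [← Complex.re_add_im (f.1 (base v))]
  linear_combination ((f.1 (base v)).im : ℂ) * (tE (η (hatDer (cI E M • Δ)))).1 v *
    Complex.I_mul_I)

theorem phiFun_dbar (η : JetEll E L) {δ : GaugeL E L} (hδ : IsDbar δ) : phiFun η δ = 0 :=
  tP_injective (by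
    rw [tP_phiFun, hatDer_eq_zero hδ, hatDer_eq_zero (hδ.smul _), map_zero, tE_zero, smul_zero,
      sub_zero, tP_zero])

/-- The inverse of the canonical isomorphism between the pull-back of `𝔍¹L` and `𝔍¹_ℝ ℓ`. -/
def phi : JetEll E L →ₗ[HatR E L] PullJet E L where
  toFun η := ⟨⟨⟨phiFun η, phiFun_add η⟩, phiFun_smul η⟩, fun _ hδ => phiFun_dbar η hδ⟩
  map_add' η η' := Subtype.ext (LinearMap.ext fun Δ => tP_injective (by
    change tP (phiFun (η + η') Δ) = tP (phiFun η Δ + phiFun η' Δ)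
    rw [tP_add]
    simp only [tP_phiFun, LinearMap.add_apply, tE_add, smul_add]
    abel))
  map_smul' h η := Subtype.ext (LinearMap.ext fun Δ => tP_injective (by
    change tP (phiFun (h • η) Δ) = tP (h • phiFun η Δ)
    rw [tP_smul]
    simp only [tP_phiFun, LinearMap.smul_apply, tE_smul]
    rw [mul_sub, mul_smul_comm]))

theorem tP_phi (η : JetEll E L) (Δ : GaugeL E L) (v : Slit L) :
    (tP ((phi η).1 Δ)).1 v = (tE (η (hatDer Δ))).1 v -
      Complex.I * (tE (η (hatDer (cI E M • Δ)))).1 v := tP_phiFun_val η Δ v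

theorem opC_hatDer_cI (Δ : GaugeL E L) {x₀ : M} (F : LocFrame E L x₀) {v : Slit L}
    (hv : base v ∈ F.U) (a : Idx E) :
    (opC (hatDer (cI E M • Δ)) (F.lam a)).1 v = Complex.I * (tilde (op Δ (F.lam a))).1 v := by
  rw [opC_hatDer_lam _ F hv, op_smul_left, tilde_smul]
  rfl

theorem exists_re_im (f : SlitC E L) (hf : ∀ r, scF (ru r) f = f) : ∃ u w : HatR E L,
    ∀ v, (hs u).1 v = ((f.1 v).re : ℂ) ∧ (hs w).1 v = ((f.1 v).im : ℂ) := by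
  have h : ∀ r v, f.1 (sc (ru r) v) = f.1 v := fun r v =>
    congrArg (fun k : SlitC E L => k.1 v) (hf r)
  obtain ⟨u, hu⟩ := exists_hs_eq (ofRealF _ _ (reF f)) (conjF_ofRealF _) fun r =>
    smoothC_ext fun v => by
      change ((f.1 (sc (ru r) v)).re : ℂ) = ((f.1 v).re : ℂ)
      rw [h]
  obtain ⟨w, hw⟩ := exists_hs_eq (ofRealF _ _ (imF f)) (conjF_ofRealF _) fun r =>
    smoothC_ext fun v => by
      change ((f.1 (sc (ru r) v)).im : ℂ) = ((f.1 v).im : ℂ)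
      rw [h]
  exact ⟨u, w, fun v => ⟨by rw [hu]; rfl, by rw [hw]; rfl⟩⟩

/-- A jet of `ℓ` is determined by its values on the derivations induced by derivations of `L`. -/
theorem tE_jet_eq (η : JetEll E L) {x₀ : M} (F : LocFrame E L x₀) {v : Slit L}
    (hv : base v ∈ F.U) (D : GaugeEll E L) : (tE (η D)).1 v =
      ((∑ a, (opC D (F.lam a)).1 v * (F.q.1 v * (tP ((phi η).1 (F.der a))).1 v)).re : ℂ) := by
  obtain ⟨b, V, hV, hxV, -, hb, hbF⟩ := exists_bump (E := E) F.isOpen hv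
  have hg := fun a => exists_re_im (pb (ofRealF _ _ b) * (F.q * opC D (F.lam a))) fun r => by
    rw [scF_mul, scF_pb, F.scF_q_mul (scF_opC r D _)]
  choose u w huw using hg
  -- Locally the derivations induced by `F.der a` and by i times it span D_ℝ ℓ over C^∞(M̂). Both
  -- sides are compared through their values on λ̃_c, where the field of `F.der a` is `tilde (F.lam
  -- none)` for a = c and zero otherwise; multiplication by q undoes this factor.
  have hD : algebraMap (FunR E M) (HatR E L) b • D =
      ∑ a, (u a • hatDer (F.der a) + w a • hatDer (cI E M • F.der a)) := by
    refine gaugeFaithful_ell _ _ fun t => tE_injective (smoothC_ext fun z => ?_)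
    have hz : ∀ s : Sec E L,
        (opC (∑ a, (u a • hatDer (F.der a) + w a • hatDer (cI E M • F.der a))) s).1 z =
        ∑ a, ((((b.1 (base z) : ℂ) * (F.q.1 z * (opC D (F.lam a)).1 z)).re : ℂ) *
            (opC (hatDer (F.der a)) s).1 z +
          (((b.1 (base z) : ℂ) * (F.q.1 z * (opC D (F.lam a)).1 z)).im : ℂ) *
            (opC (hatDer (cI E M • F.der a)) s).1 z) := fun s => by
      rw [opC_sum, smoothC_sum]
      refine Finset.sum_congr rfl fun a _ => ?_
      rw [opC_add, opC_smul, opC_smul, smoothC_add, smoothC_mul, smoothC_mul, (huw a z).1,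
        (huw a z).2]
      rfl
    by_cases hzF : base z ∈ F.U
    · refine tE_op_congr _ _ F hzF (fun c => ?_) t
      rw [hz, opC_smul, smoothC_mul, hs_algebraMap, pb_val, ofRealF_val]
      simp only [opC_hatDer_cI _ F hzF, opC_hatDer_lam _ F hzF, F.tilde_op_der, smoothC_mul,
        F.dd_lam z hzF]
      rw [Finset.sum_eq_single c (fun a _ ha => by simp [ha]) (by simp)]
      rw [if_pos rfl]
      have e := Complex.re_add_im ((b.1 (base z) : ℂ) * (F.q.1 z * (opC D (F.lam c)).1 z))
      have e2 := F.q_mul z hzF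
      linear_combination (-(tilde (F.lam none)).1 z) * e -
        (b.1 (base z) : ℂ) * (opC D (F.lam c)).1 z * e2
    · have hb0 : b.1 (base z) = 0 := image_eq_zero_of_notMem_tsupport fun h => hzF (hbF h)
      refine tE_op_congr _ _ (frameAt E L (base z)) (frameAt E L (base z)).mem (fun c => ?_) t
      rw [hz, opC_smul, smoothC_mul, hs_algebraMap, pb_val, ofRealF_val, hb0]
      simp
  have h1 := congrArg (fun D => (tE (η D)).1 v) hD
  have h2 : ∀ u : Idx E → SecEll E L, tE (∑ a, u a) = ∑ a, tE (u a) := fun u =>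
    map_sum (⟨⟨tE, tE_zero⟩, tE_add⟩ : SecEll E L →+ SlitC E L) _ _
  have h3 : (hs (algebraMap (FunR E M) (HatR E L) b)).1 v = 1 := by
    rw [hs_algebraMap, pb_val, ofRealF_val, hb _ hxV, Complex.ofReal_one]
  simp only [map_sum, map_add, map_smul, h2, smoothC_sum, tE_add, tE_smul, smoothC_add,
    smoothC_mul, h3, one_mul] at h1
  rw [h1, Complex.re_sum, Complex.ofReal_sum]
  refine Finset.sum_congr rfl fun a _ => ?_
  rw [(huw a v).1, (huw a v).2, tP_phi, smoothC_mul, smoothC_mul, pb_val, ofRealF_val, hb _ hxV,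
    Complex.ofReal_one, one_mul, tE_re (η (hatDer (F.der a))),
    tE_re (η (hatDer (cI E M • F.der a)))]
  apply Complex.ext
  · simp; ring
  · simp

theorem phi_injective : Function.Injective (phi (E := E) (L := L)) := by
  refine (injective_iff_map_eq_zero _).2 fun η h => LinearMap.ext fun D => tE_injective
    (smoothC_ext fun v => ?_)
  rw [tE_jet_eq η (frameAt E L (base v)) (frameAt E L (base v)).mem, h, LinearMap.zero_apply,
    tE_zero, smoothC_zero]
  change ((∑ a, _ * (_ * (tP (0 : PullSec E L)).1 v)).re : ℂ) = 0
  simp [tP_zero]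

/-- The pairing of a section of the pull-back of `𝔍¹L` with a derivation of `ℓ` in a frame. -/
def LocFrame.pair {x₀ : M} (F : LocFrame E L x₀) (Θ : PullJet E L) (D : GaugeEll E L) :
    SlitC E L := ∑ a, opC D (F.lam a) * (F.q * tP (Θ.1 (F.der a)))

theorem LocFrame.pair_val {x₀ : M} (F : LocFrame E L x₀) (Θ : PullJet E L) (D : GaugeEll E L)
    (v : Slit L) : (F.pair Θ D).1 v =
      ∑ a, (opC D (F.lam a)).1 v * (F.q.1 v * (tP (Θ.1 (F.der a))).1 v) := by
  rw [LocFrame.pair, smoothC_sum]; rfl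

theorem LocFrame.pair_eq {x₀ x₁ : M} (F : LocFrame E L x₀) (F' : LocFrame E L x₁) {v : Slit L}
    (hv : base v ∈ F.U) (hv' : base v ∈ F'.U) (Θ : PullJet E L) (D : GaugeEll E L) :
    (F.pair Θ D).1 v = (F'.pair Θ D).1 v := by
  rw [F.pair_val, F'.pair_val]
  simp only [tP_pullJet_eq Θ F hv (F'.der _), F'.tilde_op_der, smoothC_mul]
  simp only [isConsistent_opC D x₁ F' v hv' _ fun b => F.db_lam' F' hv hv' _ b, Finset.mul_sum,
    Finset.sum_mul]
  rw [Finset.sum_comm]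
  refine Finset.sum_congr rfl fun b _ => Finset.sum_congr rfl fun a _ => ?_
  linear_combination (-(F'.dd b (tilde (F.lam a))).1 v * (opC D (F'.lam b)).1 v * F.q.1 v *
    (tP (Θ.1 (F.der a))).1 v) * F'.q_mul v hv'

theorem exists_pair (Θ : PullJet E L) (D : GaugeEll E L) : ∃ s : SecEll E L,
    ∀ v, (tE s).1 v = ((((frameAt E L (base v)).pair Θ D).1 v).re : ℂ) := by
  have hsm : (fun v => ((((frameAt E L (base v)).pair Θ D).1 v).re : ℂ)) ∈ slitC E L := by
    intro v₀
    set F := frameAt E L (base v₀)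
    have hm : base v₀ ∈ F.U := (frameAt E L (base v₀)).mem
    refine ((ofRealF _ _ (reF (F.pair Θ D))).2 v₀).congr_of_eventuallyEq ?_
    filter_upwards [(isOpen_base_preimage F.isOpen).mem_nhds hm] with v hv
    rw [LocFrame.pair_eq _ F (frameAt E L (base v)).mem hv]
    rfl
  obtain ⟨s, hs⟩ := exists_tE_eq ⟨_, hsm⟩ (smoothC_ext fun v => Complex.conj_ofReal _) fun r =>
    smoothC_ext fun v => by
      have h : scF (ru r) ((frameAt E L (base v)).pair Θ D) =
          ((r : ℝ) : ℂ) • (frameAt E L (base v)).pair Θ D := by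
        refine smoothC_ext fun w => ?_
        rw [scF_val, smoothC_smul, LocFrame.pair_val, LocFrame.pair_val, Finset.mul_sum]
        refine Finset.sum_congr rfl fun a _ => ?_
        have h1 := congrArg (fun k : SlitC E L => k.1 w) (scF_opC r D ((frameAt E L (base v)).lam a))
        have h2 := congrArg (fun k : SlitC E L => k.1 w) ((frameAt E L (base v)).scF_q_mul
          (scF_tP r (Θ.1 ((frameAt E L (base v)).der a))))
        simp only [scF_val, smoothC_smul, smoothC_mul, ru_val] at h1 h2
        rw [h1, h2, mul_assoc]
      have h1 := congrArg (fun k : SlitC E L => k.1 v) h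
      change ((((frameAt E L (base v)).pair Θ D).1 (sc (ru r) v)).re : ℂ) =
        ((r : ℝ) : ℂ) * ((((frameAt E L (base v)).pair Θ D).1 v).re : ℂ)
      simp only [scF_val, smoothC_smul] at h1
      rw [h1, Complex.re_ofReal_mul, Complex.ofReal_mul]
  exact ⟨s, fun v => congrArg (fun k : SlitC E L => k.1 v) hs⟩

/-- The value of the canonical isomorphism. -/
def psiFun (Θ : PullJet E L) (D : GaugeEll E L) : SecEll E L := (exists_pair Θ D).choose

theorem tE_psiFun (Θ : PullJet E L) (D : GaugeEll E L) {x₀ : M} (F : LocFrame E L x₀)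
    {v : Slit L} (hv : base v ∈ F.U) : (tE (psiFun Θ D)).1 v =
      ((∑ a, (opC D (F.lam a)).1 v * (F.q.1 v * (tP (Θ.1 (F.der a))).1 v)).re : ℂ) := by
  rw [psiFun, (exists_pair Θ D).choose_spec v, LocFrame.pair_eq _ F (frameAt E L (base v)).mem hv,
    LocFrame.pair_val]

/-- The formula that reconstructs a jet of ℓ from its image is taken as a definition. It does not
depend on the frame, and applying `phi` returns the expansion of Θ in the frame. -/
theorem phi_surjective : Function.Surjective (phi (E := E) (L := L)) := fun Θ => by
  let η : JetEll E L :=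
    { toFun := psiFun Θ
      map_add' := fun D D' => tE_injective (smoothC_ext fun v => by
        have hv := (frameAt E L (base v)).mem
        rw [tE_add, smoothC_add, tE_psiFun Θ _ _ hv, tE_psiFun Θ _ _ hv, tE_psiFun Θ _ _ hv]
        simp only [opC_add, smoothC_add, add_mul, Finset.sum_add_distrib, Complex.add_re,
          Complex.ofReal_add])
      map_smul' := fun h D => tE_injective (smoothC_ext fun v => by
        have hv := (frameAt E L (base v)).mem
        rw [RingHom.id_apply, tE_smul, smoothC_mul, tE_psiFun Θ _ _ hv, tE_psiFun Θ _ _ hv]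
        simp only [opC_smul, smoothC_mul, mul_assoc]
        rw [← Finset.mul_sum _ _ ((hs h).1 v), hs_val, Complex.re_ofReal_mul,
          Complex.ofReal_mul]) }
  refine ⟨η, Subtype.ext (LinearMap.ext fun Δ => tP_injective (smoothC_ext fun v => ?_))⟩
  have hv := (frameAt E L (base v)).mem
  set F := frameAt E L (base v)
  rw [tP_phi]
  change (tE (psiFun Θ _)).1 v - Complex.I * (tE (psiFun Θ _)).1 v = _
  rw [tE_psiFun Θ _ F hv, tE_psiFun Θ _ F hv]
  simp only [opC_hatDer_cI _ F hv, opC_hatDer_lam _ F hv, mul_assoc]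
  rw [← Finset.mul_sum _ _ Complex.I, ← tP_pullJet_eq Θ F hv, Complex.I_mul_re]
  conv_rhs => rw [← Complex.re_add_im ((tP (Θ.1 Δ)).1 v)]
  push_cast
  ring

variable (E L) in
/-- The canonical isomorphism between the pull-back of `𝔍¹L` and `𝔍¹_ℝ ℓ`. -/
def psi : PullJet E L ≃ₗ[HatR E L] JetEll E L :=
  (LinearEquiv.ofBijective phi ⟨phi_injective, phi_surjective⟩).symm

theorem phi_psi (Θ : PullJet E L) : phi (psi E L Θ) = Θ :=
  (LinearEquiv.ofBijective phi ⟨phi_injective, phi_surjective⟩).apply_symm_apply Θ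

theorem tE_psi (Θ : PullJet E L) {x₀ : M} (F : LocFrame E L x₀) {v : Slit L}
    (hv : base v ∈ F.U) (D : GaugeEll E L) : (tE (psi E L Θ D)).1 v =
      ((∑ a, (opC D (F.lam a)).1 v * (F.q.1 v * (tP (Θ.1 (F.der a))).1 v)).re : ℂ) := by
  rw [tE_jet_eq _ F hv, phi_psi]

theorem tE_psi_hatDer (Θ : PullJet E L) (Δ : GaugeL E L) (v : Slit L) :
    (tE (psi E L Θ (hatDer Δ))).1 v = (((tP (Θ.1 Δ)).1 v).re : ℂ) := by
  have hv := (frameAt E L (base v)).mem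
  rw [tE_psi Θ _ hv, tP_pullJet_eq Θ _ hv]
  simp only [opC_hatDer_lam _ _ hv]

theorem tP_pullJet (θ : HolJet E L) (Δ : GaugeL E L) :
    tP ((pullJet θ).1 Δ) = tilde (θ.1 Δ) := rfl

theorem tE_hatSec_val (s : Sec E L) (v : Slit L) :
    (tE (hatSec s)).1 v = (((tilde s).1 v).re : ℂ) := rfl

theorem psi_pullJet_hatDer (θ : HolJet E L) (Δ : GaugeL E L) :
    psi E L (pullJet θ) (hatDer Δ) = hatSec (θ.1 Δ) := tE_injective (smoothC_ext fun v => by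
  rw [tE_psi_hatDer, tE_hatSec_val, tP_pullJet])

/-- Jets of `ℓ` that agree on all derivations induced by derivations of `L` are equal. -/
theorem jetEll_ext {η η' : JetEll E L} (h : ∀ Δ : GaugeL E L, η (hatDer Δ) = η' (hatDer Δ)) :
    η = η' := phi_injective (Subtype.ext (LinearMap.ext fun Δ => tP_injective
  (smoothC_ext fun v => by rw [tP_phi, tP_phi, h, h])))

theorem LocFrame.dd_tE_hatSec {x₀ : M} (F : LocFrame E L x₀) {v : Slit L} {s : Sec E L}
    (hs : ∀ a, (F.db a (tilde s)).1 v = 0) (a : Idx E) :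
    (F.dd a (tE (hatSec s))).1 v = 1 / 2 * (F.dd a (tilde s)).1 v := by
  rw [tE_hatSec, derivation_const_smul, der_add, F.dd_conj_eq, smoothC_smul, smoothC_add, conjF_val,
    hs a, map_zero, add_zero]

/-- Both sides are the real part of Σ_a (D λ_a) ∂_a s̃: the 2 from applying a real field to a real
function cancels the ½ in ∂ Re s̃ = ½ ∂s̃. -/
theorem isCanonical_psi : IsCanonical (psi E L) := by
  intro U hU s hs θ hθ D y hy
  obtain ⟨v, rfl⟩ := exists_toHat y
  have hv := (frameAt E L (base v)).mem
  set F := frameAt E L (base v)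
  refine ell_eq_at ?_
  rw [tE_psi _ F hv, tE_op_eq_re _ F hv, Finset.mul_sum]
  congr 2
  refine Finset.sum_congr rfl fun a _ => ?_
  rw [F.dd_tE_hatSec (fun a => F.hol_tilde hU hv hy ((isHolSec_iff hU).1 hs) a), tP_pullJet,
    tilde_eq_at (hθ _ _ hy), F.tilde_op_der, smoothC_mul]
  linear_combination ((opC D (F.lam a)).1 v * (F.dd a (tilde s)).1 v) * F.q_mul v hv

end Phi

end HolJacobi

/-! ### The Jacobi structure 4 Re Π on ℓ -/

namespace HolJacobi

variable {E : Type*} [NormedAddCommGroup E] [NormedSpace ℂ E] [FiniteDimensional ℂ E]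
  {M : Type*} [TopologicalSpace M] [T2Space M] [ChartedSpace E M] [IsManifold 𝓘(ℂ, E) ω M]
  {L : M → Type*} [TopologicalSpace (TotalSpace ℂ L)] [∀ x, AddCommGroup (L x)]
  [∀ x, Module ℂ (L x)] [∀ x, TopologicalSpace (L x)] [FiberBundle ℂ L] [VectorBundle ℂ ℂ L]
  [ContMDiffVectorBundle ω ℂ L 𝓘(ℂ, E)]

/-- The function of s is real, so a real field acts on it by twice the real part of its (1,0)-part.
This is one of the two factors 2 that make up the 4 in the theorem. -/
theorem tP_phi_j1 (s : SecEll E L) (Δ : GaugeL E L) {x₀ : M} (F : LocFrame E L x₀) {v : Slit L}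
    (hv : base v ∈ F.U) : (tP ((phi (j1 s)).1 Δ)).1 v =
      2 * ∑ a, (F.dd a (tE s)).1 v * (tilde (op Δ (F.lam a))).1 v := by
  rw [tP_phi, j1_apply, j1_apply, tE_op_eq_re _ F hv, tE_op_eq_re _ F hv]
  simp only [opC_hatDer_cI _ F hv, opC_hatDer_lam _ F hv, mul_left_comm _ Complex.I]
  rw [← Finset.mul_sum _ _ Complex.I, mul_left_comm, Complex.I_mul_re]
  conv_rhs => rw [← Complex.re_add_im (2 * _)]
  push_cast
  ring

section Sharp

variable {S : JetL E L →ₗ[FunC E M] GaugeL E L}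

theorem isConsistent_sharp (h : IsBiderivation S) (Θ : PullJet E L) :
    IsConsistent fun s => -tP (Θ.1 (S (j1 s))) := fun x₀ F v hv s hs => by
  simp only [smoothC_neg, tP_pullJet_eq Θ F hv (S _), tilde_op_sharp_lam h F hv hs, Finset.sum_mul,
    mul_neg, Finset.sum_neg_distrib, Finset.mul_sum]
  rw [Finset.sum_comm]
  simp only [brack, mul_assoc]

theorem exists_sharpEll (h : IsBiderivation S) (η : JetEll E L) : ∃ D : GaugeEll E L,
    ∀ t, tE (op D t) = vfield _ _ (isConsistent_sharp h (phi η)) (isConsistent_sharp h (phi η))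
      (tE t) := by
  have hsc : ∀ (r : ℝˣ) (s : Sec E L), scF (ru r) (-tP ((phi η).1 (S (j1 s)))) =
      ((ru r : ℂˣ) : ℂ) • -tP ((phi η).1 (S (j1 s))) := fun r s => smoothC_ext fun v => by
    have := congrArg (fun k : SlitC E L => k.1 v) (scF_tP r ((phi η).1 (S (j1 s))))
    simp only [scF_val, smoothC_smul] at this
    rw [scF_val, smoothC_neg, this, smoothC_smul, smoothC_neg, ru_val, mul_neg]
  obtain ⟨D, hD, -⟩ := exists_descG (vfield _ _ (isConsistent_sharp h (phi η))
    (isConsistent_sharp h (phi η))) (conjF_vfield _) fun r f => scF_vfield (hsc r) (hsc r) f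
  exact ⟨D, hD⟩

theorem opC_sharp_choose (h : IsBiderivation S) (η : JetEll E L) {x₀ : M}
    (F : LocFrame E L x₀) {v : Slit L} (hv : base v ∈ F.U) (a : Idx E) :
    (opC (exists_sharpEll h η).choose (F.lam a)).1 v =
      -(tP ((phi η).1 (S (j1 (F.lam a))))).1 v := by
  rw [opC_eq (exists_sharpEll h η).choose_spec, vfield_lam F hv, smoothC_neg]

/-- The bi-derivation of `ℓ` corresponding to four times the real part of the bi-vector on `M̃`
determined by a complex bi-derivation of `L`, as a sharp map. -/
def sharpEll (h : IsBiderivation S) : JetEll E L →ₗ[HatR E L] GaugeEll E L where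
  toFun η := (exists_sharpEll h η).choose
  map_add' η η' := gaugeEll_ext fun x₀ F v hv a => by
    rw [opC_add, smoothC_add, opC_sharp_choose h _ F hv, opC_sharp_choose h _ F hv,
      opC_sharp_choose h _ F hv, map_add]
    change -(tP ((phi η).1 _ + (phi η').1 _)).1 v = _
    rw [tP_add, smoothC_add, neg_add]
  map_smul' f η := gaugeEll_ext fun x₀ F v hv a => by
    rw [RingHom.id_apply, opC_smul, smoothC_mul, opC_sharp_choose h _ F hv,
      opC_sharp_choose h _ F hv, map_smul]
    change -(tP (f • (phi η).1 _)).1 v = _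
    rw [tP_smul, smoothC_mul, mul_neg]

variable (h : IsBiderivation S)

theorem opC_sharpEll (η : JetEll E L) {x₀ : M} (F : LocFrame E L x₀) {v : Slit L}
    (hv : base v ∈ F.U) (a : Idx E) : (opC (sharpEll h η) (F.lam a)).1 v =
      -(tP ((phi η).1 (S (j1 (F.lam a))))).1 v := opC_sharp_choose h η F hv a

theorem tilde_op_sharp_skew (h : IsBiderivation S) (s t : Sec E L) (v : Slit L) :
    (tilde (op (S (j1 s)) t)).1 v = -(tilde (op (S (j1 t)) s)).1 v := by
  have : op (S (j1 s)) t = -op (S (j1 t)) s := h.brack_skew s t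
  rw [this, tilde_neg, smoothC_neg]

/-- Each side is a double sum over the frame with coefficients {λ_a, λ_b}~, which are skew. -/
theorem isBiderivation_sharpEll : IsBiderivation (sharpEll h) := fun η τ =>
  tE_injective (smoothC_ext fun v => by
    have hv := (frameAt E L (base v)).mem
    rw [tE_neg, smoothC_neg, tE_jet_eq τ _ hv, tE_jet_eq η _ hv]
    simp only [opC_sharpEll h _ _ hv, tP_pullJet_eq _ _ hv (S _)]
    rw [← Complex.ofReal_neg, ← Complex.neg_re]
    congr 2
    simp only [neg_mul, Finset.sum_neg_distrib, Finset.sum_mul, neg_neg]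
    rw [Finset.sum_comm, ← Finset.sum_neg_distrib]
    refine Finset.sum_congr rfl fun a _ => ?_
    rw [← Finset.sum_neg_distrib]
    refine Finset.sum_congr rfl fun b _ => ?_
    rw [tilde_op_sharp_skew h]
    ring)

/-- On λ̃_a both derivations have the value −⟨θ, J♯ j¹λ_a⟩, by skewness of J. Consequently the
anchor of the jet algebroid of ℓ on pulled-back jets is the field induced by ∇_θ. -/
theorem sharpEll_psi_pullJet (θ : HolJet E L) :
    sharpEll h (psi E L (pullJet θ)) = hatDer (S θ.1) :=
  gaugeEll_ext fun x₀ F v hv a => by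
    have e : op (S θ.1) (F.lam a) = -θ.1 (S (j1 (F.lam a))) := h.op_eq _ _
    rw [opC_sharpEll h _ F hv, phi_psi, opC_hatDer_lam _ F hv, e, tilde_neg, smoothC_neg,
      tP_pullJet]

/-- The bracket of `sharpEll` is four times the real part of the bi-vector. -/
theorem tE_brack_sharpEll (s t : SecEll E L) (v : Slit L) :
    (tE (brack (sharpEll h) s t)).1 v = ((4 * (bivector h (tE s) (tE t)).1 v).re : ℂ) := by
  have hv := (frameAt E L (base v)).mem
  set F := frameAt E L (base v)
  rw [brack, tE_op_eq_re _ F hv, bivector_apply h _ F hv]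
  congr 2
  simp only [opC_sharpEll h _ F hv, tP_phi_j1 _ _ F hv, Finset.mul_sum, mul_neg]
  rw [Finset.sum_comm]
  refine Finset.sum_congr rfl fun a _ => ?_
  rw [← Finset.sum_neg_distrib]
  refine Finset.sum_congr rfl fun b _ => ?_
  rw [tilde_op_sharp_skew h, brack]
  ring

/-- Each argument contributes ∂ Re s̃ = ½ ∂s̃, and the factor 4 restores the product. This
normalization makes λ ↦ λ̂ preserve brackets of holomorphic sections. -/
theorem tE_brack_hatSec {s t : Sec E L} {x₀ : M} (F : LocFrame E L x₀) {v : Slit L}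
    (hv : base v ∈ F.U) (hs : ∀ a, (F.db a (tilde s)).1 v = 0)
    (ht : ∀ a, (F.db a (tilde t)).1 v = 0) :
    (tE (brack (sharpEll h) (hatSec s) (hatSec t))).1 v = (tE (hatSec (brack S s t))).1 v := by
  rw [tE_brack_sharpEll, bivector_apply h _ F hv, tE_hatSec_val, brack,
    tilde_op_sharp_lam h F hv hs]
  congr 2
  rw [Finset.mul_sum]
  refine Finset.sum_congr rfl fun a _ => ?_
  have : (tilde (brack S (F.lam a) t)).1 v =
      ∑ b, (F.dd b (tilde t)).1 v * (tilde (op (S (j1 (F.lam a))) (F.lam b))).1 v :=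
    tilde_op_eq _ F hv ht
  rw [this, Finset.mul_sum, Finset.mul_sum]
  refine Finset.sum_congr rfl fun b _ => ?_
  rw [F.dd_tE_hatSec hs, F.dd_tE_hatSec ht, brack]
  ring

end Sharp

theorem isHolSec_I_smul {U : Set M} (hU : IsOpen U) {s : Sec E L} (hs : IsHolSec U s) :
    IsHolSec U (Complex.I • s) := isHolSec_of_dbar hU fun δ hδ x hx => by
  have := hδ U hU s hs x hx
  rw [map_smul, ← cI_smul]
  change (cI E M).1 x • (op δ s).1 x = 0
  rw [this, smul_zero]

theorem hatSec_add (s t : Sec E L) : hatSec (s + t) = hatSec s + hatSec t :=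
  tE_injective (smoothC_ext fun v => by
    rw [tE_add, smoothC_add, tE_hatSec_val, tE_hatSec_val, tE_hatSec_val, tilde_add, smoothC_add,
      Complex.add_re, Complex.ofReal_add])

theorem hatSec_zero : hatSec (0 : Sec E L) = 0 := tE_injective (smoothC_ext fun v => by
  rw [tE_hatSec_val, tilde_zero, tE_zero]; simp)

/-- The failure of the Jacobi identity of a bi-derivation is a derivation in the last argument. -/
theorem IsBiderivation.jacobiator {k A Γ : Type*} [CommRing k] [CommRing A] [Algebra k A]
    [AddCommGroup Γ] [Module k Γ] [Module A Γ] [IsScalarTower k A Γ]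
    {S : Jet k A Γ →ₗ[A] Gauge k A Γ} (h : IsBiderivation S) (r s t : Γ) :
    brack S r (brack S s t) + brack S s (brack S t r) + brack S t (brack S r s) =
      op (comm (S (j1 r)) (S (j1 s)) - S (j1 (brack S r s))) t := by
  have e1 : brack S s (brack S t r) = -brack S s (brack S r t) := by
    rw [h.brack_skew t r]; exact map_neg _ _
  rw [e1, h.brack_skew t (brack S r s), op_sub, op_comm]
  simp only [brack]
  abel

variable {J : JetL E L →ₗ[FunC E M] GaugeL E L}

/-- The bi-derivation of `ℓ` determined by a holomorphic Jacobi structure is Jacobi. -/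
theorem isJacobi_sharpEll (hJ : IsHolJacobi J) : IsJacobi (sharpEll hJ.jacobi.1) := by
  have hB := isBiderivation_sharpEll hJ.jacobi.1
  refine ⟨hB, fun r s t => tE_injective (smoothC_ext fun v => ?_)⟩
  rw [tE_zero, smoothC_zero]
  have hv := (frameAt E L (base v)).mem
  set F := frameAt E L (base v)
  set K := sharpEll hJ.jacobi.1
  let Jac : SecEll E L → SecEll E L → SecEll E L → ℂ := fun r s t =>
    (tE (brack K r (brack K s t) + brack K s (brack K t r) + brack K t (brack K r s))).1 v
  have cyc : ∀ r s t, Jac r s t = Jac s t r := fun r s t => by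
    change (tE _).1 v = (tE _).1 v
    rw [add_rotate]
  -- In its last argument the Jacobiator is a derivation of ℓ, and a derivation vanishes at v once
  -- it does so on the sections of ℓ given by the coordinate sections and by i times them. Cyclic
  -- symmetry brings every argument into last position in turn.
  have red : ∀ r s, (∀ t : Sec E L, IsHolSec F.U t → Jac r s (hatSec t) = 0) →
      ∀ t, Jac r s t = 0 := fun r s H t => by
    change (tE _).1 v = 0
    rw [hB.jacobiator, tE_op_congr _ 0 F hv (fun a => ?_), op_zero, tE_zero, smoothC_zero]
    have h1 := H _ (F.isHolSec_lam a)
    have h2 := H _ (isHolSec_I_smul F.isOpen (F.isHolSec_lam a))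
    change (tE _).1 v = 0 at h1 h2
    rw [hB.jacobiator] at h1 h2
    rw [opC_val, h1, h2, opC_zero, smoothC_zero, mul_zero, sub_zero]
  have hol : ∀ {s : Sec E L}, IsHolSec F.U s → ∀ {w : Slit L}, base w ∈ F.U → ∀ a,
      (F.db a (tilde s)).1 w = 0 := fun hs w hw a =>
    F.hol_tilde F.isOpen hw hw ((isHolSec_iff F.isOpen).1 hs) a
  have br : ∀ {r s t : Sec E L}, IsHolSec F.U r → IsHolSec F.U s → IsHolSec F.U t →
      (tE (brack K (hatSec r) (brack K (hatSec s) (hatSec t)))).1 v =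
        (tE (hatSec (brack J r (brack J s t)))).1 v := fun hr hs ht => by
    rw [brack, opE_local _ F.isOpen hv fun w hw =>
      tE_brack_hatSec hJ.jacobi.1 F hw (hol hs hw) (hol ht hw)]
    exact tE_brack_hatSec hJ.jacobi.1 F hv (hol hr hv)
      (hol (hJ.isHolSec_brack F.isOpen hs ht) hv)
  have J3 : ∀ {r s t : Sec E L}, IsHolSec F.U r → IsHolSec F.U s → IsHolSec F.U t →
      Jac (hatSec r) (hatSec s) (hatSec t) = 0 := fun {r s t} hr hs ht => by
    change (tE _).1 v = 0
    rw [tE_add, tE_add, smoothC_add, smoothC_add, br hr hs ht, br hs ht hr, br ht hr hs,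
      ← smoothC_add, ← smoothC_add, ← tE_add, ← tE_add, ← hatSec_add, ← hatSec_add,
      hJ.jacobi.2, hatSec_zero, tE_zero, smoothC_zero]
  have J2 : ∀ {r s : Sec E L}, IsHolSec F.U r → IsHolSec F.U s → ∀ t,
      Jac (hatSec r) (hatSec s) t = 0 := fun hr hs => red _ _ fun _ ht => J3 hr hs ht
  have J1 : ∀ {r : Sec E L}, IsHolSec F.U r → ∀ s t, Jac (hatSec r) s t = 0 := fun hr s t => by
    rw [cyc, cyc]
    exact red _ _ (fun u hu => by rw [cyc]; exact J2 hr hu t) s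
  exact red _ _ (fun u hu => by rw [cyc, cyc]; exact J1 hu r s) t

/-- Multiplication of a holomorphic Jacobi structure with the imaginary unit. -/
theorem IsHolJacobi.I_smul (hJ : IsHolJacobi J) : IsHolJacobi (cI E M • J) where
  jacobi := by
    refine ⟨fun θ τ => ?_, fun r s t => ?_⟩
    · rw [LinearMap.smul_apply, LinearMap.smul_apply, map_smul, map_smul, hJ.jacobi.1, smul_neg]
    · have e : ∀ r s t : Sec E L, brack (cI E M • J) r (brack (cI E M • J) s t) =
          -brack J r (brack J s t) := fun r s t => by
        change cI E M • op (J (j1 r)) (Complex.I • brack J s t) = _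
        rw [map_smul, ← cI_smul, cI_cI_smul]
        rfl
      rw [e, e, e, ← neg_add, ← neg_add, hJ.jacobi.2, neg_zero]
  type20 θ U hU f hf x hx := by
    change (cI E M).1 x * (symbol (J θ) (conjF f)).1 x = 0
    rw [hJ.type20 θ U hU f hf x hx, mul_zero]
  dbar δ hδ θ hθ τ hτ := by
    have : comm δ ((cI E M • J) θ) - (cI E M • J) (lieD δ θ) =
        cI E M • (comm δ (J θ) - J (lieD δ θ)) := by
      rw [LinearMap.smul_apply, LinearMap.smul_apply, comm_smul, cI, Derivation.map_algebraMap,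
        zero_smul, add_zero, smul_sub]
    rw [this, map_smul, hJ.dbar δ hδ θ hθ τ hτ, smul_zero]

end HolJacobi

namespace HolJacobi

variable {E : Type*} [NormedAddCommGroup E] [NormedSpace ℂ E] [FiniteDimensional ℂ E]
  {M : Type*} [TopologicalSpace M] [T2Space M] [ChartedSpace E M] [IsManifold 𝓘(ℂ, E) ω M]
  {L : M → Type*} [TopologicalSpace (TotalSpace ℂ L)] [∀ x, AddCommGroup (L x)]
  [∀ x, Module ℂ (L x)] [∀ x, TopologicalSpace (L x)] [FiberBundle ℂ L] [VectorBundle ℂ ℂ L]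
  [ContMDiffVectorBundle ω ℂ L 𝓘(ℂ, E)]

/-! ### The bi-derivation Ĵ of Im Π -/

section HatBiderivation

variable {J : JetL E L →ₗ[FunC E M] GaugeL E L}

/-- The bi-derivation `Ĵ` of `ℓ` corresponding to the imaginary part of `Π`. -/
def hatBiderivation (hJ : IsHolJacobi J) : JetEll E L →ₗ[HatR E L] GaugeEll E L :=
  -- The sharp map built from iJ belongs to 4 Re(iΠ) = −4 Im Π.
  algebraMap ℝ (HatR E L) (-1 / 4) • sharpEll hJ.I_smul.jacobi.1

theorem hatBiderivation_apply (hJ : IsHolJacobi J) (η : JetEll E L) : hatBiderivation hJ η =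
    algebraMap ℝ (HatR E L) (-1 / 4) • sharpEll hJ.I_smul.jacobi.1 η := rfl

theorem four_smul_hatBiderivation (hJ : IsHolJacobi J) :
    4 • hatBiderivation hJ = -sharpEll hJ.I_smul.jacobi.1 := LinearMap.ext fun η => by
  have e : (4 : HatR E L) * algebraMap ℝ (HatR E L) (-1 / 4) = -1 := by
    rw [← map_ofNat (algebraMap ℝ (HatR E L)), ← map_mul]
    norm_num
  rw [LinearMap.smul_apply, hatBiderivation_apply, LinearMap.neg_apply,
    ← Nat.cast_smul_eq_nsmul (HatR E L), smul_smul, Nat.cast_ofNat, e, neg_one_smul]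

theorem bivector_I_smul (hJ : IsHolJacobi J) (f g : SlitC E L) (v : Slit L) :
    (bivector hJ.I_smul.jacobi.1 f g).1 v = Complex.I * (bivector hJ.jacobi.1 f g).1 v := by
  have hv := (frameAt E L (base v)).mem
  rw [bivector_apply _ _ _ hv, bivector_apply _ _ _ hv, Finset.mul_sum]
  refine Finset.sum_congr rfl fun a _ => ?_
  rw [Finset.mul_sum]
  refine Finset.sum_congr rfl fun b _ => ?_
  have : ∀ s t : Sec E L, (tilde (brack (cI E M • J) s t)).1 v =
      Complex.I * (tilde (brack J s t)).1 v := fun s t => by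
    have : brack (cI E M • J) s t = Complex.I • brack J s t := rfl
    rw [this, tilde_const_smul, smoothC_smul]
  rw [this]
  ring

theorem isHatBiderivation_hatBiderivation (hJ : IsHolJacobi J) :
    IsHatBiderivation (bivector hJ.jacobi.1) (hatBiderivation hJ) := by
  refine ⟨fun θ τ => ?_, fun s t v => ?_⟩
  · rw [hatBiderivation_apply, hatBiderivation_apply, map_smul, map_smul,
      isBiderivation_sharpEll, smul_neg]
  · have h1 : brack (hatBiderivation hJ) s t =
        algebraMap ℝ (HatR E L) (-1 / 4) • brack (sharpEll hJ.I_smul.jacobi.1) s t := rfl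
    have h2 : (tE (brack (hatBiderivation hJ) s t)).1 v =
        ((-1 / 4 : ℝ) : ℂ) * (tE (brack (sharpEll hJ.I_smul.jacobi.1) s t)).1 v := by
      rw [h1, tE_smul, smoothC_mul]
      rfl
    rw [tE_brack_sharpEll, bivector_I_smul hJ] at h2
    apply Complex.ofReal_injective
    refine h2.trans ?_
    rw [← Complex.ofReal_mul]
    congr 1
    change _ = ((bivector hJ.jacobi.1 (tE s) (tE t)).1 v).im
    simp
    ring

theorem tildeEll_injective : Function.Injective (tildeEll (E := E) (L := L)) := fun _ _ h =>
  tE_injective (congrArg (ofRealF _ _) h)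

/-- The bracket fixes the sharp map on prolongations, and skewness then fixes it on every jet. -/
theorem IsHatBiderivation.ext
    {P : SlitC E L →ₗ[ℂ] Derivation ℂ (SlitC E L) (SlitC E L)}
    {K K' : JetEll E L →ₗ[HatR E L] GaugeEll E L} (hK : IsHatBiderivation P K)
    (hK' : IsHatBiderivation P K') : K = K' := by
  have h1 : ∀ s : SecEll E L, K (j1 s) = K' (j1 s) := fun s =>
    gaugeFaithful_ell _ _ fun t => tildeEll_injective (smoothR_ext fun v =>
      (hK.2 s t v).trans (hK'.2 s t v).symm)
  refine LinearMap.ext fun θ => gaugeFaithful_ell _ _ fun t => ?_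
  rw [hK.1.op_eq, hK'.1.op_eq, h1]

end HatBiderivation

/-! ### Real derivations as restrictions of complex ones -/

section RealDer

variable {V H : Type*} [NormedAddCommGroup V] [NormedSpace ℝ V] [TopologicalSpace H]
  {I : ModelWithCorners ℝ V H} {N : Type*} [TopologicalSpace N] [ChartedSpace H N]

theorem ofRealF_add (f g : SmoothR I N) : ofRealF _ _ (f + g) = ofRealF _ _ f + ofRealF _ _ g :=
  RingHom.map_add _ f g

theorem ofRealF_mul (f g : SmoothR I N) : ofRealF _ _ (f * g) = ofRealF _ _ f * ofRealF _ _ g :=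
  RingHom.map_mul _ f g

/-- The restriction of a real derivation of complex functions to real functions. -/
def realDer (X : Derivation ℂ (SmoothC I N) (SmoothC I N)) (hX : ∀ f, conjF (X f) = X (conjF f)) :
    Derivation ℝ (SmoothR I N) (SmoothR I N) :=
  have key : ∀ f, ofRealF _ _ (reF (X (ofRealF _ _ f))) = X (ofRealF _ _ f) := fun f => by
    rw [ofRealF_reF, hX, conjF_ofRealF]
    exact smoothC_ext fun v => by rw [smoothC_smul, smoothC_add]; ring
  Derivation.mk'
    { toFun := fun f => reF (X (ofRealF _ _ f))
      map_add' := fun f g => by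
        rw [ofRealF_add, X.map_add]; rfl
      map_smul' := fun c f => ofRealF_injective (by
        rw [key, ofRealF_smul, derivation_const_smul, RingHom.id_apply, ofRealF_smul, key]) }
    fun f g => ofRealF_injective (by
      change ofRealF _ _ (reF (X (ofRealF _ _ (f * g)))) =
        ofRealF _ _ (f * reF (X (ofRealF _ _ g)) + g * reF (X (ofRealF _ _ f)))
      rw [key, ofRealF_mul, ofRealF_add, ofRealF_mul, ofRealF_mul, key, key, X.leibniz, smul_eq_mul, smul_eq_mul])

theorem ofRealF_realDer (X : Derivation ℂ (SmoothC I N) (SmoothC I N))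
    (hX : ∀ f, conjF (X f) = X (conjF f)) (f : SmoothR I N) :
    ofRealF _ _ (realDer X hX f) = X (ofRealF _ _ f) := by
  change ofRealF _ _ (reF (X (ofRealF _ _ f))) = X (ofRealF _ _ f)
  rw [ofRealF_reF, hX, conjF_ofRealF]
  exact smoothC_ext fun v => by rw [smoothC_smul, smoothC_add]; ring

theorem realDer_val (X : Derivation ℂ (SmoothC I N) (SmoothC I N))
    (hX : ∀ f, conjF (X f) = X (conjF f)) (f : SmoothC I N) (v : N) :
    (X f).1 v = ((realDer X hX (reF f)).1 v : ℂ) + Complex.I * ((realDer X hX (imF f)).1 v : ℂ) := by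
  have h1 := congrArg (fun k : SmoothC I N => k.1 v) (ofRealF_realDer X hX (reF f))
  have h2 := congrArg (fun k : SmoothC I N => k.1 v) (ofRealF_realDer X hX (imF f))
  simp only [ofRealF_val] at h1 h2
  rw [h1, h2]
  conv_lhs => rw [eq_re_add_im f]
  rw [X.map_add, derivation_const_smul, smoothC_add, smoothC_smul]

theorem realDer_re_im (X : Derivation ℂ (SmoothC I N) (SmoothC I N))
    (hX : ∀ f, conjF (X f) = X (conjF f)) (f : SmoothC I N) (v : N) :
    (realDer X hX (reF f)).1 v = ((X f).1 v).re ∧ (realDer X hX (imF f)).1 v = ((X f).1 v).im := by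
  rw [realDer_val X hX]
  simp

end RealDer

/-! ### The endomorphism ĵ and the identity for 4Ĵ_ĵ -/

section ComplexStructure

theorem isConsistent_I_opC (D : GaugeEll E L) : IsConsistent fun s => Complex.I • opC D s :=
  fun x₀ F v hv s hs => by
    rw [smoothC_smul, isConsistent_opC D x₀ F v hv s hs, Finset.mul_sum]
    exact Finset.sum_congr rfl fun a _ => by rw [smoothC_smul]; ring

/-- The real vector field on `M̃` corresponding to a derivation of `ℓ`. -/
def ellField (D : GaugeEll E L) : Derivation ℂ (SlitC E L) (SlitC E L) :=
  vfield _ _ (isConsistent_opC D) (isConsistent_opC D)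

theorem ellField_tE (D : GaugeEll E L) (t : SecEll E L) : ellField D (tE t) = tE (op D t) :=
  smoothC_ext fun v => by
    have hv := (frameAt E L (base v)).mem
    rw [ellField, vfield_val _ hv, LocFrame.field_val, tE_op_eq D _ hv, conjF_tE,
      Finset.sum_add_distrib, map_sum]
    congr 1
    · exact Finset.sum_congr rfl fun a _ => mul_comm _ _
    · refine Finset.sum_congr rfl fun a _ => ?_
      rw [LocFrame.db_eq, conjF_tE, conjF_val, map_mul, mul_comm]

theorem exists_hatJ (D : GaugeEll E L) : ∃ D' : GaugeEll E L,
    ∀ t, tE (op D' t) = vfield _ _ (isConsistent_I_opC D) (isConsistent_I_opC D) (tE t) := by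
  have hsc : ∀ (r : ℝˣ) (s : Sec E L), scF (ru r) (Complex.I • opC D s) =
      ((ru r : ℂˣ) : ℂ) • Complex.I • opC D s := fun r s => by
    rw [scF_smul, scF_opC, smul_comm]
  obtain ⟨D', hD, -⟩ := exists_descG (vfield _ _ (isConsistent_I_opC D) (isConsistent_I_opC D))
    (conjF_vfield _) fun r f => scF_vfield (hsc r) (hsc r) f
  exact ⟨D', hD⟩

theorem opC_hatJ_choose (D : GaugeEll E L) {x₀ : M} (F : LocFrame E L x₀) {v : Slit L}
    (hv : base v ∈ F.U) (a : Idx E) : (opC (exists_hatJ D).choose (F.lam a)).1 v =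
      Complex.I * (opC D (F.lam a)).1 v := by
  rw [opC_eq (exists_hatJ D).choose_spec, vfield_lam F hv, smoothC_smul]

variable (E L) in
/-- The endomorphism `ĵ` of the gauge algebroid of `ℓ`. -/
def hatJ : GaugeEll E L →ₗ[HatR E L] GaugeEll E L where
  toFun D := (exists_hatJ D).choose
  map_add' D D' := gaugeEll_ext fun x₀ F v hv a => by
    rw [opC_add, smoothC_add, opC_hatJ_choose _ F hv, opC_hatJ_choose _ F hv,
      opC_hatJ_choose _ F hv, opC_add, smoothC_add, mul_add]
  map_smul' f D := gaugeEll_ext fun x₀ F v hv a => by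
    rw [RingHom.id_apply, opC_smul, smoothC_mul, opC_hatJ_choose _ F hv,
      opC_hatJ_choose _ F hv, opC_smul, smoothC_mul, mul_left_comm]

theorem opC_hatJ (D : GaugeEll E L) {x₀ : M} (F : LocFrame E L x₀) {v : Slit L}
    (hv : base v ∈ F.U) (a : Idx E) : (opC (hatJ E L D) (F.lam a)).1 v =
      Complex.I * (opC D (F.lam a)).1 v := opC_hatJ_choose D F hv a

theorem hatJ_hatDer (Δ : GaugeL E L) : hatJ E L (hatDer Δ) = hatDer (cI E M • Δ) :=
  gaugeEll_ext fun x₀ F v hv a => by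
    rw [opC_hatJ _ F hv, opC_hatDer_lam _ F hv, opC_hatDer_cI _ F hv]

theorem conjF_ellField (D : GaugeEll E L) (f : SlitC E L) :
    conjF (ellField D f) = ellField D (conjF f) := conjF_vfield _ f

theorem ellField_hol (D : GaugeEll E L) {x₀ : M} (F : LocFrame E L x₀) {v : Slit L}
    (hv : base v ∈ F.U) {f : SlitC E L} (hf : ∀ a, (F.db a f).1 v = 0) :
    (ellField D f).1 v = ∑ a, (opC D (F.lam a)).1 v * (F.dd a f).1 v := by
  rw [ellField, vfield_val F hv, F.field_val]
  simp [LocFrame.dd_conj_eq, hf]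

theorem lifts_ellField (D : GaugeEll E L) :
    Lifts D (realDer (ellField D) (conjF_ellField D)) := fun s => ofRealF_injective (by
  rw [ofRealF_realDer]
  exact ellField_tE D s)

theorem isHatComplexStructure_hatJ : IsHatComplexStructure (hatJ E L) := fun D => by
  refine ⟨_, _, lifts_ellField D, lifts_ellField (hatJ E L D), fun W hW f hf v hv => ?_⟩
  have hm := (frameAt E L (base v)).mem
  have h0 := ((frameAt E L (base v)).hol_iff v hm f).1 ((hf v hv).mdifferentiableAt
    (hW.mem_nhds hv))
  have e : (ellField (hatJ E L D) f).1 v = Complex.I * (ellField D f).1 v := by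
    rw [ellField_hol _ _ hm h0, ellField_hol _ _ hm h0, Finset.mul_sum]
    exact Finset.sum_congr rfl fun a _ => by rw [opC_hatJ _ _ hm, mul_assoc]
  rw [(realDer_re_im _ _ f v).1, (realDer_re_im _ _ f v).2, (realDer_re_im _ _ f v).1,
    (realDer_re_im _ _ f v).2, e]
  simp

theorem opC_eq_lifts {D : GaugeEll E L} {X : Derivation ℝ (SlitR E L) (SlitR E L)}
    (h : Lifts D X) (s : Sec E L) (v : Slit L) : (opC D s).1 v =
      ((X (reF (tilde s))).1 v : ℂ) + Complex.I * ((X (imF (tilde s))).1 v : ℂ) := by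
  have h1 : X (reF (tilde s)) = tildeEll (op D (hatSec s)) := h (hatSec s)
  have h2 : -X (imF (tilde s)) = tildeEll (op D (hatSec (Complex.I • s))) := by
    rw [← h, ← map_neg]
    congr 1
    refine smoothR_ext fun w => ?_
    change -((tilde s).1 w).im = ((tilde (Complex.I • s)).1 w).re
    rw [tilde_const_smul, smoothC_smul, Complex.I_mul_re]
  have h3 : (X (imF (tilde s))).1 v = -(tildeEll (op D (hatSec (Complex.I • s)))).1 v := by
    rw [← h2]; exact (neg_neg _).symm
  rw [opC_val, h1, h3]
  change ((tildeEll _).1 v : ℂ) - Complex.I * ((tildeEll _).1 v : ℂ) = _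
  push_cast
  ring

/-- The rotation condition at the holomorphic functions λ̃_a prescribes the values of the rotated
derivation there, and these determine it. -/
theorem IsHatComplexStructure.eq_hatJ {φ : GaugeEll E L →ₗ[HatR E L] GaugeEll E L}
    (h : IsHatComplexStructure φ) : φ = hatJ E L := LinearMap.ext fun D =>
  gaugeEll_ext fun x₀ F v hv a => by
    obtain ⟨X, X', hX, hX', hr⟩ := h D
    have := hr _ (isOpen_base_preimage F.isOpen) _
      ((isHolSec_iff F.isOpen).1 (F.isHolSec_lam a)) v hv
    rw [opC_hatJ _ F hv, opC_eq_lifts hX, opC_eq_lifts hX', this.1, this.2]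
    push_cast
    linear_combination (-((X (imF (tilde (F.lam a)))).1 v : ℂ)) * Complex.I_mul_I

/-- Since ĵ sends the derivation induced by Δ to the one induced by iΔ, its transpose becomes
multiplication by i on the pull-back of 𝔍¹L. -/
theorem tP_phi_dagger_hatJ (η : JetEll E L) (Δ : GaugeL E L) (v : Slit L) :
    (tP ((phi (dagger (hatJ E L) η)).1 Δ)).1 v = Complex.I * (tP ((phi η).1 Δ)).1 v := by
  have e : ∀ D, dagger (hatJ E L) η D = η (hatJ E L D) := fun _ => rfl
  rw [tP_phi, tP_phi, e, e, hatJ_hatDer, hatJ_hatDer, cI_cI_smul, hatDer_neg, map_neg, tE_neg,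
    smoothC_neg]
  linear_combination ((tE (η (hatDer (cI E M • Δ)))).1 v) * Complex.I_mul_I

theorem nsmul_comp_apply {R M₁ M₂ M₃ : Type*} [CommRing R] [AddCommGroup M₁] [AddCommGroup M₂]
    [AddCommGroup M₃] [Module R M₁] [Module R M₂] [Module R M₃] (n : ℕ) (f : M₂ →ₗ[R] M₃)
    (g : M₁ →ₗ[R] M₂) (x : M₁) : (n • (f ∘ₗ g)) x = (n • f) (g x) := rfl

/-- One i comes from the transpose of ĵ and one from iJ; their product −1 cancels the sign relating
4Ĵ to the sharp map of iJ. -/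
theorem four_smul_hatBiderivation_comp {J : JetL E L →ₗ[FunC E M] GaugeL E L}
    (hJ : IsHolJacobi J) :
    4 • (hatBiderivation hJ ∘ₗ dagger (hatJ E L)) = sharpEll hJ.jacobi.1 := by
  refine LinearMap.ext fun η => ?_
  rw [nsmul_comp_apply, four_smul_hatBiderivation, LinearMap.neg_apply]
  refine gaugeEll_ext fun x₀ F v hv a => ?_
  have e2 : ∀ D : GaugeEll E L, (opC (-D) (F.lam a)).1 v = -(opC D (F.lam a)).1 v := fun D => by
    rw [eq_neg_iff_add_eq_zero, ← smoothC_add, ← opC_add, neg_add_cancel, opC_zero, smoothC_zero]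
  have e3 : (cI E M • J) (j1 (F.lam a)) = cI E M • J (j1 (F.lam a)) := rfl
  rw [e2, opC_sharpEll _ _ F hv, opC_sharpEll _ _ F hv, neg_neg, e3, tP_phi_dagger_hatJ, map_smul,
    tP_pb_smul, pb_cI_mul, smoothC_smul]
  linear_combination ((tP ((phi η).1 (J (j1 (F.lam a))))).1 v) * Complex.I_mul_I

end ComplexStructure

end HolJacobi

namespace HolJacobi

/-! ### Lie algebroids restricted along an embedding into a pull-back, and their actions -/

section Restrict

variable {A B Γ P : Type*} [CommRing A] [Algebra ℝ A] [CommRing B] [Algebra ℝ B] [Algebra A B]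
  [AddCommGroup Γ] [Module A Γ] [AddCommGroup P] [Module B P]

/-- A Lie algebroid structure on `Γ` induced by an embedding into the pull-back of a Lie algebroid
along a fibration. -/
structure LieAlgebroid.Restricts (V : LieAlgebroid B P) (j : Γ →+ P) (ρ : Γ → Derivation ℝ A A)
    (br : Γ → Γ → Γ) : Prop where
  inj : Function.Injective j
  inj_algebraMap : Function.Injective (algebraMap A B)
  map_smul : ∀ (f : A) a, j (f • a) = algebraMap A B f • j a
  anchor : ∀ a f, V.anchor (j a) (algebraMap A B f) = algebraMap A B (ρ a f)
  bracket : ∀ a b, j (br a b) = V.bracket (j a) (j b)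

namespace LieAlgebroid.Restricts

variable {V : LieAlgebroid B P} {j : Γ →+ P} {ρ : Γ → Derivation ℝ A A} {br : Γ → Γ → Γ}
  (h : V.Restricts j ρ br)

/-- The induced Lie algebroid. -/
def lieAlgebroid : LieAlgebroid A Γ where
  anchor :=
    { toFun := ρ
      map_add' := fun a b => Derivation.ext fun f => h.inj_algebraMap (by
        rw [Derivation.add_apply, map_add, ← h.anchor, ← h.anchor, ← h.anchor, map_add, map_add]
        rfl)
      map_smul' := fun g a => Derivation.ext fun f => h.inj_algebraMap (by
        rw [RingHom.id_apply, Derivation.smul_apply, smul_eq_mul, map_mul, ← h.anchor, ← h.anchor,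
          h.map_smul, _root_.map_smul]
        rfl) }
  bracket := br
  bracket_add a b c := h.inj (by
    rw [map_add, h.bracket, h.bracket, h.bracket, map_add, V.bracket_add])
  bracket_skew a b := h.inj (by rw [map_neg, h.bracket, h.bracket, V.bracket_skew])
  jacobi a b c := h.inj (by
    rw [map_add, map_add, map_zero]
    simp only [h.bracket]
    exact V.jacobi _ _ _)
  leibniz a b f := h.inj (by
    rw [h.bracket, h.map_smul, V.leibniz, h.anchor, map_add, h.map_smul, h.map_smul, h.bracket]
    rfl)
  anchor_bracket a b := Derivation.ext fun f => h.inj_algebraMap (by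
    change algebraMap A B (ρ (br a b) f) = algebraMap A B (⁅ρ a, ρ b⁆ f)
    rw [← h.anchor, h.bracket, V.anchor_bracket, Derivation.commutator_apply,
      Derivation.commutator_apply, map_sub, h.anchor, h.anchor, h.anchor, h.anchor])

/-- The action of the induced Lie algebroid on the fibration. -/
def action : LieAlgebroidAction h.lieAlgebroid B where
  act a := V.anchor (j a)
  act_add a b := by rw [map_add, map_add]
  act_smul f a := by rw [h.map_smul, _root_.map_smul]
  act_proj a f := h.anchor a f
  act_bracket a b := by
    change V.anchor (j (br a b)) = _
    rw [h.bracket, V.anchor_bracket]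

theorem isActionAlgebroid {Q : Type*} [AddCommGroup Q] [Module B Q] (Ψ : Q ≃ₗ[B] P) (pull : Γ → Q)
    (hp : ∀ a, Ψ (pull a) = j a) : IsActionAlgebroid h.action pull (V.transport Ψ) := by
  refine ⟨fun a => ?_, fun a b => ?_⟩
  · change V.anchor (Ψ (pull a)) = V.anchor (j a)
    rw [hp]
  · change Ψ.symm (V.bracket (Ψ (pull a)) (Ψ (pull b))) = pull (br a b)
    rw [hp, hp, ← h.bracket, ← hp, LinearEquiv.symm_apply_apply]

end LieAlgebroid.Restricts

/-- Lie algebroid structures with the same anchor and the same bracket on generators coincide. -/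
theorem LieAlgebroid.ext_of {R R' : LieAlgebroid A Γ} (ha : R.anchor = R'.anchor)
    (hb : ∀ a b, R.bracket a b = R'.bracket a b) : R = R' := by
  obtain ⟨_, br, _, _, _, _, _⟩ := R
  obtain ⟨_, br', _, _, _, _, _⟩ := R'
  obtain rfl : br = br' := funext fun a => funext fun b => hb a b
  obtain rfl := ha
  rfl

/-- The difference of two brackets with the same anchor. -/
def LieAlgebroid.bracketSub (R R' : LieAlgebroid A Γ) (h : R.anchor = R'.anchor) (a : Γ) :
    Γ →ₗ[A] Γ where
  toFun b := R.bracket a b - R'.bracket a b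
  map_add' b c := by rw [R.bracket_add, R'.bracket_add]; abel
  map_smul' f b := by
    rw [R.leibniz, R'.leibniz, h, RingHom.id_apply, smul_sub]; abel

theorem LieAlgebroid.bracketSub_skew (R R' : LieAlgebroid A Γ) (h : R.anchor = R'.anchor)
    (a b : Γ) : R.bracketSub R' h a b = -R.bracketSub R' h b a := by
  change R.bracket a b - R'.bracket a b = -(R.bracket b a - R'.bracket b a)
  rw [R.bracket_skew b a, R'.bracket_skew b a]; abel

end Restrict

/-! ### The real and imaginary Lie algebroids of 𝔍¹L and their actions on M̂ -/

variable {E : Type*} [NormedAddCommGroup E] [NormedSpace ℂ E] [FiniteDimensional ℂ E]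
  {M : Type*} [TopologicalSpace M] [T2Space M] [ChartedSpace E M] [IsManifold 𝓘(ℂ, E) ω M]
  {L : M → Type*} [TopologicalSpace (TotalSpace ℂ L)] [∀ x, AddCommGroup (L x)]
  [∀ x, Module ℂ (L x)] [∀ x, TopologicalSpace (L x)] [FiberBundle ℂ L] [VectorBundle ℂ ℂ L]
  [ContMDiffVectorBundle ω ℂ L 𝓘(ℂ, E)]
variable {J : JetL E L →ₗ[FunC E M] GaugeL E L}

theorem IsDbar.comm {δ ε : GaugeL E L} (hδ : IsDbar δ) (hε : IsDbar ε) :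
    IsDbar (HolJacobi.comm δ ε) := fun U hU s hs x hx => by
  have h : ∀ {δ ε : GaugeL E L}, IsDbar ε → (op δ (op ε s)).1 x = 0 := fun {δ ε} hε => by
    rw [op_local δ hU hx (t := 0) (fun y hy => hε U hU s hs y hy), map_zero]; rfl
  change (op δ (op ε s)).1 x - (op ε (op δ s)).1 x = 0
  rw [h hε, h hδ, sub_zero]

theorem holJet_eq_of_dbar (a : HolJet E L) {Δ Δ' : GaugeL E L} (h : IsDbar (Δ - Δ')) :
    a.1 Δ = a.1 Δ' := by
  have := a.2 _ h
  rwa [map_sub, sub_eq_zero] at this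

/-- The bracket `L_{∇a} b - L_{∇b} a - j¹(b(∇a))` on jets, for `∇a = ι (J♯ a)`. -/
def nablaBracket (S : JetL E L →ₗ[FunC E M] GaugeL E L) (a b : JetL E L) : JetL E L :=
  lieD (iota (S a)) b - lieD (iota (S b)) a - j1 (b (iota (S a)))

/-- Holomorphic jets vanish on every ∂̄_ξ, so ∇ may be replaced by J♯ inside the pairings. Evaluated
on δ, the bracket then becomes the expression that vanishes by ∂̄J = 0. -/
theorem nablaBracket_mem (hJ : IsHolJacobi J) (a b : HolJet E L) :
    nablaBracket J a.1 b.1 ∈ holJet E L := fun δ hδ => by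
  have e1 : ∀ a b : HolJet E L, b.1 (comm (iota (J a.1)) δ) = -b.1 (comm δ (J a.1)) :=
    fun a b => by
      have h : comm δ (iota (J a.1) - J a.1) = comm δ (iota (J a.1)) - comm δ (J a.1) := by
        rw [eq_sub_iff_add_eq, ← comm_add, sub_add_cancel]
      rw [comm_antisymm, map_neg,
        holJet_eq_of_dbar b (h ▸ IsDbar.comm hδ (isIota_iota (J a.1)).1)]
  have e2 : b.1 (iota (J a.1)) = b.1 (J a.1) := holJet_eq_of_dbar b (isIota_iota _).1
  have e3 := hJ.dbar δ hδ a.1 a.2 b.1 b.2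
  have e4 : b.1 (J (lieD δ a.1)) = -(lieD δ a.1) (J b.1) := hJ.jacobi.1 _ _
  have e5 : a.1 (J b.1) = -b.1 (J a.1) := hJ.jacobi.1 b.1 a.1
  rw [map_sub, e4, lieD_apply, e5, map_neg] at e3
  simp only [nablaBracket, LinearMap.sub_apply, lieD_apply, j1_apply, e1, e2, a.2 δ hδ, b.2 δ hδ,
    map_zero]
  refine Eq.trans ?_ e3
  abel

/-- The bracket of the real Lie algebroid of `(𝔍¹L)_J`. -/
def holBracket (hJ : IsHolJacobi J) (a b : HolJet E L) : HolJet E L :=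
  ⟨nablaBracket J a.1 b.1, nablaBracket_mem hJ a b⟩

/-- Jets of ℓ are compared on the derivations induced by ιΔ. There Ψ ∘ p̂^*, λ ↦ λ̂ and Δ ↦ `hatDer
Δ` respect pairings, the action on sections and commutators of ι-images, so the two bracket formulas
match term by term. -/
theorem psi_holBracket (hJ : IsHolJacobi J) (a b : HolJet E L) :
    psi E L (pullJet (holBracket hJ a b)) = jetBracket (sharpEll hJ.jacobi.1)
      (psi E L (pullJet a)) (psi E L (pullJet b)) := jetEll_ext fun Δ => by
  have hsub : ∀ s t : Sec E L, hatSec (s - t) = hatSec s - hatSec t := fun s t => by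
    rw [eq_sub_iff_add_eq, ← hatSec_add, sub_add_cancel]
  have h1 : ∀ a b : HolJet E L, lieD (hatDer (J a.1)) (psi E L (pullJet b)) (hatDer (iota Δ)) =
      hatSec (lieD (iota (J a.1)) b.1 (iota Δ)) := fun a b => by
    rw [lieD_apply, lieD_apply, psi_pullJet_hatDer, hatSec_op_iota, hsub, hatDer_iota,
      ← hatDer_comm_iota, psi_pullJet_hatDer]
  have h2 : ∀ Δ : GaugeL E L, hatDer Δ = hatDer (iota Δ) := fun Δ => (hatDer_iota Δ).symm
  rw [h2 Δ, psi_pullJet_hatDer]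
  change hatSec (nablaBracket J a.1 b.1 (iota Δ)) = _
  simp only [jetBracket, nablaBracket, LinearMap.sub_apply, sharpEll_psi_pullJet, h1, j1_apply,
    hsub, psi_pullJet_hatDer]
  rw [hatDer_iota, hatSec_op_iota, holJet_eq_of_dbar b (isIota_iota _).1]

/-- The jet algebroid `(𝔍¹ℓ)` of the Jacobi structure `sharpEll`. -/
def ellAlgebroid (hJ : IsHolJacobi J) : LieAlgebroid (HatR E L) (JetEll E L) :=
  jetAlgebroid gaugeFaithful_ell _ (isJacobi_sharpEll hJ)

/-- The map `θ ↦ Ψ (p̂^* θ)`. -/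
def psiPull : HolJet E L →+ JetEll E L where
  toFun θ := psi E L (pullJet θ)
  map_zero' := by
    rw [← map_zero (psi E L)]
    exact congrArg _ (Subtype.ext (LinearMap.ext fun Δ => tP_injective (by
      rw [tP_pullJet]
      change tilde (0 : Sec E L) = tP (0 : PullSec E L)
      rw [tilde_zero, tP_zero])))
  map_add' a b := by
    rw [← map_add]
    exact congrArg _ (Subtype.ext (LinearMap.ext fun Δ => tP_injective (by
      rw [tP_pullJet]
      change tilde (a.1 Δ + b.1 Δ) = tP ((pullJet a).1 Δ + (pullJet b).1 Δ)
      rw [tilde_add, tP_add]; rfl)))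

theorem psiPull_smul (f : FunR E M) (a : HolJet E L) :
    psiPull (f • a) = algebraMap (FunR E M) (HatR E L) f • psiPull a := by
  change psi E L _ = _ • psi E L _
  rw [← map_smul]
  exact congrArg _ (Subtype.ext (LinearMap.ext fun Δ => tP_injective (by
    change tilde (ofRealF _ _ f • a.1 Δ) = tP (algebraMap (FunR E M) (HatR E L) f • (pullJet a).1 Δ)
    rw [tilde_smul, tP_smul]; rfl)))

theorem psiPull_injective : Function.Injective (psiPull (E := E) (L := L)) := fun a b h => by
  have h1 : pullJet a = pullJet b := (psi E L).injective h
  refine Subtype.ext (LinearMap.ext fun Δ => sec_ext_tilde ?_)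
  rw [← tP_pullJet, ← tP_pullJet, h1]

/-- The anchor of the real Lie algebroid of `(𝔍¹L)_J`. -/
def holAnchor (S : JetL E L →ₗ[FunC E M] GaugeL E L) (θ : HolJet E L) :
    Derivation ℝ (FunR E M) (FunR E M) :=
  realDer (symbol (iota (S θ.1))) fun f => ((isIota_iota _).2 f).symm

theorem ofRealF_holAnchor (S : JetL E L →ₗ[FunC E M] GaugeL E L) (θ : HolJet E L)
    (f : FunR E M) : ofRealF _ _ (holAnchor S θ f) = symbol (iota (S θ.1)) (ofRealF _ _ f) :=
  ofRealF_realDer _ _ f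

/-- Through this embedding the real Lie algebroid receives the Jacobi identity and all other axioms
from the jet algebroid of ℓ; none is verified on 𝔍¹L directly. -/
theorem restricts_ellAlgebroid (hJ : IsHolJacobi J) :
    (ellAlgebroid hJ).Restricts psiPull (holAnchor J) (holBracket hJ) where
  inj := psiPull_injective
  inj_algebraMap f g h := ofRealF_injective (pb_injective (L := L) (congrArg hs h))
  map_smul := psiPull_smul
  anchor a f := hs_injective (by
    have : (ellAlgebroid hJ).anchor (psiPull a) = symbol (hatDer (J a.1)) :=
      congrArg symbol (sharpEll_psi_pullJet hJ.jacobi.1 a)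
    rw [this, hs_symbol_hatDer, hs_algebraMap, hs_algebraMap, ofRealF_holAnchor, pb_symbol_iota])
  bracket := psi_holBracket hJ

/-- The real Lie algebroid of `(𝔍¹L)_J`. -/
def holAlgebroid (hJ : IsHolJacobi J) : LieAlgebroid (FunR E M) (HolJet E L) :=
  (restricts_ellAlgebroid hJ).lieAlgebroid

/-- The action of the real Lie algebroid on `M̂ → M`. -/
def holAction (hJ : IsHolJacobi J) : LieAlgebroidAction (holAlgebroid hJ) (HatR E L) :=
  (restricts_ellAlgebroid hJ).action

theorem holAction_act (hJ : IsHolJacobi J) (θ : HolJet E L) :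
    (holAction hJ).act θ = symbol (hatDer (J θ.1)) :=
  congrArg symbol (sharpEll_psi_pullJet hJ.jacobi.1 θ)

theorem isInducedField (S : JetL E L →ₗ[FunC E M] GaugeL E L) (θ : HolJet E L) :
    IsInducedField S θ (symbol (hatDer (S θ.1))) := by
  refine ⟨_, isIota_iota _, realDer (xField (S θ.1)) (conjF_xField _), fun s => ?_, fun h => ?_⟩
  · constructor <;> refine smoothR_ext fun v => ?_
    · rw [(realDer_re_im _ _ _ v).1, tilde_op_iota]; rfl
    · rw [(realDer_re_im _ _ _ v).2, tilde_op_iota]; rfl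
  · refine ofRealF_injective ?_
    rw [ofRealF_realDer]
    exact (hs_symbol_hatDer _ h).symm

/-- The imaginary Lie algebroid of J is the real one of iJ. Lie derivatives and j¹ commute with the
constant i, so in the deformed bracket the terms with i outside cancel, leaving the bracket formed
with ∇_{iθ}. -/
theorem isDeformation_holAlgebroid (hJ : IsHolJacobi J) :
    IsDeformation (holAlgebroid hJ) mulI (holAlgebroid hJ.I_smul) := by
  have e : ∀ a : HolJet E L, (cI E M • J) a.1 = J (mulI a).1 := fun a =>
    (J.map_smul (cI E M) a.1).symm
  refine ⟨fun a => ?_, fun a b => ?_⟩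
  · refine Derivation.ext fun f => ofRealF_injective ?_
    change ofRealF _ _ (holAnchor _ a f) = ofRealF _ _ (holAnchor _ (mulI a) f)
    rw [ofRealF_holAnchor, ofRealF_holAnchor, e]
  · refine Subtype.ext ?_
    change nablaBracket (cI E M • J) a.1 b.1 = nablaBracket J (mulI a).1 b.1 +
      nablaBracket J a.1 (mulI b).1 - cI E M • nablaBracket J a.1 b.1
    have e2 : ∀ (Δ : GaugeL E L) (b : HolJet E L), lieD Δ (mulI b).1 = cI E M • lieD Δ b.1 :=
      fun Δ b => by
        change lieD Δ (cI E M • b.1) = _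
        rw [lieD_smul_right, cI, Derivation.map_algebraMap, zero_smul, add_zero]
    have e3 : ∀ Δ : GaugeL E L, (j1 ((mulI b).1 Δ) : JetL E L) = cI E M • j1 (b.1 Δ) := fun Δ => by
      change j1 (cI E M • b.1 Δ) = _
      rw [cI_smul, j1_smul_const]
      rfl
    simp only [nablaBracket, e, e2, e3, smul_sub]
    abel

end HolJacobi

/-! ### Anchor, bracket on holomorphic jets and uniqueness of the real Lie algebroid -/

namespace HolJacobi

variable {E : Type*} [NormedAddCommGroup E] [NormedSpace ℂ E] [FiniteDimensional ℂ E]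
  {M : Type*} [TopologicalSpace M] [T2Space M] [ChartedSpace E M] [IsManifold 𝓘(ℂ, E) ω M]
  {L : M → Type*} [TopologicalSpace (TotalSpace ℂ L)] [∀ x, AddCommGroup (L x)]
  [∀ x, Module ℂ (L x)] [∀ x, TopologicalSpace (L x)] [FiberBundle ℂ L] [VectorBundle ℂ ℂ L]
  [ContMDiffVectorBundle ω ℂ L 𝓘(ℂ, E)]
variable {J : JetL E L →ₗ[FunC E M] GaugeL E L}

theorem isHolSlit_pb {U : Set M} {f : FunC E M} (hf : IsHolFun U f) :
    IsHolSlit (L := L) (base ⁻¹' U) (pb f) := by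
  have h : ContMDiff (𝓘(ℂ, E).prod 𝓘(ℂ, ℂ →L[ℂ] ℂ)) 𝓘(ℂ, E) 1 (base : Slit L → M) :=
    (Bundle.contMDiff_proj (DualFib L)).comp contMDiff_subtype_val
  intro v hv
  exact MDifferentiableWithinAt.comp (I' := 𝓘(ℂ, E)) (g := f.1) (u := U) v (hf (base v) hv)
    (h.mdifferentiable one_ne_zero v).mdifferentiableWithinAt fun _ h => h

/-- The product of f with a nowhere vanishing local holomorphic section is holomorphic; applying δ
to it leaves the symbol on f times that section. -/
theorem IsDbar.symbol_hol {δ : GaugeL E L} (hδ : IsDbar δ) {U : Set M} (hU : IsOpen U)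
    {f : FunC E M} (hf : IsHolFun U f) {x : M} (hx : x ∈ U) : (symbol δ f).1 x = 0 := by
  have hm := (frameAt E L x).mem
  set F := frameAt E L x
  have hs : IsHolSec (U ∩ F.U) (f • F.lam none) := by
    rw [isHolSec_iff (hU.inter F.isOpen)]
    refine F.isHolSlit Set.inter_subset_right fun v hv a => ?_
    rw [tilde_smul, der_mul_val, F.db_tilde_lam hv.2, F.hol_tilde hU hv.2 hv.1 (isHolSlit_pb hf)]
    ring
  have h1 := hδ _ (hU.inter F.isOpen) _ hs x ⟨hx, hm⟩
  have h2 := hδ _ F.isOpen _ (F.isHolSec_lam none) x hm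
  have h3 : (tilde (op δ (f • F.lam none))).1 (slitOver x) = 0 := by
    rw [tilde_eq_at (v := slitOver x) (t := 0) h1, tilde_zero, smoothC_zero]
  have h4 : (tilde (op δ (F.lam none))).1 (slitOver x) = 0 := by
    rw [tilde_eq_at (v := slitOver x) (t := 0) h2, tilde_zero, smoothC_zero]
  rw [op_smul, tilde_add, tilde_smul, tilde_smul, smoothC_add, smoothC_mul, smoothC_mul, h4,
    mul_zero, zero_add] at h3
  exact (mul_eq_zero.1 h3).resolve_right (right_ne_zero_of_mul_eq_one (F.q_mul (slitOver x) hm))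

/-- The complex conjugate of a vector field. -/
def conjDer (X : Derivation ℂ (FunC E M) (FunC E M)) : Derivation ℂ (FunC E M) (FunC E M) :=
  Derivation.mk'
    { toFun := fun f => conjF (X (conjF f))
      map_add' := fun f g => by rw [conjF_add, X.map_add, conjF_add]
      map_smul' := fun c f => by
        have h : ∀ (c : ℂ) (f : FunC E M), conjF (c • f) = starRingEnd ℂ c • conjF f :=
          fun c f => smoothC_ext fun x => map_mul _ _ _
        rw [h, derivation_const_smul, h, Complex.conj_conj, RingHom.id_apply] }
    fun f g => by
      change conjF (X (conjF (f * g))) = f * conjF (X (conjF g)) + g * conjF (X (conjF f))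
      rw [conjF_mul, X.leibniz, conjF_add, smul_eq_mul, smul_eq_mul, conjF_mul, conjF_mul,
        conjF_conjF, conjF_conjF]

/-- The symbol of `ι Δ` is twice the real part of the symbol of `Δ`. -/
theorem symbol_iota_val (Δ : GaugeL E L) (h10 : IsType10 (symbol Δ)) (f : FunC E M) (x : M) :
    (symbol (iota Δ) f).1 x = (symbol Δ f).1 x + starRingEnd ℂ ((symbol Δ (conjF f)).1 x) := by
  have hι := isIota_iota Δ
  have e : ∀ g : FunC E M, ((symbol (iota Δ) - symbol Δ - conjDer (symbol Δ)) g).1 x =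
      (symbol (iota Δ - Δ) g).1 x - starRingEnd ℂ ((symbol Δ (conjF g)).1 x) := fun g => rfl
  -- Holomorphic functions are annihilated because ιΔ − Δ is a ∂̄_ξ and Δ has type (1,0);
  -- antiholomorphic ones then follow from the reality of the symbol of ιΔ.
  have key := derivation_eq_zero_of_hol (symbol (iota Δ) - symbol Δ - conjDer (symbol Δ))
    (slitOver (L := L) x) (fun U hU (hx : x ∈ U) g hg => ?_)
    (fun U hU (hx : x ∈ U) g hg => ?_) f
  · have := (e f).symm.trans key
    change (symbol (iota Δ) f).1 x - (symbol Δ f).1 x - _ = 0 at this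
    linear_combination this
  · exact (e g).trans (by rw [hι.1.symbol_hol hU hg hx, h10 U hU g hg x hx, map_zero, sub_zero])
  · refine (e _).trans ?_
    have h1 := hι.1.symbol_hol hU hg hx
    change (symbol (iota Δ) g).1 x - (symbol Δ g).1 x = 0 at h1
    change (symbol (iota Δ) (conjF g)).1 x - (symbol Δ (conjF g)).1 x - _ = 0
    rw [hι.2, h10 U hU g hg x hx, conjF_conjF, conjF_val, sub_eq_zero.1 h1]
    ring

/-- Lie derivatives of holomorphic jets along ∂̄_ξ vanish, so on them ι may be dropped from the
bracket formula. In the anchor, ι produces twice the real part. -/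
theorem isRealLieAlgebroid_holAlgebroid (hJ : IsHolJacobi J) :
    IsRealLieAlgebroid J (holAlgebroid hJ) := by
  refine ⟨fun θ f x => ?_, fun U hU θ τ hθ hτ Δ x hx => ?_⟩
  · apply Complex.ofReal_injective
    have h1 := congrArg (fun k : FunC E M => k.1 x) (ofRealF_holAnchor J θ f)
    refine h1.trans ?_
    rw [symbol_iota_val _ (hJ.type20 θ.1), conjF_ofRealF, Complex.add_conj]
  · change (nablaBracket J θ.1 τ.1 Δ).1 x = _
    have h1 := hθ _ (isIota_iota (J τ.1)).1 Δ x hx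
    have h2 := hτ _ (isIota_iota (J θ.1)).1 Δ x hx
    rw [lieD_sub_left] at h1 h2
    have h3 := sub_eq_zero.1 h1
    have h4 := sub_eq_zero.1 h2
    rw [nablaBracket, jetBracket, holJet_eq_of_dbar τ (isIota_iota (J θ.1)).1]
    change (lieD (iota (J θ.1)) τ.1 Δ).1 x - (lieD (iota (J τ.1)) θ.1 Δ).1 x - _ = _
    rw [h3, h4]
    rfl

theorem IsHolJet.I_smul {U : Set M} {θ : HolJet E L} (h : IsHolJet U θ.1) :
    IsHolJet U (mulI θ).1 := fun δ hδ Δ x hx => by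
  have e : lieD δ (mulI θ).1 = cI E M • lieD δ θ.1 := by
    change lieD δ (cI E M • θ.1) = _
    rw [lieD_smul_right, cI, Derivation.map_algebraMap, zero_smul, add_zero]
  rw [e]
  change (cI E M).1 x • (lieD δ θ.1 Δ).1 x = 0
  rw [h δ hδ Δ x hx, smul_zero]

theorem isHolJet_of_eq_j1 {V : Set M} (hV : IsOpen V) {b : FunR E M} (hb : ∀ y ∈ V, b.1 y = 1)
    {s : Sec E L} (hs : IsHolSec V s) : IsHolJet V (ofRealF _ _ b • j1 s : JetL E L) :=
  fun δ hδ Δ x hx => by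
    have hcut : ∀ r : Sec E L, ∀ y ∈ V, (ofRealF _ _ b • r).1 y = r.1 y := fun r y hy => by
      rw [ofRealF_smul_sec_val, hb y hy, Complex.ofReal_one, one_smul]
    rw [lieD_apply]
    change (op δ (ofRealF _ _ b • op Δ s)).1 x - (ofRealF _ _ b • op (comm δ Δ) s).1 x = 0
    rw [hcut _ x hx, op_local δ hV hx (hcut (op Δ s)), op_comm]
    change (op δ (op Δ s)).1 x - ((op δ (op Δ s)).1 x - (op Δ (op δ s)).1 x) = 0
    rw [op_local Δ hV hx (s := op δ s) (t := 0) (fun y hy => hδ V hV s hs y hy), map_zero]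
    change _ - (_ - (0 : L x)) = 0
    rw [sub_zero, sub_self]

/-- Holomorphic jets are locally generated by holomorphic sections. -/
theorem exists_holJet_generators (x : M) : ∃ (V : Set M) (θ : Idx E ⊕ Idx E → HolJet E L),
    IsOpen V ∧ x ∈ V ∧ (∀ i, IsHolJet V (θ i).1) ∧ ∀ β : HolJet E L,
      ∃ (g : FunR E M) (u : Idx E ⊕ Idx E → FunR E M), g.1 x = 1 ∧ g • β = ∑ i, u i • θ i := by
  have hm := (frameAt E L x).mem
  set F := frameAt E L x
  obtain ⟨b, V, hV, hxV, hVF, hb, hbF⟩ := exists_bump (E := E) F.isOpen hm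
  let η : Idx E → HolJet E L := fun a =>
    ⟨ofRealF _ _ b • j1 (F.lam a), cutoff_j1_mem_holJet F.isOpen hbF (F.isHolSec_lam a)⟩
  have hη : ∀ a, IsHolJet V (η a).1 := fun a =>
    isHolJet_of_eq_j1 hV hb ((F.isHolSec_lam a).mono hVF)
  refine ⟨V, Sum.elim η fun a => mulI (η a), hV, hxV, ?_, fun β => ?_⟩
  · rintro (a | a)
    · exact hη a
    · exact (hη a).I_smul
  have hg : ∀ a, ∃ g : FunC E M, pb g = pb (ofRealF _ _ b) * (F.q * tilde (β.1 (F.der a))) :=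
    fun a => exists_pb_eq _ fun ζ => by rw [scF_mul, scF_pb, F.scF_q_mul (scF_tilde ζ _)]
  choose g hg using hg
  -- One factor b is contained in the coefficients `g a`, the other in the generators.
  refine ⟨b * b, Sum.elim (fun a => reF (g a)) fun a => imF (g a), ?_, ?_⟩
  · change b.1 x * b.1 x = 1
    rw [hb x hxV, one_mul]
  rw [Fintype.sum_sum_type, ← Finset.sum_add_distrib]
  simp only [Sum.elim_inl, Sum.elim_inr]
  have e1 : ∀ a, reF (g a) • η a + imF (g a) • mulI (η a) = g a • η a := fun a => by
    conv_rhs => rw [funC_eq (g a), add_smul, mul_smul]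
    rfl
  simp only [e1]
  refine Subtype.ext (LinearMap.ext fun Δ => sec_ext_tilde (smoothC_ext fun v => ?_))
  have e2 : ((∑ a, g a • η a : HolJet E L).1 Δ) = ∑ a, g a • ofRealF _ _ b • op Δ (F.lam a) := by
    have : ∀ w : Idx E → HolJet E L, (∑ a, w a : HolJet E L).1 Δ = ∑ a, (w a).1 Δ := fun w => by
      let f : HolJet E L →+ Sec E L :=
        { toFun := fun θ => θ.1 Δ, map_zero' := rfl, map_add' := fun _ _ => rfl }
      exact map_sum f w Finset.univ
    rw [this]
    rfl
  have e3 : ∀ w : Idx E → Sec E L, tilde (∑ a, w a) = ∑ a, tilde (w a) := fun w =>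
    map_sum (⟨⟨tilde, tilde_zero⟩, tilde_add⟩ : Sec E L →+ SlitC E L) _ _
  have e4 : ((b * b) • β).1 Δ = ofRealF _ _ (b * b) • β.1 Δ := rfl
  rw [e2, e3, e4, smoothC_sum, tilde_smul, smoothC_mul, pb_val, ofRealF_val]
  simp only [tilde_smul, smoothC_mul, hg, pb_val, ofRealF_val]
  change ((b.1 (base v) * b.1 (base v) : ℝ) : ℂ) * _ = _
  rw [Complex.ofReal_mul]
  by_cases hv : base v ∈ F.U
  · rw [← tP_pullJet, tP_pullJet_eq _ F hv, Finset.mul_sum]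
    refine Finset.sum_congr rfl fun a _ => ?_
    rw [tP_pullJet]
    ring
  · rw [image_eq_zero_of_notMem_tsupport fun h => hv (hbF h)]
    simp

/-- The anchors agree, so the difference of the brackets is bilinear over the functions; at each
point it vanishes on local holomorphic generators. -/
theorem IsRealLieAlgebroid.ext {R R' : LieAlgebroid (FunR E M) (HolJet E L)}
    (hR : IsRealLieAlgebroid J R) (hR' : IsRealLieAlgebroid J R') : R = R' := by
  have ha : R.anchor = R'.anchor := LinearMap.ext fun θ => Derivation.ext fun f =>
    smoothR_ext fun x => (hR.1 θ f x).trans (hR'.1 θ f x).symm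
  refine LieAlgebroid.ext_of ha fun α β => ?_
  rw [← sub_eq_zero]
  change R.bracketSub R' ha α β = 0
  refine Subtype.ext (LinearMap.ext fun Δ => Subtype.ext (funext fun x => ?_))
  change ((R.bracketSub R' ha α β).1 Δ).1 x = 0
  obtain ⟨V, θ, hV, hxV, hθ, hgen⟩ := exists_holJet_generators (E := E) (L := L) x
  let ev : HolJet E L →+ L x :=
    { toFun := fun θ => (θ.1 Δ).1 x, map_zero' := rfl, map_add' := fun _ _ => rfl }
  have hev : ∀ (u : FunR E M) (a : HolJet E L), ev (u • a) = ((u.1 x : ℝ) : ℂ) • ev a :=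
    fun _ _ => rfl
  have red : ∀ α, (∀ i, ev (R.bracketSub R' ha α (θ i)) = 0) → ∀ β,
      ev (R.bracketSub R' ha α β) = 0 := fun α h β => by
    obtain ⟨g, u, hg, e⟩ := hgen β
    have h1 := congrArg (fun b => ev (R.bracketSub R' ha α b)) e
    simp only [map_smul, map_sum, hev, hg, h, smul_zero, Finset.sum_const_zero, Complex.ofReal_one,
      one_smul] at h1
    exact h1
  have skew : ∀ α β, ev (R.bracketSub R' ha α β) = -ev (R.bracketSub R' ha β α) := fun α β => by
    rw [LieAlgebroid.bracketSub_skew, map_neg]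
  refine red α (fun i => ?_) β
  rw [skew, red (θ i) (fun j => ?_) α, neg_zero]
  exact sub_eq_zero.2 ((hR.2 V hV _ _ (hθ i) (hθ j) Δ x hxV).trans
    (hR'.2 V hV _ _ (hθ i) (hθ j) Δ x hxV).symm)

theorem LieAlgebroid.isIso_neg {S : JetEll E L →ₗ[HatR E L] GaugeEll E L} (hS : IsJacobi S)
    {P : Type*} [AddCommGroup P] [Module (HatR E L) P] {T : LieAlgebroid (HatR E L) P}
    {Ψ : P ≃ₗ[HatR E L] JetEll E L} (h : T.IsIso (jetAlgebroid gaugeFaithful_ell S hS) Ψ) :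
    T.IsIso (jetAlgebroid gaugeFaithful_ell (-S) hS.neg)
      (Ψ.trans (LinearEquiv.neg (HatR E L))) := by
  refine ⟨fun a => ?_, fun a b => ?_⟩
  · rw [← h.1 a]
    change symbol (-S (-Ψ a)) = symbol (S (Ψ a))
    rw [map_neg, neg_neg]
  · change -Ψ _ = jetBracket (-S) (-Ψ a) (-Ψ b)
    rw [jetBracket_neg, h.2]
    rfl

end HolJacobi

theorem mainTheorem2 {E : Type*} [NormedAddCommGroup E] [NormedSpace ℂ E] [FiniteDimensional ℂ E]
    {M : Type*} [TopologicalSpace M] [T2Space M] [SigmaCompactSpace M] [ChartedSpace E M]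
    [IsManifold 𝓘(ℂ, E) ω M]
    {L : M → Type*} [TopologicalSpace (TotalSpace ℂ L)] [∀ x, AddCommGroup (L x)]
    [∀ x, Module ℂ (L x)] [∀ x, TopologicalSpace (L x)] [FiberBundle ℂ L] [VectorBundle ℂ ℂ L]
    [ContMDiffVectorBundle ω ℂ L 𝓘(ℂ, E)]
    (J : HolJacobi.JetL E L →ₗ[HolJacobi.FunC E M] HolJacobi.GaugeL E L)
    (hJ : HolJacobi.IsHolJacobi J) :
    ∃ (P : HolJacobi.SlitC E L →ₗ[ℂ] Derivation ℂ (HolJacobi.SlitC E L) (HolJacobi.SlitC E L))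
      (K : HolJacobi.JetEll E L →ₗ[HolJacobi.HatR E L] HolJacobi.GaugeEll E L)
      (φ : HolJacobi.GaugeEll E L →ₗ[HolJacobi.HatR E L] HolJacobi.GaugeEll E L)
      (R R' : HolJacobi.LieAlgebroid (HolJacobi.FunR E M) (HolJacobi.HolJet E L))
      (Ψ : HolJacobi.PullJet E L ≃ₗ[HolJacobi.HatR E L] HolJacobi.JetEll E L),
      -- the bi-vector `Π` on `M̃`, the bi-derivation `Ĵ` of `ℓ`, and the endomorphism `ĵ`
      HolJacobi.IsTheOnly (HolJacobi.IsPoissonization J) P ∧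
      HolJacobi.IsTheOnly (HolJacobi.IsHatBiderivation P) K ∧
      HolJacobi.IsTheOnly HolJacobi.IsHatComplexStructure φ ∧
      -- `4 Ĵ_ĵ` and `4 Ĵ` are Jacobi structures
      HolJacobi.IsJacobi (4 • (K ∘ₗ HolJacobi.dagger φ)) ∧
      HolJacobi.IsJacobi (4 • K) ∧
      -- the real and the imaginary Lie algebroid of `𝔍¹L`
      HolJacobi.IsTheOnly (HolJacobi.IsRealLieAlgebroid J) R ∧
      HolJacobi.IsDeformation R HolJacobi.mulI R' ∧
      -- the identification of the pull-back of `𝔍¹L` with `𝔍¹_ℝ ℓ`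
      HolJacobi.IsCanonical Ψ ∧
      -- the real Lie algebroid
      (∃ (α : HolJacobi.LieAlgebroidAction R (HolJacobi.HatR E L))
        (T : HolJacobi.LieAlgebroid (HolJacobi.HatR E L) (HolJacobi.PullJet E L))
        (V : HolJacobi.LieAlgebroid (HolJacobi.HatR E L) (HolJacobi.JetEll E L)),
        (∀ θ, HolJacobi.IsInducedField J θ (α.act θ)) ∧
        HolJacobi.IsActionAlgebroid α HolJacobi.pullJet T ∧
        HolJacobi.IsJetAlgebroid (4 • (K ∘ₗ HolJacobi.dagger φ)) V ∧
        T.IsIso V Ψ) ∧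
      -- the imaginary Lie algebroid
      (∃ (α : HolJacobi.LieAlgebroidAction R' (HolJacobi.HatR E L))
        (T : HolJacobi.LieAlgebroid (HolJacobi.HatR E L) (HolJacobi.PullJet E L))
        (V : HolJacobi.LieAlgebroid (HolJacobi.HatR E L) (HolJacobi.JetEll E L)),
        (∀ θ, HolJacobi.IsInducedField J (HolJacobi.mulI θ) (α.act θ)) ∧
        HolJacobi.IsActionAlgebroid α HolJacobi.pullJet T ∧
        HolJacobi.IsJetAlgebroid (4 • K) V ∧
        T.IsIso V (Ψ.trans (LinearEquiv.neg (HolJacobi.HatR E L)))) := by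

  have hK := HolJacobi.isHatBiderivation_hatBiderivation hJ
  have h1 := HolJacobi.four_smul_hatBiderivation_comp hJ
  have h2 := HolJacobi.four_smul_hatBiderivation hJ
  -- The imaginary half is the real half for iJ, followed by −1 on jets.
  have hI := HolJacobi.isJacobi_sharpEll hJ.I_smul
  refine ⟨HolJacobi.bivector hJ.jacobi.1, HolJacobi.hatBiderivation hJ, HolJacobi.hatJ E L,
    HolJacobi.holAlgebroid hJ, HolJacobi.holAlgebroid hJ.I_smul, HolJacobi.psi E L,
    ⟨HolJacobi.isPoissonization_bivector hJ, fun P hP => hP.eq_bivector hJ⟩,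
    ⟨hK, fun K hK' => hK'.ext hK⟩,
    ⟨HolJacobi.isHatComplexStructure_hatJ, fun φ hφ => hφ.eq_hatJ⟩,
    ?_, ?_,
    ⟨HolJacobi.isRealLieAlgebroid_holAlgebroid hJ,
      fun R hR => hR.ext (HolJacobi.isRealLieAlgebroid_holAlgebroid hJ)⟩,
    HolJacobi.isDeformation_holAlgebroid hJ, HolJacobi.isCanonical_psi,
    ⟨HolJacobi.holAction hJ, (HolJacobi.ellAlgebroid hJ).transport (HolJacobi.psi E L),
      HolJacobi.ellAlgebroid hJ, fun θ => ?_,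
      (HolJacobi.restricts_ellAlgebroid hJ).isActionAlgebroid _ _ fun _ => rfl, ?_,
      HolJacobi.LieAlgebroid.transport_isIso _ _⟩,
    ⟨HolJacobi.holAction hJ.I_smul,
      (HolJacobi.ellAlgebroid hJ.I_smul).transport (HolJacobi.psi E L),
      HolJacobi.jetAlgebroid HolJacobi.gaugeFaithful_ell _ hI.neg, fun θ => ?_,
      (HolJacobi.restricts_ellAlgebroid hJ.I_smul).isActionAlgebroid _ _ fun _ => rfl, ?_,
      HolJacobi.LieAlgebroid.isIso_neg hI (HolJacobi.LieAlgebroid.transport_isIso _ _)⟩⟩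
  · rw [h1]; exact HolJacobi.isJacobi_sharpEll hJ
  · rw [h2]; exact hI.neg
  · rw [HolJacobi.holAction_act]; exact HolJacobi.isInducedField J θ
  · rw [h1]; exact HolJacobi.jetAlgebroid_isJetAlgebroid _ _ _
  · rw [HolJacobi.holAction_act]
    have e : (HolJacobi.cI E M • J) θ.1 = J (HolJacobi.mulI θ).1 :=
      (J.map_smul (HolJacobi.cI E M) θ.1).symm
    rw [e]
    exact HolJacobi.isInducedField J (HolJacobi.mulI θ)
  · rw [h2]; exact HolJacobi.jetAlgebroid_isJetAlgebroid _ _ _
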